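/- Let $a,b\in\mathbb{C}$, let $Q(a,b)\subset\mathbb{P}^3$ be the quartic surface $$y^2zw-4x^3z+3a\,xzw^2-\tfrac12\,(z^2w^2+w^4)+b\,zw^3=0,$$ and let $X(a,b)$ be its minimal resolution, a K3 surface. Let $\beta$ be the involution of $X(a,b)$ induced by the birational involution $[x,y,z,w]\mapsto[xz,-yz,w^2,zw]$ of $Q(a,b)$, and let $Y(a,b)$ be the minimal resolution of $X(a,b)/\beta$, that is, the minimal nonsingular complete surface whose function field is the field of $\beta$-invariant rational functions on $Q(a,b)$. The projection $[x,y,z,w]\mapsto[x,w]$ induces a relatively minimal elliptic fibration $\Psi_2\colon Y(a,b)\to\mathbb{P}^1$. Put $P(X)=4X^3-3aX-b$ and let $\lambda$ denote the affine coordinate of the point $[\lambda,1]$ of $\mathbb{P}^1$. The functional invariant of $\Psi_2$ (the $J$-invariant of the smooth fibres, normalized as $J=j/1728$) is $$\mathcal{J}_{\Psi_2}(\lambda)=\frac{(P(\lambda)^2+3)^3}{27\,(P(\lambda)^2-1)^2}.$$ The singular fibres of $\Psi_2$ are located exactly at $[1,0]$, where the fibre is of Kodaira type $I_6^*$, and at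 the points $[\lambda,1]$ with $\lambda\in\Sigma:=\{\lambda\in\mathbb{C}\mid P(\lambda)^2=1\}$. Moreover: - If $a^3\ne(b+1)^2$ and $a^3\neq(b-1)^2$, then $P-1$ and $P+1$ have three distinct roots each, $\Sigma$ consists of six points, and the fibre over each of them is of type $I_2$. - If $a^3=(b+1)^2$, $b\ne0$, $a\neq0$, then $P+1$ has three distinct roots, while $P-1$ has a root of order two at $-(b+1)/2a$ and a simple root at $(b+1)/a$. The set $\Sigma=\{-\frac{b+1}{2a},\frac{b+1}{a}\}\cup\{\lambda\mid P(\lambda)=-1\}$ consists of five points. The fibre over $-(b+1)/2a$ is of type $I_4$, and the fibres over the other four points are of type $I_2$. - If $a^3=(b-1)^2$, $b\ne0$, $a\neq0$, then $P-1$ has three distinct roots, while $P+1$ has a root of order two at $-(b-1)/2a$ and a simple root at $(b-1)/a$. The set $\Sigma=\{-\frac{b-1}{2a},\frac{b-1}{a}\}\cup\{\lambda\mid P(\lambda)=1\}$ consists of five points. The fibre over $-(b-1)/2a$ is of type $I_4$, and the fibres over the other four points are of type $I_2$. - If $a=0$ and $b=\pm1$, then $\Sigma=\{0\}\cup\{\theta/\sqrt[3]{2}\mid\theta^3=b\}$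 consists of four points. The fibre over $0$ is of type $I_6$, and the fibres over the other three points are of type $I_2$. - If $a^3=1$ and $b=0$, then $P(X)-1=(2X+a^2)^2(X-a^2)$ and $P(X)+1=(2X-a^2)^2(X+a^2)$, and $\Sigma=\{\frac{a^2}{2},-\frac{a^2}{2},-a^2,a^2\}$ consists of four points. The fibres over $\pm a^2/2$ are of type $I_4$, and the fibres over $\pm a^2$ are of type $I_2$. -/

import Mathlib

noncomputable section

namespace Inose

section FunctionFields

open MvPolynomial

/-- The Inose form: the quartic in the homogeneous coordinates `[x, y, z, w]` (numbered
`0, 1, 2, 3`) whose zero locus in projective space is the surface `Q(a,b)`. -/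
def inoseForm (a b : ℂ) : MvPolynomial (Fin 4) ℂ :=
  X 1 ^ 2 * X 2 * X 3 - 4 * X 0 ^ 3 * X 2 + 3 * C a * X 0 * X 2 * X 3 ^ 2
    - C (1 / 2) * (X 2 ^ 2 * X 3 ^ 2 + X 3 ^ 4) + C b * X 2 * X 3 ^ 3

/-- The equation of `Q(a,b)` in the affine chart `w = 1`, with coordinates `x, y, z`. -/
def inoseAffine (a b : ℂ) : MvPolynomial (Fin 3) ℂ :=
  aeval ![X 0, X 1, X 2, 1] (inoseForm a b)

lemma inoseAffine_eq (a b : ℂ) : inoseAffine a b =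
    X 1 ^ 2 * X 2 - 4 * X 0 ^ 3 * X 2 + 3 * C a * X 0 * X 2
    - C (1 / 2) * (X 2 ^ 2 + 1) + C b * X 2 := by
  simp only [inoseAffine, inoseForm, map_add, map_sub, map_mul, map_pow, aeval_X, map_ofNat,
    aeval_C, MvPolynomial.algebraMap_eq]
  simp

lemma inoseAffine_prime (a b : ℂ) : Prime (inoseAffine a b) := by
  let e := (renameEquiv ℂ (Equiv.swap (0 : Fin 3) 2)).trans (finSuccEquiv ℂ 2)
  rw [← MulEquiv.prime_iff e.toMulEquiv]
  let q : MvPolynomial (Fin 2) ℂ :=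
    X 0 ^ 2 - 4 * X 1 ^ 3 + 3 * C a * X 1 + C b
  let g : Polynomial (MvPolynomial (Fin 2) ℂ) :=
    Polynomial.X ^ 2 + Polynomial.C (-2 * q) * Polynomial.X + Polynomial.C 1
  have hg : e (inoseAffine a b) = Polynomial.C (C (-1 / 2)) * g := by
    have e0 : e (X 0) = Polynomial.C (X 1) := by
      simp only [e, AlgEquiv.trans_apply, renameEquiv_apply, rename_X, Equiv.swap_apply_left]
      exact finSuccEquiv_X_succ (j := (1 : Fin 2))
    have e1 : e (X 1) = Polynomial.C (X 0) := by
      have : Equiv.swap (0 : Fin 3) 2 1 = 1 := by decide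
      simp only [e, AlgEquiv.trans_apply, renameEquiv_apply, rename_X, this]
      exact finSuccEquiv_X_succ (j := (0 : Fin 2))
    have e2 : e (X 2) = Polynomial.X := by
      simp only [e, AlgEquiv.trans_apply, renameEquiv_apply, rename_X, Equiv.swap_apply_right]
      exact finSuccEquiv_X_zero
    have eC (c : ℂ) : e (C c) = Polynomial.C (C c) := e.commutes c
    let k : Polynomial (MvPolynomial (Fin 2) ℂ) := Polynomial.C (C (-1 / 2))
    have h2 : k * (-2) = 1 := by
      have : (-2 : Polynomial (MvPolynomial (Fin 2) ℂ)) = Polynomial.C (C (-2)) := by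
        rw [C_neg, Polynomial.C_neg]; rfl
      rw [this, ← Polynomial.C_mul, ← C_mul]; norm_num
    have h3 : (Polynomial.C (C (1 / 2)) : Polynomial (MvPolynomial (Fin 2) ℂ)) = -k := by
      simp only [k]
      rw [← Polynomial.C_neg, ← C_neg]; norm_num
    rw [inoseAffine_eq]
    change _ = k * g
    simp only [map_add, map_sub, map_mul, map_pow, e0, e1, e2, eC, map_one, g, q, map_neg,
      h3, map_ofNat]
    linear_combination (Polynomial.C (X 0) ^ 2 - 4 * Polynomial.C (X 1) ^ 3
      + 3 * Polynomial.C (C a) * Polynomial.C (X 1) + Polynomial.C (C b)) * Polynomial.X * (-h2)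
  have hu : IsUnit (Polynomial.C (C (-1 / 2)) : Polynomial (MvPolynomial (Fin 2) ℂ)) :=
    ((isUnit_iff_ne_zero.2 (by norm_num : (-1 / 2 : ℂ) ≠ 0)).map C).map Polynomial.C
  have hirr : Irreducible g := by
    have hdeg : g.natDegree = 2 := by
      simp only [g]; compute_degree!
    have hm : g.Monic := by
      simp only [g]; monicity!
    rw [hm.irreducible_iff_roots_eq_zero_of_degree_le_three hdeg.ge (by omega)]
    by_contra h0
    obtain ⟨r, hr⟩ := Multiset.exists_mem_of_ne_zero h0
    have hr := (Polynomial.mem_roots'.1 hr).2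
    have hr' : r * (2 * q - r) = 1 := by
      simp [g, Polynomial.IsRoot] at hr
      linear_combination -hr
    have u1 : IsUnit r := IsUnit.of_mul_eq_one _ hr'
    have u2 : IsUnit (2 * q - r) := IsUnit.of_mul_eq_one_right _ hr'
    obtain ⟨c, -, hc⟩ := MvPolynomial.isUnit_iff_eq_C_of_isReduced.1 u1
    obtain ⟨d, -, hd⟩ := MvPolynomial.isUnit_iff_eq_C_of_isReduced.1 u2
    have hq : 2 * q = C (c + d) := by rw [C_add, ← hc, ← hd]; ring
    have h1 := congrArg (eval ![0, 0]) hq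
    have h2 := congrArg (eval ![1, 0]) hq
    simp [q] at h1 h2
    have : (2 : ℂ) = 0 := by linear_combination h2 - h1
    norm_num at this
  have : Prime (e (inoseAffine a b)) := by
    rw [hg]
    exact (associated_unit_mul_right g _ hu).prime hirr.prime
  exact this

/-- The coordinate ring of the affine chart `w = 1` of `Q(a,b)`. -/
abbrev InoseRing (a b : ℂ) : Type := MvPolynomial (Fin 3) ℂ ⧸ Ideal.span {inoseAffine a b}

instance (a b : ℂ) : (Ideal.span {inoseAffine a b}).IsPrime :=
  (Ideal.span_singleton_prime (inoseAffine_prime a b).ne_zero).2 (inoseAffine_prime a b)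

/-- The function field of `Q(a,b)`, that is, of its minimal resolution `X(a,b)`. -/
abbrev InoseField (a b : ℂ) : Type := FractionRing (InoseRing a b)

/-- The rational function `x/w` on `Q(a,b)`. -/
def coordX (a b : ℂ) : InoseField a b :=
  algebraMap (InoseRing a b) (InoseField a b) (Ideal.Quotient.mk _ (X 0))

/-- The rational function `y/w` on `Q(a,b)`. -/
def coordY (a b : ℂ) : InoseField a b :=
  algebraMap (InoseRing a b) (InoseField a b) (Ideal.Quotient.mk _ (X 1))

/-- The rational function `z/w` on `Q(a,b)`. -/
def coordZ (a b : ℂ) : InoseField a b :=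
  algebraMap (InoseRing a b) (InoseField a b) (Ideal.Quotient.mk _ (X 2))

/-- The map from polynomials in `x, y, z` to rational functions on `Q(a,b)`. -/
def toField (a b : ℂ) : MvPolynomial (Fin 3) ℂ →ₐ[ℂ] InoseField a b :=
  (IsScalarTower.toAlgHom ℂ (InoseRing a b) (InoseField a b)).comp
    (Ideal.Quotient.mkₐ ℂ (Ideal.span {inoseAffine a b}))

lemma aeval_coord (a b : ℂ) :
    aeval ![coordX a b, coordY a b, coordZ a b] = toField a b := by
  ext i
  fin_cases i <;> simp [toField, coordX, coordY, coordZ]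

lemma coord_eq (a b : ℂ) :
    coordY a b ^ 2 * coordZ a b - 4 * coordX a b ^ 3 * coordZ a b
      + 3 * algebraMap ℂ _ a * coordX a b * coordZ a b
      - algebraMap ℂ _ (1 / 2) * (coordZ a b ^ 2 + 1) + algebraMap ℂ _ b * coordZ a b = 0 := by
  have h : toField a b (inoseAffine a b) = 0 := by
    have : Ideal.Quotient.mk (Ideal.span {inoseAffine a b}) (inoseAffine a b) = 0 :=
      Ideal.Quotient.eq_zero_iff_mem.2 (Ideal.mem_span_singleton_self _)
    simp [toField, this]
  rw [← aeval_coord] at h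
  have h := (congrArg _ (inoseAffine_eq a b)).symm.trans h
  simpa only [map_add, map_sub, map_mul, map_pow, aeval_X, map_ofNat, aeval_C, map_one,
    Matrix.cons_val] using h

lemma coordZ_ne_zero (a b : ℂ) : coordZ a b ≠ 0 := by
  intro h
  have := coord_eq a b
  rw [h] at this
  simp at this

/-- The substitution `(x, y, z) ↦ (x, -y, 1/z)` on polynomials. -/
def betaPoly (a b : ℂ) : MvPolynomial (Fin 3) ℂ →ₐ[ℂ] InoseField a b :=
  aeval ![coordX a b, - coordY a b, (coordZ a b)⁻¹]

lemma betaPoly_inoseAffine (a b : ℂ) : betaPoly a b (inoseAffine a b) = 0 := by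
  have h := coord_eq a b
  have hz := coordZ_ne_zero a b
  refine (congrArg _ (inoseAffine_eq a b)).trans ?_
  simp only [betaPoly, map_add, map_sub, map_mul, map_pow, aeval_X, map_ofNat, aeval_C, map_one,
    Matrix.cons_val]
  field_simp
  linear_combination h

/-- The substitution `(x, y, z) ↦ (x, -y, 1/z)` on the coordinate ring. -/
def betaRing (a b : ℂ) : InoseRing a b →ₐ[ℂ] InoseField a b :=
  Ideal.Quotient.liftₐ _ (betaPoly a b) (by
    intro f hf
    obtain ⟨g, rfl⟩ := Ideal.mem_span_singleton.1 hf
    rw [map_mul, betaPoly_inoseAffine, zero_mul])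

lemma betaRing_mk (a b : ℂ) (f : MvPolynomial (Fin 3) ℂ) :
    betaRing a b (Ideal.Quotient.mk _ f) = betaPoly a b f := rfl

lemma toField_X (a b : ℂ) : toField a b (X 0) = coordX a b ∧ toField a b (X 1) = coordY a b ∧
    toField a b (X 2) = coordZ a b := ⟨rfl, rfl, rfl⟩

lemma betaPoly_X (a b : ℂ) : betaPoly a b (X 0) = coordX a b ∧
    betaPoly a b (X 1) = - coordY a b ∧ betaPoly a b (X 2) = (coordZ a b)⁻¹ := by
  simp [betaPoly]

lemma exists_reflect (a b : ℂ) (p : MvPolynomial (Fin 3) ℂ) : ∃ (N : ℕ)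
    (h : MvPolynomial (Fin 3) ℂ), toField a b h = coordZ a b ^ N * betaPoly a b p ∧
      coordZ a b ^ N * betaPoly a b h = toField a b p := by
  have hz := coordZ_ne_zero a b
  obtain ⟨t0, t1, t2⟩ := toField_X a b
  obtain ⟨b0, b1, b2⟩ := betaPoly_X a b
  induction p using MvPolynomial.induction_on with
  | C c =>
    refine ⟨0, C c, ?_, ?_⟩
    · rw [pow_zero, one_mul]
      exact ((toField a b).commutes c).trans ((betaPoly a b).commutes c).symm
    · rw [pow_zero, one_mul]
      exact ((betaPoly a b).commutes c).trans ((toField a b).commutes c).symm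
  | add p q hp hq =>
    obtain ⟨N, g, h1, h2⟩ := hp
    obtain ⟨M, k, h3, h4⟩ := hq
    refine ⟨N + M, X 2 ^ M * g + X 2 ^ N * k, ?_, ?_⟩
    · simp only [map_add, map_mul, map_pow, t2, h1, h3]; ring
    · simp only [map_add, map_mul, map_pow, b2, ← h2, ← h4, inv_pow]
      field_simp
      ring
  | mul_X p i hp =>
    obtain ⟨N, g, h1, h2⟩ := hp
    fin_cases i
    · refine ⟨N, g * X 0, ?_, ?_⟩ <;> simp only [Fin.zero_eta, map_mul, t0, b0, h1, ← h2] <;> ring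
    · refine ⟨N, -(g * X 1), ?_, ?_⟩ <;>
        simp only [Fin.mk_one, map_mul, map_neg, t1, b1, h1, ← h2] <;> ring
    · refine ⟨N + 1, g, ?_, ?_⟩ <;> simp only [Fin.reduceFinMk, map_mul, t2, b2, h1, ← h2]
      · field_simp
        ring
      · ring

lemma betaRing_injective (a b : ℂ) : Function.Injective (betaRing a b) := by
  rw [injective_iff_map_eq_zero]
  intro r hr
  obtain ⟨p, rfl⟩ := Ideal.Quotient.mk_surjective r
  obtain ⟨N, h, h1, h2⟩ := exists_reflect a b p
  have hinj : Function.Injective (algebraMap (InoseRing a b) (InoseField a b)) :=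
    IsFractionRing.injective _ _
  rw [betaRing_mk] at hr
  rw [hr, mul_zero] at h1
  have h3 : Ideal.Quotient.mk (Ideal.span {inoseAffine a b}) h = 0 :=
    hinj (h1.trans (map_zero _).symm)
  have h4 : betaPoly a b h = 0 := by
    rw [← betaRing_mk, h3, map_zero]
  rw [h4, mul_zero] at h2
  exact hinj (h2.symm.trans (map_zero _).symm)

/-- The substitution `(x, y, z) ↦ (x, -y, 1/z)` on the function field. -/
def betaHom (a b : ℂ) : InoseField a b →ₐ[ℂ] InoseField a b :=
  IsFractionRing.liftAlgHom (betaRing_injective a b)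

lemma betaHom_coord (a b : ℂ) : betaHom a b (coordX a b) = coordX a b ∧
    betaHom a b (coordY a b) = - coordY a b ∧ betaHom a b (coordZ a b) = (coordZ a b)⁻¹ := by
  obtain ⟨b0, b1, b2⟩ := betaPoly_X a b
  refine ⟨?_, ?_, ?_⟩
  · exact (IsFractionRing.lift_algebraMap (betaRing_injective a b) _).trans b0
  · exact (IsFractionRing.lift_algebraMap (betaRing_injective a b) _).trans b1
  · exact (IsFractionRing.lift_algebraMap (betaRing_injective a b) _).trans b2

lemma betaHom_betaHom (a b : ℂ) : (betaHom a b).comp (betaHom a b) = AlgHom.id ℂ _ := by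
  obtain ⟨b0, b1, b2⟩ := betaHom_coord a b
  have key : ((betaHom a b).comp (betaHom a b)).comp (toField a b) = toField a b := by
    apply MvPolynomial.algHom_ext
    intro i
    obtain ⟨t0, t1, t2⟩ := toField_X a b
    fin_cases i <;> simp [t0, t1, t2, b0, b1, b2]
  apply AlgHom.coe_ringHom_injective
  apply IsFractionRing.ringHom_ext (A := InoseRing a b)
  intro r
  obtain ⟨p, rfl⟩ := Ideal.Quotient.mk_surjective r
  exact DFunLike.congr_fun key p

/-- The involution of the function field induced by the birational involution
`[x, y, z, w] ↦ [xz, -yz, w², zw]` of `Q(a,b)`; in the chart `w = 1` it is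
`(x, y, z) ↦ (x, -y, 1/z)`, see `beta_coord`. -/
def beta (a b : ℂ) : InoseField a b ≃ₐ[ℂ] InoseField a b :=
  AlgEquiv.ofAlgHom (betaHom a b) (betaHom a b) (betaHom_betaHom a b) (betaHom_betaHom a b)

lemma beta_coord (a b : ℂ) : beta a b (coordX a b) = coordX a b ∧
    beta a b (coordY a b) = - coordY a b ∧ beta a b (coordZ a b) = (coordZ a b)⁻¹ :=
  betaHom_coord a b

/-- The function field of the quotient of `X(a,b)` by the involution, that is, of its minimal
resolution `Y(a,b)`. -/
abbrev QuotientField (a b : ℂ) : IntermediateField ℂ (InoseField a b) :=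
  IntermediateField.fixedField (Subgroup.zpowers (beta a b))

/-- The rational function `x/w` on `Y(a,b)`: the affine coordinate `λ` of the point
`[λ, 1] = [x, w]` on the projective line, along which `Y(a,b)` is fibred. -/
def lam (a b : ℂ) : QuotientField a b :=
  ⟨coordX a b, by
    have h : Subgroup.zpowers (beta a b) ≤ MulAction.stabilizer _ (coordX a b) :=
      (Subgroup.zpowers_le).2 (beta_coord a b).1
    rintro ⟨g, hg⟩
    exact h hg⟩

/-- The cubic polynomial `P(X) = 4X³ - 3aX - b`. -/
def cubicP (a b : ℂ) : Polynomial ℂ :=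
  4 * Polynomial.X ^ 3 - 3 * Polynomial.C a * Polynomial.X - Polynomial.C b

/-- The set `Σ = {λ | P(λ)² = 1}`. -/
def singularSet (a b : ℂ) : Set ℂ := {c | (cubicP a b).eval c ^ 2 = 1}

end FunctionFields

section Models

open IsLocalRing

/-- A local ring between `ℂ` and the field `K`. -/
@[ext]
structure LocalRingIn (K : Type*) [Field K] [Algebra ℂ K] where
  carrier : Subalgebra ℂ K
  isLocal : IsLocalRing carrier

attribute [instance] LocalRingIn.isLocal

namespace LocalRingIn

variable {K : Type*} [Field K] [Algebra ℂ K]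

lemma coe_ne_zero {A : Subalgebra ℂ K} {p : Ideal A} {d : A} (hd : d ∉ p) : (d : K) ≠ 0 := by
  intro h
  have h0 : d = 0 := Subtype.ext h
  exact hd (h0 ▸ p.zero_mem)

/-- The subalgebra of fractions `n / d` with `n, d ∈ A` and `d ∉ p`. -/
def fractions (A : Subalgebra ℂ K) (p : Ideal A) [hp : p.IsPrime] : Subalgebra ℂ K where
  carrier := {f | ∃ n d : A, d ∉ p ∧ f = n / d}
  mul_mem' := by
    rintro _ _ ⟨n, d, hd, rfl⟩ ⟨m, e, he, rfl⟩
    refine ⟨n * m, d * e, fun h => (hp.mem_or_mem h).elim hd he, ?_⟩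
    simp only [MulMemClass.coe_mul]
    exact div_mul_div_comm _ _ _ _
  add_mem' := by
    rintro _ _ ⟨n, d, hd, rfl⟩ ⟨m, e, he, rfl⟩
    refine ⟨n * e + d * m, d * e, fun h => (hp.mem_or_mem h).elim hd he, ?_⟩
    have hd0 : (d : K) ≠ 0 := coe_ne_zero hd
    have he0 : (e : K) ≠ 0 := coe_ne_zero he
    simp only [MulMemClass.coe_mul, AddMemClass.coe_add]
    exact div_add_div _ _ hd0 he0
  algebraMap_mem' c := by
    refine ⟨algebraMap ℂ A c, 1, fun h => hp.ne_top ((Ideal.eq_top_iff_one _).2 h), ?_⟩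
    simp

/-- The localization of a subalgebra of `K` at a prime ideal. -/
def ofPrime (A : Subalgebra ℂ K) (p : Ideal A) [hp : p.IsPrime] : LocalRingIn K where
  carrier := fractions A p
  isLocal := by
    have key (n d : A) (hd : d ∉ p) (hn : n ∉ p) (h : (n / d : K) ∈ fractions A p) :
        IsUnit (⟨n / d, h⟩ : fractions A p) := by
      have hd0 : (d : K) ≠ 0 := coe_ne_zero hd
      have hn0 : (n : K) ≠ 0 := coe_ne_zero hn
      refine IsUnit.of_mul_eq_one ⟨d / n, d, n, hn, rfl⟩ (Subtype.ext ?_)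
      change (n / d : K) * (d / n) = 1
      field_simp
    refine IsLocalRing.of_isUnit_or_isUnit_one_sub_self ?_
    rintro ⟨f, n, d, hd, rfl⟩
    by_cases hn : n ∈ p
    · right
      have hd0 : (d : K) ≠ 0 := coe_ne_zero hd
      have hdn : d - n ∉ p := fun h => hd (by simpa using p.add_mem h hn)
      have he : (1 - n / d : K) = ((d - n : A) : K) / d := by
        rw [AddSubgroupClass.coe_sub]; field_simp
      have := key (d - n) d hd hdn ⟨_, _, hd, rfl⟩
      convert this using 1
      exact Subtype.ext he
    · left
      exact key n d hd hn _

/-- The local ring `P` is dominated by the valuation ring `V`: `P ⊆ V`, and elements of `P` that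
are invertible in `V` are invertible in `P`. In other words, `V` has centre `P`. -/
def IsDominatedBy (P : LocalRingIn K) (V : ValuationSubring K) : Prop :=
  (∀ f ∈ P.carrier, f ∈ V) ∧ ∀ f ∈ P.carrier, f⁻¹ ∈ V → f⁻¹ ∈ P.carrier

/-- The rational function `t` is regular at `P` and vanishes there. -/
def Vanishes (P : LocalRingIn K) (t : K) : Prop :=
  ∃ h : t ∈ P.carrier, (⟨t, h⟩ : P.carrier) ∈ maximalIdeal P.carrier

/-- For a point `P` lying on the curve with local ring `C` (that is, `P.carrier ≤ C.carrier`):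
the ideal of the curve in the local ring of `P`. -/
def idealOf (P C : LocalRingIn K) : Ideal P.carrier :=
  Ideal.span {f : P.carrier | C.Vanishes (f : K)}

/-- The order of vanishing of `t` along the curve whose local ring is the discrete valuation
ring `C`. -/
def order (C : LocalRingIn K) (t : K) : ℕ∞ :=
  ⨆ (n : ℕ) (_ : ∃ h : t ∈ C.carrier, (⟨t, h⟩ : C.carrier) ∈ maximalIdeal C.carrier ^ n), (n : ℕ∞)

/-- The curve with local ring `C` is rational: its function field, which is the residue field
of `C`, is a rational function field in one variable. -/
def IsRational (C : LocalRingIn K) : Prop :=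
  Nonempty (RatFunc ℂ ≃ₐ[ℂ] ResidueField C.carrier)

end LocalRingIn

/-- The points (in the sense of schemes) covered by the affine varieties with coordinate rings in
`charts`, each given by its local ring. -/
def pointsOf {K : Type*} [Field K] [Algebra ℂ K] (charts : Set (Subalgebra ℂ K)) :
    Set (LocalRingIn K) :=
  {P | ∃ A ∈ charts, ∃ (p : Ideal A) (_ : p.IsPrime), P = LocalRingIn.ofPrime A p}

/-- A complete algebraic variety over `ℂ` with function field `K`, in the sense of Zariski: it is
covered by finitely many affine varieties with function field `K`, points of these being identified
when they have the same local ring in `K`. It is separated and complete by the valuative criterion: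
every valuation ring of `K` over `ℂ` has exactly one centre. Every complete variety over `ℂ` is of
this form. -/
structure CompleteVariety (K : Type*) [Field K] [Algebra ℂ K] where
  /-- the coordinate rings of the affine charts -/
  charts : Set (Subalgebra ℂ K)
  finite_charts : charts.Finite
  fg : ∀ A ∈ charts, A.FG
  isFractionRing : ∀ A ∈ charts, IsFractionRing A K
  existsUnique_centre : ∀ V : ValuationSubring K, (∀ c : ℂ, algebraMap ℂ K c ∈ V) →
    ∃! P : LocalRingIn K, P ∈ pointsOf charts ∧ P.IsDominatedBy V

namespace CompleteVariety

variable {K : Type*} [Field K] [Algebra ℂ K]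

/-- The points of the variety, including the generic points of subvarieties. -/
def points (Y : CompleteVariety K) : Set (LocalRingIn K) := pointsOf Y.charts

/-- The closed points of the variety. -/
def closedPoints (Y : CompleteVariety K) : Set (LocalRingIn K) :=
  {P | ∃ A ∈ Y.charts, ∃ (p : Ideal A) (_ : p.IsMaximal), P = LocalRingIn.ofPrime A p}

/-- The variety is nonsingular. -/
def IsNonsingular (Y : CompleteVariety K) : Prop :=
  ∀ P ∈ Y.closedPoints, IsRegularLocalRing P.carrier

/-- The curves on a nonsingular surface, each given by the local ring of its generic point. -/
def curves (Y : CompleteVariety K) : Set (LocalRingIn K) :=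
  {C | C ∈ Y.points ∧ IsDiscreteValuationRing C.carrier}

/-- The closed points of the curve `C`. -/
def closedPointsOn (Y : CompleteVariety K) (C : LocalRingIn K) : Set (LocalRingIn K) :=
  {P | P ∈ Y.closedPoints ∧ P.carrier ≤ C.carrier}

/-- The rational function `f` defines a morphism from the variety to the projective line. -/
def IsMorphism (Y : CompleteVariety K) (f : K) : Prop :=
  ∀ P ∈ Y.points, f ∈ P.carrier ∨ f⁻¹ ∈ P.carrier

/-- The curve `C` on a surface is nonsingular: at each of its closed points the (one-dimensional)
local ring of `C`, which is the local ring of the surface modulo the ideal of `C`, has a principal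
maximal ideal. -/
def IsNonsingularCurve (Y : CompleteVariety K) (C : LocalRingIn K) : Prop :=
  ∀ P ∈ Y.closedPointsOn C, ∃ g : P.carrier, maximalIdeal P.carrier = P.idealOf C ⊔ Ideal.span {g}

/-- The length of the quotient ring `R / I`. -/
def quotientLength (R : Type*) [CommRing R] (I : Ideal R) : ℕ∞ := Module.length R (R ⧸ I)

/-- The intersection number of two distinct curves on a nonsingular complete surface. -/
def intersectionNumber (Y : CompleteVariety K) (C D : LocalRingIn K) : ℕ∞ :=
  ∑ᶠ P ∈ Y.closedPointsOn C ∩ Y.closedPointsOn D,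
    quotientLength P.carrier (P.idealOf C ⊔ P.idealOf D)

/-- The two curves meet transversally at each of their common points. -/
def MeetTransversally (Y : CompleteVariety K) (C D : LocalRingIn K) : Prop :=
  ∀ P ∈ Y.closedPointsOn C ∩ Y.closedPointsOn D,
    P.idealOf C ⊔ P.idealOf D = maximalIdeal P.carrier

/-! Fibres. Let a surface be fibred over the projective line by the rational function `f`. The
fibre over the point `c` is described by the local parameter `t = f - c`, the fibre over infinity
by the local parameter `t = f⁻¹`. -/

/-- The irreducible components of the fibre with local parameter `t`; the multiplicity of the
component `C` in the fibre is `C.order t`. -/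
def fibreComponents (Y : CompleteVariety K) (t : K) : Set (LocalRingIn K) :=
  {C | C ∈ Y.curves ∧ C.Vanishes t}

/-- The fibre is nonsingular: at each of its points the local parameter `t` of the base is part of
a system of local parameters of the surface. -/
def IsSmoothFibre (Y : CompleteVariety K) (t : K) : Prop :=
  ∀ P ∈ Y.closedPoints, P.Vanishes t →
    ∀ h : t ∈ P.carrier, (⟨t, h⟩ : P.carrier) ∉ maximalIdeal P.carrier ^ 2

/-- The component `E` of the fibre with local parameter `t` is an exceptional curve of the first
kind: a nonsingular rational curve with self-intersection `-1`. The self-intersection is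
expressed through the fact that the intersection number of `E` with the whole fibre is `0`. -/
def IsExceptionalComponent (Y : CompleteVariety K) (t : K) (E : LocalRingIn K) : Prop :=
  E ∈ Y.fibreComponents t ∧ Y.IsNonsingularCurve E ∧ E.IsRational ∧
    ∑ᶠ D ∈ Y.fibreComponents t \ {E}, D.order t * Y.intersectionNumber D E = E.order t

/-- The surface is relatively minimal over the projective line: no fibre of the morphism given by
`f` contains an exceptional curve of the first kind. -/
def IsRelativelyMinimal (Y : CompleteVariety K) (f : K) : Prop :=
  (∀ (c : ℂ) (E : LocalRingIn K), ¬ Y.IsExceptionalComponent (f - algebraMap ℂ K c) E) ∧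
    ∀ E : LocalRingIn K, ¬ Y.IsExceptionalComponent f⁻¹ E

/-- The fibre with local parameter `t` consists of nonsingular rational curves `Cᵢ` (for `i` in
`ι`) with multiplicities `mult i` and intersection numbers `Cᵢ · Cⱼ = inter i j` for `i ≠ j`; all
intersections are transversal, and no three components pass through the same point. -/
def HasFibreConfiguration (Y : CompleteVariety K) (t : K) {ι : Type} (mult : ι → ℕ∞)
    (inter : ι → ι → ℕ∞) : Prop :=
  ∃ C : ι → LocalRingIn K, Function.Injective C ∧ Set.range C = Y.fibreComponents t ∧
    (∀ i, Y.IsNonsingularCurve (C i) ∧ (C i).IsRational ∧ (C i).order t = mult i) ∧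
    (∀ i j, i ≠ j → Y.intersectionNumber (C i) (C j) = inter i j ∧
      Y.MeetTransversally (C i) (C j)) ∧
    ∀ i j k, i ≠ j → j ≠ k → i ≠ k →
      Y.closedPointsOn (C i) ∩ Y.closedPointsOn (C j) ∩ Y.closedPointsOn (C k) = ∅

/-- The fibre is of Kodaira type `I_n`, where `n ≥ 2`: a cycle of `n` nonsingular rational curves
of multiplicity one (for `n = 2`: two curves meeting in two points). -/
def IsFibreI (Y : CompleteVariety K) (t : K) (n : ℕ) : Prop :=
  2 ≤ n ∧ Y.HasFibreConfiguration t (ι := ZMod n) (fun _ => 1)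
    (fun i j => (if j = i + 1 then 1 else 0) + (if i = j + 1 then 1 else 0))

/-- The dual graph of a fibre of type `I*_n`: a chain `inl 0, …, inl n` with two further vertices
`inr 0, inr 1` attached to its first vertex and two, `inr 2, inr 3`, to its last vertex. -/
def interIStar (n : ℕ) : Fin (n + 1) ⊕ Fin 4 → Fin (n + 1) ⊕ Fin 4 → ℕ∞
  | .inl i, .inl j => if i.val + 1 = j.val ∨ j.val + 1 = i.val then 1 else 0
  | .inl i, .inr k => if (k.val < 2 ∧ i.val = 0) ∨ (2 ≤ k.val ∧ i.val = n) then 1 else 0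
  | .inr k, .inl i => if (k.val < 2 ∧ i.val = 0) ∨ (2 ≤ k.val ∧ i.val = n) then 1 else 0
  | .inr _, .inr _ => 0

/-- The fibre is of Kodaira type `I*_n`: the chain of curves has multiplicity two, the four further
curves have multiplicity one. -/
def IsFibreIStar (Y : CompleteVariety K) (t : K) (n : ℕ) : Prop :=
  Y.HasFibreConfiguration t (Sum.elim (fun _ => 2) (fun _ => 1)) (interIStar n)

end CompleteVariety

/-- The field `κ` is the function field of an elliptic curve over `ℂ` with modular invariant `J`,
normalized as `J = j / 1728`. -/
def HasModularInvariant (κ : Type*) [Field κ] [Algebra ℂ κ] (J : ℂ) : Prop :=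
  ∃ (W : WeierstrassCurve ℂ) (_ : W.IsElliptic), W.j = 1728 * J ∧
    Nonempty (W.toAffine.FunctionField ≃ₐ[ℂ] κ)

/-- The functional invariant of the elliptic fibration given by `f` is the meromorphic function
`J`: each nonsingular fibre over a point `c ∈ ℂ` is an irreducible curve whose function field is
that of an elliptic curve with modular invariant `J c`. -/
def CompleteVariety.IsFunctionalInvariant {K : Type*} [Field K] [Algebra ℂ K]
    (Y : CompleteVariety K) (f : K) (J : ℂ → ℂ) : Prop :=
  ∀ c : ℂ, Y.IsSmoothFibre (f - algebraMap ℂ K c) →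
    ∃ C : LocalRingIn K, Y.fibreComponents (f - algebraMap ℂ K c) = {C} ∧
      HasModularInvariant (ResidueField C.carrier) (J c)

end Models

end Inose

end

noncomputable section

namespace Inose

open IsLocalRing

section LocalAlgebra

variable {R : Type*} [CommRing R] [IsLocalRing R]

lemma two_le_ringKrullDim {p : Ideal R} [hp : p.IsPrime] {q : Ideal R} [hq : q.IsPrime] (h0 : q < p)
    (hpm : p ≠ maximalIdeal R) : 2 ≤ ringKrullDim R := by
  have h1 : p < maximalIdeal R := lt_of_le_of_ne (le_maximalIdeal hp.ne_top) hpm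
  have h2 := Ideal.height_add_one_le_of_lt_of_isPrime h0
  have h3 := Ideal.height_add_one_le_of_lt_of_isPrime h1
  rw [← maximalIdeal_height_eq_ringKrullDim]
  have h4 : (2 : ℕ∞) ≤ (maximalIdeal R).height := by
    calc (2 : ℕ∞) = 0 + 1 + 1 := by norm_num
      _ ≤ q.height + 1 + 1 := by gcongr; exact zero_le
      _ ≤ _ := (by gcongr : q.height + 1 + 1 ≤ p.height + 1).trans h3
  exact WithBot.coe_le_coe.2 h4

variable [IsNoetherianRing R]

lemma notMem_sq_of_pair {g y : R} (hm : maximalIdeal R = Ideal.span {g, y})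
    (hd : 2 ≤ ringKrullDim R) : g ∉ maximalIdeal R ^ 2 := by
  intro hg
  have h1 : maximalIdeal R ≤ Ideal.span {y} := by
    apply Submodule.le_of_le_smul_of_le_jacobson_bot (I := maximalIdeal R)
      (IsNoetherian.noetherian _) (IsLocalRing.maximalIdeal_le_jacobson _)
    rw [smul_eq_mul, ← pow_two]
    nth_rw 1 [hm]
    rw [Ideal.span_le]
    rintro z (rfl | rfl)
    · exact Submodule.mem_sup_right hg
    · exact Submodule.mem_sup_left (Ideal.subset_span rfl)
  have h2 : maximalIdeal R = Ideal.span {y} := by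
    refine le_antisymm h1 ?_
    rw [hm]
    exact Ideal.span_mono (by simp)
  have h3 := ringKrullDim_le_spanFinrank_maximalIdeal R
  have h4 : (maximalIdeal R).spanFinrank ≤ 1 := by
    rw [h2]
    exact (Submodule.spanFinrank_span_le_ncard_of_finite (Set.finite_singleton y)).trans (by simp)
  have h5 := hd.trans h3
  have h6 : 2 ≤ (maximalIdeal R).spanFinrank := by exact_mod_cast h5
  omega

lemma isRegularLocalRing_of_pair {g y : R} (hm : maximalIdeal R = Ideal.span {g, y})
    (hd : 2 ≤ ringKrullDim R) : IsRegularLocalRing R := by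
  apply IsRegularLocalRing.of_spanFinrank_maximalIdeal_le
  refine le_trans ?_ hd
  have : (maximalIdeal R).spanFinrank ≤ 2 := by
    rw [hm]
    exact (Submodule.spanFinrank_span_le_ncard_of_finite (Set.toFinite {g, y})).trans
      ((Set.ncard_insert_le _ _).trans (by simp))
  exact_mod_cast this

end LocalAlgebra

section LocalRings

variable {K : Type*} [Field K] [Algebra ℂ K]

namespace LocalRingIn

lemma mem_maximalIdeal_iff (P : LocalRingIn K) (f : P.carrier) :
    f ∈ maximalIdeal P.carrier ↔ (f : K) = 0 ∨ (f : K)⁻¹ ∉ P.carrier := by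
  rw [mem_maximalIdeal, mem_nonunits_iff]
  constructor
  · intro h
    by_contra! hc
    refine h (IsUnit.of_mul_eq_one ⟨_, hc.2⟩ (Subtype.ext ?_))
    simp [mul_inv_cancel₀ hc.1]
  · rintro h ⟨u, rfl⟩
    have h1 : ((u : P.carrier) : K) * ((u⁻¹ : P.carrierˣ) : P.carrier) = 1 := by
      rw [← MulMemClass.coe_mul, Units.mul_inv]; rfl
    rcases h with h | h
    · rw [h] at h1; simp at h1
    · rw [← eq_inv_of_mul_eq_one_right h1] at h
      exact h (Subtype.property _)

lemma vanishes_iff (P : LocalRingIn K) (f : K) :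
    P.Vanishes f ↔ f ∈ P.carrier ∧ (f = 0 ∨ f⁻¹ ∉ P.carrier) := by
  constructor
  · rintro ⟨h, h'⟩
    exact ⟨h, (mem_maximalIdeal_iff P ⟨f, h⟩).1 h'⟩
  · rintro ⟨h, h'⟩
    exact ⟨h, (mem_maximalIdeal_iff P ⟨f, h⟩).2 h'⟩

lemma Vanishes.mul_left {P : LocalRingIn K} {f g : K} (hf : f ∈ P.carrier) (h : P.Vanishes g) :
    P.Vanishes (f * g) := by
  obtain ⟨h1, h2⟩ := h
  exact ⟨mul_mem hf h1, Ideal.mul_mem_left _ (⟨f, hf⟩ : P.carrier) h2⟩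

lemma Vanishes.mul_right {P : LocalRingIn K} {f g : K} (h : P.Vanishes g) (hf : f ∈ P.carrier) :
    P.Vanishes (g * f) := mul_comm f g ▸ h.mul_left hf

lemma mem_fractions {A : Subalgebra ℂ K} {p : Ideal A} [p.IsPrime] {f : K} :
    f ∈ (ofPrime A p).carrier ↔ ∃ n d : A, d ∉ p ∧ f = n / d := Iff.rfl

variable (A : Subalgebra ℂ K) (p : Ideal A) [hp : p.IsPrime]

lemma le_ofPrime : A ≤ (ofPrime A p).carrier := by
  intro a ha
  exact ⟨⟨a, ha⟩, 1, fun h => hp.ne_top ((Ideal.eq_top_iff_one _).2 h), by simp⟩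

/-- The inclusion of a coordinate ring into the local ring at one of its primes. -/
def toLocal : A →ₐ[ℂ] (ofPrime A p).carrier := Subalgebra.inclusion (le_ofPrime A p)

@[simp] lemma coe_toLocal (a : A) : ((toLocal A p a : (ofPrime A p).carrier) : K) = a := rfl

lemma toLocal_mem_iff (a : A) :
    toLocal A p a ∈ maximalIdeal (ofPrime A p).carrier ↔ a ∈ p := by
  rw [mem_maximalIdeal_iff]
  constructor
  · rintro h
    by_contra hn
    rcases h with h | h
    · exact coe_ne_zero hn h
    · exact h ⟨1, a, hn, by simp⟩
  · intro ha
    by_cases h0 : (a : K) = 0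
    · exact Or.inl h0
    · right
      rintro ⟨n, d, hd, h⟩
      have hd0 := coe_ne_zero hd
      have : d = n * a := by
        apply Subtype.ext
        change (d : K) = n * a
        simp only [coe_toLocal] at h
        field_simp at h
        rw [h, mul_comm]
      exact hd (this ▸ p.mul_mem_left n ha)

lemma vanishes_ofPrime (a : A) : (ofPrime A p).Vanishes (a : K) ↔ a ∈ p := by
  rw [← toLocal_mem_iff A p]
  exact ⟨fun h => h.2, fun h => ⟨_, h⟩⟩

instance : Algebra A (ofPrime A p).carrier := (toLocal A p).toRingHom.toAlgebra

lemma isUnit_toLocal {a : A} (ha : a ∉ p) : IsUnit (toLocal A p a) := by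
  by_contra h
  exact ha ((toLocal_mem_iff A p a).1 h)

instance : IsLocalization.AtPrime (ofPrime A p).carrier p where
  map_units := by
    rintro ⟨a, ha⟩
    exact isUnit_toLocal A p ha
  surj := by
    rintro ⟨_, n, d, hd, rfl⟩
    refine ⟨(n, ⟨d, hd⟩), Subtype.ext ?_⟩
    have := coe_ne_zero hd
    change (n / d : K) * d = n
    field_simp
  exists_of_eq := by
    intro x y h
    have : (x : K) = y := congrArg (fun z : (ofPrime A p).carrier => (z : K)) h
    exact ⟨1, by rw [Subtype.ext this]⟩

lemma isNoetherianRing_ofPrime (hA : A.FG) : IsNoetherianRing (ofPrime A p).carrier := by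
  have : Algebra.FiniteType ℂ A := (Subalgebra.fg_iff_finiteType A).1 hA
  have : IsNoetherianRing A := Algebra.FiniteType.isNoetherianRing ℂ A
  exact IsLocalization.isNoetherianRing p.primeCompl _ this

lemma isFractionRing_ofPrime [IsFractionRing A K] : IsFractionRing (ofPrime A p).carrier K := by
  refine IsFractionRing.of_field _ _ fun z => ?_
  obtain ⟨n, d, hd, rfl⟩ := IsFractionRing.div_surjective (A := A) z
  exact ⟨toLocal A p n, toLocal A p d, rfl⟩

lemma maximalIdeal_ofPrime_eq_map :
    maximalIdeal (ofPrime A p).carrier = p.map (toLocal A p) := by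
  exact (IsLocalization.AtPrime.map_eq_maximalIdeal p (ofPrime A p).carrier).symm

/-- A local generation criterion. -/
lemma maximalIdeal_ofPrime_eq_span (S : Set A) (hS : S ⊆ p)
    (h : ∀ a ∈ p, ∃ d ∉ p, d * a ∈ Ideal.span S) :
    maximalIdeal (ofPrime A p).carrier = Ideal.span (toLocal A p '' S) := by
  rw [maximalIdeal_ofPrime_eq_map]
  apply le_antisymm
  · rw [Ideal.map_le_iff_le_comap]
    intro a ha
    obtain ⟨d, hd, hda⟩ := h a ha
    have h1 := Ideal.mem_map_of_mem (toLocal A p) hda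
    rw [Ideal.map_span, map_mul] at h1
    exact (Ideal.unit_mul_mem_iff_mem _ (isUnit_toLocal A p hd)).1 h1
  · rw [Ideal.span_le]
    rintro _ ⟨s, hs, rfl⟩
    exact Ideal.mem_map_of_mem _ (hS hs)

lemma ofPrime_congr {q : Ideal A} [q.IsPrime] (h : p = q) : ofPrime A p = ofPrime A q := by
  subst h; rfl

lemma exists_const (hA : A.FG) (q : Ideal A) [hq : q.IsMaximal] (a : A) :
    ∃ c : ℂ, a - algebraMap ℂ A c ∈ q := by
  have : Algebra.FiniteType ℂ A := (Subalgebra.fg_iff_finiteType A).1 hA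
  have h1 : Algebra.FiniteType ℂ (A ⧸ q) :=
    Algebra.FiniteType.of_surjective (Ideal.Quotient.mkₐ ℂ q) Ideal.Quotient.mk_surjective
  let := Ideal.Quotient.field q
  have h2 : Module.Finite ℂ (A ⧸ q) := finite_of_finite_type_of_isJacobsonRing _ _
  obtain ⟨c, hc⟩ := (IsAlgClosed.algebraMap_bijective_of_isIntegral (k := ℂ) (K := A ⧸ q)).2
    (Ideal.Quotient.mk q a)
  refine ⟨c, ?_⟩
  rw [← Ideal.Quotient.eq_zero_iff_mem, map_sub, ← hc, sub_eq_zero]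
  rfl

end LocalRingIn

section Centre

variable (A : Subalgebra ℂ K) (V : ValuationSubring K)

/-- The coordinate ring `A` is contained in the valuation ring `V`. -/
def Below : Prop := ∀ a ∈ A, a ∈ V

variable {A V}

/-- The ideal of the centre of `V` on the affine variety with coordinate ring `A`. -/
def centreIdeal (h : Below A V) : Ideal A :=
  (maximalIdeal V).comap (A.subtype.codRestrict V.toSubring fun a => h a a.2)

instance (h : Below A V) : (centreIdeal h).IsPrime := by
  unfold centreIdeal; infer_instance

lemma notMem_maximalIdeal_iff {K : Type*} [Field K] {V : ValuationSubring K} (f : V) : f ∉ maximalIdeal V ↔ (f : K) ≠ 0 ∧ (f : K)⁻¹ ∈ V := by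
  rw [mem_maximalIdeal, mem_nonunits_iff, not_not]
  constructor
  · rintro ⟨u, rfl⟩
    have h1 : ((u : V) : K) * ((u⁻¹ : Vˣ) : V) = 1 := by
      rw [← MulMemClass.coe_mul, Units.mul_inv]; rfl
    refine ⟨fun h => by rw [h] at h1; simp at h1, ?_⟩
    rw [← eq_inv_of_mul_eq_one_right h1]
    exact Subtype.property _
  · rintro ⟨h, h'⟩
    refine IsUnit.of_mul_eq_one ⟨_, h'⟩ (Subtype.ext ?_)
    simp [mul_inv_cancel₀ h]

lemma notMem_centreIdeal (h : Below A V) (a : A) :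
    a ∉ centreIdeal h ↔ (a : K) ≠ 0 ∧ (a : K)⁻¹ ∈ V :=
  notMem_maximalIdeal_iff (V := V) ⟨a, h a a.2⟩

/-- The local ring of the centre of `V` on the affine variety with coordinate ring `A`. -/
def centre (h : Below A V) : LocalRingIn K := LocalRingIn.ofPrime A (centreIdeal h)

lemma le_centre (h : Below A V) : A ≤ (centre h).carrier := LocalRingIn.le_ofPrime A _

lemma inv_mem_centre (h : Below A V) {f : K} (hf : f ∈ (centre h).carrier) (hV : f⁻¹ ∈ V) :
    f⁻¹ ∈ (centre h).carrier := by
  by_cases h0 : f = 0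
  · subst h0; simp
  obtain ⟨n, d, hd, rfl⟩ := hf
  refine ⟨d, n, ?_, by simp⟩
  rw [notMem_centreIdeal]
  have hd0 : (d : K) ≠ 0 := LocalRingIn.coe_ne_zero hd
  refine ⟨fun hn => h0 (by simp [hn]), ?_⟩
  have h1 := V.mul_mem _ _ hV ((notMem_centreIdeal h d).1 hd).2
  rw [inv_div, div_mul_eq_mul_div, mul_inv_cancel₀ hd0, one_div] at h1
  exact h1

lemma mem_centre_of_inv (h : Below A V) {f : K} (hf : f⁻¹ ∈ (centre h).carrier) (hV : f ∈ V) :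
    f ∈ (centre h).carrier := by
  have := inv_mem_centre h hf (by simpa using hV)
  simpa using this

lemma centre_isDominatedBy (h : Below A V) : (centre h).IsDominatedBy V := by
  refine ⟨?_, fun f hf hV => inv_mem_centre h hf hV⟩
  rintro _ ⟨n, d, hd, rfl⟩
  rw [div_eq_mul_inv]
  exact V.mul_mem _ _ (h n n.2) ((notMem_centreIdeal h d).1 hd).2

lemma centre_le_of_le {A' : Subalgebra ℂ K} (h : Below A V) (h' : Below A' V)
    (hle : A ≤ (centre h').carrier) : (centre h).carrier ≤ (centre h').carrier := by
  rintro _ ⟨n, d, hd, rfl⟩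
  rw [div_eq_mul_inv]
  exact mul_mem (hle n.2) (inv_mem_centre h' (hle d.2) ((notMem_centreIdeal h d).1 hd).2)

lemma centre_eq_of_le {A' : Subalgebra ℂ K} (h : Below A V) (h' : Below A' V)
    (hle : A ≤ (centre h').carrier) (hle' : A' ≤ (centre h).carrier) : centre h = centre h' :=
  LocalRingIn.ext (le_antisymm (centre_le_of_le h h' hle) (centre_le_of_le h' h hle'))

lemma eq_centre_of_isDominatedBy {p : Ideal A} [p.IsPrime]
    (hP : (LocalRingIn.ofPrime A p).IsDominatedBy V) :
    ∃ (h : Below A V), p = centreIdeal h := by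
  have h : Below A V := fun a ha => hP.1 a (LocalRingIn.le_ofPrime A p ha)
  refine ⟨h, Ideal.ext fun a => ?_⟩
  rw [← not_iff_not, notMem_centreIdeal]
  constructor
  · intro ha
    exact ⟨LocalRingIn.coe_ne_zero ha, hP.1 _ ⟨1, a, ha, by simp⟩⟩
  · rintro ⟨h0, h1⟩ hap
    have h2 := hP.2 a (LocalRingIn.le_ofPrime A p a.2) h1
    have h3 := (LocalRingIn.vanishes_ofPrime A p a).2 hap
    rw [LocalRingIn.vanishes_iff] at h3
    exact h3.2.elim h0 (fun h => h h2)

/-- The valuation ring `V` contains the constants. -/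
def Constants (V : ValuationSubring K) : Prop := ∀ c : ℂ, algebraMap ℂ K c ∈ V

lemma LocalRingIn.exists_dominating (P : LocalRingIn K) :
    ∃ V : ValuationSubring K, Constants V ∧ P.IsDominatedBy V := by
  have : IsLocalRing P.carrier.toSubring := P.isLocal
  obtain ⟨V, hV⟩ := LocalSubring.exists_le_valuationSubring (LocalSubring.mk P.carrier.toSubring)
  obtain ⟨h1, h2⟩ := LocalSubring.le_def.1 hV
  refine ⟨V, fun c => h1 (P.carrier.algebraMap_mem c), fun f hf => h1 hf, fun f hf hfV => ?_⟩
  by_cases h0 : f = 0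
  · subst h0; simp
  have hu : IsUnit (Subring.inclusion h1 ⟨f, hf⟩) := by
    refine IsUnit.of_mul_eq_one ⟨f⁻¹, hfV⟩ (Subtype.ext ?_)
    exact mul_inv_cancel₀ h0
  obtain ⟨u, hu⟩ := h2.map_nonunit ⟨f, hf⟩ hu
  have h3 : f * ((u⁻¹ : (P.carrier.toSubring)ˣ) : P.carrier.toSubring) = 1 := by
    have h4 := congrArg (fun z : P.carrier.toSubring => (z : K)) (Units.mul_inv u)
    rw [hu] at h4
    exact h4
  rw [← eq_inv_of_mul_eq_one_right h3]
  exact Subtype.property _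

end Centre

/-- A variety is complete and separated if every valuation ring contains one of the charts, and
the centres of a valuation ring on two charts agree. -/
def CompleteVariety.ofCharts (charts : Set (Subalgebra ℂ K)) (hfin : charts.Finite)
    (hfg : ∀ A ∈ charts, A.FG) (hfrac : ∀ A ∈ charts, IsFractionRing A K)
    (hcover : ∀ V : ValuationSubring K, Constants V → ∃ A ∈ charts, Below A V)
    (hsep : ∀ V : ValuationSubring K, Constants V → ∀ A ∈ charts, ∀ A' ∈ charts,
      Below A V → ∀ h' : Below A' V, A ≤ (centre h').carrier) : CompleteVariety K where
  charts := charts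
  finite_charts := hfin
  fg := hfg
  isFractionRing := hfrac
  existsUnique_centre := by
    intro V hV
    obtain ⟨A, hA, h⟩ := hcover V hV
    refine ⟨centre h, ⟨⟨A, hA, _, inferInstance, rfl⟩, centre_isDominatedBy h⟩, ?_⟩
    rintro P ⟨⟨A', hA', p, hp, rfl⟩, hdom⟩
    obtain ⟨h', rfl⟩ := eq_centre_of_isDominatedBy hdom
    exact centre_eq_of_le h' h (hsep V hV A' hA' A hA h' h) (hsep V hV A hA A' hA' h h')

namespace CompleteVariety

variable (Y : CompleteVariety K)

lemma eq_centre {P : LocalRingIn K} (hP : P ∈ Y.points) {V : ValuationSubring K}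
    (hV : Constants V) (hdom : P.IsDominatedBy V) {A : Subalgebra ℂ K} (hA : A ∈ Y.charts)
    (h : Below A V) : P = centre h :=
  (Y.existsUnique_centre V hV).unique ⟨hP, hdom⟩
    ⟨⟨A, hA, _, inferInstance, rfl⟩, centre_isDominatedBy h⟩

lemma points_of_closedPoints {P : LocalRingIn K} (hP : P ∈ Y.closedPoints) : P ∈ Y.points := by
  obtain ⟨A, hA, p, hp, rfl⟩ := hP
  exact ⟨A, hA, p, hp.isPrime, rfl⟩

lemma exists_const_of_mem {P : LocalRingIn K} (hP : P ∈ Y.closedPoints) {f : K}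
    (hf : f ∈ P.carrier) : ∃ c : ℂ, P.Vanishes (f - algebraMap ℂ K c) := by
  obtain ⟨A, hA, p, hp, rfl⟩ := hP
  obtain ⟨n, d, hd, rfl⟩ := hf
  have hd0 : (d : K) ≠ 0 := LocalRingIn.coe_ne_zero hd
  obtain ⟨c, hc⟩ := LocalRingIn.exists_const A (Y.fg A hA) p n
  obtain ⟨e, he⟩ := LocalRingIn.exists_const A (Y.fg A hA) p d
  have he0 : e ≠ 0 := by
    rintro rfl
    simp at he
    exact hd he
  refine ⟨c / e, ?_⟩
  have key : (n - algebraMap ℂ A (c / e) * d) ∈ p := by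
    have h1 := p.sub_mem hc (p.mul_mem_left (algebraMap ℂ A (c / e)) he)
    have : n - algebraMap ℂ A (c / e) * d =
        n - algebraMap ℂ A c - algebraMap ℂ A (c / e) * (d - algebraMap ℂ A e) := by
      rw [mul_sub, ← map_mul, div_mul_cancel₀ _ he0]; ring
    rwa [this]
  have h2 := (LocalRingIn.vanishes_ofPrime A p _).2 key
  have h3 : (n / d : K) - algebraMap ℂ K (c / e) =
      (1 / d : K) * ((n - algebraMap ℂ A (c / e) * d : A) : K) := by
    rw [AddSubgroupClass.coe_sub, MulMemClass.coe_mul, Subalgebra.coe_algebraMap]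
    field_simp
  rw [h3]
  exact h2.mul_left ⟨1, d, hd, by simp⟩

/-- A closed point, as seen on any chart containing it. -/
lemma exists_maximal {P : LocalRingIn K} (hP : P ∈ Y.closedPoints) {V : ValuationSubring K}
    (hV : Constants V) (hdom : P.IsDominatedBy V) {A : Subalgebra ℂ K} (hA : A ∈ Y.charts)
    (h : Below A V) : ∃ (p : Ideal A) (_ : p.IsMaximal), P = LocalRingIn.ofPrime A p := by
  have h1 := Y.eq_centre (Y.points_of_closedPoints hP) hV hdom hA h
  refine ⟨centreIdeal h, ?_, h1⟩
  rw [Ideal.isMaximal_iff]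
  refine ⟨fun h => (Ideal.IsPrime.ne_top' ((Ideal.eq_top_iff_one _).2 h)), ?_⟩
  intro J a hJ ha haJ
  have haP : (a : K) ∈ P.carrier := h1 ▸ le_centre h a.2
  obtain ⟨c, hc⟩ := Y.exists_const_of_mem hP haP
  rw [h1] at hc
  have h2 : a - algebraMap ℂ A c ∈ centreIdeal h :=
    (LocalRingIn.vanishes_ofPrime A (centreIdeal h) (a - algebraMap ℂ A c)).1 hc
  have h3 : algebraMap ℂ A c ∈ J := by
    have := J.sub_mem haJ (hJ h2)
    simpa using this
  have hc0 : c ≠ 0 := by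
    rintro rfl
    simp at h2
    exact ha h2
  have := J.mul_mem_left (algebraMap ℂ A c⁻¹) h3
  rwa [← map_mul, inv_mul_cancel₀ hc0, map_one] at this

end CompleteVariety

end LocalRings

end Inose

end

noncomputable section

namespace Inose

open IsLocalRing

section Curves

variable {K : Type*} [Field K] [Algebra ℂ K]

lemma LocalRingIn.exists_valuationSubring (C : LocalRingIn K) [IsDiscreteValuationRing C.carrier]
    [IsFractionRing C.carrier K] :
    ∃ V : ValuationSubring K, Constants V ∧ ∀ f, f ∈ V ↔ f ∈ C.carrier := by
  refine ⟨{ C.carrier.toSubring with mem_or_inv_mem' := fun x => ?_ },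
    fun c => C.carrier.algebraMap_mem c, fun f => Iff.rfl⟩
  have := (ValuationRing.iff_isInteger_or_isInteger C.carrier K).1 inferInstance x
  rcases this with ⟨y, hy⟩ | ⟨y, hy⟩
  · left; rw [← hy]; exact y.2
  · right; rw [← hy]; exact y.2

lemma LocalRingIn.two_le_ringKrullDim {A : Subalgebra ℂ K} {p q : Ideal A} [p.IsPrime] [q.IsPrime]
    (hq0 : q ≠ ⊥) (hqp : q ≤ p) (hne : q ≠ p) : 2 ≤ ringKrullDim (ofPrime A p).carrier := by
  have hdisj : Disjoint (p.primeCompl : Set A) (q : Set A) := by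
    rw [Set.disjoint_left]
    exact fun a ha haq => ha (hqp haq)
  have hprime : (q.map (algebraMap A (ofPrime A p).carrier)).IsPrime :=
    IsLocalization.isPrime_of_isPrime_disjoint p.primeCompl _ q inferInstance hdisj
  have hcomap := IsLocalization.under_map_of_isPrime_disjoint p.primeCompl
    (ofPrime A p).carrier (I := q) inferInstance hdisj
  refine Inose.two_le_ringKrullDim (p := q.map (algebraMap A (ofPrime A p).carrier)) (q := ⊥) ?_ ?_
  · rw [bot_lt_iff_ne_bot]
    intro h
    obtain ⟨a, ha, ha0⟩ := Submodule.exists_mem_ne_zero_of_ne_bot hq0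
    have h1 : algebraMap A (ofPrime A p).carrier a ∈ q.map (algebraMap A (ofPrime A p).carrier) :=
      Ideal.mem_map_of_mem _ ha
    rw [h, Ideal.mem_bot] at h1
    exact ha0 (Subtype.ext (congrArg (fun z : (ofPrime A p).carrier => (z : K)) h1))
  · intro h
    rw [h] at hcomap
    exact hne (hcomap.symm.trans (IsLocalization.AtPrime.under_maximalIdeal _ p))

lemma LocalRingIn.eq_of_isDiscreteValuationRing {A : Subalgebra ℂ K} {p q : Ideal A} [p.IsPrime]
    [q.IsPrime] [IsDiscreteValuationRing (ofPrime A p).carrier] (hq0 : q ≠ ⊥) (hqp : q ≤ p) :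
    q = p := by
  by_contra hne
  have h1 := LocalRingIn.two_le_ringKrullDim hq0 hqp hne
  rw [IsDiscreteValuationRing.ringKrullDim_eq_one] at h1
  norm_num at h1

/-- A rational curve on the affine variety with coordinate ring `A`, with equation `g` and
parameter `s`; the map `φ` is the restriction of functions to the curve. -/
structure RationalCurve (A : Subalgebra ℂ K) where
  g : A
  φ : A →ₐ[ℂ] RatFunc ℂ
  s : A
  g_ne : g ≠ 0
  map_eq_zero : ∀ a, φ a = 0 ↔ g ∣ a
  map_s : φ s = RatFunc.X

namespace RationalCurve

variable {A : Subalgebra ℂ K} (R : RationalCurve A)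

/-- The prime ideal of a rational curve. -/
def prime : Ideal A := RingHom.ker R.φ

instance : R.prime.IsPrime := RingHom.ker_isPrime _

lemma mem_prime {a : A} : a ∈ R.prime ↔ R.g ∣ a := R.map_eq_zero a

lemma prime_eq_span : R.prime = Ideal.span {R.g} := by
  ext a; rw [mem_prime, Ideal.mem_span_singleton]

lemma g_mem : R.g ∈ R.prime := R.mem_prime.2 dvd_rfl

lemma prime_ne_bot : R.prime ≠ ⊥ := by
  rw [prime_eq_span, Ne, Ideal.span_singleton_eq_bot]
  exact R.g_ne

lemma prime_le {p : Ideal A} (h : R.g ∈ p) : R.prime ≤ p := by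
  rw [prime_eq_span, Ideal.span_singleton_le_iff_mem]
  exact h

/-- The local ring of the generic point of a rational curve. -/
abbrev localRing : LocalRingIn K := LocalRingIn.ofPrime A R.prime

open LocalRingIn in
lemma maximalIdeal_localRing :
    maximalIdeal R.localRing.carrier = Ideal.span {toLocal A R.prime R.g} := by
  have := maximalIdeal_ofPrime_eq_span A R.prime {R.g} (by simpa using R.g_mem)
    (fun a ha => ⟨1, fun h => Ideal.IsPrime.ne_top' ((Ideal.eq_top_iff_one _).2 h), by
      rw [one_mul, ← prime_eq_span]; exact ha⟩)
  rwa [Set.image_singleton] at this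

lemma toLocal_g_ne : (LocalRingIn.toLocal A R.prime R.g) ≠ 0 := by
  intro h
  exact R.g_ne (Subtype.ext (congrArg (fun z : (LocalRingIn.ofPrime A R.prime).carrier => (z : K)) h))

lemma isDiscreteValuationRing (hA : A.FG) : IsDiscreteValuationRing R.localRing.carrier := by
  have h1 : IsNoetherianRing R.localRing.carrier := LocalRingIn.isNoetherianRing_ofPrime A R.prime hA
  have h2 : ¬ IsField R.localRing.carrier := by
    rw [isField_iff_maximalIdeal_eq, maximalIdeal_localRing, Ideal.span_singleton_eq_bot]
    exact R.toLocal_g_ne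
  refine ((IsDiscreteValuationRing.TFAE R.localRing.carrier h2).out 0 4).2 ?_
  exact ⟨_, R.maximalIdeal_localRing⟩

lemma map_aeval_s (q : Polynomial ℂ) :
    R.φ (Polynomial.aeval R.s q) = algebraMap (Polynomial ℂ) (RatFunc ℂ) q := by
  rw [← Polynomial.aeval_algHom_apply, map_s]
  have h := Polynomial.aeval_algHom_apply (IsScalarTower.toAlgHom ℂ (Polynomial ℂ) (RatFunc ℂ))
    Polynomial.X q
  simp only [IsScalarTower.coe_toAlgHom', RatFunc.algebraMap_X, Polynomial.aeval_X_left_apply] at h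
  exact h

lemma aeval_s_mem {q : Polynomial ℂ} : Polynomial.aeval R.s q ∈ R.prime ↔ q = 0 := by
  change R.φ _ = 0 ↔ _
  rw [map_aeval_s, map_eq_zero_iff _ (RatFunc.algebraMap_injective ℂ)]

lemma exists_num_denom (a : A) : ∃ N D : Polynomial ℂ, IsCoprime N D ∧ D ≠ 0 ∧
    Polynomial.aeval R.s D * a - Polynomial.aeval R.s N ∈ R.prime := by
  refine ⟨(R.φ a).num, (R.φ a).denom, RatFunc.isCoprime_num_denom _, RatFunc.denom_ne_zero _, ?_⟩
  change R.φ _ = 0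
  rw [map_sub, map_mul, map_aeval_s, map_aeval_s, sub_eq_zero]
  have h := RatFunc.num_div_denom (R.φ a)
  have h0 : algebraMap (Polynomial ℂ) (RatFunc ℂ) (R.φ a).denom ≠ 0 :=
    RatFunc.algebraMap_ne_zero (RatFunc.denom_ne_zero _)
  rw [div_eq_iff h0] at h
  rw [h, mul_comm]

lemma isRational : R.localRing.IsRational := by
  let ψ : A →ₐ[ℂ] ResidueField R.localRing.carrier :=
    (IsScalarTower.toAlgHom ℂ R.localRing.carrier (ResidueField R.localRing.carrier)).comp
      (LocalRingIn.toLocal A R.prime)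
  have hψ (a : A) : ψ a = 0 ↔ a ∈ R.prime := by
    change residue _ (LocalRingIn.toLocal A R.prime a) = 0 ↔ _
    rw [residue_eq_zero_iff]
    exact LocalRingIn.toLocal_mem_iff A R.prime a
  have hs (q : Polynomial ℂ) : Polynomial.aeval (ψ R.s) q = 0 ↔ q = 0 := by
    rw [Polynomial.aeval_algHom_apply, hψ, aeval_s_mem]
  let θ : RatFunc ℂ →ₐ[ℂ] ResidueField R.localRing.carrier :=
    RatFunc.liftAlgHom (Polynomial.aeval (ψ R.s)) (by
      intro q hq
      rw [Submonoid.mem_comap, mem_nonZeroDivisors_iff_ne_zero]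
      rw [mem_nonZeroDivisors_iff_ne_zero] at hq
      exact fun h => hq ((hs q).1 h))
  have hθ (q : Polynomial ℂ) : θ (algebraMap _ _ q) = ψ (Polynomial.aeval R.s q) := by
    rw [← Polynomial.aeval_algHom_apply]
    have := RatFunc.liftAlgHom_apply_div' (L := ResidueField R.localRing.carrier) (S := ℂ)
      (φ := Polynomial.aeval (ψ R.s)) (by
      intro q hq
      rw [Submonoid.mem_comap, mem_nonZeroDivisors_iff_ne_zero]
      rw [mem_nonZeroDivisors_iff_ne_zero] at hq
      exact fun h => hq ((hs q).1 h)) q 1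
    simpa using this
  have hA (a : A) : ψ a ∈ θ.range := by
    obtain ⟨N, D, -, hD, h⟩ := R.exists_num_denom a
    have h1 : ψ (Polynomial.aeval R.s D) * ψ a = ψ (Polynomial.aeval R.s N) := by
      rw [← sub_eq_zero, ← map_mul, ← map_sub, hψ]
      exact h
    have hD' : ψ (Polynomial.aeval R.s D) ≠ 0 := by
      rw [Ne, hψ, aeval_s_mem]
      exact hD
    refine ⟨algebraMap _ _ N / algebraMap _ _ D, ?_⟩
    change θ (_ / _) = _
    rw [map_div₀, hθ, hθ, ← h1]
    field_simp
  refine ⟨AlgEquiv.ofBijective θ ⟨RingHom.injective _, ?_⟩⟩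
  intro y
  obtain ⟨f, rfl⟩ := residue_surjective y
  obtain ⟨n, d, hd, hf⟩ := LocalRingIn.mem_fractions.1 f.2
  obtain ⟨n', hn'⟩ := hA n
  obtain ⟨d', hd'⟩ := hA d
  have hd0 : ψ d ≠ 0 := fun h => hd ((hψ d).1 h)
  refine ⟨n' / d', ?_⟩
  change θ _ = _
  rw [map_div₀]
  change θ n' = _ at hn'
  change θ d' = _ at hd'
  rw [hn', hd', div_eq_iff hd0]
  change residue _ _ = residue _ _ * residue _ _
  rw [← map_mul]
  congr 1
  apply Subtype.ext
  change (n : K) = f * d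
  rw [hf]
  have := LocalRingIn.coe_ne_zero hd
  field_simp

lemma order_eq {t : K} {e : ℕ} {b : A} (ht : t = (R.g : K) ^ e * b) (hb : R.φ b ≠ 0) :
    R.localRing.order t = e := by
  have htm : t ∈ R.localRing.carrier := by
    rw [ht]
    exact LocalRingIn.le_ofPrime A R.prime (mul_mem (pow_mem R.g.2 e) b.2)
  have key (n : ℕ) : (⟨t, htm⟩ : R.localRing.carrier) ∈ maximalIdeal R.localRing.carrier ^ n ↔
      n ≤ e := by
    have h1 : (⟨t, htm⟩ : R.localRing.carrier) = (LocalRingIn.toLocal A R.prime R.g) ^ e *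
        LocalRingIn.toLocal A R.prime b := Subtype.ext ht
    have hu : IsUnit (LocalRingIn.toLocal A R.prime b) := LocalRingIn.isUnit_toLocal A R.prime hb
    rw [maximalIdeal_localRing, Ideal.span_singleton_pow, Ideal.mem_span_singleton, h1]
    have hnu : ¬ IsUnit (LocalRingIn.toLocal A R.prime R.g) := by
      intro h
      have := (LocalRingIn.toLocal_mem_iff A R.prime R.g).2 R.g_mem
      rw [mem_maximalIdeal, mem_nonunits_iff] at this
      exact this h
    have h2 : (LocalRingIn.toLocal A R.prime R.g) ^ n ∣ (LocalRingIn.toLocal A R.prime R.g) ^ e *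
        LocalRingIn.toLocal A R.prime b ↔ (LocalRingIn.toLocal A R.prime R.g) ^ n ∣
        (LocalRingIn.toLocal A R.prime R.g) ^ e := hu.dvd_mul_right
    rw [← pow_dvd_pow_iff R.toLocal_g_ne hnu]
    exact h2
  unfold LocalRingIn.order
  apply le_antisymm
  · refine iSup₂_le fun n hn => ?_
    obtain ⟨h, hn⟩ := hn
    exact_mod_cast (key n).1 hn
  · exact le_iSup₂_of_le e ⟨htm, (key e).2 le_rfl⟩ le_rfl

lemma exists_parameter (hA : A.FG) {p : Ideal A} [hp : p.IsMaximal] (hg : R.g ∈ p) :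
    ∃ y ∈ p, maximalIdeal (LocalRingIn.ofPrime A p).carrier =
      Ideal.span {LocalRingIn.toLocal A p R.g, LocalRingIn.toLocal A p y} := by
  obtain ⟨c, hc⟩ := LocalRingIn.exists_const A hA p R.s
  refine ⟨_, hc, ?_⟩
  have hev (q : Polynomial ℂ) :
      Polynomial.aeval R.s q - algebraMap ℂ A (q.eval c) ∈ Ideal.span {R.s - algebraMap ℂ A c} := by
    rw [Ideal.mem_span_singleton]
    have := Polynomial.sub_dvd_eval_sub R.s (algebraMap ℂ A c) (q.map (algebraMap ℂ A))
    rwa [Polynomial.eval_map_algebraMap, Polynomial.eval_map_algebraMap,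
      Polynomial.aeval_algebraMap_apply, Polynomial.coe_aeval_eq_eval] at this
  have hle : Ideal.span {R.s - algebraMap ℂ A c} ≤ p := by
    rw [Ideal.span_singleton_le_iff_mem]; exact hc
  have hroot (q : Polynomial ℂ) : Polynomial.aeval R.s q ∈ p ↔ q.eval c = 0 := by
    constructor
    · intro h
      by_contra h0
      have h1 := p.sub_mem h (hle (hev q))
      rw [sub_sub_cancel] at h1
      exact hp.ne_top (Ideal.eq_top_of_isUnit_mem _ h1
        ((isUnit_iff_ne_zero.2 h0).map (algebraMap ℂ A)))
    · intro h
      have := hle (hev q)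
      rwa [h, map_zero, sub_zero] at this
  have := LocalRingIn.maximalIdeal_ofPrime_eq_span A p {R.g, R.s - algebraMap ℂ A c} (by
    rintro _ (rfl | rfl)
    exacts [hg, hc]) (by
    intro a ha
    obtain ⟨N, D, hND, hD, h⟩ := R.exists_num_denom a
    have h1 := R.prime_le hg h
    have hN : Polynomial.aeval R.s N ∈ p := by
      have := p.sub_mem (p.mul_mem_left (Polynomial.aeval R.s D) ha) h1
      rwa [sub_sub_cancel] at this
    refine ⟨Polynomial.aeval R.s D, ?_, ?_⟩
    · intro hDp
      rw [hroot] at hDp hN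
      obtain ⟨u, v, huv⟩ := hND
      have := congrArg (Polynomial.eval c) huv
      simp [hDp, hN] at this
    · have h2 : Polynomial.aeval R.s N ∈ Ideal.span {R.g, R.s - algebraMap ℂ A c} := by
        rw [hroot] at hN
        have := hev N
        rw [hN, map_zero, sub_zero] at this
        exact Ideal.span_mono (by simp) this
      have h3 : Polynomial.aeval R.s D * a - Polynomial.aeval R.s N ∈
          Ideal.span {R.g, R.s - algebraMap ℂ A c} := by
        rw [prime_eq_span] at h
        exact Ideal.span_mono (by simp) h
      simpa using add_mem h3 h2)
  rwa [Set.image_pair] at this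

lemma two_le_ringKrullDim (hA : A.FG) {p : Ideal A} [hp : p.IsMaximal] (hg : R.g ∈ p) :
    2 ≤ ringKrullDim (LocalRingIn.ofPrime A p).carrier := by
  refine LocalRingIn.two_le_ringKrullDim R.prime_ne_bot (R.prime_le hg) ?_
  rintro rfl
  obtain ⟨c, hc⟩ := LocalRingIn.exists_const A hA R.prime R.s
  have h1 := R.aeval_s_mem (q := Polynomial.X - Polynomial.C c)
  simp only [map_sub, Polynomial.aeval_X, Polynomial.aeval_C] at h1
  exact Polynomial.X_sub_C_ne_zero c (h1.1 hc)

lemma isRegularLocalRing (hA : A.FG) {p : Ideal A} [hp : p.IsMaximal] (hg : R.g ∈ p) :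
    IsRegularLocalRing (LocalRingIn.ofPrime A p).carrier := by
  have := LocalRingIn.isNoetherianRing_ofPrime A p hA
  obtain ⟨y, -, h⟩ := R.exists_parameter hA hg
  exact isRegularLocalRing_of_pair h (R.two_le_ringKrullDim hA hg)

lemma idealOf_eq {p : Ideal A} [hp : p.IsPrime] (hg : R.g ∈ p) :
    (LocalRingIn.ofPrime A p).idealOf R.localRing = Ideal.span {LocalRingIn.toLocal A p R.g} := by
  unfold LocalRingIn.idealOf
  apply le_antisymm
  · rw [Ideal.span_le]
    rintro ⟨f, n, d, hd, hf⟩ h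
    have hd0 := LocalRingIn.coe_ne_zero hd
    have hdR : d ∉ R.prime := fun h => hd (R.prime_le hg h)
    have h1 : R.localRing.Vanishes ((n : A) : K) := by
      have h2 := LocalRingIn.Vanishes.mul_right h (LocalRingIn.le_ofPrime A R.prime d.2)
      have h3 : f * d = n := by rw [hf]; field_simp
      rwa [h3] at h2
    have h4 := (LocalRingIn.vanishes_ofPrime A R.prime n).1 h1
    obtain ⟨m, rfl⟩ := R.mem_prime.1 h4
    rw [SetLike.mem_coe, Ideal.mem_span_singleton]
    refine ⟨⟨m / d, m, d, hd, rfl⟩, Subtype.ext ?_⟩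
    change f = R.g * (m / d)
    rw [hf, MulMemClass.coe_mul, mul_div_assoc]
  · rw [Ideal.span_singleton_le_iff_mem]
    apply Ideal.subset_span
    exact (LocalRingIn.vanishes_ofPrime A R.prime R.g).2 R.g_mem

lemma le_localRing {p : Ideal A} [hp : p.IsPrime] (hg : R.g ∈ p) :
    (LocalRingIn.ofPrime A p).carrier ≤ R.localRing.carrier := by
  rintro _ ⟨n, d, hd, rfl⟩
  exact ⟨n, d, fun h => hd (R.prime_le hg h), rfl⟩

end RationalCurve

end Curves

end Inose

end

noncomputable section

namespace Inose

open IsLocalRing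

variable {K : Type*} [Field K] [Algebra ℂ K]

/-- A description, on charts, of a fibre with rational components `C i` and multiplicities
`mult i`; the relation `edge e i j` says that `C i` and `C j` meet on the chart `e`. -/
structure FibreAtlas (Y : CompleteVariety K) (t : K) {ι : Type} (mult : ι → ℕ) where
  E : Type
  finiteE : Finite E
  Ch : E → Subalgebra ℂ K
  mem_charts : ∀ e, Ch e ∈ Y.charts
  ne_zero : t ≠ 0
  mem_or_inv_mem : ∀ P ∈ Y.points, t ∈ P.carrier ∨ t⁻¹ ∈ P.carrier
  cover : ∀ V : ValuationSubring K, Constants V → t ∈ V → t⁻¹ ∉ V → ∃ e, Below (Ch e) V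
  J : E → Type
  lab : ∀ e, J e → ι
  curve : ∀ e, J e → RationalCurve (Ch e)
  C : ι → LocalRingIn K
  C_injective : Function.Injective C
  localRing_eq : ∀ e j, (curve e j).localRing = C (lab e j)
  lab_injective : ∀ e, Function.Injective (lab e)
  lab_surjective : ∀ i, ∃ e j, lab e j = i
  mult_pos : ∀ i, mult i ≠ 0
  factor : ∀ e j, ∃ b : Ch e, t = ((curve e j).g : K) ^ mult (lab e j) * b ∧ (curve e j).φ b ≠ 0
  mem : ∀ e, t ∈ Ch e
  exists_mem : ∀ e (p : Ideal (Ch e)) [p.IsPrime], ⟨t, mem e⟩ ∈ p → ∃ j, (curve e j).g ∈ p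
  edge : E → ι → ι → Prop
  edge_or : ∀ e i j, i ≠ j →
    (edge e (lab e i) (lab e j) ∧ (Ideal.span {(curve e i).g, (curve e j).g}).IsMaximal) ∨
    (¬ edge e (lab e i) (lab e j) ∧ IsCoprime (curve e i).g (curve e j).g)
  exists_of_edge : ∀ e a b, edge e a b → ∃ i j, i ≠ j ∧ lab e i = a ∧ lab e j = b
  no_triangle : ∀ e a b c, a ≠ b → b ≠ c → a ≠ c → ¬ (edge e a b ∧ edge e b c ∧ edge e a c)
  edge_disjoint : ∀ e e' a b, e ≠ e' → edge e a b → edge e' a b → ∀ i j, lab e i = a → lab e j = b →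
    ∃ f ∈ Ideal.span {(curve e i).g, (curve e j).g}, (f : K) ≠ 0 ∧ (f : K)⁻¹ ∈ Ch e'

lemma CompleteVariety.isFractionRing_of_mem_points (Y : CompleteVariety K) {C : LocalRingIn K}
    (hC : C ∈ Y.points) : IsFractionRing C.carrier K := by
  obtain ⟨A, hA, p, hp, rfl⟩ := hC
  have := Y.isFractionRing A hA
  exact LocalRingIn.isFractionRing_ofPrime A p

namespace FibreAtlas

variable {Y : CompleteVariety K} {t : K} {ι : Type} {mult : ι → ℕ} (D : FibreAtlas Y t mult)

lemma fg (e : D.E) : (D.Ch e).FG := Y.fg _ (D.mem_charts e)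

lemma localRing_mem_points (e : D.E) (j : D.J e) : (D.curve e j).localRing ∈ Y.points :=
  ⟨_, D.mem_charts e, _, inferInstance, rfl⟩

lemma mem_points (i : ι) : D.C i ∈ Y.points := by
  obtain ⟨e, j, rfl⟩ := D.lab_surjective i
  rw [← D.localRing_eq]
  exact D.localRing_mem_points e j

lemma isDVR (i : ι) : IsDiscreteValuationRing (D.C i).carrier := by
  obtain ⟨e, j, rfl⟩ := D.lab_surjective i
  rw [← D.localRing_eq]
  exact (D.curve e j).isDiscreteValuationRing (D.fg e)

lemma order_eq (i : ι) : (D.C i).order t = mult i := by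
  obtain ⟨e, j, rfl⟩ := D.lab_surjective i
  obtain ⟨b, hb, hb0⟩ := D.factor e j
  rw [← D.localRing_eq]
  exact (D.curve e j).order_eq hb hb0

lemma vanishes (i : ι) : (D.C i).Vanishes t := by
  obtain ⟨e, j, rfl⟩ := D.lab_surjective i
  obtain ⟨b, hb, hb0⟩ := D.factor e j
  rw [← D.localRing_eq]
  have h1 : (⟨t, D.mem e⟩ : D.Ch e) = (D.curve e j).g ^ mult (D.lab e j) * b := Subtype.ext hb
  have : (D.curve e j).g ^ mult (D.lab e j) * b ∈ (D.curve e j).prime :=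
    Ideal.mul_mem_right _ _ (Ideal.pow_mem_of_mem _ (D.curve e j).g_mem _
      (Nat.pos_of_ne_zero (D.mult_pos _)))
  rw [← h1] at this
  exact (LocalRingIn.vanishes_ofPrime _ _ _).2 this

lemma exists_lab {C : LocalRingIn K} (hC : C ∈ Y.points) [IsDiscreteValuationRing C.carrier]
    (ht : C.Vanishes t) {V : ValuationSubring K} (hV : Constants V)
    (hVC : ∀ f, f ∈ V ↔ f ∈ C.carrier) {e : D.E} (he : Below (D.Ch e) V) :
    ∃ j, D.C (D.lab e j) = C := by
  have hdom : C.IsDominatedBy V := ⟨fun f hf => (hVC f).2 hf, fun f _ hf => (hVC _).1 hf⟩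
  have h1 := Y.eq_centre hC hV hdom (D.mem_charts e) he
  subst h1
  have h2 : (⟨t, D.mem e⟩ : D.Ch e) ∈ centreIdeal he :=
    (LocalRingIn.vanishes_ofPrime _ (centreIdeal he) ⟨t, D.mem e⟩).1 ht
  obtain ⟨j, hj⟩ := D.exists_mem e _ h2
  have : IsDiscreteValuationRing (LocalRingIn.ofPrime (D.Ch e) (centreIdeal he)).carrier :=
    ‹IsDiscreteValuationRing (centre he).carrier›
  have h3 := LocalRingIn.eq_of_isDiscreteValuationRing (D.curve e j).prime_ne_bot
    ((D.curve e j).prime_le hj)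
  exact ⟨j, (D.localRing_eq e j).symm.trans (LocalRingIn.ofPrime_congr _ _ h3)⟩

lemma fibreComponents_eq : Set.range D.C = Y.fibreComponents t := by
  ext C
  constructor
  · rintro ⟨i, rfl⟩
    exact ⟨⟨D.mem_points i, D.isDVR i⟩, D.vanishes i⟩
  · rintro ⟨⟨hC, hdvr⟩, ht⟩
    have : IsFractionRing C.carrier K := Y.isFractionRing_of_mem_points hC
    obtain ⟨V, hV, hVC⟩ := C.exists_valuationSubring
    have ht' := (LocalRingIn.vanishes_iff _ _).1 ht
    obtain ⟨e, he⟩ := D.cover V hV ((hVC t).2 ht'.1)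
      (fun h => ht'.2.elim D.ne_zero (fun h' => h' ((hVC _).1 h)))
    obtain ⟨j, hj⟩ := D.exists_lab hC ht hV hVC he
    exact ⟨_, hj⟩

lemma exists_chart {P : LocalRingIn K} (hP : P ∈ Y.closedPoints) (ht : P.Vanishes t) :
    ∃ (e : D.E) (p : Ideal (D.Ch e)) (_ : p.IsMaximal),
      P = LocalRingIn.ofPrime (D.Ch e) p ∧ ∃ j, (D.curve e j).g ∈ p := by
  obtain ⟨V, hV, hdom⟩ := P.exists_dominating
  have ht' := (LocalRingIn.vanishes_iff _ _).1 ht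
  obtain ⟨e, he⟩ := D.cover V hV (hdom.1 t ht'.1)
    (fun h => ht'.2.elim D.ne_zero (fun h' => h' (hdom.2 t ht'.1 h)))
  obtain ⟨p, hp, rfl⟩ := Y.exists_maximal hP hV hdom (D.mem_charts e) he
  exact ⟨e, p, hp, rfl, D.exists_mem e p ((LocalRingIn.vanishes_ofPrime _ p ⟨t, D.mem e⟩).1 ht)⟩

lemma isRegularLocalRing (D : FibreAtlas Y t mult) {P : LocalRingIn K} (hP : P ∈ Y.closedPoints) (ht : P.Vanishes t) :
    IsRegularLocalRing P.carrier := by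
  obtain ⟨e, p, hp, rfl, j, hj⟩ := D.exists_chart hP ht
  exact (D.curve e j).isRegularLocalRing (D.fg e) hj

/-- A component through a closed point of a chart is one of the components on the chart. -/
lemma exists_lab_eq {e : D.E} {p : Ideal (D.Ch e)} [p.IsPrime] {i : ι}
    (h : (LocalRingIn.ofPrime (D.Ch e) p).carrier ≤ (D.C i).carrier) :
    ∃ j, D.lab e j = i ∧ (D.curve e j).g ∈ p := by
  have := D.isDVR i
  have := Y.isFractionRing_of_mem_points (D.mem_points i)
  obtain ⟨V, hV, hVC⟩ := (D.C i).exists_valuationSubring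
  have he : Below (D.Ch e) V := fun a ha => (hVC a).2 (h (LocalRingIn.le_ofPrime _ p ha))
  obtain ⟨j, hj⟩ := D.exists_lab (D.mem_points i) (D.vanishes i) hV hVC he
  refine ⟨j, D.C_injective hj, ?_⟩
  by_contra hg
  have h1 := h (LocalRingIn.mem_fractions.2 ⟨1, (D.curve e j).g, hg, rfl⟩)
  have h2 := (LocalRingIn.vanishes_ofPrime _ (D.curve e j).prime _).2 (D.curve e j).g_mem
  rw [← D.C_injective hj, ← D.localRing_eq] at h1
  rw [LocalRingIn.vanishes_iff] at h2
  refine h2.2.elim (fun h => (D.curve e j).g_ne (Subtype.ext h)) (fun h => h ?_)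
  simpa using h1

lemma closedPointsOn_le {e : D.E} {p : Ideal (D.Ch e)} [p.IsPrime] {j : D.J e}
    (hj : (D.curve e j).g ∈ p) :
    (LocalRingIn.ofPrime (D.Ch e) p).carrier ≤ (D.C (D.lab e j)).carrier := by
  rw [← D.localRing_eq]
  exact (D.curve e j).le_localRing hj

lemma vanishes_of_mem_closedPointsOn {P : LocalRingIn K} {i : ι}
    (hP : P ∈ Y.closedPointsOn (D.C i)) : P.Vanishes t := by
  obtain ⟨hP, hle⟩ := hP
  have h1 := (LocalRingIn.vanishes_iff _ _).1 (D.vanishes i)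
  have h2 : t⁻¹ ∉ P.carrier := fun h => h1.2.elim D.ne_zero (fun h' => h' (hle h))
  rw [LocalRingIn.vanishes_iff]
  exact ⟨(D.mem_or_inv_mem P (Y.points_of_closedPoints hP)).resolve_right h2, Or.inr h2⟩

lemma isNonsingularCurve (i : ι) : Y.IsNonsingularCurve (D.C i) := by
  intro P hP
  obtain ⟨e, p, hp, rfl, -⟩ := D.exists_chart hP.1 (D.vanishes_of_mem_closedPointsOn hP)
  obtain ⟨j, rfl, hj⟩ := D.exists_lab_eq hP.2
  obtain ⟨y, hy, h⟩ := (D.curve e j).exists_parameter (D.fg e) hj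
  refine ⟨LocalRingIn.toLocal _ p y, ?_⟩
  rw [← D.localRing_eq, (D.curve e j).idealOf_eq hj, h, ← Ideal.span_union, Set.singleton_union]

lemma isRational (i : ι) : (D.C i).IsRational := by
  obtain ⟨e, j, rfl⟩ := D.lab_surjective i
  rw [← D.localRing_eq]
  exact (D.curve e j).isRational

/-- The points common to two components are the ones visible on the charts. -/
lemma exists_edge {P : LocalRingIn K} {a b : ι} (hab : a ≠ b)
    (hP : P ∈ Y.closedPointsOn (D.C a) ∩ Y.closedPointsOn (D.C b)) :
    ∃ (e : D.E) (i j : D.J e) (_ : (Ideal.span {(D.curve e i).g, (D.curve e j).g}).IsMaximal),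
      D.edge e a b ∧ D.lab e i = a ∧ D.lab e j = b ∧
      P = LocalRingIn.ofPrime (D.Ch e) (Ideal.span {(D.curve e i).g, (D.curve e j).g}) := by
  obtain ⟨e, p, hp, rfl, -⟩ := D.exists_chart hP.1.1 (D.vanishes_of_mem_closedPointsOn hP.1)
  obtain ⟨i, rfl, hi⟩ := D.exists_lab_eq hP.1.2
  obtain ⟨j, rfl, hj⟩ := D.exists_lab_eq hP.2.2
  have hij : i ≠ j := fun h => hab (by rw [h])
  have hle : Ideal.span {(D.curve e i).g, (D.curve e j).g} ≤ p := by
    rw [Ideal.span_le]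
    rintro _ (rfl | rfl)
    exacts [hi, hj]
  rcases D.edge_or e i j hij with ⟨h1, h2⟩ | ⟨-, h2⟩
  · refine ⟨e, i, j, h2, h1, rfl, rfl, LocalRingIn.ofPrime_congr _ _ ?_⟩
    exact (h2.eq_of_le hp.ne_top hle).symm
  · exfalso
    obtain ⟨u, v, huv⟩ := h2
    apply hp.ne_top
    rw [Ideal.eq_top_iff_one, ← huv]
    exact p.add_mem (p.mul_mem_left _ hi) (p.mul_mem_left _ hj)

lemma exists_edge_triple {P : LocalRingIn K} {a b c : ι} (hab : a ≠ b) (hbc : b ≠ c) (hac : a ≠ c)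
    (ha : P ∈ Y.closedPointsOn (D.C a)) (hb : P ∈ Y.closedPointsOn (D.C b))
    (hc : P ∈ Y.closedPointsOn (D.C c)) : False := by
  obtain ⟨e, p, hp, rfl, -⟩ := D.exists_chart ha.1 (D.vanishes_of_mem_closedPointsOn ha)
  obtain ⟨i, rfl, hi⟩ := D.exists_lab_eq ha.2
  obtain ⟨j, rfl, hj⟩ := D.exists_lab_eq hb.2
  obtain ⟨k, rfl, hk⟩ := D.exists_lab_eq hc.2
  have key {i j : D.J e} (hij : D.lab e i ≠ D.lab e j) (hi : (D.curve e i).g ∈ p)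
      (hj : (D.curve e j).g ∈ p) : D.edge e (D.lab e i) (D.lab e j) := by
    rcases D.edge_or e i j (fun h => hij (by rw [h])) with ⟨h1, -⟩ | ⟨-, h2⟩
    · exact h1
    · exfalso
      obtain ⟨u, v, huv⟩ := h2
      apply hp.ne_top
      rw [Ideal.eq_top_iff_one, ← huv]
      exact p.add_mem (p.mul_mem_left _ hi) (p.mul_mem_left _ hj)
  exact D.no_triangle e _ _ _ hab hbc hac ⟨key hab hi hj, key hbc hj hk, key hac hi hk⟩

lemma span_eq {e : D.E} {i j : D.J e}
    [hm : (Ideal.span {(D.curve e i).g, (D.curve e j).g}).IsMaximal] :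
    (LocalRingIn.ofPrime (D.Ch e) (Ideal.span {(D.curve e i).g, (D.curve e j).g})).idealOf
      (D.C (D.lab e i)) ⊔
    (LocalRingIn.ofPrime (D.Ch e) (Ideal.span {(D.curve e i).g, (D.curve e j).g})).idealOf
      (D.C (D.lab e j)) = maximalIdeal (LocalRingIn.ofPrime (D.Ch e)
        (Ideal.span {(D.curve e i).g, (D.curve e j).g})).carrier := by
  rw [← D.localRing_eq, ← D.localRing_eq, (D.curve e i).idealOf_eq (Ideal.subset_span (by simp)),
    (D.curve e j).idealOf_eq (Ideal.subset_span (by simp)), ← Ideal.span_union,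
    Set.singleton_union, LocalRingIn.maximalIdeal_ofPrime_eq_map, Ideal.map_span, Set.image_pair]

lemma meetTransversally {a b : ι} (hab : a ≠ b) : Y.MeetTransversally (D.C a) (D.C b) := by
  intro P hP
  obtain ⟨e, i, j, hm, -, rfl, rfl, rfl⟩ := D.exists_edge hab hP
  exact D.span_eq

lemma exists_point {e : D.E} {a b : ι} (hab : a ≠ b) (h : D.edge e a b) :
    ∃ (i j : D.J e) (_ : (Ideal.span {(D.curve e i).g, (D.curve e j).g}).IsMaximal),
      D.lab e i = a ∧ D.lab e j = b := by
  obtain ⟨i, j, hij, rfl, rfl⟩ := D.exists_of_edge e a b h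
  rcases D.edge_or e i j hij with ⟨-, h2⟩ | ⟨h1, -⟩
  · exact ⟨i, j, h2, rfl, rfl⟩
  · exact absurd h h1

lemma mem_closedPoints (e : D.E) (p : Ideal (D.Ch e)) [hp : p.IsMaximal] :
    LocalRingIn.ofPrime (D.Ch e) p ∈ Y.closedPoints := ⟨_, D.mem_charts e, p, hp, rfl⟩

lemma intersectionNumber_eq {a b : ι} (hab : a ≠ b) :
    Y.intersectionNumber (D.C a) (D.C b) = {e | D.edge e a b}.encard := by
  classical
  have := D.finiteE
  choose i j hm hi hj using fun (e : D.E) (h : D.edge e a b) => D.exists_point hab h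
  let pt : {e | D.edge e a b} → LocalRingIn K := fun e =>
    haveI := hm e.1 e.2
    LocalRingIn.ofPrime (D.Ch e.1) (Ideal.span {(D.curve e.1 (i e.1 e.2)).g, (D.curve e.1 (j e.1 e.2)).g})
  have hinj : Function.Injective pt := by
    rintro ⟨e, he⟩ ⟨e', he'⟩ h
    have := hm e he
    have := hm e' he'
    by_contra hne
    obtain ⟨f, hf, hf0, hf'⟩ := D.edge_disjoint e e' a b (fun h => hne (Subtype.ext h)) he he' (i e he)
      (j e he) (hi e he) (hj e he)
    have h1 := (LocalRingIn.vanishes_ofPrime _ _ f).2 hf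
    rw [LocalRingIn.vanishes_iff] at h1
    refine h1.2.elim hf0 (fun h2 => h2 ?_)
    have h3 := LocalRingIn.le_ofPrime (D.Ch e')
      (Ideal.span {(D.curve e' (i e' he')).g, (D.curve e' (j e' he')).g}) hf'
    change pt ⟨e, he⟩ = pt ⟨e', he'⟩ at h
    change (f : K)⁻¹ ∈ (pt ⟨e, he⟩).carrier
    rw [h]
    exact h3
  have hrange : Set.range pt = Y.closedPointsOn (D.C a) ∩ Y.closedPointsOn (D.C b) := by
    ext P
    constructor
    · rintro ⟨⟨e, he⟩, rfl⟩
      have := hm e he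
      refine ⟨⟨D.mem_closedPoints e _, ?_⟩, ⟨D.mem_closedPoints e _, ?_⟩⟩
      · have := D.closedPointsOn_le (p := Ideal.span {(D.curve e (i e he)).g, (D.curve e (j e he)).g})
          (j := i e he) (Ideal.subset_span (by simp))
        rwa [hi e he] at this
      · have := D.closedPointsOn_le (p := Ideal.span {(D.curve e (i e he)).g, (D.curve e (j e he)).g})
          (j := j e he) (Ideal.subset_span (by simp))
        rwa [hj e he] at this
    · intro hP
      obtain ⟨e, i', j', hm', he, hi', hj', rfl⟩ := D.exists_edge hab hP
      refine ⟨⟨e, he⟩, LocalRingIn.ofPrime_congr _ _ ?_⟩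
      have h1 : D.C (D.lab e i') = D.C (D.lab e (i e he)) := by rw [hi', hi e he]
      have h2 : D.C (D.lab e j') = D.C (D.lab e (j e he)) := by rw [hj', hj e he]
      rw [D.lab_injective e (hi'.trans (hi e he).symm), D.lab_injective e (hj'.trans (hj e he).symm)]
  unfold CompleteVariety.intersectionNumber
  have hlen (P) (hP : P ∈ Y.closedPointsOn (D.C a) ∩ Y.closedPointsOn (D.C b)) :
      CompleteVariety.quotientLength P.carrier (P.idealOf (D.C a) ⊔ P.idealOf (D.C b)) = 1 := by
    rw [D.meetTransversally hab P hP]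
    unfold CompleteVariety.quotientLength
    rw [Module.length_eq_one_iff]
    exact isSimpleModule_iff_isCoatom.2 (maximalIdeal.isMaximal _).out
  rw [finsum_mem_congr rfl hlen, ← hrange]
  have hfin : (Set.range pt).Finite := Set.finite_range pt
  rw [finsum_mem_eq_finite_toFinset_sum _ hfin, Finset.sum_const, nsmul_eq_mul, mul_one,
    ← hfin.encard_eq_coe_toFinset_card, ← Set.image_univ, hinj.encard_image]
  simp

theorem hasFibreConfiguration (inter : ι → ι → ℕ∞)
    (hinter : ∀ i j, i ≠ j → inter i j = {e | D.edge e i j}.encard) :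
    Y.HasFibreConfiguration t (fun i => (mult i : ℕ∞)) inter :=
  ⟨D.C, D.C_injective, D.fibreComponents_eq,
    fun i => ⟨D.isNonsingularCurve i, D.isRational i, D.order_eq i⟩,
    fun i j hij => ⟨(D.intersectionNumber_eq hij).trans (hinter i j hij).symm,
      D.meetTransversally hij⟩,
    fun _ _ _ hij hjk hik => Set.eq_empty_of_forall_notMem fun _ hP =>
      D.exists_edge_triple hij hjk hik hP.1.1 hP.1.2 hP.2⟩

/-- A fibre with two components that meet is singular. -/
theorem not_isSmoothFibre {e : D.E} {a b : ι} (hab : a ≠ b) (he : D.edge e a b) :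
    ¬ Y.IsSmoothFibre t := by
  obtain ⟨i, j, hm, rfl, rfl⟩ := D.exists_point hab he
  intro hs
  have hij : i ≠ j := fun h => hab (by rw [h])
  set p := Ideal.span {(D.curve e i).g, (D.curve e j).g} with hp
  have hi : (D.curve e i).g ∈ p := Ideal.subset_span (by simp)
  have hj : (D.curve e j).g ∈ p := Ideal.subset_span (by simp)
  have htsq : (⟨t, D.mem e⟩ : D.Ch e) ∈ p ^ 2 := by
    obtain ⟨b, hb, -⟩ := D.factor e i
    obtain ⟨n, hn⟩ := Nat.exists_eq_succ_of_ne_zero (D.mult_pos (D.lab e i))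
    have h1 : (⟨t, D.mem e⟩ : D.Ch e) = (D.curve e i).g * ((D.curve e i).g ^ n * b) := by
      apply Subtype.ext
      rw [hn, pow_succ'] at hb
      simpa [mul_assoc] using hb
    obtain ⟨b', hb', -⟩ := D.factor e j
    have h2 : (⟨t, D.mem e⟩ : D.Ch e) ∈ (D.curve e j).prime := by
      obtain ⟨m, hm⟩ := Nat.exists_eq_succ_of_ne_zero (D.mult_pos (D.lab e j))
      rw [RationalCurve.mem_prime]
      refine ⟨(D.curve e j).g ^ m * b', Subtype.ext ?_⟩
      rw [hm, pow_succ'] at hb'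
      simpa [mul_assoc] using hb'
    have h3 : (D.curve e i).g ∉ (D.curve e j).prime := by
      intro h
      have := (D.curve e j).isDiscreteValuationRing (D.fg e)
      have h4 := LocalRingIn.eq_of_isDiscreteValuationRing (p := (D.curve e j).prime)
        (D.curve e i).prime_ne_bot ((D.curve e i).prime_le h)
      apply hab
      apply D.C_injective
      rw [← D.localRing_eq, ← D.localRing_eq]
      exact LocalRingIn.ofPrime_congr _ _ h4
    rw [h1] at h2 ⊢
    rw [pow_two]
    exact Ideal.mul_mem_mul hi ((D.curve e j).prime_le hj
      ((Ideal.IsPrime.mem_or_mem inferInstance h2).resolve_left h3))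
  have htP : t ∈ (LocalRingIn.ofPrime (D.Ch e) p).carrier :=
    LocalRingIn.le_ofPrime _ p (D.mem e)
  refine hs _ (D.mem_closedPoints e p) ?_ htP ?_
  · exact (LocalRingIn.vanishes_ofPrime _ p ⟨t, D.mem e⟩).2 (Ideal.pow_le_self two_ne_zero htsq)
  · rw [LocalRingIn.maximalIdeal_ofPrime_eq_map, ← Ideal.map_pow]
    exact Ideal.mem_map_of_mem (LocalRingIn.toLocal _ p) htsq

end FibreAtlas

/-- A fibre as in `HasFibreConfiguration` contains no exceptional curve if no component has
intersection number `-1` with itself. -/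
lemma CompleteVariety.HasFibreConfiguration.not_isExceptionalComponent {Y : CompleteVariety K}
    {t : K} {ι : Type} [Fintype ι] [DecidableEq ι] {mult : ι → ℕ∞} {inter : ι → ι → ℕ∞}
    (h : Y.HasFibreConfiguration t mult inter)
    (hne : ∀ i, ∑ j ∈ Finset.univ.erase i, mult j * inter j i ≠ mult i) (E : LocalRingIn K) :
    ¬ Y.IsExceptionalComponent t E := by
  obtain ⟨C, hinj, hrange, h1, h2, -⟩ := h
  rintro ⟨hE, -, -, hsum⟩
  rw [← hrange] at hE hsum
  obtain ⟨i, rfl⟩ := hE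
  apply hne i
  rw [(h1 i).2.2] at hsum
  rw [← hsum]
  have hset : Set.range C \ {C i} = C '' ↑(Finset.univ.erase i) := by
    ext x
    simp only [Set.mem_sdiff, Set.mem_range, Set.mem_singleton_iff, Finset.coe_erase,
      Finset.coe_univ, Set.mem_image, Set.mem_univ, true_and]
    constructor
    · rintro ⟨⟨j, rfl⟩, hj⟩
      exact ⟨j, fun h => hj (by rw [h]), rfl⟩
    · rintro ⟨j, hj, rfl⟩
      exact ⟨⟨j, rfl⟩, fun h => hj (hinj h)⟩
  rw [hset, finsum_mem_image hinj.injOn, finsum_mem_coe_finset]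
  refine Finset.sum_congr rfl fun j hj => ?_
  rw [(h1 j).2.2, (h2 j i (Finset.ne_of_mem_erase hj)).1]

end Inose

end

noncomputable section

namespace Inose

open IsLocalRing

section Frames

variable {K : Type*} [Field K] [Algebra ℂ K]

/-- The field `K` is a quadratic extension, with generator `z` whose square is in the base field,
of the field of rational functions in `r` and `s`. -/
structure IsFrame (r s z : K) : Prop where
  ind : AlgebraicIndependent ℂ ![r, s]
  notMem : z ∉ IntermediateField.adjoin ℂ {r, s}
  sq_mem : z ^ 2 ∈ IntermediateField.adjoin ℂ {r, s}
  top : IntermediateField.adjoin ℂ {r, s, z} = ⊤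

namespace IsFrame

open IntermediateField.algebraAdjoinAdjoin in
lemma algebraicIndependent_of_isAlgebraic {r s r' s' z : K} (h : AlgebraicIndependent ℂ ![r, s])
    (htop : IntermediateField.adjoin ℂ {r', s', z} = ⊤)
    (hz : z ^ 2 ∈ IntermediateField.adjoin ℂ {r', s'}) : AlgebraicIndependent ℂ ![r', s'] := by
  have hint : IsIntegral (IntermediateField.adjoin ℂ {r', s'}) z := by
    refine ⟨Polynomial.X ^ 2 - Polynomial.C ⟨z ^ 2, hz⟩, Polynomial.monic_X_pow_sub_C _ two_ne_zero, ?_⟩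
    simp
  have h1 : Algebra.IsAlgebraic (IntermediateField.adjoin ℂ {r', s'}) K := by
    have h2 : IntermediateField.adjoin (IntermediateField.adjoin ℂ {r', s'}) {z} = ⊤ := by
      rw [← IntermediateField.restrictScalars_eq_top_iff (K := ℂ),
        IntermediateField.adjoin_adjoin_left, ← htop]
      congr 1
      ext x; simp only [Set.union_singleton, Set.mem_insert_iff, Set.mem_singleton_iff]; tauto
    have h3 := IntermediateField.isAlgebraic_adjoin_simple hint
    rw [h2] at h3
    exact IntermediateField.topEquiv.isAlgebraic
  have hr : Set.range ![r', s'] = {r', s'} := by simp [Set.pair_comm]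
  have h4 : Algebra.IsAlgebraic (Algebra.adjoin ℂ {r', s'}) K :=
    Algebra.IsAlgebraic.trans _ (IntermediateField.adjoin ℂ {r', s'}) _
  rw [← hr] at h4
  refine (Algebra.IsAlgebraic.isTranscendenceBasis_of_lift_le_trdeg_of_finite ℂ ![r', s'] ?_).1
  exact h.lift_cardinalMk_le_trdeg

lemma change {r s z r' s' l : K} (h : IsFrame r s z)
    (hr' : r' ∈ IntermediateField.adjoin ℂ {r, s}) (hs' : s' ∈ IntermediateField.adjoin ℂ {r, s})
    (hr : r ∈ IntermediateField.adjoin ℂ {r', s'}) (hs : s ∈ IntermediateField.adjoin ℂ {r', s'})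
    (hl : l ∈ IntermediateField.adjoin ℂ {r, s}) (hl0 : l ≠ 0) : IsFrame r' s' (l * z) := by
  have heq : IntermediateField.adjoin ℂ {r', s'} = IntermediateField.adjoin ℂ {r, s} := by
    apply le_antisymm
    · rw [IntermediateField.adjoin_le_iff]
      rintro _ (rfl | rfl)
      exacts [hr', hs']
    · rw [IntermediateField.adjoin_le_iff]
      rintro _ (rfl | rfl)
      exacts [hr, hs]
  have hsq : (l * z) ^ 2 ∈ IntermediateField.adjoin ℂ {r', s'} := by
    rw [heq, mul_pow]
    exact mul_mem (pow_mem hl 2) h.sq_mem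
  have htop : IntermediateField.adjoin ℂ {r', s', l * z} = ⊤ := by
    rw [← top_le_iff, ← h.top, IntermediateField.adjoin_le_iff]
    have hle : IntermediateField.adjoin ℂ {r, s} ≤ IntermediateField.adjoin ℂ {r', s', l * z} := by
      rw [← heq]
      exact IntermediateField.adjoin.mono _ _ _ (by simp [Set.insert_subset_iff])
    have h1 : l * z ∈ IntermediateField.adjoin ℂ {r', s', l * z} :=
      IntermediateField.subset_adjoin _ _ (by simp)
    rintro _ (rfl | rfl | rfl)
    · exact hle (IntermediateField.subset_adjoin _ _ (by simp))
    · exact hle (IntermediateField.subset_adjoin _ _ (by simp))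
    · have := mul_mem (inv_mem (hle hl)) h1
      rwa [inv_mul_cancel_left₀ hl0] at this
  refine ⟨algebraicIndependent_of_isAlgebraic h.ind htop hsq, ?_, hsq, htop⟩
  rw [heq]
  intro h1
  have := mul_mem (inv_mem hl) h1
  rw [inv_mul_cancel_left₀ hl0] at this
  exact h.notMem this

end IsFrame

end Frames

section Charts

open MvPolynomial

variable {K : Type*} [Field K] [Algebra ℂ K]

/-- The coordinate ring generated by `r`, `s`, `z` and the inverse of `δ`. -/
def chartRing (r s z δ : K) : Subalgebra ℂ K := Algebra.adjoin ℂ {r, s, z, δ⁻¹}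

lemma mem_chartRing (r s z δ : K) : r ∈ chartRing r s z δ ∧ s ∈ chartRing r s z δ ∧
    z ∈ chartRing r s z δ ∧ δ⁻¹ ∈ chartRing r s z δ :=
  ⟨Algebra.subset_adjoin (by simp), Algebra.subset_adjoin (by simp),
    Algebra.subset_adjoin (by simp), Algebra.subset_adjoin (by simp)⟩

lemma chartRing_le {r s z δ : K} {B : Subalgebra ℂ K} (hr : r ∈ B) (hs : s ∈ B) (hz : z ∈ B)
    (hδ : δ⁻¹ ∈ B) : chartRing r s z δ ≤ B := by
  unfold chartRing
  rw [Algebra.adjoin_le_iff]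
  rintro _ (rfl | rfl | rfl | rfl) <;> assumption

lemma fg_chartRing (r s z δ : K) : (chartRing r s z δ).FG :=
  Subalgebra.fg_def.2 ⟨_, Set.toFinite _, rfl⟩

/-- A valuation ring containing the constants, as a subalgebra. -/
def Constants.subalgebra {V : ValuationSubring K} (hV : Constants V) : Subalgebra ℂ K :=
  { V.toSubring with algebraMap_mem' := hV }

lemma below_chartRing {r s z δ : K} {V : ValuationSubring K} (hV : Constants V) :
    Below (chartRing r s z δ) V ↔ r ∈ V ∧ s ∈ V ∧ z ∈ V ∧ δ⁻¹ ∈ V := by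
  obtain ⟨h1, h2, h3, h4⟩ := mem_chartRing r s z δ
  refine ⟨fun h => ⟨h _ h1, h _ h2, h _ h3, h _ h4⟩, fun ⟨h1, h2, h3, h4⟩ => ?_⟩
  exact chartRing_le (B := hV.subalgebra) h1 h2 h3 h4

/-- The evaluation at `(r, s)` and `z` of a polynomial in two variables and a third one. -/
def evalHom {T : Type*} [CommRing T] [Algebra ℂ T] (r s z : T) :
    Polynomial (MvPolynomial (Fin 2) ℂ) →+* T :=
  Polynomial.eval₂RingHom (aeval ![r, s]).toRingHom z

section

variable {r s z : K} {a b : MvPolynomial (Fin 2) ℂ}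

lemma isPrimitive_of_isRelPrime (hab : IsRelPrime a b) :
    (Polynomial.C a * Polynomial.X ^ 2 - Polynomial.C b).IsPrimitive := by
  intro c hc
  rw [Polynomial.C_dvd_iff_dvd_coeff] at hc
  have h2 := hc 2
  have h0 := hc 0
  simp only [Polynomial.coeff_sub, Polynomial.coeff_C_mul, Polynomial.coeff_X_pow,
    Polynomial.coeff_C] at h2 h0
  norm_num at h2 h0
  exact hab h2 h0

/-- All relations among the coordinates are consequences of the quadratic equation for `z`. -/
lemma dvd_of_evalHom_eq_zero (hind : AlgebraicIndependent ℂ ![r, s])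
    (hz : z ∉ IntermediateField.adjoin ℂ {r, s}) (hab : IsRelPrime a b)
    (hrel : aeval ![r, s] a * z ^ 2 = aeval ![r, s] b) (ha : a ≠ 0)
    {p : Polynomial (MvPolynomial (Fin 2) ℂ)} (hp : evalHom r s z p = 0) :
    Polynomial.C a * Polynomial.X ^ 2 - Polynomial.C b ∣ p := by
  let S := MvPolynomial (Fin 2) ℂ
  let F := FractionRing S
  let i : S →+* K := (aeval ![r, s]).toRingHom
  have hi : Function.Injective i := hind
  let j : F →+* K := IsFractionRing.lift hi
  have hj (x : S) : j (algebraMap S F x) = i x := IsFractionRing.lift_algebraMap hi x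
  have hmem (x : S) : i x ∈ IntermediateField.adjoin ℂ {r, s} := by
    change aeval ![r, s] x ∈ _
    induction x using MvPolynomial.induction_on with
    | C c => rw [aeval_C]; exact IntermediateField.algebraMap_mem _ c
    | add p q hp hq => rw [map_add]; exact add_mem hp hq
    | mul_X p k hp =>
      rw [map_mul, aeval_X]
      refine mul_mem hp (IntermediateField.subset_adjoin _ _ ?_)
      fin_cases k <;> simp
  have hjmem (y : F) : j y ∈ IntermediateField.adjoin ℂ {r, s} := by
    obtain ⟨n, d, -, rfl⟩ := IsFractionRing.div_surjective (A := S) y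
    rw [map_div₀, hj, hj]
    exact div_mem (hmem n) (hmem d)
  let : NormalizationMonoid S := Classical.choice inferInstance
  let : NormalizedGCDMonoid S := UniqueFactorizationMonoid.toNormalizedGCDMonoid S
  refine (isPrimitive_of_isRelPrime hab).dvd_of_fraction_map_dvd_fraction_map (K := F) ?_
  have haF : algebraMap S F a ≠ 0 := by
    rw [Ne, map_eq_zero_iff _ (IsFractionRing.injective S F)]; exact ha
  set q : Polynomial F := Polynomial.X ^ 2 - Polynomial.C (algebraMap S F b / algebraMap S F a)
    with hq
  have hqm : q.Monic := Polynomial.monic_X_pow_sub_C _ two_ne_zero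
  have hfac : Polynomial.map (algebraMap S F) (Polynomial.C a * Polynomial.X ^ 2 - Polynomial.C b) =
      Polynomial.C (algebraMap S F a) * q := by
    rw [hq, mul_sub, ← Polynomial.C_mul, mul_div_cancel₀ _ haF]
    simp
  rw [hfac]
  have hev : Polynomial.eval₂ j z (p.map (algebraMap S F)) = 0 := by
    rw [Polynomial.eval₂_map]
    have : j.comp (algebraMap S F) = i := RingHom.ext hj
    rw [this]
    exact hp
  have hqz : Polynomial.eval₂ j z q = 0 := by
    have hia : i a ≠ 0 := by rw [← hj, Ne, map_eq_zero]; exact haF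
    have : i a * z ^ 2 = i b := hrel
    rw [hq, Polynomial.eval₂_sub, Polynomial.eval₂_C, Polynomial.eval₂_X_pow, map_div₀, hj, hj,
      ← this]
    field_simp
    simp
  have hdvd : q ∣ p.map (algebraMap S F) := by
    rw [← Polynomial.modByMonic_eq_zero_iff_dvd hqm]
    set m := p.map (algebraMap S F) %ₘ q with hm
    have hm0 : Polynomial.eval₂ j z m = 0 := by
      have h1 := Polynomial.modByMonic_add_div (p.map (algebraMap S F)) q
      rw [← h1, Polynomial.eval₂_add, Polynomial.eval₂_mul, hqz, zero_mul, add_zero] at hev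
      exact hev
    have hdeg : m.natDegree ≤ 1 := by
      have h1 : q.natDegree = 2 := Polynomial.natDegree_X_pow_sub_C
      have h2 := Polynomial.natDegree_modByMonic_lt (p.map (algebraMap S F)) hqm (fun h => by
        rw [h, Polynomial.natDegree_one] at h1; omega)
      rw [← hm, h1] at h2
      omega
    obtain ⟨c, d, hcd⟩ := Polynomial.exists_eq_X_add_C_of_natDegree_le_one hdeg
    rw [hcd] at hm0 ⊢
    simp only [Polynomial.eval₂_add, Polynomial.eval₂_mul, Polynomial.eval₂_C,
      Polynomial.eval₂_X] at hm0
    have hc : c = 0 := by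
      by_contra hc
      apply hz
      have hjc : j c ≠ 0 := by rw [Ne, map_eq_zero]; exact hc
      have : z = - j d / j c := by
        field_simp
        linear_combination hm0
      rw [this]
      exact div_mem (neg_mem (hjmem _)) (hjmem _)
    rw [hc, map_zero, zero_mul, zero_add, map_eq_zero] at hm0
    rw [hc, hm0]
    simp
  exact (((isUnit_iff_ne_zero.2 haF).map Polynomial.C).mul_left_dvd).2 hdvd

end

/-- An affine chart, given by its coordinates `r`, `s`, `z`, the relation `a z² = b`, where `a`
and `b` are polynomials in `r` and `s`, and the function `δ = Δ(r, s, z)` that is inverted. -/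
structure IsChart (r s z : K) (a b : MvPolynomial (Fin 2) ℂ) (Δ : MvPolynomial (Fin 3) ℂ) :
    Prop where
  frame : IsFrame r s z
  relPrime : IsRelPrime a b
  ne_zero : a ≠ 0
  rel : aeval ![r, s] a * z ^ 2 = aeval ![r, s] b
  Δ_ne_zero : aeval ![r, s, z] Δ ≠ 0

namespace IsChart

variable {r s z : K} {a b : MvPolynomial (Fin 2) ℂ} {Δ : MvPolynomial (Fin 3) ℂ}

open IntermediateField.algebraAdjoinAdjoin in
lemma isFractionRing (h : IsChart r s z a b Δ) (δ : K) : IsFractionRing (chartRing r s z δ) K := by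
  refine IsFractionRing.of_field _ _ fun y => ?_
  have hy : y ∈ IntermediateField.adjoin ℂ {r, s, z} := h.frame.top ▸ IntermediateField.mem_top
  obtain ⟨n, hn, d, hd, rfl⟩ := IntermediateField.mem_adjoin_iff_div.1 hy
  have hle : Algebra.adjoin ℂ {r, s, z} ≤ chartRing r s z δ :=
    Algebra.adjoin_mono (by simp [Set.insert_subset_iff])
  exact ⟨⟨n, hle hn⟩, ⟨d, hle hd⟩, rfl⟩

/-- The universal property of a chart. -/
lemma exists_hom (h : IsChart r s z a b Δ) {T : Type*} [CommRing T] [Algebra ℂ T] (r₀ s₀ z₀ : T)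
    (hrel : aeval ![r₀, s₀] a * z₀ ^ 2 = aeval ![r₀, s₀] b)
    (hΔ : IsUnit (aeval ![r₀, s₀, z₀] Δ)) :
    ∃ φ : chartRing r s z (aeval ![r, s, z] Δ) →ₐ[ℂ] T,
      φ ⟨r, (mem_chartRing _ _ _ _).1⟩ = r₀ ∧ φ ⟨s, (mem_chartRing _ _ _ _).2.1⟩ = s₀ ∧
      φ ⟨z, (mem_chartRing _ _ _ _).2.2.1⟩ = z₀ := by
  obtain ⟨u, hu⟩ := hΔ
  set δ := aeval ![r, s, z] Δ with hδ
  have hδ0 : δ ≠ 0 := h.Δ_ne_zero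
  let G : Subalgebra ℂ (K × T) :=
    Algebra.adjoin ℂ {(r, r₀), (s, s₀), (z, z₀), (δ⁻¹, ((u⁻¹ : Tˣ) : T))}
  let Sx := Polynomial (MvPolynomial (Fin 2) ℂ)
  let e : MvPolynomial (Fin 3) ℂ →ₐ[ℂ] Sx :=
    aeval ![Polynomial.C (X 0), Polynomial.C (X 1), Polynomial.X]
  have heK : evalHom r s z (e Δ) = δ := by
    have : (evalHom r s z).comp e.toRingHom = (aeval ![r, s, z] : MvPolynomial (Fin 3) ℂ →ₐ[ℂ] K).toRingHom := by
      apply MvPolynomial.ringHom_ext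
      · intro c
        have : e (C c) = Polynomial.C (C c) := aeval_C _ _
        simp [this, evalHom]
      · intro i
        fin_cases i <;> simp [e, evalHom]
    exact DFunLike.congr_fun this Δ
  have heT : evalHom r₀ s₀ z₀ (e Δ) = u := by
    have : (evalHom r₀ s₀ z₀).comp e.toRingHom =
        (aeval ![r₀, s₀, z₀] : MvPolynomial (Fin 3) ℂ →ₐ[ℂ] T).toRingHom := by
      apply MvPolynomial.ringHom_ext
      · intro c
        have : e (C c) = Polynomial.C (C c) := aeval_C _ _
        simp [this, evalHom]
      · intro i
        fin_cases i <;> simp [e, evalHom]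
    exact (DFunLike.congr_fun this Δ).trans hu.symm
  have hG (g : K × T) (hg : g ∈ G) : ∃ (k : ℕ) (p : Sx), δ ^ k * g.1 = evalHom r s z p ∧
      (u : T) ^ k * g.2 = evalHom r₀ s₀ z₀ p := by
    induction hg using Algebra.adjoin_induction with
    | mem x hx =>
      rcases hx with rfl | rfl | rfl | rfl
      · exact ⟨0, Polynomial.C (X 0), by simp [evalHom], by simp [evalHom]⟩
      · exact ⟨0, Polynomial.C (X 1), by simp [evalHom], by simp [evalHom]⟩
      · exact ⟨0, Polynomial.X, by simp [evalHom], by simp [evalHom]⟩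
      · exact ⟨1, 1, by simp [hδ0], by simp⟩
    | algebraMap c =>
      exact ⟨0, Polynomial.C (C c), by simp [evalHom], by simp [evalHom]⟩
    | add x y _ _ hx hy =>
      obtain ⟨k, p, h1, h2⟩ := hx
      obtain ⟨l, q, h3, h4⟩ := hy
      refine ⟨k + l, e Δ ^ l * p + e Δ ^ k * q, ?_, ?_⟩
      · rw [map_add, map_mul, map_mul, map_pow, map_pow, heK, ← h1, ← h3, Prod.fst_add]; ring
      · rw [map_add, map_mul, map_mul, map_pow, map_pow, heT, ← h2, ← h4, Prod.snd_add]; ring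
    | mul x y _ _ hx hy =>
      obtain ⟨k, p, h1, h2⟩ := hx
      obtain ⟨l, q, h3, h4⟩ := hy
      refine ⟨k + l, p * q, ?_, ?_⟩
      · rw [map_mul, ← h1, ← h3, Prod.fst_mul]; ring
      · rw [map_mul, ← h2, ← h4, Prod.snd_mul]; ring
  have hinj (g : K × T) (hg : g ∈ G) (h0 : g.1 = 0) : g.2 = 0 := by
    obtain ⟨k, p, h1, h2⟩ := hG g hg
    rw [h0, mul_zero] at h1
    obtain ⟨q, hq⟩ := dvd_of_evalHom_eq_zero h.frame.ind h.frame.notMem h.relPrime h.rel h.ne_zero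
      h1.symm
    have h3 : evalHom r₀ s₀ z₀ (Polynomial.C a * Polynomial.X ^ 2 - Polynomial.C b) = 0 := by
      simpa [evalHom, sub_eq_zero] using hrel
    rw [hq, map_mul, h3, zero_mul] at h2
    exact ((u.isUnit.pow k).mul_right_eq_zero).1 h2
  let π : G →ₐ[ℂ] K := (AlgHom.fst ℂ K T).comp G.val
  have hπ : Function.Injective π := by
    rw [injective_iff_map_eq_zero]
    rintro ⟨g, hg⟩ h0
    exact Subtype.ext (Prod.ext h0 (hinj g hg h0))
  have hrange : π.range = chartRing r s z δ := by
    have h1 : π.range = G.map (AlgHom.fst ℂ K T) := by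
      ext x
      constructor
      · rintro ⟨g, rfl⟩
        exact ⟨g, g.2, rfl⟩
      · rintro ⟨g, hg, rfl⟩
        exact ⟨⟨g, hg⟩, rfl⟩
    rw [h1, AlgHom.map_adjoin]
    simp only [Set.image_insert_eq, Set.image_singleton, AlgHom.fst_apply]
    rfl
  let ε := (AlgEquiv.ofInjective π hπ).trans (Subalgebra.equivOfEq _ _ hrange)
  let φ : chartRing r s z δ →ₐ[ℂ] T := ((AlgHom.snd ℂ K T).comp G.val).comp ε.symm.toAlgHom
  have hφ (x : K) (y : T) (hxy : (x, y) ∈ G) (hx : x ∈ chartRing r s z δ) : φ ⟨x, hx⟩ = y := by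
    have : ε.symm ⟨x, hx⟩ = ⟨(x, y), hxy⟩ := by
      rw [AlgEquiv.symm_apply_eq]
      rfl
    change ((ε.symm ⟨x, hx⟩ : G) : K × T).2 = y
    rw [this]
  exact ⟨φ, hφ _ _ (Algebra.subset_adjoin (by simp)) _, hφ _ _ (Algebra.subset_adjoin (by simp)) _,
    hφ _ _ (Algebra.subset_adjoin (by simp)) _⟩

end IsChart

end Charts

end Inose

end

noncomputable section

namespace Inose

open IsLocalRing MvPolynomial

variable {K : Type*} [Field K] [Algebra ℂ K]

lemma aeval_polynomial_aeval {σ R : Type*} [CommRing R] [Algebra ℂ R] (f : σ → R)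
    (p : MvPolynomial σ ℂ) (q : Polynomial ℂ) :
    aeval f (Polynomial.aeval p q) = Polynomial.aeval (aeval f p) q :=
  (Polynomial.aeval_algHom_apply (aeval f) p q).symm

lemma map_polynomial_aeval {R S : Type*} [CommRing R] [CommRing S] [Algebra ℂ R] [Algebra ℂ S]
    (φ : R →ₐ[ℂ] S) (x : R) (q : Polynomial ℂ) :
    φ (Polynomial.aeval x q) = Polynomial.aeval (φ x) q :=
  (Polynomial.aeval_algHom_apply φ x q).symm

lemma map_mvPolynomial_aeval {σ R S : Type*} [CommRing R] [CommRing S] [Algebra ℂ R] [Algebra ℂ S]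
    (φ : R →ₐ[ℂ] S) (x : σ → R) (q : MvPolynomial σ ℂ) :
    φ (aeval x q) = aeval (fun i => φ (x i)) q := by
  have := MvPolynomial.comp_aeval x φ
  exact DFunLike.congr_fun this q

lemma isRelPrime_X {i : Fin 2} {p : MvPolynomial (Fin 2) ℂ} (f : Fin 2 → ℂ) (hf : f i = 0)
    (hp : aeval f p ≠ 0) : IsRelPrime (X i) p := by
  rw [(MvPolynomial.X_prime (R := ℂ)).irreducible.isRelPrime_iff_not_dvd]
  rintro ⟨q, rfl⟩
  simp [hf] at hp

namespace IsChart

variable {r s z : K} {a b : MvPolynomial (Fin 2) ℂ} {Δ : MvPolynomial (Fin 3) ℂ}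

/-- The coordinate ring of a chart. -/
def ring (_ : IsChart r s z a b Δ) : Subalgebra ℂ K := chartRing r s z (aeval ![r, s, z] Δ)

variable (h : IsChart r s z a b Δ)

/-- The first coordinate of a chart. -/
def cr : h.ring := ⟨r, (mem_chartRing _ _ _ _).1⟩
/-- The second coordinate of a chart. -/
def cs : h.ring := ⟨s, (mem_chartRing _ _ _ _).2.1⟩
/-- The third coordinate of a chart. -/
def cz : h.ring := ⟨z, (mem_chartRing _ _ _ _).2.2.1⟩
/-- The inverse of the distinguished function of a chart. -/
def ci : h.ring := ⟨(aeval ![r, s, z] Δ)⁻¹, (mem_chartRing _ _ _ _).2.2.2⟩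

@[simp] lemma coe_cr : (h.cr : K) = r := rfl
@[simp] lemma coe_cs : (h.cs : K) = s := rfl
@[simp] lemma coe_cz : (h.cz : K) = z := rfl
@[simp] lemma coe_ci : (h.ci : K) = (aeval ![r, s, z] Δ)⁻¹ := rfl

lemma coe_aeval₂ (q : MvPolynomial (Fin 2) ℂ) :
    ((aeval ![h.cr, h.cs] q : h.ring) : K) = aeval ![r, s] q := by
  refine (map_mvPolynomial_aeval h.ring.val _ q).trans ?_
  congr 2
  ext i; fin_cases i <;> rfl

lemma coe_aeval₃ (q : MvPolynomial (Fin 3) ℂ) :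
    ((aeval ![h.cr, h.cs, h.cz] q : h.ring) : K) = aeval ![r, s, z] q := by
  refine (map_mvPolynomial_aeval h.ring.val _ q).trans ?_
  congr 2
  ext i; fin_cases i <;> rfl

lemma ring_rel : aeval ![h.cr, h.cs] a * h.cz ^ 2 = aeval ![h.cr, h.cs] b := by
  apply Subtype.ext
  rw [MulMemClass.coe_mul, coe_aeval₂, coe_aeval₂, SubmonoidClass.coe_pow, coe_cz, h.rel]

lemma mul_ci : aeval ![h.cr, h.cs, h.cz] Δ * h.ci = 1 := by
  apply Subtype.ext
  rw [MulMemClass.coe_mul, coe_aeval₃, coe_ci]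
  exact mul_inv_cancel₀ h.Δ_ne_zero

lemma fg_ring : h.ring.FG := fg_chartRing _ _ _ _

lemma isFractionRing_ring : IsFractionRing h.ring K := h.isFractionRing _

lemma below_ring {V : ValuationSubring K} (hV : Constants V) :
    Below h.ring V ↔ r ∈ V ∧ s ∈ V ∧ z ∈ V ∧ (aeval ![r, s, z] Δ)⁻¹ ∈ V := below_chartRing hV

lemma ring_le_iff (B : Subalgebra ℂ K) : h.ring ≤ B ↔ r ∈ B ∧ s ∈ B ∧ z ∈ B ∧
    (aeval ![r, s, z] Δ)⁻¹ ∈ B := by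
  obtain ⟨h1, h2, h3, h4⟩ := mem_chartRing r s z (aeval ![r, s, z] Δ)
  exact ⟨fun h => ⟨h h1, h h2, h h3, h h4⟩, fun ⟨h1, h2, h3, h4⟩ => chartRing_le h1 h2 h3 h4⟩

/-- To check that `h.ring` is contained in the local ring of a centre, it is enough to look at the
coordinates. -/
lemma ring_le_centre {V : ValuationSubring K} (hV : Constants V) (hb : Below h.ring V)
    {A : Subalgebra ℂ K} (hA : Below A V) (hr : r ∈ (centre hA).carrier)
    (hs : s ∈ (centre hA).carrier) (hz : z ∈ (centre hA).carrier) :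
    h.ring ≤ (centre hA).carrier := by
  rw [ring_le_iff]
  refine ⟨hr, hs, hz, inv_mem_centre hA ?_ ((h.below_ring hV).1 hb).2.2.2⟩
  have key (q : MvPolynomial (Fin 3) ℂ) : aeval ![r, s, z] q ∈ (centre hA).carrier := by
    induction q using MvPolynomial.induction_on with
    | C c => rw [aeval_C]; exact (centre hA).carrier.algebraMap_mem c
    | add p q hp hq => rw [map_add]; exact add_mem hp hq
    | mul_X p k hp =>
      rw [map_mul, aeval_X]
      refine mul_mem hp ?_
      fin_cases k
      exacts [hr, hs, hz]
  exact key Δ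

lemma induction {motive : h.ring → Prop} (cr : motive h.cr) (cs : motive h.cs) (cz : motive h.cz)
    (ci : motive h.ci) (const : ∀ c : ℂ, motive (algebraMap ℂ h.ring c))
    (add : ∀ x y, motive x → motive y → motive (x + y))
    (mul : ∀ x y, motive x → motive y → motive (x * y)) (x : h.ring) : motive x := by
  obtain ⟨x, hx⟩ := x
  induction hx using Algebra.adjoin_induction with
  | mem x hx =>
    rcases hx with rfl | rfl | rfl | rfl
    exacts [cr, cs, cz, ci]
  | algebraMap c => exact const c
  | add x y hx hy h1 h2 => exact add ⟨x, hx⟩ ⟨y, hy⟩ h1 h2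
  | mul x y hx hy h1 h2 => exact mul ⟨x, hx⟩ ⟨y, hy⟩ h1 h2

lemma exists_hom' {T : Type*} [CommRing T] [Algebra ℂ T] (r₀ s₀ z₀ : T)
    (hrel : aeval ![r₀, s₀] a * z₀ ^ 2 = aeval ![r₀, s₀] b)
    (hΔ : IsUnit (aeval ![r₀, s₀, z₀] Δ)) :
    ∃ φ : h.ring →ₐ[ℂ] T, φ h.cr = r₀ ∧ φ h.cs = s₀ ∧ φ h.cz = z₀ :=
  h.exists_hom r₀ s₀ z₀ hrel hΔ

/-- The coordinates of the points of a chart satisfying a maximal set of equations. -/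
lemma isMaximal (r₀ s₀ z₀ : ℂ) (hrel : aeval ![r₀, s₀] a * z₀ ^ 2 = aeval ![r₀, s₀] b)
    (hΔ : aeval ![r₀, s₀, z₀] Δ ≠ 0) {I : Ideal h.ring}
    (hI : ∀ χ : h.ring →ₐ[ℂ] ℂ, χ h.cr = r₀ → χ h.cs = s₀ → χ h.cz = z₀ → ∀ x ∈ I, χ x = 0)
    (hr : h.cr - algebraMap ℂ _ r₀ ∈ I) (hs : h.cs - algebraMap ℂ _ s₀ ∈ I)
    (hz : h.cz - algebraMap ℂ _ z₀ ∈ I) : I.IsMaximal := by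
  obtain ⟨χ, h1, h2, h3⟩ := h.exists_hom' r₀ s₀ z₀ hrel (isUnit_iff_ne_zero.2 hΔ)
  have hker : I = RingHom.ker χ := by
    apply le_antisymm
    · exact fun x hx => hI χ h1 h2 h3 x hx
    · have key (x : h.ring) : x - algebraMap ℂ _ (χ x) ∈ I := by
        have hmul (x y : h.ring) (hx : x - algebraMap ℂ _ (χ x) ∈ I)
            (hy : y - algebraMap ℂ _ (χ y) ∈ I) : x * y - algebraMap ℂ _ (χ (x * y)) ∈ I := by
          have : x * y - algebraMap ℂ _ (χ (x * y)) = (x - algebraMap ℂ _ (χ x)) * y +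
              algebraMap ℂ _ (χ x) * (y - algebraMap ℂ _ (χ y)) := by
            rw [map_mul, map_mul]; ring
          rw [this]
          exact add_mem (I.mul_mem_right _ hx) (I.mul_mem_left _ hy)
        have hadd (x y : h.ring) (hx : x - algebraMap ℂ _ (χ x) ∈ I)
            (hy : y - algebraMap ℂ _ (χ y) ∈ I) : x + y - algebraMap ℂ _ (χ (x + y)) ∈ I := by
          have : x + y - algebraMap ℂ _ (χ (x + y)) = (x - algebraMap ℂ _ (χ x)) +
              (y - algebraMap ℂ _ (χ y)) := by
            rw [map_add, map_add]; ring
          rw [this]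
          exact add_mem hx hy
        have hconst (c : ℂ) : algebraMap ℂ h.ring c - algebraMap ℂ _ (χ (algebraMap ℂ h.ring c)) ∈ I := by
          rw [AlgHom.commutes]; simp
        have hcr : h.cr - algebraMap ℂ _ (χ h.cr) ∈ I := by rwa [h1]
        have hcs : h.cs - algebraMap ℂ _ (χ h.cs) ∈ I := by rwa [h2]
        have hcz : h.cz - algebraMap ℂ _ (χ h.cz) ∈ I := by rwa [h3]
        refine h.induction (motive := fun x => x - algebraMap ℂ _ (χ x) ∈ I) hcr hcs hcz ?_
          hconst hadd hmul x
        have hpoly (q : MvPolynomial (Fin 3) ℂ) : aeval ![h.cr, h.cs, h.cz] q -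
            algebraMap ℂ _ (χ (aeval ![h.cr, h.cs, h.cz] q)) ∈ I := by
          induction q using MvPolynomial.induction_on with
          | C c => rw [aeval_C]; exact hconst c
          | add p q hp hq => rw [map_add]; exact hadd _ _ hp hq
          | mul_X p k hp =>
            rw [map_mul, aeval_X]
            refine hmul _ _ hp ?_
            fin_cases k
            exacts [hcr, hcs, hcz]
        have h4 := hpoly Δ
        set δ := aeval ![h.cr, h.cs, h.cz] Δ
        have h5 : χ δ * χ h.ci = 1 := by rw [← map_mul, h.mul_ci, map_one]
        have h6 : h.ci - algebraMap ℂ h.ring (χ h.ci) =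
            - (δ - algebraMap ℂ _ (χ δ)) * (h.ci * algebraMap ℂ _ (χ h.ci)) := by
          have h7 : algebraMap ℂ h.ring (χ δ) * algebraMap ℂ h.ring (χ h.ci) = 1 := by
            rw [← map_mul, h5, map_one]
          linear_combination (algebraMap ℂ h.ring (χ h.ci)) * h.mul_ci - h.ci * h7
        rw [h6]
        exact I.mul_mem_right _ (neg_mem h4)
      intro x hx
      have := key x
      rw [RingHom.mem_ker] at hx
      change χ x = 0 at hx
      rwa [hx, map_zero, sub_zero] at this
  rw [hker]
  exact RingHom.ker_isMaximal_of_surjective χ fun c => ⟨algebraMap ℂ _ c, AlgHom.commutes χ c⟩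

/-- The parametrized curve `(r₀, s₀, z₀)` on a chart, with equation `g` and parameter `par`. -/
lemma exists_curve (r₀ s₀ z₀ : RatFunc ℂ)
    (hrel : aeval ![r₀, s₀] a * z₀ ^ 2 = aeval ![r₀, s₀] b)
    (hΔ : aeval ![r₀, s₀, z₀] Δ ≠ 0) (g par : h.ring) (hg0 : (g : K) ≠ 0)
    (hφ : ∀ φ : h.ring →ₐ[ℂ] RatFunc ℂ, φ h.cr = r₀ → φ h.cs = s₀ → φ h.cz = z₀ →
      φ g = 0 ∧ φ par = RatFunc.X)
    (D : Polynomial ℂ) (e : h.ring) (hD : g ∣ Polynomial.aeval par D * e - 1)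
    (hr : ∃ (k : ℕ) (N : Polynomial ℂ), g ∣ Polynomial.aeval par D ^ k * h.cr - Polynomial.aeval par N)
    (hs : ∃ (k : ℕ) (N : Polynomial ℂ), g ∣ Polynomial.aeval par D ^ k * h.cs - Polynomial.aeval par N)
    (hz : ∃ (k : ℕ) (N : Polynomial ℂ), g ∣ Polynomial.aeval par D ^ k * h.cz - Polynomial.aeval par N)
    (hi : ∃ (k : ℕ) (N : Polynomial ℂ), g ∣ Polynomial.aeval par D ^ k * h.ci - Polynomial.aeval par N) :
    ∃ R : RationalCurve h.ring, R.g = g ∧ R.φ h.cr = r₀ ∧ R.φ h.cs = s₀ ∧ R.φ h.cz = z₀ := by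
  obtain ⟨φ, h1, h2, h3⟩ := h.exists_hom' r₀ s₀ z₀ hrel (isUnit_iff_ne_zero.2 hΔ)
  obtain ⟨hg, hpar⟩ := hφ φ h1 h2 h3
  set δ := Polynomial.aeval par D with hδ
  have key (x : h.ring) : ∃ (k : ℕ) (N : Polynomial ℂ), g ∣ δ ^ k * x - Polynomial.aeval par N := by
    refine h.induction (motive := fun x => ∃ (k : ℕ) (N : Polynomial ℂ), g ∣ δ ^ k * x - Polynomial.aeval par N)
      hr hs hz hi ?_ ?_ ?_ x
    · exact fun c => ⟨0, Polynomial.C c, by simp⟩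
    · rintro x y ⟨k, N, u, hu⟩ ⟨l, M, v, hv⟩
      refine ⟨k + l, D ^ l * N + D ^ k * M, δ ^ l * u + δ ^ k * v, ?_⟩
      simp only [map_add, map_mul, map_pow, ← hδ]
      linear_combination δ ^ l * hu + δ ^ k * hv
    · rintro x y ⟨k, N, u, hu⟩ ⟨l, M, v, hv⟩
      refine ⟨k + l, N * M, u * (δ ^ l * y) + Polynomial.aeval par N * v, ?_⟩
      simp only [map_mul]
      linear_combination δ ^ l * y * hu + Polynomial.aeval par N * hv
  refine ⟨⟨g, φ, par, fun h => hg0 (by rw [h]; rfl), fun x => ⟨fun hx => ?_, ?_⟩, hpar⟩,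
    rfl, h1, h2, h3⟩
  · obtain ⟨k, N, u, hu⟩ := key x
    have hN : N = 0 := by
      have h4 := congrArg φ hu
      rw [map_sub, map_mul, hx, mul_zero, zero_sub, map_mul, hg, zero_mul, neg_eq_zero,
        map_polynomial_aeval, hpar, ← RatFunc.algebraMap_X,
        Polynomial.aeval_algebraMap_apply, Polynomial.aeval_X_left_apply] at h4
      exact (map_eq_zero_iff _ (RatFunc.algebraMap_injective ℂ)).1 h4
    rw [hN, map_zero, sub_zero] at hu
    have h5 : g ∣ δ ^ k * x := ⟨u, hu⟩
    have h6 : g ∣ (δ * e) ^ k - 1 := hD.trans (by simpa using sub_dvd_pow_sub_pow (δ * e) 1 k)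
    have h7 : x = e ^ k * (δ ^ k * x) - ((δ * e) ^ k - 1) * x := by ring
    rw [h7]
    exact dvd_sub (h5.mul_left _) (h6.mul_right _)
  · rintro ⟨y, rfl⟩
    rw [map_mul, hg, zero_mul]

/-- A version of `exists_curve` for curves whose coordinate ring is the localization of the
polynomial ring in the parameter at the restriction `D` of `Δ`. -/
lemma exists_curve' (r₀ s₀ z₀ : RatFunc ℂ)
    (hrel : aeval ![r₀, s₀] a * z₀ ^ 2 = aeval ![r₀, s₀] b)
    (hΔ : aeval ![r₀, s₀, z₀] Δ ≠ 0) (g par : h.ring) (hg0 : (g : K) ≠ 0)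
    (hφ : ∀ φ : h.ring →ₐ[ℂ] RatFunc ℂ, φ h.cr = r₀ → φ h.cs = s₀ → φ h.cz = z₀ →
      φ g = 0 ∧ φ par = RatFunc.X)
    (D N₁ N₂ N₃ : Polynomial ℂ) (hD : g ∣ aeval ![h.cr, h.cs, h.cz] Δ - Polynomial.aeval par D)
    (hr : g ∣ h.cr - Polynomial.aeval par N₁) (hs : g ∣ h.cs - Polynomial.aeval par N₂)
    (hz : g ∣ h.cz - Polynomial.aeval par N₃) :
    ∃ R : RationalCurve h.ring, R.g = g ∧ R.φ h.cr = r₀ ∧ R.φ h.cs = s₀ ∧ R.φ h.cz = z₀ := by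
  have h1 : g ∣ Polynomial.aeval par D * h.ci - 1 := by
    have : Polynomial.aeval par D * h.ci - 1 =
      - (aeval ![h.cr, h.cs, h.cz] Δ - Polynomial.aeval par D) * h.ci := by
      linear_combination h.mul_ci
    rw [this]
    exact (dvd_neg.2 hD).mul_right _
  exact h.exists_curve r₀ s₀ z₀ hrel hΔ g par hg0 hφ D h.ci h1 ⟨0, N₁, by simpa using hr⟩
    ⟨0, N₂, by simpa using hs⟩ ⟨0, N₃, by simpa using hz⟩ ⟨1, 1, by simpa using h1⟩

end IsChart

end Inose

end

noncomputable section

namespace Inose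

open IsLocalRing MvPolynomial

variable {K : Type*} [Field K] [Algebra ℂ K]

section Valuations

variable {V : ValuationSubring K}

lemma Constants.valuation_le_one (hV : Constants V) (c : ℂ) : V.valuation (algebraMap ℂ K c) ≤ 1 :=
  (V.valuation_le_one_iff _).2 (hV c)

lemma Constants.valuation_eq_one (hV : Constants V) {c : ℂ} (hc : c ≠ 0) :
    V.valuation (algebraMap ℂ K c) = 1 := by
  apply le_antisymm (hV.valuation_le_one c)
  have h := hV.valuation_le_one c⁻¹
  have hc' : V.valuation (algebraMap ℂ K c) ≠ 0 := by simpa using hc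
  rw [map_inv₀, map_inv₀] at h
  exact (inv_le_one₀ (zero_lt_iff.2 hc')).1 h

lemma Constants.valuation_aeval_le_one (hV : Constants V) {x : K} (hx : V.valuation x ≤ 1)
    (p : Polynomial ℂ) : V.valuation (Polynomial.aeval x p) ≤ 1 := by
  induction p using Polynomial.induction_on' with
  | add p q hp hq => rw [map_add]; exact Valuation.map_add_le _ hp hq
  | monomial k c =>
    rw [Polynomial.aeval_monomial, map_mul, map_pow]
    exact mul_le_one' (hV.valuation_le_one c) (pow_le_one' hx k)

lemma aeval_eq_coeff_zero_add {R : Type*} [CommRing R] [Algebra ℂ R] (x : R) (p : Polynomial ℂ) :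
    Polynomial.aeval x p = algebraMap ℂ R (p.coeff 0) + x * Polynomial.aeval x p.divX := by
  conv_lhs => rw [← Polynomial.divX_mul_X_add p]
  simp only [map_add, map_mul, Polynomial.aeval_X, Polynomial.aeval_C]
  ring

lemma Constants.valuation_aeval_eq_one (hV : Constants V) {x : K} (hx : V.valuation x < 1)
    {p : Polynomial ℂ} (hp : p.coeff 0 ≠ 0) : V.valuation (Polynomial.aeval x p) = 1 := by
  rw [aeval_eq_coeff_zero_add, Valuation.map_add_eq_of_lt_left, hV.valuation_eq_one hp]
  rw [hV.valuation_eq_one hp, map_mul]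
  exact mul_lt_one_of_lt_of_le hx (hV.valuation_aeval_le_one hx.le _)

lemma valuation_inv_le_one_iff {K : Type*} [Field K] {V : ValuationSubring K} {x : K} (hx : x ≠ 0) : V.valuation x⁻¹ ≤ 1 ↔ 1 ≤ V.valuation x := by
  rw [map_inv₀, inv_le_one₀ (zero_lt_iff.2 (by simpa using hx))]

end Valuations

namespace RationalCurve

variable {A : Subalgebra ℂ K} (R : RationalCurve A)

lemma exists_place (hA : A.FG) (hf : IsFractionRing A K) : ∃ V : ValuationSubring K, Constants V ∧
    ∀ f, f ∈ V ↔ f ∈ R.localRing.carrier := by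
  have := R.isDiscreteValuationRing hA
  have := LocalRingIn.isFractionRing_ofPrime A R.prime
  exact R.localRing.exists_valuationSubring

/-- The valuation ring of a rational curve on a surface. -/
def place (hA : A.FG) (hf : IsFractionRing A K) : ValuationSubring K := (R.exists_place hA hf).choose

variable {hA : A.FG} {hf : IsFractionRing A K}

lemma constants_place : Constants (R.place hA hf) := (R.exists_place hA hf).choose_spec.1

lemma mem_place (f : K) : f ∈ R.place hA hf ↔ f ∈ R.localRing.carrier :=
  (R.exists_place hA hf).choose_spec.2 f

lemma valuation_le_one (a : A) : (R.place hA hf).valuation a ≤ 1 := by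
  rw [ValuationSubring.valuation_le_one_iff, mem_place]
  exact LocalRingIn.le_ofPrime A _ a.2

lemma valuation_lt_one_iff (a : A) : (R.place hA hf).valuation a < 1 ↔ R.φ a = 0 := by
  by_cases h0 : a = 0
  · subst h0; simp
  have h0' : (a : K) ≠ 0 := fun h => h0 (Subtype.ext h)
  rw [R.map_eq_zero, ← R.mem_prime, ← LocalRingIn.vanishes_ofPrime, LocalRingIn.vanishes_iff,
    ← R.mem_place (hA := hA) (hf := hf), ← R.mem_place (hA := hA) (hf := hf), ← not_le,
    ← valuation_inv_le_one_iff h0', ValuationSubring.valuation_le_one_iff,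
    ← ValuationSubring.valuation_le_one_iff _ (a : K)]
  simp [h0', R.valuation_le_one a]

lemma valuation_eq_one_iff (a : A) : (R.place hA hf).valuation a = 1 ↔ R.φ a ≠ 0 := by
  rw [Ne, ← R.valuation_lt_one_iff (hA := hA) (hf := hf), not_lt]
  exact ⟨fun h => h.ge, fun h => le_antisymm (R.valuation_le_one a) h⟩

lemma place_isDominatedBy : R.localRing.IsDominatedBy (R.place hA hf) :=
  ⟨fun f hf => (R.mem_place f).2 hf, fun _ _ hf => (R.mem_place _).1 hf⟩

end RationalCurve

/-- If the place of a curve has its centre on another curve, then the two curves coincide. -/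
lemma CompleteVariety.localRing_eq (Y : CompleteVariety K) {A B : Subalgebra ℂ K}
    (hA : A ∈ Y.charts) (hB : B ∈ Y.charts) (R : RationalCurve A) (R' : RationalCurve B)
    (hle : Below A (R'.place (Y.fg B hB) (Y.isFractionRing B hB)))
    (hv : (R'.place (Y.fg B hB) (Y.isFractionRing B hB)).valuation (R.g : K) < 1) :
    R.localRing = R'.localRing := by
  have h1 := Y.eq_centre (P := R'.localRing) ⟨B, hB, _, inferInstance, rfl⟩ R'.constants_place
    R'.place_isDominatedBy hA hle
  have : IsDiscreteValuationRing (LocalRingIn.ofPrime A (centreIdeal hle)).carrier := by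
    have := R'.isDiscreteValuationRing (Y.fg B hB)
    rw [h1] at this
    exact this
  rw [h1]
  refine LocalRingIn.ofPrime_congr _ _ (LocalRingIn.eq_of_isDiscreteValuationRing R.prime_ne_bot
    (R.prime_le ?_))
  by_contra h
  rw [notMem_centreIdeal] at h
  rw [← not_le, ← valuation_inv_le_one_iff h.1, ValuationSubring.valuation_le_one_iff] at hv
  exact hv h.2

/-- Curves given on charts are identified by means of their places. -/
lemma CompleteVariety.exists_components (Y : CompleteVariety K) {ι E : Type} {Ch : E → Subalgebra ℂ K}
    (hCh : ∀ e, Ch e ∈ Y.charts) {J : E → Type} (lab : ∀ e, J e → ι)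
    (curve : ∀ e, J e → RationalCurve (Ch e)) (lab_surjective : ∀ i, ∃ e j, lab e j = i)
    (Φ : ι → ValuationSubring K → Prop)
    (hΦ : ∀ e j, Φ (lab e j) ((curve e j).place (Y.fg _ (hCh e)) (Y.isFractionRing _ (hCh e))))
    (hb : ∀ e j V, Constants V → Φ (lab e j) V → Below (Ch e) V ∧ V.valuation ((curve e j).g : K) < 1)
    (hinj : ∀ i j V, Constants V → Φ i V → Φ j V → i = j) :
    ∃ C : ι → LocalRingIn K, Function.Injective C ∧
      ∀ e j, (curve e j).localRing = C (lab e j) := by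
  choose e j h using lab_surjective
  refine ⟨fun i => (curve (e i) (j i)).localRing, fun i i' hii => ?_, fun e' j' => ?_⟩
  · have h1 := hΦ (e i) (j i)
    have h2 := hΦ (e i') (j i')
    have h3 : (curve (e i) (j i)).place (Y.fg _ (hCh (e i))) (Y.isFractionRing _ (hCh (e i))) =
        (curve (e i') (j i')).place (Y.fg _ (hCh (e i'))) (Y.isFractionRing _ (hCh (e i'))) := by
      ext f
      rw [RationalCurve.mem_place, RationalCurve.mem_place]
      change f ∈ ((fun i => (curve (e i) (j i)).localRing) i).carrier ↔ _
      rw [hii]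
    rw [h3] at h1
    rw [← h i, ← h i']
    exact hinj _ _ _ (RationalCurve.constants_place _) h1 h2
  · have h1 := hΦ (e (lab e' j')) (j (lab e' j'))
    rw [h] at h1
    obtain ⟨h2, h3⟩ := hb e' j' _ (RationalCurve.constants_place _) h1
    exact Y.localRing_eq (hCh e') (hCh _) _ _ h2 h3

lemma aeval_ratFuncX_ne_zero {q : Polynomial ℂ} (hq : q ≠ 0) :
    Polynomial.aeval (RatFunc.X : RatFunc ℂ) q ≠ 0 := by
  have : Polynomial.aeval (RatFunc.X : RatFunc ℂ) q = algebraMap _ _ q := by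
    have h := Polynomial.aeval_algHom_apply (IsScalarTower.toAlgHom ℂ (Polynomial ℂ) (RatFunc ℂ))
      Polynomial.X q
    simp only [IsScalarTower.coe_toAlgHom', RatFunc.algebraMap_X,
      Polynomial.aeval_X_left_apply] at h
    exact h
  rw [this]
  simpa using hq

/-- A local equation of a degenerating family of elliptic curves: the curves
`W² = c₁ U + c₂ τⁿ / U + c₃`, where the `cᵢ` are polynomials in `τ`. -/
structure FibreModel (K : Type*) [Field K] [Algebra ℂ K] where
  τ : K
  U : K
  W : K
  n : ℕ
  c₁ : Polynomial ℂ
  c₂ : Polynomial ℂ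
  c₃ : Polynomial ℂ
  d : Polynomial ℂ
  frame : IsFrame τ U W
  n_ne : n ≠ 0
  rel : W ^ 2 = Polynomial.aeval τ c₁ * U + Polynomial.aeval τ c₂ * (τ ^ n / U) +
    Polynomial.aeval τ c₃
  dvd₁ : c₁ ∣ d
  dvd₂ : c₂ ∣ d
  d_zero : d.coeff 0 ≠ 0

lemma IsFrame.ne_zero {r s z : K} (h : IsFrame r s z) : r ≠ 0 ∧ s ≠ 0 ∧ z ≠ 0 := by
  refine ⟨h.ind.ne_zero 0, h.ind.ne_zero 1, ?_⟩
  rintro rfl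
  exact h.notMem (zero_mem _)

lemma IsFrame.change' {r s z r' s' z' l : K} (h : IsFrame r s z)
    (hr' : r' ∈ IntermediateField.adjoin ℂ {r, s}) (hs' : s' ∈ IntermediateField.adjoin ℂ {r, s})
    (hr : r ∈ IntermediateField.adjoin ℂ {r', s'}) (hs : s ∈ IntermediateField.adjoin ℂ {r', s'})
    (hl : l ∈ IntermediateField.adjoin ℂ {r, s}) (hl0 : l ≠ 0) (hz : z' = l * z) :
    IsFrame r' s' z' := hz ▸ h.change hr' hs' hr hs hl hl0

lemma left_mem_adjoin (r s : K) : r ∈ IntermediateField.adjoin ℂ {r, s} :=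
  IntermediateField.subset_adjoin _ _ (by simp)

lemma right_mem_adjoin (r s : K) : s ∈ IntermediateField.adjoin ℂ {r, s} :=
  IntermediateField.subset_adjoin _ _ (by simp)

lemma coeff_zero_ne_of_dvd {p q : Polynomial ℂ} (h : p ∣ q) (hq : q.coeff 0 ≠ 0) :
    p.coeff 0 ≠ 0 := by
  obtain ⟨r, rfl⟩ := h
  rw [Polynomial.mul_coeff_zero] at hq
  exact left_ne_zero_of_mul hq

lemma aeval_ne_zero_of_algebraicIndependent {x y : K} (h : AlgebraicIndependent ℂ ![x, y])
    {p : Polynomial ℂ} (hp : p ≠ 0) : Polynomial.aeval x p ≠ 0 := by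
  have h1 : Transcendental ℂ x := h.transcendental 0
  exact fun h0 => h1 ⟨p, hp, h0⟩

namespace FibreModel

variable (D : FibreModel K)

lemma τ_ne : D.τ ≠ 0 := D.frame.ne_zero.1
lemma U_ne : D.U ≠ 0 := D.frame.ne_zero.2.1
lemma W_ne : D.W ≠ 0 := D.frame.ne_zero.2.2

lemma d_ne : Polynomial.aeval D.τ D.d ≠ 0 :=
  aeval_ne_zero_of_algebraicIndependent D.frame.ind fun h => D.d_zero (by simp [h])

lemma c₁_zero : D.c₁.coeff 0 ≠ 0 := coeff_zero_ne_of_dvd D.dvd₁ D.d_zero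
lemma c₂_zero : D.c₂.coeff 0 ≠ 0 := coeff_zero_ne_of_dvd D.dvd₂ D.d_zero

/-- The symmetry exchanging `U` and `τⁿ / U`. -/
def swap : FibreModel K where
  τ := D.τ
  U := D.τ ^ D.n / D.U
  W := D.W
  n := D.n
  c₁ := D.c₂
  c₂ := D.c₁
  c₃ := D.c₃
  d := D.d
  frame := by
    have hτ := D.τ_ne
    have hU := D.U_ne
    have h1 := left_mem_adjoin D.τ D.U
    have h2 := right_mem_adjoin D.τ D.U
    have h3 := left_mem_adjoin D.τ (D.τ ^ D.n / D.U)
    have h4 := right_mem_adjoin D.τ (D.τ ^ D.n / D.U)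
    refine D.frame.change' (l := 1) h1 (div_mem (pow_mem h1 _) h2) h3 ?_ (one_mem _) one_ne_zero
      (one_mul _).symm
    have : D.U = D.τ ^ D.n / (D.τ ^ D.n / D.U) := by field_simp
    have h5 := div_mem (pow_mem h3 D.n) h4
    rwa [← this] at h5
  n_ne := D.n_ne
  rel := by
    have hτ := D.τ_ne
    have hU := D.U_ne
    rw [D.rel]
    field_simp
    ring
  dvd₁ := D.dvd₂
  dvd₂ := D.dvd₁
  d_zero := D.d_zero

/-- The numerator of the equation at infinity. -/
def infPoly : MvPolynomial (Fin 2) ℂ :=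
  Polynomial.aeval (X 0) D.c₁ + Polynomial.aeval (X 0) D.c₃ * X 1 +
    Polynomial.aeval (X 0) D.c₂ * X 0 ^ D.n * X 1 ^ 2

lemma aeval_infPoly {R : Type*} [CommRing R] [Algebra ℂ R] (r s : R) : aeval ![r, s] D.infPoly =
    Polynomial.aeval r D.c₁ + Polynomial.aeval r D.c₃ * s +
      Polynomial.aeval r D.c₂ * r ^ D.n * s ^ 2 := by
  simp [infPoly, aeval_polynomial_aeval]

lemma infPoly_eval_ne : aeval ![(0 : ℂ), 0] D.infPoly ≠ 0 := by
  rw [aeval_infPoly]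
  simpa [Polynomial.coeff_zero_eq_aeval_zero] using D.c₁_zero

lemma infPoly_rel : aeval ![D.τ, D.U⁻¹] D.infPoly * (D.W⁻¹) ^ 2 = D.U⁻¹ := by
  have hτ := D.τ_ne
  have hU := D.U_ne
  have hW := D.W_ne
  have := D.rel
  rw [aeval_infPoly]
  field_simp at this ⊢
  linear_combination -this

lemma isChart_inf : IsChart D.τ D.U⁻¹ D.W⁻¹ D.infPoly (X 1) (Polynomial.aeval (X 0) D.d) where
  frame := by
    have hW := D.W_ne
    refine D.frame.change' (l := (D.W ^ 2)⁻¹) (left_mem_adjoin _ _) (inv_mem (right_mem_adjoin _ _))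
      (left_mem_adjoin _ _) ?_ (inv_mem D.frame.sq_mem) (by simpa using hW) (by field_simp)
    have := inv_mem (right_mem_adjoin D.τ D.U⁻¹)
    rwa [inv_inv] at this
  relPrime := (isRelPrime_X ![0, 0] (by simp) D.infPoly_eval_ne).symm
  ne_zero := fun h => D.infPoly_eval_ne (by rw [h, map_zero])
  rel := by rw [D.infPoly_rel]; simp
  Δ_ne_zero := by rw [aeval_polynomial_aeval]; simpa using D.d_ne

/-- The coordinate ring of the chart at infinity. -/
abbrev infRing : Subalgebra ℂ K := D.isChart_inf.ring

lemma aeval_infPoly_sub {R : Type*} [CommRing R] [Algebra ℂ R] (r s : R) : r ∣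
    aeval ![r, s] D.infPoly - (algebraMap ℂ R (D.c₁.coeff 0) + algebraMap ℂ R (D.c₃.coeff 0) * s) := by
  rw [aeval_infPoly, aeval_eq_coeff_zero_add r D.c₁, aeval_eq_coeff_zero_add r D.c₃]
  obtain ⟨k, hk⟩ := Nat.exists_eq_succ_of_ne_zero D.n_ne
  refine ⟨Polynomial.aeval r D.c₁.divX + Polynomial.aeval r D.c₃.divX * s +
    Polynomial.aeval r D.c₂ * r ^ k * s ^ 2, ?_⟩
  rw [hk, Nat.succ_eq_add_one, pow_succ]
  ring

lemma algebraMap_mul_inv {R : Type*} [CommRing R] [Algebra ℂ R] {c : ℂ} (hc : c ≠ 0) :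
    algebraMap ℂ R c * algebraMap ℂ R c⁻¹ = 1 := by
  rw [← map_mul, mul_inv_cancel₀ hc, map_one]

/-- The component of the fibre on the chart at infinity. -/
lemma exists_curve_inf : ∃ R : RationalCurve D.infRing, (R.g : K) = D.τ ∧
    ∀ hf hf', (R.place hf hf').valuation D.τ < 1 ∧ (R.place hf hf').valuation D.U = 1 ∧
      ∀ c : ℂ, (R.place hf hf').valuation (D.W - algebraMap ℂ K c) = 1 := by
  have h := D.isChart_inf
  set x : RatFunc ℂ := RatFunc.X with hx
  set A := D.c₁.coeff 0 with hA
  set B := D.c₃.coeff 0 with hB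
  have hA0 : A ≠ 0 := D.c₁_zero
  have hpol (q : Polynomial ℂ) (hq : q ≠ 0) : Polynomial.aeval x q ≠ 0 := aeval_ratFuncX_ne_zero hq
  have hx0 : x ≠ 0 := RatFunc.X_ne_zero
  have hD0 : 1 - algebraMap ℂ (RatFunc ℂ) B * x ^ 2 ≠ 0 := by
    have := hpol (1 - Polynomial.C B * Polynomial.X ^ 2) (fun h => by
      have := congrArg (fun p => Polynomial.coeff p 0) h
      simp at this)
    simpa using this
  have hAx : algebraMap ℂ (RatFunc ℂ) A ≠ 0 := by simpa using hA0
  set s₀ : RatFunc ℂ := algebraMap ℂ _ A * x ^ 2 / (1 - algebraMap ℂ _ B * x ^ 2) with hs₀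
  have hinf : aeval ![0, s₀] D.infPoly = algebraMap ℂ (RatFunc ℂ) A + algebraMap ℂ _ B * s₀ := by
    have := D.aeval_infPoly_sub 0 s₀
    rw [zero_dvd_iff, sub_eq_zero] at this
    exact this
  have hcr : h.cr ∣ aeval ![h.cr, h.cs] D.infPoly -
      (algebraMap ℂ _ A + algebraMap ℂ _ B * h.cs) := D.aeval_infPoly_sub _ _
  have hrel : aeval ![h.cr, h.cs] D.infPoly * h.cz ^ 2 = h.cs := by
    have := h.ring_rel
    rwa [aeval_X] at this
  have hci : Polynomial.aeval h.cr D.d * h.ci = 1 := by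
    have := h.mul_ci
    rwa [aeval_polynomial_aeval, aeval_X] at this
  have hd := aeval_eq_coeff_zero_add h.cr D.d
  obtain ⟨q, hq⟩ := hcr
  have hA1 := algebraMap_mul_inv (R := h.ring) hA0
  have hd1 := algebraMap_mul_inv (R := h.ring) D.d_zero
  obtain ⟨R, h1, h2, h3, h4⟩ := h.exists_curve 0 s₀ x
    (by rw [hinf, hs₀, aeval_X]; simp only [Matrix.cons_val]; field_simp; ring)
    (by
      rw [aeval_polynomial_aeval, aeval_X, aeval_eq_coeff_zero_add]
      simpa using D.d_zero)
    h.cr h.cz D.τ_ne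
    (fun φ h1 _ h3 => ⟨h1, h3⟩) (1 - Polynomial.C B * Polynomial.X ^ 2)
    ((algebraMap ℂ _ A + algebraMap ℂ _ B * h.cs) * algebraMap ℂ _ A⁻¹) (by
      refine ⟨q * algebraMap ℂ _ B * h.cz ^ 2 * algebraMap ℂ _ A⁻¹, ?_⟩
      simp
      linear_combination hA1 - (algebraMap ℂ _ B * algebraMap ℂ _ A⁻¹) * hrel +
        (algebraMap ℂ _ B * h.cz ^ 2 * algebraMap ℂ _ A⁻¹) * hq)
    ⟨0, 0, by simp⟩ ⟨1, Polynomial.C A * Polynomial.X ^ 2, q * h.cz ^ 2, by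
      simp
      linear_combination h.cz ^ 2 * hq - hrel⟩ ⟨0, Polynomial.X, by simp⟩
    ⟨0, Polynomial.C (D.d.coeff 0)⁻¹, - Polynomial.aeval h.cr D.d.divX * h.ci *
        algebraMap ℂ _ (D.d.coeff 0)⁻¹, by
      simp
      linear_combination algebraMap ℂ _ (D.d.coeff 0)⁻¹ * hci - algebraMap ℂ _ (D.d.coeff 0)⁻¹ * h.ci * hd
        - h.ci * hd1⟩
  refine ⟨R, by rw [h1]; rfl, fun hf hf' => ?_⟩
  have hv (a : h.ring) (ha : R.φ a ≠ 0) : (R.place hf hf').valuation (a : K) = 1 :=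
    (R.valuation_eq_one_iff a).2 ha
  have hs₀0 : s₀ ≠ 0 := div_ne_zero (mul_ne_zero hAx (pow_ne_zero _ hx0)) hD0
  have hU : (R.place hf hf').valuation D.U = 1 := by
    have := hv h.cs (by rw [h3]; exact hs₀0)
    rwa [h.coe_cs, map_inv₀, inv_eq_one] at this
  refine ⟨(R.valuation_lt_one_iff h.cr).2 h2, hU, fun c => ?_⟩
  have hW : (R.place hf hf').valuation D.W = 1 := by
    have := hv h.cz (by rw [h4]; exact hx0)
    rwa [h.coe_cz, map_inv₀, inv_eq_one] at this
  have h5 := hv (1 - algebraMap ℂ _ c * h.cz) (by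
    rw [map_sub, map_mul, map_one, AlgHom.commutes, h4]
    have := hpol (1 - Polynomial.C c * Polynomial.X) (fun h => by
      have := congrArg (fun p => Polynomial.coeff p 0) h
      simp at this)
    simpa using this)
  have hW0 := D.W_ne
  have h6 : D.W - algebraMap ℂ K c = D.W * ((1 - algebraMap ℂ _ c * h.cz : h.ring) : K) := by
    push_cast
    rw [h.coe_cz]
    field_simp
  rw [h6, map_mul, hW, h5, one_mul]

end FibreModel

end Inose

end

noncomputable section

namespace Inose

open IsLocalRing MvPolynomial

variable {K : Type*} [Field K] [Algebra ℂ K]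

lemma RationalCurve.exists_of_eq {A B : Subalgebra ℂ K} (h : A = B) (R : RationalCurve A) :
    ∃ R' : RationalCurve B, (R'.g : K) = R.g ∧
      ∀ P : ValuationSubring K → Prop, (∀ hf hf', P (R.place hf hf')) →
        ∀ hf hf', P (R'.place hf hf') := by
  subst h
  exact ⟨R, rfl, fun P h => h⟩

namespace FibreModel

variable (D : FibreModel K)

/-- The right hand side of the equation of a chart of a fibre of type `I`. -/
def cycPoly (i : ℕ) : MvPolynomial (Fin 2) ℂ :=
  Polynomial.aeval (X 0 * X 1) D.c₁ * X 0 * (X 0 * X 1) ^ i +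
    Polynomial.aeval (X 0 * X 1) D.c₂ * X 1 * (X 0 * X 1) ^ (D.n - 1 - i) +
    Polynomial.aeval (X 0 * X 1) D.c₃

/-- The function inverted on a chart of a fibre of type `I`. -/
def cycUnit (w : ℂ) : MvPolynomial (Fin 3) ℂ :=
  Polynomial.aeval (X 0 * X 1) D.d * (X 2 + C w)

/-- The coordinate rings of the charts of a fibre of type `I`. -/
def cycRing (i : ℕ) (w : ℂ) : Subalgebra ℂ K :=
  chartRing (D.U / D.τ ^ i) (D.τ ^ (i + 1) / D.U) D.W
    (aeval ![D.U / D.τ ^ i, D.τ ^ (i + 1) / D.U, D.W] (D.cycUnit w))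

lemma cyc_mul (i : ℕ) : (D.U / D.τ ^ i) * (D.τ ^ (i + 1) / D.U) = D.τ := by
  have hτ := D.τ_ne
  have hU := D.U_ne
  field_simp
  ring

lemma aeval_cycPoly {R : Type*} [CommRing R] [Algebra ℂ R] (i : ℕ) (r s : R) :
    aeval ![r, s] (D.cycPoly i) = Polynomial.aeval (r * s) D.c₁ * r * (r * s) ^ i +
      Polynomial.aeval (r * s) D.c₂ * s * (r * s) ^ (D.n - 1 - i) +
      Polynomial.aeval (r * s) D.c₃ := by
  simp [cycPoly, aeval_polynomial_aeval]

lemma aeval_cycUnit {R : Type*} [CommRing R] [Algebra ℂ R] (w : ℂ) (r s z : R) :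
    aeval ![r, s, z] (D.cycUnit w) = Polynomial.aeval (r * s) D.d * (z + algebraMap ℂ R w) := by
  simp [cycUnit, aeval_polynomial_aeval]

lemma W_add_ne (w : ℂ) : D.W + algebraMap ℂ K w ≠ 0 := by
  intro h
  apply D.frame.notMem
  rw [eq_neg_of_add_eq_zero_left h]
  exact neg_mem (IntermediateField.algebraMap_mem _ _)

lemma isChart_cyc {i : ℕ} (hi : i < D.n) (w : ℂ) : IsChart (D.U / D.τ ^ i) (D.τ ^ (i + 1) / D.U) D.W 1 (D.cycPoly i)
    (D.cycUnit w) where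
  frame := by
    have hτ := D.τ_ne
    have hU := D.U_ne
    have h1 := left_mem_adjoin D.τ D.U
    have h2 := right_mem_adjoin D.τ D.U
    have h3 := left_mem_adjoin (D.U / D.τ ^ i) (D.τ ^ (i + 1) / D.U)
    have h4 := mul_mem h3 (right_mem_adjoin (D.U / D.τ ^ i) (D.τ ^ (i + 1) / D.U))
    rw [D.cyc_mul] at h4
    refine D.frame.change' (l := 1) (div_mem h2 (pow_mem h1 _)) (div_mem (pow_mem h1 _) h2) h4 ?_
      (one_mem _) one_ne_zero (one_mul _).symm
    have := mul_mem h3 (pow_mem h4 i)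
    rwa [div_mul_cancel₀ _ (pow_ne_zero _ hτ)] at this
  relPrime := isRelPrime_one_left
  ne_zero := one_ne_zero
  rel := by
    have hτ := D.τ_ne
    have hU := D.U_ne
    rw [map_one, one_mul, D.rel, aeval_cycPoly, D.cyc_mul]
    have h1 : D.τ ^ D.n = D.τ ^ (i + 1) * D.τ ^ (D.n - 1 - i) := by
      rw [← pow_add]; congr 1; omega
    rw [h1]
    field_simp
  Δ_ne_zero := by
    rw [aeval_cycUnit, D.cyc_mul]
    exact mul_ne_zero D.d_ne (D.W_add_ne w)

lemma fg_cycRing (i : ℕ) (w : ℂ) : (D.cycRing i w).FG := fg_chartRing _ _ _ _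

lemma isFractionRing_cycRing {i : ℕ} (hi : i < D.n) (w : ℂ) : IsFractionRing (D.cycRing i w) K :=
  (D.isChart_cyc hi w).isFractionRing_ring

lemma swap_cycRing {i : ℕ} (hi : i < D.n) (w : ℂ) : D.swap.cycRing (D.n - 1 - i) w = D.cycRing i w := by
  have hτ := D.τ_ne
  have hU := D.U_ne
  have h1 : D.τ ^ D.n / D.U / D.τ ^ (D.n - 1 - i) = D.τ ^ (i + 1) / D.U := by
    have : D.τ ^ D.n = D.τ ^ (i + 1) * D.τ ^ (D.n - 1 - i) := by
      rw [← pow_add]; congr 1; omega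
    rw [this]; field_simp
  have h2 : D.τ ^ (D.n - 1 - i + 1) / (D.τ ^ D.n / D.U) = D.U / D.τ ^ i := by
    have : D.τ ^ D.n = D.τ ^ i * D.τ ^ (D.n - 1 - i + 1) := by
      rw [← pow_add]; congr 1; omega
    rw [this]; field_simp
  unfold cycRing
  rw [aeval_cycUnit, aeval_cycUnit, D.cyc_mul, D.swap.cyc_mul]
  simp only [swap]
  rw [h1, h2]
  unfold chartRing
  rw [Set.insert_comm]

/-- The places of the components of a fibre of type `I`: the component with label `κ` for
`0 < κ < n`, and the value `w` of `W`, and the two components with labels `0` and `n`. -/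
def IsCycPlace (κ : ℕ) (w : ℂ) (V : ValuationSubring K) : Prop :=
  V.valuation D.τ < 1 ∧ V.valuation D.U = V.valuation D.τ ^ κ ∧
    (κ = 0 ∨ κ = D.n → ∀ c : ℂ, V.valuation (D.W - algebraMap ℂ K c) = 1) ∧
    (κ ≠ 0 → κ ≠ D.n → V.valuation (D.W - algebraMap ℂ K w) < 1)

/-- The equation of a component of a fibre of type `I` on a chart. -/
def cycPar (i κ : ℕ) : K := if κ = i then D.τ ^ (i + 1) / D.U else D.U / D.τ ^ i

lemma exists_curve_cyc {i : ℕ} (hi : i < D.n) {w : ℂ} (hw : w ≠ 0) (hc : D.c₃.coeff 0 = w ^ 2) :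
    ∃ R : RationalCurve (D.cycRing i w), (R.g : K) = D.τ ^ (i + 1) / D.U ∧
      ∀ hf hf', (R.place hf hf').valuation D.τ < 1 ∧
        (R.place hf hf').valuation D.U = (R.place hf hf').valuation D.τ ^ i ∧
        (i = 0 → ∀ c : ℂ, (R.place hf hf').valuation (D.W - algebraMap ℂ K c) = 1) ∧
        (i ≠ 0 → (R.place hf hf').valuation (D.W - algebraMap ℂ K w) < 1) := by
  have h := D.isChart_cyc hi w
  set x : RatFunc ℂ := RatFunc.X with hx
  have hx0 : x ≠ 0 := RatFunc.X_ne_zero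
  have hτ := D.τ_ne
  have hU := D.U_ne
  have hrel : h.cz ^ 2 = aeval ![h.cr, h.cs] (D.cycPoly i) := by
    have := h.ring_rel
    rwa [map_one, one_mul] at this
  rw [aeval_cycPoly] at hrel
  have hci := h.mul_ci
  rw [aeval_cycUnit] at hci
  have hg : (h.cs : K) ≠ 0 := div_ne_zero (pow_ne_zero _ hτ) hU
  have key (R : RationalCurve h.ring) (h1 : R.g = h.cs) (h2 : R.φ h.cs = 0) (h3 : R.φ h.cr ≠ 0) (hf hf') :
      (R.place hf hf').valuation D.τ < 1 ∧
        (R.place hf hf').valuation D.U = (R.place hf hf').valuation D.τ ^ i := by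
    have h4 := (R.valuation_lt_one_iff (hA := hf) (hf := hf') (h.cr * h.cs)).2 (by rw [map_mul, h2, mul_zero])
    have h5 := (R.valuation_eq_one_iff (hA := hf) (hf := hf') h.cr).2 h3
    have h6 : ((h.cr * h.cs : h.ring) : K) = D.τ := D.cyc_mul i
    rw [h6] at h4
    refine ⟨h4, ?_⟩
    rw [h.coe_cr, map_div₀, map_pow] at h5
    rwa [div_eq_one_iff_eq (by simpa using fun h => absurd h hτ)] at h5
  have hd := aeval_eq_coeff_zero_add (h.cr * h.cs) D.d
  have hc1 := aeval_eq_coeff_zero_add (h.cr * h.cs) D.c₁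
  have hc3 := aeval_eq_coeff_zero_add (h.cr * h.cs) D.c₃
  rcases Nat.eq_zero_or_pos i with rfl | hi0
  · set A := D.c₁.coeff 0
    have hA0 : A ≠ 0 := D.c₁_zero
    have hA1 := algebraMap_mul_inv (R := h.ring) hA0
    have hA2 := algebraMap_mul_inv (R := RatFunc ℂ) hA0
    obtain ⟨R, h1, h2, h3, h4⟩ := h.exists_curve' (algebraMap ℂ _ A⁻¹ * (x ^ 2 - algebraMap ℂ _ (w ^ 2)))
      0 x (by
        rw [map_one, one_mul, aeval_cycPoly, aeval_eq_coeff_zero_add _ D.c₁,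
          aeval_eq_coeff_zero_add _ D.c₃, hc]
        simp only [mul_zero, zero_mul, add_zero, pow_zero, mul_one]
        linear_combination -(x ^ 2 - algebraMap ℂ _ (w ^ 2)) * hA2)
      (by
        rw [aeval_cycUnit, mul_zero, aeval_eq_coeff_zero_add, zero_mul, add_zero]
        refine mul_ne_zero (by simpa using D.d_zero) ?_
        simpa using aeval_ratFuncX_ne_zero (Polynomial.X_add_C_ne_zero w))
      h.cs h.cz hg (fun φ _ h2 h3 => ⟨h2, h3⟩)
      (Polynomial.C (D.d.coeff 0) * (Polynomial.X + Polynomial.C w))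
      (Polynomial.C A⁻¹ * (Polynomial.X ^ 2 - Polynomial.C (w ^ 2))) 0 Polynomial.X
      (by
        rw [aeval_cycUnit, hd]
        refine ⟨h.cr * Polynomial.aeval (h.cr * h.cs) D.d.divX * (h.cz + algebraMap ℂ _ w), ?_⟩
        simp only [map_mul, Polynomial.aeval_C, map_add, Polynomial.aeval_X]
        ring)
      (by
        rw [hc3, hc1, hc] at hrel
        refine ⟨- algebraMap ℂ _ A⁻¹ * (h.cr * Polynomial.aeval (h.cr * h.cs) D.c₁.divX * h.cr +
          Polynomial.aeval (h.cr * h.cs) D.c₂ * (h.cr * h.cs) ^ (D.n - 1 - 0) +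
          h.cr * Polynomial.aeval (h.cr * h.cs) D.c₃.divX), ?_⟩
        simp only [map_mul, Polynomial.aeval_C, map_sub, Polynomial.aeval_X, map_pow] at hrel ⊢
        linear_combination -h.cr * hA1 - algebraMap ℂ _ A⁻¹ * hrel) (by simp) (by simp)
    refine ⟨R, by rw [h1]; rfl, fun hf hf' => ?_⟩
    obtain ⟨h5, h6⟩ := key R h1 h3 (by
      rw [h2]
      refine mul_ne_zero (by simpa using hA0) ?_
      have := aeval_ratFuncX_ne_zero (Polynomial.X_pow_sub_C_ne_zero two_pos (w ^ 2))
      rwa [map_sub, map_pow, Polynomial.aeval_X, Polynomial.aeval_C] at this) hf hf'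
    refine ⟨h5, h6, fun _ c => ?_, fun h => absurd rfl h⟩
    refine (R.valuation_eq_one_iff (h.cz - algebraMap ℂ _ c)).2 ?_
    rw [map_sub, h4, AlgHom.commutes]
    simpa using aeval_ratFuncX_ne_zero (Polynomial.X_sub_C_ne_zero c)
  · obtain ⟨k, rfl⟩ : ∃ k, i = k + 1 := ⟨i - 1, by omega⟩
    have hw2 : algebraMap ℂ (RatFunc ℂ) w + algebraMap ℂ (RatFunc ℂ) w ≠ 0 := by
      rw [← map_add]
      simpa using hw
    obtain ⟨R, h1, h2, h3, h4⟩ := h.exists_curve' x 0 (algebraMap ℂ _ w) (by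
        rw [map_one, one_mul, aeval_cycPoly, aeval_eq_coeff_zero_add _ D.c₃, hc]
        simp)
      (by
        rw [aeval_cycUnit, mul_zero, aeval_eq_coeff_zero_add, zero_mul, add_zero]
        exact mul_ne_zero (by simpa using D.d_zero) hw2)
      h.cs h.cr hg (fun φ h1 h2 _ => ⟨h2, h1⟩)
      (Polynomial.C (D.d.coeff 0 * (w + w))) Polynomial.X 0 (Polynomial.C w)
      (by
        rw [aeval_cycUnit, hd]
        have hz : h.cs ∣ h.cz - algebraMap ℂ _ w := by
          rw [hc3, hc] at hrel
          refine ⟨(Polynomial.aeval (h.cr * h.cs) D.c₁ * h.cr * h.cr * (h.cr * h.cs) ^ k +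
            Polynomial.aeval (h.cr * h.cs) D.c₂ * (h.cr * h.cs) ^ (D.n - 1 - (k + 1)) +
            h.cr * Polynomial.aeval (h.cr * h.cs) D.c₃.divX) *
              (Polynomial.aeval (h.cr * h.cs) D.d * h.ci), ?_⟩
          
          simp only [map_pow] at hrel
          linear_combination (Polynomial.aeval (h.cr * h.cs) D.d * h.ci) * hrel -
            (h.cz - algebraMap ℂ _ w) * hci
        obtain ⟨q, hq⟩ := hz
        refine ⟨h.cr * Polynomial.aeval (h.cr * h.cs) D.d.divX * (h.cz + algebraMap ℂ _ w) +
          algebraMap ℂ _ (D.d.coeff 0) * q, ?_⟩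
        simp only [Polynomial.aeval_C, map_mul, map_add]
        linear_combination algebraMap ℂ _ (D.d.coeff 0) * hq)
      (by simp) (by simp)
      (by
        rw [hc3, hc] at hrel
        refine ⟨(Polynomial.aeval (h.cr * h.cs) D.c₁ * h.cr * h.cr * (h.cr * h.cs) ^ k +
          Polynomial.aeval (h.cr * h.cs) D.c₂ * (h.cr * h.cs) ^ (D.n - 1 - (k + 1)) +
          h.cr * Polynomial.aeval (h.cr * h.cs) D.c₃.divX) *
            (Polynomial.aeval (h.cr * h.cs) D.d * h.ci), ?_⟩
        
        simp only [map_pow, Polynomial.aeval_C] at hrel ⊢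
        linear_combination (Polynomial.aeval (h.cr * h.cs) D.d * h.ci) * hrel -
          (h.cz - algebraMap ℂ _ w) * hci)
    refine ⟨R, by rw [h1]; rfl, fun hf hf' => ?_⟩
    obtain ⟨h5, h6⟩ := key R h1 h3 (by rw [h2]; exact hx0) hf hf'
    refine ⟨h5, h6, fun h => absurd h hi0.ne', fun _ => ?_⟩
    refine (R.valuation_lt_one_iff (h.cz - algebraMap ℂ _ w)).2 ?_
    rw [map_sub, h4, AlgHom.commutes, sub_self]

/-- The components of a fibre of type `I` on a chart. -/
lemma exists_curve_isCycPlace {i : ℕ} (hi : i < D.n) {w : ℂ} (hw : w ≠ 0) (hc : D.c₃.coeff 0 = w ^ 2) {κ : ℕ}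
    (hκ : κ = i ∨ κ = i + 1) : ∃ R : RationalCurve (D.cycRing i w), (R.g : K) = D.cycPar i κ ∧
      ∀ hf hf', D.IsCycPlace κ w (R.place hf hf') := by
  rcases hκ with rfl | rfl
  · obtain ⟨R, h1, h2⟩ := D.exists_curve_cyc hi hw hc
    refine ⟨R, by rw [h1, cycPar, if_pos rfl], fun hf hf' => ?_⟩
    obtain ⟨h3, h4, h5, h6⟩ := h2 hf hf'
    exact ⟨h3, h4, fun h => h5 (h.resolve_right hi.ne), fun h _ => h6 h⟩
  · obtain ⟨R, h1, h2⟩ := D.swap.exists_curve_cyc (i := D.n - 1 - i)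
      (by have : D.swap.n = D.n := rfl
          omega) hw hc
    have hτ := D.τ_ne
    have hU := D.U_ne
    obtain ⟨R', h3, h4⟩ := R.exists_of_eq (D.swap_cycRing hi w)
    refine ⟨R', ?_, h4 _ fun hf hf' => ?_⟩
    · rw [h3, h1, cycPar, if_neg (by omega)]
      simp only [swap]
      have : D.τ ^ D.n = D.τ ^ i * D.τ ^ (D.n - 1 - i + 1) := by
        rw [← pow_add]; congr 1; omega
      rw [this]; field_simp
    · obtain ⟨h5, h6, h7, h8⟩ := h2 hf hf'
      refine ⟨h5, ?_, fun h => h7 (by omega), fun _ h => h8 (by omega)⟩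
      have h10 : (R.place hf hf').valuation (D.τ ^ D.n / D.U) =
        (R.place hf hf').valuation D.τ ^ (D.n - 1 - i) := h6
      clear h8 h7 h6 h5
      generalize (R.place hf hf').valuation = v at h10 ⊢
      have h9 : v D.τ ≠ 0 := by simpa using hτ
      have h9' : v D.U ≠ 0 := by simpa using hU
      rw [map_div₀, map_pow, div_eq_iff h9'] at h10
      have h12 : v D.τ ^ D.n = v D.τ ^ (D.n - 1 - i) * v D.τ ^ (i + 1) := by
        rw [← pow_add]; congr 1; omega
      exact (mul_left_cancel₀ (pow_ne_zero _ h9) (h12.symm.trans h10)).symm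

end FibreModel

end Inose

end

noncomputable section

namespace Inose

open IsLocalRing MvPolynomial

variable {K : Type*} [Field K] [Algebra ℂ K]

/-- If `V` has a centre on both charts, then the coordinate ring `A` is contained in the local ring
of the centre on the chart `A'`. -/
def Glues (V : ValuationSubring K) (A A' : Subalgebra ℂ K) : Prop :=
  Below A V → ∀ h : Below A' V, A ≤ (centre h).carrier

lemma glues_self (V : ValuationSubring K) (A : Subalgebra ℂ K) : Glues V A A := fun _ h => le_centre h

lemma inv_mem_iff_one_le {K : Type*} [Field K] {V : ValuationSubring K} {x : K} (hx : x ≠ 0) :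
    x⁻¹ ∈ V ↔ 1 ≤ V.valuation x := by
  rw [← ValuationSubring.valuation_le_one_iff, valuation_inv_le_one_iff hx]

lemma valuation_add_algebraMap_le {V : ValuationSubring K} (hV : Constants V) {x : K}
    (hx : V.valuation x ≤ 1) (c : ℂ) : V.valuation (x + algebraMap ℂ K c) ≤ 1 :=
  Valuation.map_add_le _ hx (hV.valuation_le_one c)

lemma valuation_add_algebraMap_eq {V : ValuationSubring K} (hV : Constants V) {x : K}
    (hx : V.valuation x < 1) {c : ℂ} (hc : c ≠ 0) : V.valuation (x + algebraMap ℂ K c) = 1 := by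
  rw [Valuation.map_add_eq_of_lt_right, hV.valuation_eq_one hc]
  rwa [hV.valuation_eq_one hc]

lemma valuation_mul_lt_one {K : Type*} [Field K] {V : ValuationSubring K} {a b : V.ValueGroup}
    (ha : a ≤ 1) (hb : b < 1) : a * b < 1 := by
  rw [mul_comm]
  exact mul_lt_one_of_lt_of_le hb ha

namespace FibreModel

variable (D : FibreModel K) {V : ValuationSubring K}

lemma below_infRing (hV : Constants V) (hτ : V.valuation D.τ < 1) :
    Below D.infRing V ↔ 1 ≤ V.valuation D.U ∧ 1 ≤ V.valuation D.W := by
  rw [IsChart.below_ring _ hV, aeval_polynomial_aeval, aeval_X]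
  simp only [Matrix.cons_val_zero]
  rw [inv_mem_iff_one_le D.U_ne, inv_mem_iff_one_le D.W_ne, inv_mem_iff_one_le D.d_ne,
    hV.valuation_aeval_eq_one hτ D.d_zero, ← ValuationSubring.valuation_le_one_iff]
  simp [hτ.le]

lemma below_cycRing (i : ℕ) (w : ℂ) (hV : Constants V) (hτ : V.valuation D.τ < 1) :
    Below (D.cycRing i w) V ↔ V.valuation D.U ≤ V.valuation D.τ ^ i ∧
      V.valuation D.τ ^ (i + 1) ≤ V.valuation D.U ∧ V.valuation D.W ≤ 1 ∧
      V.valuation (D.W + algebraMap ℂ K w) = 1 := by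
  have h1 : V.valuation D.τ ^ i ≠ 0 := pow_ne_zero _ (by simpa using D.τ_ne)
  have h2 : V.valuation D.U ≠ 0 := by simpa using D.U_ne
  rw [cycRing, below_chartRing hV, aeval_cycUnit, D.cyc_mul,
    inv_mem_iff_one_le (mul_ne_zero D.d_ne (D.W_add_ne w)), map_mul,
    hV.valuation_aeval_eq_one hτ D.d_zero, one_mul, ← ValuationSubring.valuation_le_one_iff,
    ← ValuationSubring.valuation_le_one_iff, ← ValuationSubring.valuation_le_one_iff, map_div₀,
    map_div₀, map_pow, map_pow, div_le_one₀ (zero_lt_iff.2 h1), div_le_one₀ (zero_lt_iff.2 h2)]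
  constructor
  · rintro ⟨h1, h2, h3, h4⟩
    exact ⟨h1, h2, h3, le_antisymm (valuation_add_algebraMap_le hV h3 w) h4⟩
  · rintro ⟨h1, h2, h3, h4⟩
    exact ⟨h1, h2, h3, h4.ge⟩

namespace IsCycPlace

variable {D} {κ : ℕ} {w : ℂ}

lemma valuation_W (hV : Constants V) (h : D.IsCycPlace κ w V) : V.valuation D.W ≤ 1 := by
  by_cases hκ : κ = 0 ∨ κ = D.n
  · simpa using (h.2.2.1 hκ 0).le
  · push Not at hκ
    have := valuation_add_algebraMap_le hV (h.2.2.2 hκ.1 hκ.2).le w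
    rwa [sub_add_cancel] at this

lemma valuation_W_add (hV : Constants V) (hw : w ≠ 0) (h : D.IsCycPlace κ w V) :
    V.valuation (D.W + algebraMap ℂ K w) = 1 := by
  by_cases hκ : κ = 0 ∨ κ = D.n
  · simpa using h.2.2.1 hκ (-w)
  · push Not at hκ
    have := valuation_add_algebraMap_eq hV (h.2.2.2 hκ.1 hκ.2) (c := w + w) (by simpa using hw)
    rw [← this, RingHom.map_add]
    congr 1
    ring

lemma below_cycRing (hV : Constants V) (hw : w ≠ 0) (h : D.IsCycPlace κ w V) {i : ℕ} (hi : i < D.n)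
    (hκ : κ = i ∨ κ = i + 1) :
    Below (D.cycRing i w) V ∧ V.valuation (D.cycPar i κ) < 1 := by
  have h0 : V.valuation D.τ ≠ 0 := by simpa using D.τ_ne
  refine ⟨(D.below_cycRing _ w hV h.1).2 ⟨?_, ?_, h.valuation_W hV, h.valuation_W_add hV hw⟩, ?_⟩
  · rw [h.2.1]
    exact pow_le_pow_right_of_le_one' h.1.le (by omega)
  · rw [h.2.1]
    exact pow_le_pow_right_of_le_one' h.1.le (by omega)
  · rcases hκ with rfl | rfl
    · rw [cycPar, if_pos rfl, map_div₀, map_pow, h.2.1, pow_succ, mul_div_cancel_left₀ _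
        (pow_ne_zero _ h0)]
      exact h.1
    · rw [cycPar, if_neg (by omega), map_div₀, map_pow, h.2.1, pow_succ, mul_div_cancel_left₀ _
        (pow_ne_zero _ h0)]
      exact h.1

lemma below_infRing (hV : Constants V) (h : D.IsCycPlace 0 w V) : Below D.infRing V := by
  rw [D.below_infRing hV h.1, h.2.1]
  have := h.2.2.1 (Or.inl rfl) 0
  simp at this
  simp [this]

lemma below_infRing_swap (hV : Constants V) (h : D.IsCycPlace D.n w V) :
    Below D.swap.infRing V := by
  have h0 : V.valuation D.τ ≠ 0 := by simpa using D.τ_ne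
  have := h.2.2.1 (Or.inr rfl) 0
  rw [map_zero, sub_zero] at this
  rw [D.swap.below_infRing hV h.1]
  simp only [swap]
  rw [this, map_div₀, map_pow, h.2.1, div_self (pow_ne_zero _ h0)]
  simp

lemma eq (hV : Constants V) {κ' : ℕ} {w' : ℂ} (h : D.IsCycPlace κ w V)
    (h' : D.IsCycPlace κ' w' V) : κ = κ' ∧ (κ ≠ 0 → κ ≠ D.n → w = w') := by
  have h0 : V.valuation D.τ ≠ 0 := by simpa using D.τ_ne
  have hκ : κ = κ' := pow_right_injective₀ (zero_lt_iff.2 h0) h.1.ne (h.2.1.symm.trans h'.2.1)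
  subst hκ
  refine ⟨rfl, fun h1 h2 => ?_⟩
  by_contra hne
  have h3 := h.2.2.2 h1 h2
  have h4 := valuation_add_algebraMap_eq hV h3 (c := w - w') (sub_ne_zero.2 hne)
  rw [map_sub, sub_add_sub_cancel] at h4
  exact (h'.2.2.2 h1 h2).ne h4

end IsCycPlace

/-- The charts of a fibre of type `I`. -/
def IsCycChart (w : ℂ) (A : Subalgebra ℂ K) : Prop :=
  A = D.infRing ∨ A = D.swap.infRing ∨ ∃ i < D.n, A = D.cycRing i w ∨ A = D.cycRing i (-w)

lemma glues_cyc_cyc (hV : Constants V) (hτ : V.valuation D.τ < 1) {i j : ℕ} (hi : i < D.n)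
    (hj : j < D.n) (s t : ℂ) : Glues V (D.cycRing i s) (D.cycRing j t) := by
  intro hb hb'
  obtain ⟨h1, h2, h3, -⟩ := (D.below_cycRing _ s hV hτ).1 hb
  obtain ⟨h1', h2', h3', -⟩ := (D.below_cycRing _ t hV hτ).1 hb'
  have hτ0 := D.τ_ne
  have hU0 := D.U_ne
  have h0 : 0 < V.valuation D.τ := zero_lt_iff.2 (by simpa using hτ0)
  obtain ⟨m1, m2, m3, -⟩ := (IsChart.ring_le_iff (D.isChart_cyc hj t) _).1 (le_centre hb')
  have m4 := mul_mem m1 m2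
  rw [D.cyc_mul] at m4
  obtain ⟨e1, e2, -, -⟩ := (IsChart.below_ring (D.isChart_cyc hi s) hV).1 hb
  have hij : i + 1 ≥ j := by
    by_contra h
    exact (pow_lt_pow_right_of_lt_one₀ h0 hτ (not_le.1 h)).not_ge (h2.trans h1')
  have hji : j + 1 ≥ i := by
    by_contra h
    exact (pow_lt_pow_right_of_lt_one₀ h0 hτ (not_le.1 h)).not_ge (h2'.trans h1)
  refine (D.isChart_cyc hi s).ring_le_centre hV hb hb' ?_ ?_ m3
  · rcases (by omega : i = j + 1 ∨ i = j ∨ j = i + 1) with rfl | rfl | rfl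
    · refine mem_centre_of_inv hb' ?_ e1
      rwa [inv_div]
    · exact m1
    · have : D.U / D.τ ^ i = D.U / D.τ ^ (i + 1) * D.τ := by field_simp; ring
      rw [this]
      exact mul_mem m1 m4
  · rcases (by omega : i = j + 1 ∨ i = j ∨ j = i + 1) with rfl | rfl | rfl
    · have : D.τ ^ (j + 1 + 1) / D.U = D.τ * (D.τ ^ (j + 1) / D.U) := by field_simp; ring
      rw [this]
      exact mul_mem m4 m2
    · exact m2
    · refine mem_centre_of_inv hb' ?_ e2
      rwa [inv_div]

lemma cyc_inf_zero (hV : Constants V) (hτ : V.valuation D.τ < 1) {i : ℕ} {s : ℂ} (hb : Below D.infRing V) (hb' : Below (D.cycRing i s) V) : i = 0 := by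
  have h0 : 0 < V.valuation D.τ := zero_lt_iff.2 (by simpa using D.τ_ne)
  obtain ⟨h1, -⟩ := (D.below_infRing hV hτ).1 hb
  obtain ⟨h1', -⟩ := (D.below_cycRing _ s hV hτ).1 hb'
  by_contra h
  exact (pow_lt_one₀ zero_le hτ h).not_ge (h1.trans h1')

lemma glues_inf_cyc (hV : Constants V) (hτ : V.valuation D.τ < 1) {i : ℕ} (hi : i < D.n) (s : ℂ) :
    Glues V D.infRing (D.cycRing i s) := by
  intro hb hb'
  obtain rfl := D.cyc_inf_zero hV hτ hb hb'
  obtain ⟨m1, m2, m3, -⟩ := (IsChart.ring_le_iff (D.isChart_cyc hi s) _).1 (le_centre hb')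
  have m4 := mul_mem m1 m2
  rw [D.cyc_mul] at m4
  rw [pow_zero, div_one] at m1
  obtain ⟨-, e1, e2, -⟩ := (IsChart.below_ring D.isChart_inf hV).1 hb
  exact D.isChart_inf.ring_le_centre hV hb hb' m4 (inv_mem_centre hb' m1 e1)
    (inv_mem_centre hb' m3 e2)

lemma glues_cyc_inf (hV : Constants V) (hτ : V.valuation D.τ < 1) {i : ℕ} (hi : i < D.n) (s : ℂ) :
    Glues V (D.cycRing i s) D.infRing := by
  intro hb hb'
  obtain rfl := D.cyc_inf_zero hV hτ hb' hb
  obtain ⟨m1, m2, m3, -⟩ := (IsChart.ring_le_iff D.isChart_inf _).1 (le_centre hb')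
  obtain ⟨e1, -, e3, -⟩ := (IsChart.below_ring (D.isChart_cyc hi s) hV).1 hb
  rw [pow_zero, div_one] at e1
  refine (D.isChart_cyc hi s).ring_le_centre hV hb hb' ?_ ?_ (mem_centre_of_inv hb' m3 e3)
  · rw [pow_zero, div_one]
    exact mem_centre_of_inv hb' m2 e1
  · rw [zero_add, pow_one, div_eq_mul_inv]
    exact mul_mem m1 m2

lemma not_below_inf_swap (hV : Constants V) (hτ : V.valuation D.τ < 1) (h : Below D.infRing V)
    (h' : Below D.swap.infRing V) : False := by
  have h1 := ((D.below_infRing hV hτ).1 h).1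
  have h2 := ((D.swap.below_infRing hV hτ).1 h').1
  simp only [swap] at h2
  have h0 : V.valuation D.U ≠ 0 := by simpa using D.U_ne
  rw [map_div₀, one_le_div₀ (zero_lt_iff.2 h0), map_pow] at h2
  exact (pow_lt_one₀ zero_le hτ D.n_ne).not_ge (h1.trans h2)

lemma glues_isCycChart (hV : Constants V) (hτ : V.valuation D.τ < 1) {w : ℂ} {A B : Subalgebra ℂ K}
    (hA : D.IsCycChart w A) (hB : D.IsCycChart w B) : Glues V A B := by
  have key1 {i : ℕ} (hi : i < D.n) (s : ℂ) : Glues V D.swap.infRing (D.cycRing i s) := by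
    have := D.swap.glues_inf_cyc hV hτ (i := D.n - 1 - i) (by
      have : D.swap.n = D.n := rfl
      omega) s
    rwa [D.swap_cycRing hi] at this
  have key2 {i : ℕ} (hi : i < D.n) (s : ℂ) : Glues V (D.cycRing i s) D.swap.infRing := by
    have := D.swap.glues_cyc_inf hV hτ (i := D.n - 1 - i) (by
      have : D.swap.n = D.n := rfl
      omega) s
    rwa [D.swap_cycRing hi] at this
  rcases hA with rfl | rfl | ⟨i, hi, rfl | rfl⟩ <;> rcases hB with rfl | rfl | ⟨j, hj, rfl | rfl⟩
  · exact glues_self _ _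
  · exact fun h h' => (D.not_below_inf_swap hV hτ h h').elim
  · exact D.glues_inf_cyc hV hτ hj _
  · exact D.glues_inf_cyc hV hτ hj _
  · exact fun h h' => (D.not_below_inf_swap hV hτ h' h).elim
  · exact glues_self _ _
  · exact key1 hj _
  · exact key1 hj _
  · exact D.glues_cyc_inf hV hτ hi _
  · exact key2 hi _
  · exact D.glues_cyc_cyc hV hτ hi hj _ _
  · exact D.glues_cyc_cyc hV hτ hi hj _ _
  · exact D.glues_cyc_inf hV hτ hi _
  · exact key2 hi _
  · exact D.glues_cyc_cyc hV hτ hi hj _ _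
  · exact D.glues_cyc_cyc hV hτ hi hj _ _

lemma below_infRing_of_one_lt (hV : Constants V) (hτ : V.valuation D.τ < 1)
    (hU : 1 < V.valuation D.U) : Below D.infRing V := by
  rw [D.below_infRing hV hτ]
  refine ⟨hU.le, ?_⟩
  have h1 := D.infPoly_rel
  have hU' : V.valuation D.U⁻¹ < 1 := by
    rw [map_inv₀]
    exact inv_lt_one_of_one_lt₀ hU
  have hG : V.valuation (aeval ![D.τ, D.U⁻¹] D.infPoly) = 1 := by
    rw [aeval_infPoly, add_assoc, Valuation.map_add_eq_of_lt_left,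
      hV.valuation_aeval_eq_one hτ D.c₁_zero]
    rw [hV.valuation_aeval_eq_one hτ D.c₁_zero]
    apply Valuation.map_add_lt
    · rw [map_mul]
      exact valuation_mul_lt_one (hV.valuation_aeval_le_one hτ.le _) hU'
    · rw [map_mul, map_mul, map_pow, map_pow]
      exact valuation_mul_lt_one (mul_le_one' (hV.valuation_aeval_le_one hτ.le _)
        (pow_le_one' hτ.le _)) (pow_lt_one₀ zero_le hU' two_ne_zero)
  have h2 := congrArg V.valuation h1
  rw [map_mul, hG, one_mul, map_pow] at h2
  rw [← valuation_inv_le_one_iff D.W_ne]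
  by_contra h
  rw [not_le] at h
  exact (one_lt_pow₀ h two_ne_zero).not_gt (h2 ▸ hU')

lemma valuation_W_le_one (hV : Constants V) (hτ : V.valuation D.τ < 1) (hU : V.valuation D.U ≤ 1)
    (hQ : V.valuation (D.τ ^ D.n / D.U) ≤ 1) : V.valuation D.W ≤ 1 := by
  by_contra h
  rw [not_le] at h
  refine (one_lt_pow₀ h two_ne_zero).not_ge ?_
  rw [← map_pow, D.rel]
  refine Valuation.map_add_le _ (Valuation.map_add_le _ ?_ ?_) (hV.valuation_aeval_le_one hτ.le _)
  · rw [map_mul]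
    exact mul_le_one' (hV.valuation_aeval_le_one hτ.le _) hU
  · rw [map_mul]
    exact mul_le_one' (hV.valuation_aeval_le_one hτ.le _) hQ

lemma exists_isCycChart (hV : Constants V) (hτ : V.valuation D.τ < 1) {w : ℂ} (hw : w ≠ 0) :
    ∃ A, D.IsCycChart w A ∧ Below A V := by
  rcases lt_or_ge 1 (V.valuation D.U) with hU | hU
  · exact ⟨_, Or.inl rfl, D.below_infRing_of_one_lt hV hτ hU⟩
  rcases lt_or_ge 1 (V.valuation (D.τ ^ D.n / D.U)) with hQ | hQ
  · exact ⟨_, Or.inr (Or.inl rfl), D.swap.below_infRing_of_one_lt hV hτ hQ⟩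
  have hW := D.valuation_W_le_one hV hτ hU hQ
  have h0 : V.valuation D.U ≠ 0 := by simpa using D.U_ne
  have hQ' := hQ
  rw [map_div₀, div_le_one₀ (zero_lt_iff.2 h0), map_pow] at hQ'
  have hn := Nat.pos_of_ne_zero D.n_ne
  obtain ⟨i, hi, h1, h2⟩ : ∃ i < D.n, V.valuation D.U ≤ V.valuation D.τ ^ i ∧
      V.valuation D.τ ^ (i + 1) ≤ V.valuation D.U := by
    classical
    have hex : ∃ j, V.valuation D.τ ^ j ≤ V.valuation D.U := ⟨_, hQ'⟩
    have hle := Nat.find_min' hex hQ'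
    have hspec := Nat.find_spec hex
    rcases Nat.eq_zero_or_pos (Nat.find hex) with h | h
    · refine ⟨0, hn, by simpa using hU, ?_⟩
      rw [h] at hspec
      exact (pow_le_pow_right_of_le_one' hτ.le (Nat.zero_le _)).trans hspec
    · refine ⟨Nat.find hex - 1, by omega, ?_, ?_⟩
      · exact (not_le.1 (Nat.find_min hex (m := Nat.find hex - 1) (by omega))).le
      · rwa [Nat.sub_add_cancel h]
  rcases lt_or_ge (V.valuation (D.W + algebraMap ℂ K w)) 1 with h3 | h3
  · refine ⟨_, Or.inr (Or.inr ⟨i, hi, Or.inr rfl⟩), (D.below_cycRing _ _ hV hτ).2 ⟨h1, h2, hW, ?_⟩⟩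
    have := valuation_add_algebraMap_eq hV h3 (c := -w - w) (by
      intro h
      apply hw
      linear_combination (-1 / 2 : ℂ) * h)
    rw [← this, map_sub]
    congr 1
    ring
  · exact ⟨_, Or.inr (Or.inr ⟨i, hi, Or.inl rfl⟩), (D.below_cycRing _ _ hV hτ).2 ⟨h1, h2, hW,
      le_antisymm (valuation_add_algebraMap_le hV hW w) h3⟩⟩

lemma cycPar_mul {i κ κ' : ℕ} (h : κ = i ∧ κ' = i + 1 ∨ κ = i + 1 ∧ κ' = i) :
    D.cycPar i κ * D.cycPar i κ' = D.τ := by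
  rcases h with ⟨rfl, rfl⟩ | ⟨rfl, rfl⟩
  · rw [cycPar, cycPar, if_pos rfl, if_neg (by omega), mul_comm, D.cyc_mul]
  · rw [cycPar, cycPar, if_pos rfl, if_neg (by omega), D.cyc_mul]

/-- The common point of the components on a chart. -/
lemma span_cyc {i : ℕ} (hi : i < D.n) {w : ℂ} (hw : w ≠ 0) (hc : D.c₃.coeff 0 = w ^ 2) {κ κ' : ℕ}
    (h : κ = i ∧ κ' = i + 1 ∨ κ = i + 1 ∧ κ' = i) {g g' : D.cycRing i w}
    (hg : (g : K) = D.cycPar i κ) (hg' : (g' : K) = D.cycPar i κ') :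
    (Ideal.span {g, g'}).IsMaximal ∧
      ∃ f ∈ Ideal.span {g, g'}, (f : K) = D.W - algebraMap ℂ K w := by
  wlog h1 : κ = i + 1 ∧ κ' = i generalizing κ κ' g g'
  · rw [Set.pair_comm]
    exact this (by tauto) hg' hg (by tauto)
  obtain ⟨rfl, rfl⟩ := h1
  have H := D.isChart_cyc hi w
  rw [cycPar, if_neg (by omega)] at hg
  rw [cycPar, if_pos rfl] at hg'
  obtain rfl : g = H.cr := Subtype.ext hg
  obtain rfl : g' = H.cs := Subtype.ext hg'
  have hr : H.cr ∈ Ideal.span {H.cr, H.cs} := Ideal.subset_span (by simp)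
  have hs : H.cs ∈ Ideal.span {H.cr, H.cs} := Ideal.subset_span (by simp)
  have hz : H.cz - algebraMap ℂ H.ring w ∈ Ideal.span {H.cr, H.cs} := by
    have h1 := H.ring_rel
    rw [map_one, one_mul, aeval_cycPoly, aeval_eq_coeff_zero_add _ D.c₃, hc, map_pow] at h1
    have h2 := H.mul_ci
    rw [aeval_cycUnit] at h2
    have : H.cz - algebraMap ℂ H.ring w = (Polynomial.aeval (H.cr * H.cs) D.d * H.ci) *
        ((Polynomial.aeval (H.cr * H.cs) D.c₁ * (H.cr * H.cs) ^ κ' +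
          H.cs * Polynomial.aeval (H.cr * H.cs) D.c₃.divX) * H.cr +
        (Polynomial.aeval (H.cr * H.cs) D.c₂ * (H.cr * H.cs) ^ (D.n - 1 - κ')) * H.cs) := by
      linear_combination (Polynomial.aeval (H.cr * H.cs) D.d * H.ci) * h1 -
        (H.cz - algebraMap ℂ H.ring w) * h2
    rw [this]
    exact Ideal.mul_mem_left _ _ (add_mem (Ideal.mul_mem_left _ _ hr) (Ideal.mul_mem_left _ _ hs))
  refine ⟨?_, _, hz, rfl⟩
  refine H.isMaximal 0 0 w ?_ ?_ ?_ 
    (by rw [map_zero, sub_zero]; exact hr) (by rw [map_zero, sub_zero]; exact hs) hz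
  · rw [map_one, one_mul, aeval_cycPoly, aeval_eq_coeff_zero_add _ D.c₃, hc]
    simp
  · rw [aeval_cycUnit, aeval_eq_coeff_zero_add]
    simpa using ⟨D.d_zero, hw⟩
  · intro χ h1 h2 _ x hx
    have : Ideal.span {H.cr, H.cs} ≤ RingHom.ker χ := by
      rw [Ideal.span_le]
      rintro _ (rfl | rfl)
      exacts [h1, h2]
    exact this hx

lemma inv_mem_cycRing (i : ℕ) (w : ℂ) : (D.W + algebraMap ℂ K w)⁻¹ ∈ D.cycRing i w := by
  obtain ⟨h1, h2, -, h4⟩ := mem_chartRing (D.U / D.τ ^ i) (D.τ ^ (i + 1) / D.U) D.W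
    (aeval ![D.U / D.τ ^ i, D.τ ^ (i + 1) / D.U, D.W] (D.cycUnit w))
  have h5 := mul_mem h1 h2
  rw [D.cyc_mul] at h5
  rw [aeval_cycUnit, D.cyc_mul] at h4
  have h6 : Polynomial.aeval D.τ D.d ∈ D.cycRing i w := by
    have := (Polynomial.aeval (⟨D.τ, h5⟩ : D.cycRing i w) D.d).2
    have e := map_polynomial_aeval (D.cycRing i w).val ⟨D.τ, h5⟩ D.d
    exact e ▸ this
  have h7 := mul_mem h6 (show _ ∈ D.cycRing i w by
    unfold cycRing; rw [aeval_cycUnit, D.cyc_mul]; exact h4)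
  rwa [mul_inv, ← mul_assoc, mul_inv_cancel₀ D.d_ne, one_mul] at h7

end FibreModel

end Inose

end

noncomputable section

namespace Inose

open IsLocalRing MvPolynomial

variable {K : Type*} [Field K] [Algebra ℂ K]

section Cycles

/-- The index of a chart of a fibre of type `I`. -/
def cycIdx (n : ℕ) (e : ZMod (2 * n)) : ℕ := if e.val < n then e.val else 2 * n - 1 - e.val

/-- The distance of a component of a cycle from the component `0`. -/
def cycDist (n : ℕ) (e : ZMod (2 * n)) : ℕ := if e.val ≤ n then e.val else 2 * n - e.val

/-- The value of `W` on a half of the cycle. -/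
def cycSign {n : ℕ} (w : ℂ) (e : ZMod (2 * n)) : ℂ := if e.val < n then w else -w

variable {n : ℕ}

lemma val_add_one (hn : n ≠ 0) (e : ZMod (2 * n)) : e.val < 2 * n ∧
    (e + 1).val = if e.val + 1 = 2 * n then 0 else e.val + 1 := by
  have : NeZero (2 * n) := ⟨by omega⟩
  have : Fact (1 < 2 * n) := ⟨by omega⟩
  have h1 := ZMod.val_lt e
  refine ⟨h1, ?_⟩
  rw [ZMod.val_add, ZMod.val_one]
  split_ifs with h
  · rw [h, Nat.mod_self]
  · exact Nat.mod_eq_of_lt (by omega)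

lemma cycIdx_lt (hn : n ≠ 0) (e : ZMod (2 * n)) : cycIdx n e < n := by
  have := (val_add_one hn e).1
  unfold cycIdx
  split_ifs <;> omega

lemma cycDist_idx (hn : n ≠ 0) (e : ZMod (2 * n)) :
    cycDist n e = cycIdx n e ∧ cycDist n (e + 1) = cycIdx n e + 1 ∨
      cycDist n e = cycIdx n e + 1 ∧ cycDist n (e + 1) = cycIdx n e := by
  obtain ⟨h1, h2⟩ := val_add_one hn e
  unfold cycDist cycIdx
  rw [h2]
  split_ifs <;> omega

lemma cycSign_add_one (hn : n ≠ 0) (w : ℂ) (e : ZMod (2 * n)) (h0 : cycDist n (e + 1) ≠ 0)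
    (h : cycDist n (e + 1) ≠ n) : cycSign w (e + 1) = cycSign w e := by
  obtain ⟨h1, h2⟩ := val_add_one hn e
  unfold cycDist at h0 h
  unfold cycSign
  rw [h2] at h0 h ⊢
  split_ifs at * <;> first | rfl | omega

lemma eq_of_cycDist_eq (hn : n ≠ 0) {w : ℂ} (hw : w ≠ 0) {e e' : ZMod (2 * n)}
    (h : cycDist n e = cycDist n e')
    (h' : cycDist n e ≠ 0 → cycDist n e ≠ n → cycSign w e = cycSign w e') : e = e' := by
  have : NeZero (2 * n) := ⟨by omega⟩
  apply ZMod.val_injective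
  have h1 := (val_add_one hn e).1
  have h2 := (val_add_one hn e').1
  have h3 : w ≠ -w := self_ne_neg.2 hw
  unfold cycDist at h h'
  unfold cycSign at h'
  split_ifs at h h' <;> first | omega | (by_contra h4; exact h3 (h' (by omega) (by omega))) |
    (by_contra h4; exact h3 (h' (by omega) (by omega)).symm)

lemma cycSign_eq_or (w : ℂ) (e : ZMod (2 * n)) : cycSign w e = w ∨ cycSign w e = -w := by
  unfold cycSign
  split_ifs
  exacts [Or.inl rfl, Or.inr rfl]

/-- The components `a` and `b` are the two components on the chart `e`. -/
def CycEdge (e a b : ZMod (2 * n)) : Prop := a = e ∧ b = e + 1 ∨ a = e + 1 ∧ b = e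

lemma self_ne_add_one (hn : n ≠ 0) (e : ZMod (2 * n)) : e ≠ e + 1 := by
  obtain ⟨h1, h2⟩ := val_add_one hn e
  intro h
  rw [← h] at h2
  split_ifs at h2 <;> omega

lemma cycSign_of_cycEdge (hn : n ≠ 0) (w : ℂ) {e e' a b : ZMod (2 * n)} (hne : e ≠ e')
    (h : CycEdge e a b) (h' : CycEdge e' a b) : cycSign w e' = -cycSign w e := by
  have h1 : e' = e + 1 ∧ e = e' + 1 := by
    rcases h with ⟨rfl, rfl⟩ | ⟨rfl, rfl⟩ <;> rcases h' with ⟨h1, h2⟩ | ⟨h1, h2⟩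
    · exact absurd h1 hne
    · exact ⟨h2.symm, h1⟩
    · exact ⟨h1.symm, h2⟩
    · exact absurd h2 hne
  obtain ⟨h2, h3⟩ := val_add_one hn e
  obtain ⟨h4, h5⟩ := val_add_one hn e'
  rw [← h1.1] at h3
  rw [← h1.2] at h5
  have hn1 : n = 1 := by
    split_ifs at h3 h5 <;> omega
  subst hn1
  unfold cycSign
  split_ifs at * <;> first | omega | simp

lemma encard_cycEdge {a b : ZMod (2 * n)} (hab : a ≠ b) :
    {e | CycEdge e a b}.encard = (if b = a + 1 then 1 else 0) + (if a = b + 1 then 1 else 0) := by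
  have h : {e | CycEdge e a b} = {e | e = a ∧ b = a + 1} ∪ {e | e = b ∧ a = b + 1} := by
    ext e
    simp only [CycEdge, Set.mem_ofPred_eq, Set.mem_union]
    constructor
    · rintro (⟨rfl, rfl⟩ | ⟨rfl, rfl⟩) <;> simp
    · rintro (⟨rfl, rfl⟩ | ⟨rfl, rfl⟩) <;> simp
  rw [h, Set.encard_union_eq]
  · congr 1
    · split_ifs with h <;> simp [h]
    · split_ifs with h <;> simp [h]
  · rw [Set.disjoint_left]
    rintro e ⟨rfl, -⟩ ⟨h, -⟩
    exact hab h

end Cycles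

namespace FibreModel

variable (D : FibreModel K) {w : ℂ}

/-- The charts of a fibre of type `I`, indexed by the vertices of the cycle and the charts at
infinity. -/
def cycChart (w : ℂ) : ZMod (2 * D.n) ⊕ Bool → Subalgebra ℂ K
  | .inl e => D.cycRing (cycIdx D.n e) (cycSign w e)
  | .inr false => D.infRing
  | .inr true => D.swap.infRing

lemma isCycChart_cycChart (e) : D.IsCycChart w (D.cycChart w e) := by
  rcases e with e | e | e
  · refine Or.inr (Or.inr ⟨cycIdx D.n e, cycIdx_lt D.n_ne e, ?_⟩)
    rcases cycSign_eq_or w e with h | h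
    · left; simp only [cycChart, h]
    · right; simp only [cycChart, h]
  · exact Or.inl rfl
  · exact Or.inr (Or.inl rfl)

lemma isCycChart_iff {A : Subalgebra ℂ K} : D.IsCycChart w A ↔ ∃ e, A = D.cycChart w e := by
  constructor
  · have hn := D.n_ne
    have : NeZero (2 * D.n) := ⟨by omega⟩
    rintro (rfl | rfl | ⟨i, hi, rfl | rfl⟩)
    · exact ⟨.inr false, rfl⟩
    · exact ⟨.inr true, rfl⟩
    · refine ⟨.inl (i : ℕ), ?_⟩
      have h1 : ((i : ℕ) : ZMod (2 * D.n)).val = i := ZMod.val_cast_of_lt (by omega)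
      simp only [cycChart, cycIdx, cycSign, h1, if_pos hi]
    · refine ⟨.inl ((2 * D.n - 1 - i : ℕ)), ?_⟩
      have h1 : ((2 * D.n - 1 - i : ℕ) : ZMod (2 * D.n)).val = 2 * D.n - 1 - i :=
        ZMod.val_cast_of_lt (by omega)
      have h2 : ¬ (2 * D.n - 1 - i < D.n) := by omega
      have h3 : 2 * D.n - 1 - (2 * D.n - 1 - i) = i := by omega
      simp only [cycChart, cycIdx, cycSign, h1, if_neg h2, h3]
  · rintro ⟨e, rfl⟩
    exact D.isCycChart_cycChart e

/-- The components visible on a chart. -/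
abbrev CycComp (n : ℕ) : ZMod (2 * n) ⊕ Bool → Type
  | .inl _ => Bool
  | .inr _ => Unit

/-- The label of a component visible on a chart. -/
def cycLab (n : ℕ) : (e : ZMod (2 * n) ⊕ Bool) → CycComp n e → ZMod (2 * n)
  | .inl e, false => e
  | .inl e, true => e + 1
  | .inr false, _ => 0
  | .inr true, _ => n

/-- The equation of a component on a chart. -/
def cycEq : (e : ZMod (2 * D.n) ⊕ Bool) → CycComp D.n e → K
  | .inl e, j => D.cycPar (cycIdx D.n e) (cycDist D.n (cycLab D.n (.inl e) j))
  | .inr _, _ => D.τ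

/-- The places of the components of the fibre. -/
def IsCompPlace (w : ℂ) (i : ZMod (2 * D.n)) (V : ValuationSubring K) : Prop :=
  D.IsCycPlace (cycDist D.n i) (cycSign w i) V

lemma cycSign_ne (hw : w ≠ 0) {n : ℕ} (e : ZMod (2 * n)) : cycSign w e ≠ 0 := by
  rcases cycSign_eq_or w e with h | h <;> simpa [h] using hw

lemma cycDist_zero (n : ℕ) : cycDist n 0 = 0 := by simp [cycDist]

lemma cycDist_self {n : ℕ} (hn : n ≠ 0) : cycDist n (n : ZMod (2 * n)) = n := by
  have h1 : (n : ZMod (2 * n)).val = n := ZMod.val_cast_of_lt (by omega)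
  simp [cycDist, h1]

lemma cycDist_lab {n : ℕ} (hn : n ≠ 0) (e : ZMod (2 * n)) (j : Bool) :
    cycDist n (cycLab n (.inl e) j) = cycIdx n e ∨
      cycDist n (cycLab n (.inl e) j) = cycIdx n e + 1 := by
  have := cycDist_idx hn e
  cases j <;> simp only [cycLab] <;> tauto

lemma isCompPlace_lab (e : ZMod (2 * D.n)) (j : Bool) (V : ValuationSubring K) :
    D.IsCompPlace w (cycLab D.n (.inl e) j) V ↔
      D.IsCycPlace (cycDist D.n (cycLab D.n (.inl e) j)) (cycSign w e) V := by
  cases j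
  · exact Iff.rfl
  · simp only [cycLab, IsCompPlace, IsCycPlace]
    refine and_congr_right fun _ => and_congr_right fun _ => and_congr_right fun _ => ?_
    refine forall_congr' fun h1 => forall_congr' fun h2 => ?_
    rw [cycSign_add_one D.n_ne w e h1 h2]

lemma exists_cycCurve (hw : w ≠ 0) (hc : D.c₃.coeff 0 = w ^ 2) (e : ZMod (2 * D.n) ⊕ Bool)
    (j : CycComp D.n e) : ∃ R : RationalCurve (D.cycChart w e), (R.g : K) = D.cycEq e j ∧
      ∀ hf hf', D.IsCompPlace w (cycLab D.n e j) (R.place hf hf') := by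
  rcases e with e | e | e
  · obtain ⟨R, h1, h2⟩ := D.exists_curve_isCycPlace (cycIdx_lt D.n_ne e) (cycSign_ne hw e)
      (by rcases cycSign_eq_or w e with h | h <;> simp [h, hc]) (cycDist_lab D.n_ne e j)
    exact ⟨R, h1, fun hf hf' => (D.isCompPlace_lab e j _).2 (h2 hf hf')⟩
  · obtain ⟨R, h1, h2⟩ := D.exists_curve_inf
    refine ⟨R, h1, fun hf hf' => ?_⟩
    obtain ⟨h3, h4, h5⟩ := h2 hf hf'
    simp only [IsCompPlace, cycLab, cycDist_zero]
    exact ⟨h3, h4.trans (pow_zero _).symm, fun _ => h5, fun h => absurd rfl h⟩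
  · obtain ⟨R, h1, h2⟩ := D.swap.exists_curve_inf
    refine ⟨R, h1, fun hf hf' => ?_⟩
    obtain ⟨h3, h4, h5⟩ := h2 hf hf'
    simp only [IsCompPlace, cycLab, cycDist_self D.n_ne]
    refine ⟨h3, ?_, fun _ => h5, fun _ h => absurd rfl h⟩
    have h6 : (R.place hf hf').valuation (D.τ ^ D.n / D.U) = 1 := h4
    have h7 : (R.place hf hf').valuation D.U ≠ 0 := by simpa using D.U_ne
    rw [map_div₀, map_pow, div_eq_one_iff_eq h7] at h6
    exact h6.symm

lemma below_cycChart (hw : w ≠ 0) {V : ValuationSubring K} (hV : Constants V)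
    (e : ZMod (2 * D.n) ⊕ Bool) (j : CycComp D.n e) (h : D.IsCompPlace w (cycLab D.n e j) V) :
    Below (D.cycChart w e) V ∧ V.valuation (D.cycEq e j) < 1 := by
  rcases e with e | e | e
  · rw [isCompPlace_lab] at h
    exact h.below_cycRing hV (cycSign_ne hw e) (cycIdx_lt D.n_ne e) (cycDist_lab D.n_ne e j)
  · simp only [IsCompPlace, cycLab, cycDist_zero] at h
    exact ⟨h.below_infRing hV, h.1⟩
  · simp only [IsCompPlace, cycLab, cycDist_self D.n_ne] at h
    exact ⟨h.below_infRing_swap hV, h.1⟩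

lemma isCompPlace_inj (hw : w ≠ 0) {V : ValuationSubring K} (hV : Constants V)
    (i j : ZMod (2 * D.n)) (hi : D.IsCompPlace w i V) (hj : D.IsCompPlace w j V) : i = j := by
  obtain ⟨h1, h2⟩ := IsCycPlace.eq hV hi hj
  exact eq_of_cycDist_eq D.n_ne hw h1 h2

lemma cycEq_mul (e : ZMod (2 * D.n)) (i j : Bool) (hij : i ≠ j) :
    D.cycEq (.inl e) i * D.cycEq (.inl e) j = D.τ := by
  have h := cycDist_idx D.n_ne e
  apply D.cycPar_mul
  cases i <;> cases j <;> first | exact absurd rfl hij | (simp only [cycLab]; tauto)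

lemma τ_mem_cycChart (e) : D.τ ∈ D.cycChart w e := by
  rcases e with e | e | e
  · obtain ⟨h1, h2, -⟩ := (IsChart.ring_le_iff
      (D.isChart_cyc (cycIdx_lt D.n_ne e) (cycSign w e)) _).1 le_rfl
    have := mul_mem h1 h2
    rwa [D.cyc_mul] at this
  · exact ((IsChart.ring_le_iff D.isChart_inf _).1 le_rfl).1
  · exact ((IsChart.ring_le_iff D.swap.isChart_inf _).1 le_rfl).1

/-- The components and their intersections, as seen on the charts of a fibre of type `I`. -/
theorem exists_cycAtlas (hw : w ≠ 0) (hc : D.c₃.coeff 0 = w ^ 2) (Y : CompleteVariety K)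
    (hY : ∀ A, D.IsCycChart w A → A ∈ Y.charts)
    (hmor : ∀ P ∈ Y.points, D.τ ∈ P.carrier ∨ D.τ⁻¹ ∈ P.carrier) :
    ∃ F : FibreAtlas Y D.τ (fun _ : ZMod (2 * D.n) => 1), ∃ f : F.E ≃ (ZMod (2 * D.n) ⊕ Bool),
      ∀ e a b, F.edge e a b ↔ ∃ e', f e = Sum.inl e' ∧ CycEdge e' a b := by
  have : NeZero (2 * D.n) := ⟨by have := D.n_ne; omega⟩
  have hCh (e) : D.cycChart w e ∈ Y.charts := hY _ (D.isCycChart_cycChart e)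
  choose curve curve_g curve_place using D.exists_cycCurve hw hc
  have lab_surjective (i : ZMod (2 * D.n)) : ∃ e j, cycLab D.n e j = i := ⟨.inl i, false, rfl⟩
  obtain ⟨C, C_injective, C_eq⟩ := Y.exists_components hCh (cycLab D.n) curve lab_surjective
    (D.IsCompPlace w) (fun e j => curve_place e j _ _)
    (fun e j V hV h => by
      rw [curve_g]
      exact D.below_cycChart hw hV e j h)
    (fun i j V hV => D.isCompPlace_inj hw hV i j)
  refine ⟨{
    E := ZMod (2 * D.n) ⊕ Bool
    finiteE := inferInstance
    Ch := D.cycChart w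
    mem_charts := hCh
    ne_zero := D.τ_ne
    mem_or_inv_mem := hmor
    cover := ?_
    J := CycComp D.n
    lab := cycLab D.n
    curve := curve
    C := C
    C_injective := C_injective
    localRing_eq := C_eq
    lab_injective := ?_
    lab_surjective := lab_surjective
    mult_pos := fun _ => one_ne_zero
    factor := ?_
    mem := D.τ_mem_cycChart
    exists_mem := ?_
    edge := fun e a b => ∃ e', e = Sum.inl e' ∧ CycEdge e' a b
    edge_or := ?_
    exists_of_edge := ?_
    no_triangle := ?_
    edge_disjoint := ?_ }, Equiv.refl _, fun e a b => Iff.rfl⟩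
  · intro V hV h1 h2
    rw [inv_mem_iff_one_le D.τ_ne, not_le] at h2
    obtain ⟨A, hA, hb⟩ := D.exists_isCycChart hV h2 hw
    obtain ⟨e, rfl⟩ := D.isCycChart_iff.1 hA
    exact ⟨e, hb⟩
  · rintro (e | e)
    · rintro (_ | _) (_ | _) h
      · rfl
      · exact absurd h (self_ne_add_one D.n_ne e)
      · exact absurd h.symm (self_ne_add_one D.n_ne e)
      · rfl
    · exact fun _ _ _ => rfl
  · rintro (e | e) j
    · refine ⟨(curve (.inl e) (!j)).g, ?_, ?_⟩
      · rw [pow_one, curve_g, curve_g, D.cycEq_mul e j (!j) (by cases j <;> simp)]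
      · rw [← (curve (.inl e) j).valuation_eq_one_iff (hA := Y.fg _ (hCh _))
          (hf := Y.isFractionRing _ (hCh _)), curve_g]
        have h1 := (D.isCompPlace_lab e j _).1 (curve_place (.inl e) j (Y.fg _ (hCh _))
          (Y.isFractionRing _ (hCh _)))
        generalize (curve (.inl e) j).place _ _ = V at h1 ⊢
        have h2 : V.valuation D.τ ≠ 0 := by simpa using D.τ_ne
        have h3 := cycDist_idx D.n_ne e
        have h4 := h1.2.1
        have key {i κ κ' : ℕ} (h : κ = i ∧ κ' = i + 1 ∨ κ = i + 1 ∧ κ' = i)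
            (hU : V.valuation D.U = V.valuation D.τ ^ κ) : V.valuation (D.cycPar i κ') = 1 := by
          rcases h with ⟨rfl, rfl⟩ | ⟨rfl, rfl⟩
          · rw [cycPar, if_neg (by omega), map_div₀, map_pow, hU, div_self (pow_ne_zero _ h2)]
          · rw [cycPar, if_pos rfl, map_div₀, map_pow, hU, div_self (pow_ne_zero _ h2)]
        refine key ?_ h4
        cases j <;> simp only [cycLab, Bool.not_false, Bool.not_true] <;> tauto
    · refine ⟨1, ?_, by simp⟩
      rw [pow_one, curve_g]
      simp [cycEq]
  · rintro (e | e) p hp h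
    · have h1 : (⟨D.τ, D.τ_mem_cycChart (.inl e)⟩ : D.cycChart w (.inl e)) =
          (curve (.inl e) false).g * (curve (.inl e) true).g := by
        apply Subtype.ext
        rw [MulMemClass.coe_mul, curve_g, curve_g]
        exact (D.cycEq_mul e false true (by simp)).symm
      rw [h1] at h
      rcases hp.mem_or_mem h with h | h
      exacts [⟨false, h⟩, ⟨true, h⟩]
    · refine ⟨(), ?_⟩
      have h1 : (⟨D.τ, D.τ_mem_cycChart (.inr e)⟩ : D.cycChart w (.inr e)) =
          (curve (.inr e) ()).g := Subtype.ext (curve_g (.inr e) ()).symm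
      rw [← h1]
      exact h
  · rintro (e | e) i j hij
    · left
      refine ⟨⟨e, rfl, ?_⟩, ?_⟩
      · cases i <;> cases j <;> simp [CycEdge, cycLab] at hij ⊢
      · refine (D.span_cyc (cycIdx_lt D.n_ne e) (cycSign_ne hw e)
          (by rcases cycSign_eq_or w e with h | h <;> simp [h, hc]) ?_ (curve_g (.inl e) i)
            (curve_g (.inl e) j)).1
        have := cycDist_idx D.n_ne e
        cases i <;> cases j <;> first | exact absurd rfl hij | (simp only [cycLab]; tauto)
    · exact absurd rfl hij
  · rintro e a b ⟨e, rfl, ⟨rfl, rfl⟩ | ⟨rfl, rfl⟩⟩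
    · exact ⟨false, true, by simp, rfl, rfl⟩
    · exact ⟨true, false, by simp, rfl, rfl⟩
  · rintro e a b c hab hbc hac ⟨⟨e1, rfl, h1⟩, ⟨e2, h, h2⟩, ⟨e3, h', h3⟩⟩
    obtain rfl := Sum.inl_injective h
    obtain rfl := Sum.inl_injective h'
    unfold CycEdge at h1 h2 h3
    grind
  · rintro e e' a b hne ⟨e, rfl, h1⟩ ⟨e', rfl, h2⟩ i j hi hj
    have hne' : e ≠ e' := fun h => hne (by rw [h])
    have hij : i ≠ j := by
      rintro rfl
      have h3 := self_ne_add_one D.n_ne e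
      rw [← hi, ← hj] at h1
      rcases h1 with ⟨h4, h5⟩ | ⟨h4, h5⟩
      · exact h3 (h4.symm.trans h5)
      · exact h3 (h5.symm.trans h4)
    obtain ⟨f, hf, hfW⟩ := (D.span_cyc (cycIdx_lt D.n_ne e) (cycSign_ne hw e)
          (by rcases cycSign_eq_or w e with h | h <;> simp [h, hc]) (by
            have := cycDist_idx D.n_ne e
            cases i <;> cases j <;> first | exact absurd rfl hij | (simp only [cycLab]; tauto))
          (curve_g (.inl e) i) (curve_g (.inl e) j)).2
    have hfW' : (f : K) = D.W + algebraMap ℂ K (cycSign w e') := by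
      rw [hfW, cycSign_of_cycEdge D.n_ne w hne' h1 h2, map_neg, sub_eq_add_neg]
    refine ⟨f, hf, ?_, ?_⟩
    · rw [hfW']; exact D.W_add_ne _
    · rw [hfW']; exact D.inv_mem_cycRing _ _

theorem isFibreI (hw : w ≠ 0) (hc : D.c₃.coeff 0 = w ^ 2) (Y : CompleteVariety K)
    (hY : ∀ A, D.IsCycChart w A → A ∈ Y.charts)
    (hmor : ∀ P ∈ Y.points, D.τ ∈ P.carrier ∨ D.τ⁻¹ ∈ P.carrier) :
    (∀ P ∈ Y.closedPoints, P.Vanishes D.τ → IsRegularLocalRing P.carrier) ∧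
      Y.IsFibreI D.τ (2 * D.n) ∧ ¬ Y.IsSmoothFibre D.τ := by
  obtain ⟨F, f, hf⟩ := D.exists_cycAtlas hw hc Y hY hmor
  refine ⟨fun P hP hPτ => F.isRegularLocalRing hP hPτ, ⟨by have := D.n_ne; omega, ?_⟩, ?_⟩
  · have h1 := F.hasFibreConfiguration
      (fun i j => (if j = i + 1 then 1 else 0) + (if i = j + 1 then 1 else 0)) (by
        intro a b hab
        rw [← encard_cycEdge hab]
        have : {e | F.edge e a b} = (f.symm ∘ Sum.inl) '' {e | CycEdge e a b} := by
          ext e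
          simp only [Set.mem_ofPred_eq, hf, Set.mem_image, Function.comp_apply]
          exact ⟨fun ⟨e', h1, h2⟩ => ⟨e', h2, by rw [← h1, Equiv.symm_apply_apply]⟩,
            fun ⟨e', h1, h2⟩ => ⟨e', by rw [← h2, Equiv.apply_symm_apply], h1⟩⟩
        rw [this, (f.symm.injective.comp Sum.inl_injective).encard_image])
    simpa using h1
  · have hab : (0 : ZMod (2 * D.n)) ≠ 1 := by simpa using self_ne_add_one D.n_ne 0
    refine F.not_isSmoothFibre hab (e := f.symm (Sum.inl 0)) ?_
    rw [hf]
    exact ⟨0, by simp, Or.inl ⟨rfl, by simp⟩⟩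

end FibreModel

end Inose

end

noncomputable section

namespace Inose

open IsLocalRing MvPolynomial

variable {K : Type*} [Field K] [Algebra ℂ K]

/-- A local equation of a family of elliptic curves with a fibre of type `I*₆`. -/
structure StarModel (K : Type*) [Field K] [Algebra ℂ K] extends FibreModel K where
  c₄ : Polynomial ℂ
  n_eq : n = 5
  c₃_eq : c₃ = Polynomial.X * c₄
  c₄_zero : c₄.coeff 0 ≠ 0

namespace StarModel

variable (D : StarModel K)

lemma τ_ne : D.τ ≠ 0 := D.toFibreModel.τ_ne
lemma U_ne : D.U ≠ 0 := D.toFibreModel.U_ne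
lemma W_ne : D.W ≠ 0 := D.toFibreModel.W_ne
lemma c₁_zero : D.c₁.coeff 0 ≠ 0 := D.toFibreModel.c₁_zero
lemma c₂_zero : D.c₂.coeff 0 ≠ 0 := D.toFibreModel.c₂_zero

lemma rel' : D.W ^ 2 = Polynomial.aeval D.τ D.c₁ * D.U +
    Polynomial.aeval D.τ D.c₂ * (D.τ ^ 5 / D.U) + D.τ * Polynomial.aeval D.τ D.c₄ := by
  have := D.rel
  rw [D.n_eq, D.c₃_eq] at this
  rw [this]
  simp

/-- The symmetry exchanging `U` and `τ⁵ / U`. -/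
def swap : StarModel K where
  toFibreModel := D.toFibreModel.swap
  c₄ := D.c₄
  n_eq := D.n_eq
  c₃_eq := D.c₃_eq
  c₄_zero := D.c₄_zero

/-- The equation of the simple component meeting the chain. -/
def tipPoly : MvPolynomial (Fin 2) ℂ :=
  Polynomial.aeval (X 0 * X 1) D.c₁ + Polynomial.aeval (X 0 * X 1) D.c₄ * X 1 +
    Polynomial.aeval (X 0 * X 1) D.c₂ * X 0 ^ 3 * X 1 ^ 5

/-- The function `W² / τ` on a chart. -/
def unitPoly (k : ℕ) : MvPolynomial (Fin 2) ℂ :=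
  Polynomial.aeval (X 0 * X 1) D.c₄ +
    Polynomial.aeval (X 0 * X 1) D.c₁ * X 0 ^ (k + 1) * X 1 ^ k +
    Polynomial.aeval (X 0 * X 1) D.c₂ * X 0 ^ (2 - k) * X 1 ^ (3 - k)

lemma aeval_tipPoly {R : Type*} [CommRing R] [Algebra ℂ R] (r s : R) :
    aeval ![r, s] D.tipPoly = Polynomial.aeval (r * s) D.c₁ + Polynomial.aeval (r * s) D.c₄ * s +
      Polynomial.aeval (r * s) D.c₂ * r ^ 3 * s ^ 5 := by
  simp [tipPoly, aeval_polynomial_aeval]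

lemma aeval_unitPoly {R : Type*} [CommRing R] [Algebra ℂ R] (k : ℕ) (r s : R) :
    aeval ![r, s] (D.unitPoly k) = Polynomial.aeval (r * s) D.c₄ +
      Polynomial.aeval (r * s) D.c₁ * r ^ (k + 1) * s ^ k +
      Polynomial.aeval (r * s) D.c₂ * r ^ (2 - k) * s ^ (3 - k) := by
  simp [unitPoly, aeval_polynomial_aeval]

lemma mul_tip : D.U * (D.τ / D.U) = D.τ := mul_div_cancel₀ _ D.U_ne

lemma tip_eq : aeval ![D.U, D.τ / D.U] D.tipPoly = D.W ^ 2 / D.U := by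
  have hτ := D.τ_ne
  have hU := D.U_ne
  rw [aeval_tipPoly, D.mul_tip, D.rel']
  field_simp
  ring

lemma unit_eq {k : ℕ} (hk : k < 3) :
    aeval ![D.U / D.τ ^ (k + 1), D.τ ^ (k + 1 + 1) / D.U] (D.unitPoly k) = D.W ^ 2 / D.τ := by
  have hτ := D.τ_ne
  have hU := D.U_ne
  rw [aeval_unitPoly, D.cyc_mul, D.rel']
  obtain rfl | rfl | rfl : k = 0 ∨ k = 1 ∨ k = 2 := by omega
  all_goals
    simp only [Nat.reduceAdd, Nat.reduceSub, div_pow, ← pow_mul, Nat.reduceMul]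
    field_simp
    try ring

lemma frame_a {k : ℕ} (hk : k < 3) : IsFrame (D.U / D.τ ^ (k + 1)) (D.τ ^ (k + 1 + 1) / D.U)
    (D.W * D.τ ^ (k + 1) / D.U) := by
  have hτ := D.τ_ne
  have hU := D.U_ne
  have h := (D.isChart_cyc (i := k + 1) (by rw [D.n_eq]; omega) 0).frame
  refine h.change' (l := (D.U / D.τ ^ (k + 1))⁻¹) (left_mem_adjoin _ _) (right_mem_adjoin _ _)
    (left_mem_adjoin _ _) (right_mem_adjoin _ _) (inv_mem (left_mem_adjoin _ _)) ?_ ?_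
  · exact inv_ne_zero (div_ne_zero hU (pow_ne_zero _ hτ))
  · field_simp

lemma frame_zero : IsFrame D.U (D.τ / D.U) D.W := by
  have h := (D.isChart_cyc (i := 0) (by rw [D.n_eq]; omega) 0).frame
  simpa using h

/-- The charts along the chain. -/
lemma isChart_a {k : ℕ} (hk : k < 3) : IsChart (D.U / D.τ ^ (k + 1)) (D.τ ^ (k + 1 + 1) / D.U)
    (D.W * D.τ ^ (k + 1) / D.U) (X 0) (X 1 * D.unitPoly k)
    (Polynomial.aeval (X 0 * X 1) D.d * rename ![0, 1] (D.unitPoly k)) where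
  frame := D.frame_a hk
  relPrime := by
    have h1 := D.c₂_zero
    have h2 := D.c₄_zero
    refine isRelPrime_X ![0, D.c₄.coeff 0 / D.c₂.coeff 0] rfl ?_
    rw [map_mul, aeval_unitPoly, zero_mul, aeval_eq_coeff_zero_add, aeval_eq_coeff_zero_add (0 : ℂ) D.c₂]
    have h3 : D.c₄.coeff 0 / D.c₂.coeff 0 ≠ 0 := div_ne_zero h2 h1
    refine mul_ne_zero (by simpa using h3) ?_
    obtain rfl | rfl | rfl : k = 0 ∨ k = 1 ∨ k = 2 := by omega
    · simpa using h2
    · simpa using h2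
    · have : D.c₄.coeff 0 + D.c₂.coeff 0 * (D.c₄.coeff 0 / D.c₂.coeff 0) ≠ 0 := by
        field_simp
        simpa [← two_mul] using h2
      simpa using this
  ne_zero := X_ne_zero _
  rel := by
    have hτ := D.τ_ne
    have hU := D.U_ne
    rw [map_mul, D.unit_eq hk, aeval_X, aeval_X]
    simp only [Matrix.cons_val]
    field_simp
    ring
  Δ_ne_zero := by
    have hτ := D.τ_ne
    have hW := D.W_ne
    have h1 : aeval ![D.U / D.τ ^ (k + 1), D.τ ^ (k + 1 + 1) / D.U, D.W * D.τ ^ (k + 1) / D.U]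
      (rename ![0, 1] (D.unitPoly k)) = D.W ^ 2 / D.τ := by
      rw [aeval_rename, ← D.unit_eq hk]
      congr 2
      ext i; fin_cases i <;> rfl
    rw [map_mul, h1, aeval_polynomial_aeval]
    simp only [map_mul, aeval_X, Matrix.cons_val]
    rw [D.cyc_mul]
    exact mul_ne_zero D.d_ne (div_ne_zero (pow_ne_zero _ hW) hτ)

/-- The chart at the branch point of the dual graph. -/
lemma isChart_b : IsChart D.U (D.τ / D.U) (D.U / D.W) D.tipPoly (X 0)
    (Polynomial.aeval (X 0 * X 1) D.d) where
  frame := by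
    have hW := D.W_ne
    have hU := D.U_ne
    refine D.frame_zero.change' (l := D.U * (D.W ^ 2)⁻¹) (left_mem_adjoin _ _) (right_mem_adjoin _ _)
      (left_mem_adjoin _ _) (right_mem_adjoin _ _)
      (mul_mem (left_mem_adjoin _ _) (inv_mem D.frame_zero.sq_mem)) ?_ ?_
    · exact mul_ne_zero hU (inv_ne_zero (pow_ne_zero _ hW))
    · field_simp
  relPrime := by
    refine (isRelPrime_X ![0, 0] rfl ?_).symm
    rw [aeval_tipPoly, zero_mul, aeval_eq_coeff_zero_add]
    simpa using D.c₁_zero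
  ne_zero := by
    intro h
    have h1 := congrArg (aeval ![(0 : ℂ), 0]) h
    rw [aeval_tipPoly, zero_mul, aeval_eq_coeff_zero_add] at h1
    exact D.c₁_zero (by simpa using h1)
  rel := by
    have hW := D.W_ne
    have hU := D.U_ne
    rw [D.tip_eq, aeval_X]
    simp only [Matrix.cons_val]
    field_simp
  Δ_ne_zero := by
    rw [aeval_polynomial_aeval]
    simp only [map_mul, aeval_X, Matrix.cons_val]
    rw [D.mul_tip]
    exact D.d_ne

/-- The chart at the tip of the dual graph. -/
lemma isChart_tip : IsChart D.U (D.τ / D.U) (D.W / D.U) (X 0) D.tipPoly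
    (Polynomial.aeval (X 0 * X 1) D.d * X 1) where
  frame := by
    have hW := D.W_ne
    have hU := D.U_ne
    refine D.frame_zero.change' (l := D.U⁻¹) (left_mem_adjoin _ _) (right_mem_adjoin _ _)
      (left_mem_adjoin _ _) (right_mem_adjoin _ _) (inv_mem (left_mem_adjoin _ _))
      (inv_ne_zero hU) (by field_simp)
  relPrime := by
    refine isRelPrime_X ![0, 0] rfl ?_
    rw [aeval_tipPoly, zero_mul, aeval_eq_coeff_zero_add]
    simpa using D.c₁_zero
  ne_zero := X_ne_zero _
  rel := by
    have hW := D.W_ne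
    have hU := D.U_ne
    rw [D.tip_eq, aeval_X]
    simp only [Matrix.cons_val]
    field_simp
  Δ_ne_zero := by
    rw [map_mul, aeval_polynomial_aeval]
    simp only [map_mul, aeval_X, Matrix.cons_val]
    rw [D.mul_tip]
    exact mul_ne_zero D.d_ne (div_ne_zero D.τ_ne D.U_ne)

end StarModel

end Inose

end

noncomputable section

namespace Inose

open IsLocalRing MvPolynomial

variable {K : Type*} [Field K] [Algebra ℂ K]

lemma dvd_aeval_sub {σ R : Type*} [CommRing R] [Algebra ℂ R] {g : R} {f f' : σ → R}
    (h : ∀ i, g ∣ f i - f' i) (p : MvPolynomial σ ℂ) : g ∣ aeval f p - aeval f' p := by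
  induction p using MvPolynomial.induction_on with
  | C c => simp
  | add p q hp hq =>
    rw [map_add, map_add, add_sub_add_comm]
    exact dvd_add hp hq
  | mul_X p k hp =>
    rw [map_mul, map_mul, aeval_X, aeval_X]
    have : aeval f p * f k - aeval f' p * f' k =
        (aeval f p - aeval f' p) * f k + aeval f' p * (f k - f' k) := by ring
    rw [this]
    exact dvd_add (hp.mul_right _) ((h k).mul_left _)

lemma aeval_pair {T : Type*} [CommRing T] [Algebra ℂ T] (x : T) (N₁ N₂ : Polynomial ℂ)
    (p : MvPolynomial (Fin 2) ℂ) : aeval ![Polynomial.aeval x N₁, Polynomial.aeval x N₂] p =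
      Polynomial.aeval x (aeval ![N₁, N₂] p) := by
  rw [map_mvPolynomial_aeval]
  congr 2
  ext i; fin_cases i <;> rfl

lemma aeval_triple {T : Type*} [CommRing T] [Algebra ℂ T] (x : T) (N₁ N₂ N₃ : Polynomial ℂ)
    (p : MvPolynomial (Fin 3) ℂ) :
    aeval ![Polynomial.aeval x N₁, Polynomial.aeval x N₂, Polynomial.aeval x N₃] p =
      Polynomial.aeval x (aeval ![N₁, N₂, N₃] p) := by
  rw [map_mvPolynomial_aeval]
  congr 2
  ext i; fin_cases i <;> rfl

lemma IsChart.exists_curve_poly {r s z : K} {a b : MvPolynomial (Fin 2) ℂ}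
    {Δ : MvPolynomial (Fin 3) ℂ} (h : IsChart r s z a b Δ) (N₁ N₂ N₃ : Polynomial ℂ)
    (hrel : aeval ![N₁, N₂] a * N₃ ^ 2 = aeval ![N₁, N₂] b) (hΔ : aeval ![N₁, N₂, N₃] Δ ≠ 0)
    (g par : h.ring) (hg0 : (g : K) ≠ 0)
    (hφ : ∀ φ : h.ring →ₐ[ℂ] RatFunc ℂ, φ h.cr = Polynomial.aeval RatFunc.X N₁ →
      φ h.cs = Polynomial.aeval RatFunc.X N₂ → φ h.cz = Polynomial.aeval RatFunc.X N₃ →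
      φ g = 0 ∧ φ par = RatFunc.X)
    (hr : g ∣ h.cr - Polynomial.aeval par N₁) (hs : g ∣ h.cs - Polynomial.aeval par N₂)
    (hz : g ∣ h.cz - Polynomial.aeval par N₃) :
    ∃ R : RationalCurve h.ring, R.g = g ∧ R.φ h.cr = Polynomial.aeval RatFunc.X N₁ ∧
      R.φ h.cs = Polynomial.aeval RatFunc.X N₂ ∧ R.φ h.cz = Polynomial.aeval RatFunc.X N₃ := by
  refine h.exists_curve' _ _ _ ?_ ?_ g par hg0 hφ (aeval ![N₁, N₂, N₃] Δ) N₁ N₂ N₃ ?_ hr hs hz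
  · rw [aeval_pair, aeval_pair, ← hrel, map_mul, map_pow]
  · rw [aeval_triple]
    exact aeval_ratFuncX_ne_zero hΔ
  · rw [← aeval_triple]
    refine dvd_aeval_sub ?_ Δ
    intro i
    fin_cases i
    exacts [hr, hs, hz]

namespace StarModel

variable (D : StarModel K)

/-- The places of the components of the fibre. -/
def IsStarPlace (κ ν : ℕ) (V : ValuationSubring K) : Prop :=
  V.valuation D.τ < 1 ∧ V.valuation D.U ^ 2 = V.valuation D.τ ^ κ ∧
    V.valuation D.W ^ 2 = V.valuation D.τ ^ ν

lemma aeval_unitPoly_zero {R : Type*} [CommRing R] [Algebra ℂ R] {k : ℕ} (hk : k < 3) (r : R) :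
    aeval ![r, 0] (D.unitPoly k) = algebraMap ℂ R (D.c₄.coeff 0) +
      algebraMap ℂ R (D.c₁.coeff 0) * r ^ (k + 1) * 0 ^ k := by
  rw [aeval_unitPoly, mul_zero, aeval_eq_coeff_zero_add, aeval_eq_coeff_zero_add (0 : R) D.c₁]
  rw [zero_pow (n := 3 - k) (by omega)]
  simp

lemma aeval_tipPoly_zero {R : Type*} [CommRing R] [Algebra ℂ R] (s : R) :
    aeval ![0, s] D.tipPoly = algebraMap ℂ R (D.c₁.coeff 0) + algebraMap ℂ R (D.c₄.coeff 0) * s := by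
  rw [aeval_tipPoly, zero_mul, aeval_eq_coeff_zero_add, aeval_eq_coeff_zero_add (0 : R) D.c₄]
  simp

lemma aeval_rename_unitPoly {R : Type*} [CommRing R] [Algebra ℂ R] (k : ℕ) (r s z : R) :
    aeval ![r, s, z] (rename ![0, 1] (D.unitPoly k)) = aeval ![r, s] (D.unitPoly k) := by
  rw [aeval_rename]
  congr 2
  ext i; fin_cases i <;> rfl

lemma aeval_unit {R : Type*} [CommRing R] [Algebra ℂ R] (k : ℕ) (r s z : R) :
    aeval ![r, s, z] (Polynomial.aeval (X 0 * X 1) D.d * rename ![0, 1] (D.unitPoly k)) =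
      Polynomial.aeval (r * s) D.d * aeval ![r, s] (D.unitPoly k) := by
  rw [map_mul, aeval_rename_unitPoly, aeval_polynomial_aeval]
  simp

section Chain

variable {k : ℕ} (hk : k < 3)

lemma chain_mul : (D.isChart_a hk).cr * (D.isChart_a hk).cz ^ 2 =
    (D.isChart_a hk).cs * aeval ![(D.isChart_a hk).cr, (D.isChart_a hk).cs] (D.unitPoly k) := by
  have := (D.isChart_a hk).ring_rel
  rwa [map_mul, aeval_X, aeval_X] at this

lemma chain_unit : Polynomial.aeval ((D.isChart_a hk).cr * (D.isChart_a hk).cs) D.d *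
    aeval ![(D.isChart_a hk).cr, (D.isChart_a hk).cs] (D.unitPoly k) * (D.isChart_a hk).ci = 1 := by
  have := (D.isChart_a hk).mul_ci
  rwa [aeval_unit] at this

/-- The inverse of `W² / τ` on a chart of the chain. -/
def chainUnit : (D.isChart_a hk).ring :=
  Polynomial.aeval ((D.isChart_a hk).cr * (D.isChart_a hk).cs) D.d * (D.isChart_a hk).ci

lemma chainUnit_mul : aeval ![(D.isChart_a hk).cr, (D.isChart_a hk).cs] (D.unitPoly k) *
    D.chainUnit hk = 1 := by
  rw [← D.chain_unit hk, chainUnit]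
  ring

lemma isUnit_chainUnit : IsUnit (D.chainUnit hk) := IsUnit.of_mul_eq_one_right _ (D.chainUnit_mul hk)

lemma chain_s : (D.isChart_a hk).cs = (D.isChart_a hk).cr * (D.isChart_a hk).cz ^ 2 *
    D.chainUnit hk := by
  linear_combination (-(D.chainUnit hk)) * D.chain_mul hk - (D.isChart_a hk).cs * D.chainUnit_mul hk

lemma chain_τ : D.τ = (((D.isChart_a hk).cr ^ 2 * (D.isChart_a hk).cz ^ 2 * D.chainUnit hk :
    (D.isChart_a hk).ring) : K) := by
  have h : (((D.isChart_a hk).cr * (D.isChart_a hk).cs : (D.isChart_a hk).ring) : K) = D.τ :=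
    D.cyc_mul (k + 1)
  have h1 := D.chain_s hk
  nth_rewrite 1 [← h]
  congr 1
  linear_combination (D.isChart_a hk).cr * h1

lemma valuation_chain (R : RationalCurve (D.isChart_a hk).ring) (hf hf') :
    (R.place hf hf').valuation D.W ^ 2 = (R.place hf hf').valuation D.τ := by
  have h1 : R.φ (aeval ![(D.isChart_a hk).cr, (D.isChart_a hk).cs] (D.unitPoly k)) ≠ 0 := by
    intro h
    have := congrArg R.φ (D.chainUnit_mul hk)
    rw [map_mul, h, zero_mul, map_one] at this
    exact zero_ne_one this
  rw [← R.valuation_eq_one_iff (hA := hf) (hf := hf'), IsChart.coe_aeval₂, D.unit_eq hk, map_div₀,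
    div_eq_one_iff_eq (by simpa using D.τ_ne), map_pow] at h1
  exact h1

/-- The components with odd labels. -/
lemma exists_curve_chain_r : ∃ R : RationalCurve (D.isChart_a hk).ring, R.g = (D.isChart_a hk).cr ∧
    (∃ b : (D.isChart_a hk).ring, D.τ = (R.g : K) ^ 2 * b ∧ R.φ b ≠ 0) ∧
    ∀ hf hf', D.IsStarPlace (2 * k + 3) 1 (R.place hf hf') := by
  have h := D.isChart_a hk
  have hτ := D.τ_ne
  have hU := D.U_ne
  obtain ⟨R, h1, h2, h3, h4⟩ := h.exists_curve_poly 0 0 Polynomial.X (by simp)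
    (by
      rw [aeval_unit, aeval_unitPoly_zero D hk, mul_zero, aeval_eq_coeff_zero_add]
      simpa using ⟨D.d_zero, D.c₄_zero⟩) h.cr h.cz (div_ne_zero hU (pow_ne_zero _ hτ))
    (fun φ h1 _ h3 => ⟨by simpa using h1, by simpa using h3⟩) (by simp) (by
      rw [map_zero, sub_zero, D.chain_s hk, mul_assoc]
      exact dvd_mul_right _ _) (by simp)
  rw [map_zero] at h2 h3
  rw [Polynomial.aeval_X] at h4
  have hb : R.φ (h.cz ^ 2 * D.chainUnit hk) ≠ 0 := by
    rw [map_mul, map_pow, h4]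
    exact mul_ne_zero (pow_ne_zero _ RatFunc.X_ne_zero) ((D.isUnit_chainUnit hk).map R.φ).ne_zero
  have hτ' : D.τ = (R.g : K) ^ 2 * ((h.cz ^ 2 * D.chainUnit hk : h.ring) : K) := by
    rw [h1]
    refine (D.chain_τ hk).trans ?_
    push_cast
    ring
  refine ⟨R, h1, ⟨_, hτ', hb⟩, fun hf hf' => ?_⟩
  have e1 := (R.valuation_eq_one_iff (hA := hf) (hf := hf') _).2 hb
  have e2 := congrArg (R.place hf hf').valuation hτ'
  rw [map_mul, e1, mul_one, map_pow, h1, h.coe_cr] at e2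
  have e3 := (R.valuation_lt_one_iff (hA := hf) (hf := hf') h.cr).2 h2
  refine ⟨?_, ?_, ?_⟩
  · rw [e2]
    exact pow_lt_one₀ zero_le e3 two_ne_zero
  · have h0 : (R.place hf hf').valuation D.τ ≠ 0 := by simpa using hτ
    rw [map_div₀, div_pow, map_pow, eq_div_iff (pow_ne_zero _ (pow_ne_zero _ h0))] at e2
    rw [← e2, ← pow_mul, ← pow_succ']
    congr 1
    omega
  · rw [pow_one]
    exact D.valuation_chain hk R hf hf'

/-- The components with even labels. -/
lemma exists_curve_chain_z : ∃ R : RationalCurve (D.isChart_a hk).ring, R.g = (D.isChart_a hk).cz ∧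
    (∃ b : (D.isChart_a hk).ring, D.τ = (R.g : K) ^ 2 * b ∧ R.φ b ≠ 0) ∧
    ∀ hf hf', D.IsStarPlace (2 * k + 2) 1 (R.place hf hf') := by
  have h := D.isChart_a hk
  have hτ := D.τ_ne
  have hU := D.U_ne
  have hW := D.W_ne
  obtain ⟨R, h1, h2, h3, h4⟩ := h.exists_curve_poly Polynomial.X 0 0 (by simp)
    (by
      rw [aeval_unit, aeval_unitPoly_zero D hk, mul_zero, aeval_eq_coeff_zero_add]
      refine mul_ne_zero (by simpa using D.d_zero) fun h => ?_
      have := congrArg (fun p => Polynomial.coeff p 0) h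
      simp [Polynomial.coeff_X_pow, Polynomial.algebraMap_eq] at this
      exact D.c₄_zero this) h.cz h.cr (div_ne_zero (mul_ne_zero hW (pow_ne_zero _ hτ)) hU)
    (fun φ h1 _ h3 => ⟨by simpa using h3, by simpa using h1⟩) (by simp) (by
      rw [map_zero, sub_zero, D.chain_s hk]
      exact ⟨h.cr * h.cz * D.chainUnit hk, by ring⟩) (by simp)
  rw [map_zero] at h4 h3
  rw [Polynomial.aeval_X] at h2
  have hb : R.φ (h.cr ^ 2 * D.chainUnit hk) ≠ 0 := by
    rw [map_mul, map_pow, h2]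
    exact mul_ne_zero (pow_ne_zero _ RatFunc.X_ne_zero) ((D.isUnit_chainUnit hk).map R.φ).ne_zero
  have hτ' : D.τ = (R.g : K) ^ 2 * ((h.cr ^ 2 * D.chainUnit hk : h.ring) : K) := by
    rw [h1]
    refine (D.chain_τ hk).trans ?_
    push_cast
    ring
  refine ⟨R, h1, ⟨_, hτ', hb⟩, fun hf hf' => ?_⟩
  have e1 := (R.valuation_eq_one_iff (hA := hf) (hf := hf') _).2 hb
  have e2 := congrArg (R.place hf hf').valuation hτ'
  rw [map_mul, e1, mul_one, map_pow, h1] at e2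
  have e3 := (R.valuation_lt_one_iff (hA := hf) (hf := hf') h.cz).2 h4
  have e4 := (R.valuation_eq_one_iff (hA := hf) (hf := hf') h.cr).2
    (by rw [h2]; exact RatFunc.X_ne_zero)
  have h0 : (R.place hf hf').valuation D.τ ≠ 0 := by simpa using hτ
  refine ⟨?_, ?_, ?_⟩
  · rw [e2]
    exact pow_lt_one₀ zero_le e3 two_ne_zero
  · rw [h.coe_cr, map_div₀, map_pow, div_eq_one_iff_eq (pow_ne_zero _ h0)] at e4
    rw [e4, ← pow_mul]
    congr 1
    omega
  · rw [pow_one]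
    exact D.valuation_chain hk R hf hf'

lemma isMaximal_chain : (Ideal.span {(D.isChart_a hk).cz, (D.isChart_a hk).cr}).IsMaximal := by
  have h := D.isChart_a hk
  have hz : h.cz ∈ Ideal.span {h.cz, h.cr} := Ideal.subset_span (by simp)
  have hr : h.cr ∈ Ideal.span {h.cz, h.cr} := Ideal.subset_span (by simp)
  refine h.isMaximal 0 0 0 (by simp) ?_ ?_ (by simpa using hr) ?_ (by simpa using hz)
  · rw [aeval_unit, aeval_unitPoly_zero D hk, mul_zero, aeval_eq_coeff_zero_add]
    simpa using ⟨D.d_zero, D.c₄_zero⟩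
  · intro χ h1 h2 h3 x hx
    have : Ideal.span {h.cz, h.cr} ≤ RingHom.ker χ := by
      rw [Ideal.span_le]
      rintro _ (rfl | rfl)
      exacts [h3, h1]
    exact this hx
  · rw [map_zero, sub_zero, D.chain_s hk, mul_assoc]
    exact Ideal.mul_mem_right _ _ hr

end Chain

end StarModel

end Inose

end

noncomputable section

namespace Inose

open IsLocalRing MvPolynomial

variable {K : Type*} [Field K] [Algebra ℂ K]

namespace StarModel

variable (D : StarModel K)

/-- The equation of the simple component meeting the chain. -/
def branchTip : D.isChart_b.ring := aeval ![D.isChart_b.cr, D.isChart_b.cs] D.tipPoly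

lemma coe_branchTip : (D.branchTip : K) = D.W ^ 2 / D.U := by
  rw [branchTip, IsChart.coe_aeval₂, D.tip_eq]

lemma branch_r : D.isChart_b.cr = D.branchTip * D.isChart_b.cz ^ 2 := by
  have := D.isChart_b.ring_rel
  rw [aeval_X] at this
  exact this.symm

lemma branch_τ : D.τ = ((D.branchTip * D.isChart_b.cz ^ 2 * D.isChart_b.cs : D.isChart_b.ring) : K) := by
  rw [← branch_r]
  exact D.mul_tip.symm

lemma branchTip_dvd : ∃ q, D.branchTip = algebraMap ℂ _ (D.c₁.coeff 0) +
    algebraMap ℂ _ (D.c₄.coeff 0) * D.isChart_b.cs + D.isChart_b.cr * q := by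
  have h : D.isChart_b.cr ∣ aeval ![D.isChart_b.cr, D.isChart_b.cs] D.tipPoly -
      aeval ![0, D.isChart_b.cs] D.tipPoly := dvd_aeval_sub (by
    intro i
    fin_cases i <;> simp) _
  rw [aeval_tipPoly_zero] at h
  obtain ⟨q, hq⟩ := h
  exact ⟨q, by rw [← hq, branchTip]; ring⟩

lemma linear_ne_zero : algebraMap ℂ (Polynomial ℂ) (D.c₁.coeff 0) +
    algebraMap ℂ (Polynomial ℂ) (D.c₄.coeff 0) * Polynomial.X ≠ 0 := by
  intro h
  have := congrArg (fun p => Polynomial.coeff p 1) h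
  simp [Polynomial.algebraMap_eq] at this
  exact D.c₄_zero this

lemma aeval_tipPoly_zero' {R : Type*} [CommRing R] [Algebra ℂ R] (r : R) :
    aeval ![r, 0] D.tipPoly = algebraMap ℂ R (D.c₁.coeff 0) := by
  rw [aeval_tipPoly, mul_zero, aeval_eq_coeff_zero_add (0 : R) D.c₁]
  simp

lemma aeval_d_ne {R : Type*} [CommRing R] [IsDomain R] [Algebra ℂ R] (s z : R) :
    aeval ![(0 : R), s, z] (Polynomial.aeval (X 0 * X 1 : MvPolynomial (Fin 3) ℂ) D.d) ≠ 0 := by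
  rw [aeval_polynomial_aeval]
  simp only [map_mul, aeval_X, Matrix.cons_val, zero_mul]
  rw [aeval_eq_coeff_zero_add]
  have : algebraMap ℂ R (D.d.coeff 0) ≠ 0 := by
    rw [Ne, FaithfulSMul.algebraMap_eq_zero_iff]
    exact D.d_zero
  simpa using this

/-- The end of the chain. -/
lemma exists_curve_branch_z : ∃ R : RationalCurve D.isChart_b.ring, R.g = D.isChart_b.cz ∧
    (∃ b : D.isChart_b.ring, D.τ = (R.g : K) ^ 2 * b ∧ R.φ b ≠ 0) ∧
    ∀ hf hf', D.IsStarPlace 2 1 (R.place hf hf') := by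
  have h := D.isChart_b
  have hτ := D.τ_ne
  have hU := D.U_ne
  have hW := D.W_ne
  obtain ⟨R, h1, h2, h3, h4⟩ := h.exists_curve_poly 0 Polynomial.X 0
    (by simp) (D.aeval_d_ne _ _) h.cz h.cs (div_ne_zero hU hW)
    (fun φ _ h2 h3 => ⟨by simpa using h3, by simpa using h2⟩)
    (by rw [map_zero, sub_zero, D.branch_r]; exact ⟨D.branchTip * h.cz, by ring⟩)
    (by simp) (by simp)
  rw [map_zero] at h2 h4
  rw [Polynomial.aeval_X] at h3
  obtain ⟨q, hq⟩ := D.branchTip_dvd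
  have he : R.φ D.branchTip ≠ 0 := by
    rw [hq]
    simp only [map_add, map_mul, AlgHom.commutes]
    rw [h2, h3, zero_mul, add_zero]
    simpa [Polynomial.algebraMap_eq] using aeval_ratFuncX_ne_zero D.linear_ne_zero
  refine ⟨R, h1, ⟨D.branchTip * h.cs, ?_, ?_⟩, fun hf hf' => ?_⟩
  · rw [h1]
    refine D.branch_τ.trans ?_
    push_cast
    ring
  · rw [map_mul, h3]
    exact mul_ne_zero he RatFunc.X_ne_zero
  have e1 := (R.valuation_lt_one_iff (hA := hf) (hf := hf') h.cr).2 h2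
  have e2 := (R.valuation_eq_one_iff (hA := hf) (hf := hf') h.cs).2 (by
    rw [h3]; exact RatFunc.X_ne_zero)
  have e3 := (R.valuation_eq_one_iff (hA := hf) (hf := hf') _).2 he
  have h0 : (R.place hf hf').valuation D.U ≠ 0 := by simpa using hU
  rw [h.coe_cr] at e1
  rw [h.coe_cs, map_div₀, div_eq_one_iff_eq h0] at e2
  rw [coe_branchTip, map_div₀, div_eq_one_iff_eq h0, map_pow] at e3
  exact ⟨e2 ▸ e1, by rw [e2], by rw [e3, e2, pow_one]⟩

/-- The component meeting the zero section. -/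
lemma exists_curve_branch_s : ∃ R : RationalCurve D.isChart_b.ring, R.g = D.isChart_b.cs ∧
    (∃ b : D.isChart_b.ring, D.τ = (R.g : K) ^ 1 * b ∧ R.φ b ≠ 0) ∧
    ∀ hf hf', D.IsStarPlace 0 0 (R.place hf hf') := by
  have h := D.isChart_b
  have hτ := D.τ_ne
  have hU := D.U_ne
  have hW := D.W_ne
  have hdvd : h.cs ∣ aeval ![h.cr, h.cs] D.tipPoly - aeval ![h.cr, 0] D.tipPoly :=
    dvd_aeval_sub (by intro i; fin_cases i <;> simp) _
  rw [aeval_tipPoly_zero'] at hdvd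
  obtain ⟨q, hq⟩ := hdvd
  obtain ⟨R, h1, h2, h3, h4⟩ := h.exists_curve_poly
    (Polynomial.C (D.c₁.coeff 0) * Polynomial.X ^ 2) 0 Polynomial.X
    (by simp [aeval_tipPoly_zero', Polynomial.algebraMap_eq])
    (by
      rw [aeval_polynomial_aeval]
      simp only [map_mul, aeval_X, Matrix.cons_val, mul_zero]
      rw [aeval_eq_coeff_zero_add]
      simpa using D.d_zero) h.cs h.cz (div_ne_zero hτ hU)
    (fun φ _ h2 h3 => ⟨by simpa using h2, by simpa using h3⟩)
    (by
      refine ⟨q * h.cz ^ 2, ?_⟩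
      rw [D.branch_r]
      simp only [map_mul, map_pow, Polynomial.aeval_C, Polynomial.aeval_X]
      have : D.branchTip = algebraMap ℂ _ (D.c₁.coeff 0) + h.cs * q := by
        rw [← hq, branchTip]; ring
      rw [this]
      ring)
    (by simp) (by simp)
  rw [map_zero] at h3
  rw [Polynomial.aeval_X] at h4
  have hr : R.φ h.cr ≠ 0 := by
    rw [h2]
    simpa using ⟨D.c₁_zero, RatFunc.X_ne_zero⟩
  have he : R.φ D.branchTip ≠ 0 := by
    intro h5
    rw [D.branch_r, map_mul, h5, zero_mul] at hr
    exact hr rfl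
  refine ⟨R, h1, ⟨h.cr, ?_, hr⟩, fun hf hf' => ?_⟩
  · rw [h1, pow_one, mul_comm]
    exact D.mul_tip.symm
  have e1 := (R.valuation_eq_one_iff (hA := hf) (hf := hf') h.cr).2 hr
  have e2 := (R.valuation_lt_one_iff (hA := hf) (hf := hf') (h.cr * h.cs)).2 (by
    rw [map_mul, h3, mul_zero])
  have e3 := (R.valuation_eq_one_iff (hA := hf) (hf := hf') _).2 he
  have h0 : (R.place hf hf').valuation D.U ≠ 0 := by simpa using hU
  have e4 : ((h.cr * h.cs : h.ring) : K) = D.τ := D.mul_tip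
  rw [h.coe_cr] at e1
  rw [e4] at e2
  rw [coe_branchTip, map_div₀, div_eq_one_iff_eq h0, map_pow, e1] at e3
  exact ⟨e2, by rw [e1]; simp, by rw [e3]; simp⟩

/-- The component at the tip, on the chart at the branch point. -/
lemma exists_curve_branch_tip : ∃ R : RationalCurve D.isChart_b.ring, R.g = D.branchTip ∧
    (∃ b : D.isChart_b.ring, D.τ = (R.g : K) ^ 1 * b ∧ R.φ b ≠ 0) ∧
    ∀ hf hf', D.IsStarPlace 2 2 (R.place hf hf') := by
  have h := D.isChart_b
  have hτ := D.τ_ne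
  have hU := D.U_ne
  have hW := D.W_ne
  have hc4 := D.c₄_zero
  have hc1 := D.c₁_zero
  set B : ℂ := - (D.c₁.coeff 0 / D.c₄.coeff 0) with hB
  have hB0 : D.c₁.coeff 0 + D.c₄.coeff 0 * B = 0 := by rw [hB]; field_simp; ring
  have hBne : B ≠ 0 := by simp [hB, hc1, hc4]
  obtain ⟨q, hq⟩ := D.branchTip_dvd
  have hc4' := FibreModel.algebraMap_mul_inv (R := h.ring) hc4
  have hB' : algebraMap ℂ h.ring (D.c₁.coeff 0) +
      algebraMap ℂ h.ring (D.c₄.coeff 0) * algebraMap ℂ h.ring B = 0 := by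
    rw [← map_mul, ← map_add, hB0, map_zero]
  have hBX : algebraMap ℂ (Polynomial ℂ) (D.c₁.coeff 0) +
      algebraMap ℂ (Polynomial ℂ) (D.c₄.coeff 0) * Polynomial.C B = 0 := by
    rw [Polynomial.algebraMap_eq, ← map_mul, ← map_add, hB0, map_zero]
  obtain ⟨R, h1, h2, h3, h4⟩ := h.exists_curve_poly 0 (Polynomial.C B) Polynomial.X
    (by rw [aeval_tipPoly_zero, hBX]; simp) (D.aeval_d_ne _ _) D.branchTip h.cz
    (by rw [coe_branchTip]; exact div_ne_zero (pow_ne_zero _ hW) hU)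
    (fun φ h1 h2 h3 => ⟨by
      rw [hq]
      simp only [map_add, map_mul, AlgHom.commutes, h1, h2]
      rw [map_zero, zero_mul, add_zero, Polynomial.aeval_C, ← map_mul, ← map_add, hB0, map_zero],
      by simpa using h3⟩)
    (by rw [map_zero, sub_zero, D.branch_r]; exact dvd_mul_right _ _)
    (by
      refine ⟨algebraMap ℂ _ (D.c₄.coeff 0)⁻¹ * (1 - q * h.cz ^ 2), ?_⟩
      have h5 := D.branch_r
      rw [Polynomial.aeval_C]
      have h6 : h.cr = D.branchTip * h.cz ^ 2 := h5
      linear_combination (-(h.cs - algebraMap ℂ _ B)) * hc4' - algebraMap ℂ _ (D.c₄.coeff 0)⁻¹ * hq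
        - algebraMap ℂ _ (D.c₄.coeff 0)⁻¹ * hB' - algebraMap ℂ _ (D.c₄.coeff 0)⁻¹ * q * h6)
    (by simp)
  rw [map_zero] at h2
  rw [Polynomial.aeval_X] at h4
  have hs : R.φ h.cs ≠ 0 := by
    rw [h3]
    simpa using hBne
  refine ⟨R, h1, ⟨h.cz ^ 2 * h.cs, ?_, ?_⟩, fun hf hf' => ?_⟩
  · rw [h1]
    refine D.branch_τ.trans ?_
    push_cast
    ring
  · rw [map_mul, map_pow, h4]
    exact mul_ne_zero (pow_ne_zero _ RatFunc.X_ne_zero) hs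
  have e1 := (R.valuation_lt_one_iff (hA := hf) (hf := hf') h.cr).2 h2
  have e2 := (R.valuation_eq_one_iff (hA := hf) (hf := hf') h.cs).2 hs
  have e3 := (R.valuation_eq_one_iff (hA := hf) (hf := hf') h.cz).2 (by
    rw [h4]; exact RatFunc.X_ne_zero)
  have h0 : (R.place hf hf').valuation D.U ≠ 0 := by simpa using hU
  have h0' : (R.place hf hf').valuation D.W ≠ 0 := by simpa using hW
  rw [h.coe_cr] at e1
  rw [h.coe_cs, map_div₀, div_eq_one_iff_eq h0] at e2
  rw [h.coe_cz, map_div₀, div_eq_one_iff_eq h0'] at e3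
  exact ⟨e2 ▸ e1, by rw [e2], by rw [← e3, e2]⟩

lemma isMaximal_branch_s : (Ideal.span {D.isChart_b.cz, D.isChart_b.cs}).IsMaximal := by
  have h := D.isChart_b
  have hz : h.cz ∈ Ideal.span {h.cz, h.cs} := Ideal.subset_span (by simp)
  have hs : h.cs ∈ Ideal.span {h.cz, h.cs} := Ideal.subset_span (by simp)
  refine h.isMaximal 0 0 0 (by simp) (D.aeval_d_ne _ _) ?_ ?_ (by simpa using hs) (by simpa using hz)
  · intro χ h1 h2 h3 x hx
    have : Ideal.span {h.cz, h.cs} ≤ RingHom.ker χ := by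
      rw [Ideal.span_le]
      rintro _ (rfl | rfl)
      exacts [h3, h2]
    exact this hx
  · rw [map_zero, sub_zero, D.branch_r]
    exact Ideal.mul_mem_left _ _ (Ideal.pow_mem_of_mem _ hz _ two_pos)

lemma isMaximal_branch_tip : (Ideal.span {D.isChart_b.cz, D.branchTip}).IsMaximal := by
  have h := D.isChart_b
  have hc4 := D.c₄_zero
  have hc1 := D.c₁_zero
  set B : ℂ := - (D.c₁.coeff 0 / D.c₄.coeff 0) with hB
  have hB0 : D.c₁.coeff 0 + D.c₄.coeff 0 * B = 0 := by rw [hB]; field_simp; ring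
  obtain ⟨q, hq⟩ := D.branchTip_dvd
  have hc4' := FibreModel.algebraMap_mul_inv (R := h.ring) hc4
  have hB' : algebraMap ℂ h.ring (D.c₁.coeff 0) +
      algebraMap ℂ h.ring (D.c₄.coeff 0) * algebraMap ℂ h.ring B = 0 := by
    rw [← map_mul, ← map_add, hB0, map_zero]
  have hz : h.cz ∈ Ideal.span {h.cz, D.branchTip} := Ideal.subset_span (by simp)
  have ht : D.branchTip ∈ Ideal.span {h.cz, D.branchTip} := Ideal.subset_span (by simp)
  refine h.isMaximal 0 B 0 (by simp) (D.aeval_d_ne _ _) ?_ ?_ ?_ (by simpa using hz)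
  · intro χ h1 h2 h3 x hx
    have : Ideal.span {h.cz, D.branchTip} ≤ RingHom.ker χ := by
      rw [Ideal.span_le]
      rintro _ (rfl | rfl)
      · exact h3
      · change χ D.branchTip = 0
        rw [hq]
        simp only [map_add, map_mul, AlgHom.commutes, h1, h2]
        simpa using hB0
    exact this hx
  · rw [map_zero, sub_zero, D.branch_r]
    exact Ideal.mul_mem_right _ _ ht
  · have h6 : h.cr = D.branchTip * h.cz ^ 2 := D.branch_r
    have : h.cs - algebraMap ℂ h.ring B =
        algebraMap ℂ _ (D.c₄.coeff 0)⁻¹ * (1 - q * h.cz ^ 2) * D.branchTip := by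
      linear_combination (-(h.cs - algebraMap ℂ _ B)) * hc4' - algebraMap ℂ _ (D.c₄.coeff 0)⁻¹ * hq
        - algebraMap ℂ _ (D.c₄.coeff 0)⁻¹ * hB' - algebraMap ℂ _ (D.c₄.coeff 0)⁻¹ * q * h6
    rw [this]
    exact Ideal.mul_mem_left _ _ ht

lemma isCoprime_branch : IsCoprime D.isChart_b.cs D.branchTip := by
  have h := D.isChart_b
  have hdvd : h.cs ∣ aeval ![h.cr, h.cs] D.tipPoly - aeval ![h.cr, 0] D.tipPoly :=
    dvd_aeval_sub (by intro i; fin_cases i <;> simp) _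
  rw [aeval_tipPoly_zero'] at hdvd
  obtain ⟨q, hq⟩ := hdvd
  have hc1 := FibreModel.algebraMap_mul_inv (R := h.ring) D.c₁_zero
  have hq' : D.branchTip - algebraMap ℂ _ (D.c₁.coeff 0) = h.cs * q := hq
  refine ⟨- q * algebraMap ℂ _ (D.c₁.coeff 0)⁻¹, algebraMap ℂ _ (D.c₁.coeff 0)⁻¹, ?_⟩
  linear_combination hc1 + algebraMap ℂ _ (D.c₁.coeff 0)⁻¹ * hq'

/-- The component at the tip. -/
lemma exists_curve_tip : ∃ R : RationalCurve D.isChart_tip.ring, R.g = D.isChart_tip.cr ∧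
    (∃ b : D.isChart_tip.ring, D.τ = (R.g : K) ^ 1 * b ∧ R.φ b ≠ 0) ∧
    ∀ hf hf', D.IsStarPlace 2 2 (R.place hf hf') := by
  have h := D.isChart_tip
  have hτ := D.τ_ne
  have hU := D.U_ne
  have hW := D.W_ne
  have hc4 := D.c₄_zero
  have hc1 := D.c₁_zero
  set B : ℂ := - (D.c₁.coeff 0 / D.c₄.coeff 0) with hB
  have hB0 : D.c₁.coeff 0 + D.c₄.coeff 0 * B = 0 := by rw [hB]; field_simp; ring
  have hBne : B ≠ 0 := by simp [hB, hc1, hc4]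
  have hdvd : h.cr ∣ aeval ![h.cr, h.cs] D.tipPoly - aeval ![0, h.cs] D.tipPoly :=
    dvd_aeval_sub (by intro i; fin_cases i <;> simp) _
  rw [aeval_tipPoly_zero] at hdvd
  obtain ⟨q, hq⟩ := hdvd
  have hrel : h.cr * h.cz ^ 2 = aeval ![h.cr, h.cs] D.tipPoly := by
    have := h.ring_rel
    rwa [aeval_X] at this
  have hc4' := FibreModel.algebraMap_mul_inv (R := h.ring) hc4
  have hB' : algebraMap ℂ h.ring (D.c₁.coeff 0) +
      algebraMap ℂ h.ring (D.c₄.coeff 0) * algebraMap ℂ h.ring B = 0 := by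
    rw [← map_mul, ← map_add, hB0, map_zero]
  have hBX : algebraMap ℂ (Polynomial ℂ) (D.c₁.coeff 0) +
      algebraMap ℂ (Polynomial ℂ) (D.c₄.coeff 0) * Polynomial.C B = 0 := by
    rw [Polynomial.algebraMap_eq, ← map_mul, ← map_add, hB0, map_zero]
  obtain ⟨R, h1, h2, h3, h4⟩ := h.exists_curve_poly 0 (Polynomial.C B) Polynomial.X
    (by rw [aeval_tipPoly_zero, hBX]; simp)
    (by
      rw [map_mul, aeval_X]
      exact mul_ne_zero (D.aeval_d_ne _ _) (by simpa using hBne)) h.cr h.cz hU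
    (fun φ h1 _ h3 => ⟨by simpa using h1, by simpa using h3⟩) (by simp)
    (by
      refine ⟨algebraMap ℂ _ (D.c₄.coeff 0)⁻¹ * (h.cz ^ 2 - q), ?_⟩
      rw [Polynomial.aeval_C]
      linear_combination (-(h.cs - algebraMap ℂ _ B)) * hc4' - algebraMap ℂ _ (D.c₄.coeff 0)⁻¹ * hq
        - algebraMap ℂ _ (D.c₄.coeff 0)⁻¹ * hB' - algebraMap ℂ _ (D.c₄.coeff 0)⁻¹ * hrel)
    (by simp)
  rw [map_zero] at h2
  rw [Polynomial.aeval_X] at h4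
  have hs : R.φ h.cs ≠ 0 := by
    rw [h3]
    simpa using hBne
  refine ⟨R, h1, ⟨h.cs, ?_, hs⟩, fun hf hf' => ?_⟩
  · rw [h1, pow_one]
    exact D.mul_tip.symm
  have e1 := (R.valuation_lt_one_iff (hA := hf) (hf := hf') h.cr).2 h2
  have e2 := (R.valuation_eq_one_iff (hA := hf) (hf := hf') h.cs).2 hs
  have e3 := (R.valuation_eq_one_iff (hA := hf) (hf := hf') h.cz).2 (by
    rw [h4]; exact RatFunc.X_ne_zero)
  have h0 : (R.place hf hf').valuation D.U ≠ 0 := by simpa using hU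
  rw [h.coe_cr] at e1
  rw [h.coe_cs, map_div₀, div_eq_one_iff_eq h0] at e2
  rw [h.coe_cz, map_div₀, div_eq_one_iff_eq h0] at e3
  exact ⟨e2 ▸ e1, by rw [e2], by rw [e3, e2]⟩

lemma exists_curve_star_inf : ∃ R : RationalCurve D.infRing, (R.g : K) = D.τ ∧
    (∃ b : D.infRing, D.τ = (R.g : K) ^ 1 * b ∧ R.φ b ≠ 0) ∧
    ∀ hf hf', D.IsStarPlace 0 0 (R.place hf hf') := by
  obtain ⟨R, h1, h2⟩ := D.exists_curve_inf
  refine ⟨R, h1, ⟨1, by simp [h1], by simp⟩, fun hf hf' => ?_⟩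
  obtain ⟨h3, h4, h5⟩ := h2 hf hf'
  have := h5 0
  rw [map_zero, sub_zero] at this
  exact ⟨h3, by rw [h4]; simp, by rw [this]; simp⟩

end StarModel

end Inose

end

noncomputable section

namespace Inose

open IsLocalRing MvPolynomial

variable {K : Type*} [Field K] [Algebra ℂ K]

section Order

variable {Γ : Type*} [LinearOrderedCommGroupWithZero Γ] {t u w : Γ}

lemma sq_le_sq_iff_le : u ^ 2 ≤ w ^ 2 ↔ u ≤ w :=
  pow_le_pow_iff_left₀ zero_le zero_le two_ne_zero

lemma sq_lt_sq_iff_lt : u ^ 2 < w ^ 2 ↔ u < w :=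
  pow_lt_pow_iff_left₀ zero_le zero_le two_ne_zero

lemma eq_of_sq_eq_sq (h : u ^ 2 = w ^ 2) : u = w :=
  le_antisymm (sq_le_sq_iff_le.1 h.le) (sq_le_sq_iff_le.1 h.ge)

lemma lt_one_of_sq_lt_one (h : u ^ 2 < 1) : u < 1 := by
  rw [← one_pow 2] at h
  exact sq_lt_sq_iff_lt.1 h

lemma exponent_le (ht0 : t ≠ 0) (ht : t < 1) {m n : ℕ} (h : t ^ m ≤ t ^ n) : n ≤ m :=
  (pow_le_pow_iff_right_of_lt_one₀ (zero_lt_iff.2 ht0) ht).1 h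

end Order

namespace StarModel

variable (D : StarModel K)

lemma swap_swap : D.swap.swap = D := by
  have h : D.τ ^ D.n / (D.τ ^ D.n / D.U) = D.U := by
    have := D.τ_ne
    have := D.U_ne
    field_simp
  revert h
  obtain ⟨⟨τ, U, W, n, c₁, c₂, c₃, d, -, -, -, -, -, -⟩, c₄, -, -, -⟩ := D
  intro h
  simp only [swap, FibreModel.swap, mk.injEq, FibreModel.mk.injEq]
  simpa using h

/-- The coordinate ring of the chart at infinity. -/
abbrev infRing : Subalgebra ℂ K := D.toFibreModel.infRing

/-- The coordinate ring of the chart at the branch point. -/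
abbrev branchRing : Subalgebra ℂ K := D.isChart_b.ring

/-- The coordinate ring of the chart at the tip. -/
abbrev tipRing : Subalgebra ℂ K := D.isChart_tip.ring

/-- The coordinate rings of the charts along the chain. -/
abbrev chainRing (k : Fin 3) : Subalgebra ℂ K := (D.isChart_a k.2).ring

variable {V : ValuationSubring K}

lemma valuation_τ_ne : V.valuation D.τ ≠ 0 := by simpa using D.τ_ne
lemma valuation_U_ne : V.valuation D.U ≠ 0 := by simpa using D.U_ne
lemma valuation_W_ne : V.valuation D.W ≠ 0 := by simpa using D.W_ne

lemma valuation_swap_U : V.valuation D.swap.U = V.valuation D.τ ^ 5 / V.valuation D.U := by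
  have : D.swap.U = D.τ ^ 5 / D.U := by
    have h : D.swap.U = D.τ ^ D.n / D.U := rfl
    rw [h, D.n_eq]
  rw [this, map_div₀, map_pow]

lemma below_infRing (hV : Constants V) (hτ : V.valuation D.τ < 1) :
    Below D.infRing V ↔ 1 ≤ V.valuation D.U ∧ 1 ≤ V.valuation D.W :=
  D.toFibreModel.below_infRing hV hτ

lemma below_branchRing (hV : Constants V) (hτ : V.valuation D.τ < 1) :
    Below D.branchRing V ↔ V.valuation D.U ≤ 1 ∧ V.valuation D.τ ≤ V.valuation D.U ∧
      V.valuation D.U ≤ V.valuation D.W := by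
  have h0 := zero_lt_iff.2 (D.valuation_U_ne (V := V))
  have h1 := zero_lt_iff.2 (D.valuation_W_ne (V := V))
  rw [IsChart.below_ring _ hV, aeval_polynomial_aeval]
  simp only [map_mul, aeval_X, Matrix.cons_val]
  rw [D.mul_tip, inv_mem_iff_one_le D.d_ne, hV.valuation_aeval_eq_one hτ D.d_zero,
    ← ValuationSubring.valuation_le_one_iff, ← ValuationSubring.valuation_le_one_iff,
    ← ValuationSubring.valuation_le_one_iff, map_div₀, map_div₀, div_le_one₀ h0, div_le_one₀ h1]
  simp

lemma below_tipRing (hV : Constants V) (hτ : V.valuation D.τ < 1) :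
    Below D.tipRing V ↔ V.valuation D.U = V.valuation D.τ ∧
      V.valuation D.W ≤ V.valuation D.U := by
  have h0 := zero_lt_iff.2 (D.valuation_U_ne (V := V))
  rw [IsChart.below_ring _ hV, map_mul, aeval_polynomial_aeval]
  simp only [map_mul, aeval_X, Matrix.cons_val]
  rw [D.mul_tip, inv_mem_iff_one_le (mul_ne_zero D.d_ne (div_ne_zero D.τ_ne D.U_ne)), map_mul,
    hV.valuation_aeval_eq_one hτ D.d_zero, one_mul,
    ← ValuationSubring.valuation_le_one_iff, ← ValuationSubring.valuation_le_one_iff,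
    ← ValuationSubring.valuation_le_one_iff, map_div₀, map_div₀, div_le_one₀ h0, div_le_one₀ h0,
    one_le_div₀ h0]
  constructor
  · rintro ⟨-, h2, h3, h4⟩
    exact ⟨le_antisymm h4 h2, h3⟩
  · rintro ⟨h1, h2⟩
    exact ⟨h1 ▸ hτ.le, h1.ge, h2, h1.le⟩

lemma below_chainRing (k : Fin 3) (hV : Constants V) (hτ : V.valuation D.τ < 1) :
    Below (D.chainRing k) V ↔ V.valuation D.W ^ 2 = V.valuation D.τ ∧
      V.valuation D.τ ^ (2 * k.1 + 3) ≤ V.valuation D.U ^ 2 ∧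
      V.valuation D.U ^ 2 ≤ V.valuation D.τ ^ (2 * k.1 + 2) := by
  have hu := zero_lt_iff.2 (D.valuation_U_ne (V := V))
  have ht0 := D.valuation_τ_ne (V := V)
  have ht := zero_lt_iff.2 ht0
  have e1 : V.valuation (D.U / D.τ ^ (k.1 + 1)) ≤ 1 ↔
      V.valuation D.U ^ 2 ≤ V.valuation D.τ ^ (2 * k.1 + 2) := by
    rw [map_div₀, map_pow, div_le_one₀ (pow_pos ht _), ← sq_le_sq_iff_le, ← pow_mul]
    congr! 2
    ring
  have e2 : V.valuation (D.τ ^ (k.1 + 1 + 1) / D.U) ≤ 1 ↔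
      V.valuation D.τ ^ (2 * k.1 + 4) ≤ V.valuation D.U ^ 2 := by
    rw [map_div₀, map_pow, div_le_one₀ hu, ← sq_le_sq_iff_le, ← pow_mul]
    congr! 2
    ring
  have e3 : V.valuation (D.W * D.τ ^ (k.1 + 1) / D.U) ≤ 1 ↔
      V.valuation D.W ^ 2 * V.valuation D.τ ^ (2 * k.1 + 2) ≤ V.valuation D.U ^ 2 := by
    rw [map_div₀, map_mul, map_pow, div_le_one₀ hu, ← sq_le_sq_iff_le, mul_pow, ← pow_mul]
    congr! 3
    ring
  have e4 : V.valuation (D.W ^ 2 / D.τ) ≤ 1 ↔ V.valuation D.W ^ 2 ≤ V.valuation D.τ := by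
    rw [map_div₀, map_pow, div_le_one₀ ht]
  have e5 : 1 ≤ V.valuation (D.W ^ 2 / D.τ) ↔ V.valuation D.τ ≤ V.valuation D.W ^ 2 := by
    rw [map_div₀, map_pow, one_le_div₀ ht]
  have h5 : V.valuation D.τ * V.valuation D.τ ^ (2 * k.1 + 2) =
      V.valuation D.τ ^ (2 * k.1 + 3) := by rw [← pow_succ']
  have hne : D.W ^ 2 / D.τ ≠ 0 := div_ne_zero (pow_ne_zero _ D.W_ne) D.τ_ne
  constructor
  · intro hb
    have hu := hb _ (aeval ![(D.isChart_a k.2).cr, (D.isChart_a k.2).cs] (D.unitPoly k)).2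
    rw [IsChart.coe_aeval₂, D.unit_eq k.2, ← ValuationSubring.valuation_le_one_iff, e4] at hu
    rw [IsChart.below_ring _ hV, aeval_unit, D.unit_eq k.2, D.cyc_mul,
      inv_mem_iff_one_le (mul_ne_zero D.d_ne hne), map_mul,
      hV.valuation_aeval_eq_one hτ D.d_zero, one_mul, e5,
      ← ValuationSubring.valuation_le_one_iff, ← ValuationSubring.valuation_le_one_iff,
      ← ValuationSubring.valuation_le_one_iff, e1, e2, e3] at hb
    obtain ⟨h1, h2, h3, h4⟩ := hb
    have h := le_antisymm hu h4
    rw [h, h5] at h3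
    exact ⟨h, h3, h1⟩
  · rintro ⟨h1, h2, h3⟩
    rw [IsChart.below_ring _ hV, aeval_unit, D.unit_eq k.2, D.cyc_mul,
      inv_mem_iff_one_le (mul_ne_zero D.d_ne hne), map_mul,
      hV.valuation_aeval_eq_one hτ D.d_zero, one_mul, e5,
      ← ValuationSubring.valuation_le_one_iff, ← ValuationSubring.valuation_le_one_iff,
      ← ValuationSubring.valuation_le_one_iff, e1, e2, e3, h1, h5]
    refine ⟨h3, le_trans ?_ h2, h2, le_rfl⟩
    exact pow_le_pow_right_of_le_one' hτ.le (by omega)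

/-- The charts of one half of a fibre of type `I*₆`. -/
def IsHalfChart (A : Subalgebra ℂ K) : Prop :=
  (A = D.infRing ∨ A = D.branchRing ∨ A = D.tipRing) ∨ ∃ k, A = D.chainRing k

/-- The charts of a fibre of type `I*₆`. -/
def IsStarChart (A : Subalgebra ℂ K) : Prop := D.IsHalfChart A ∨ D.swap.IsHalfChart A

lemma isStarChart_swap {A : Subalgebra ℂ K} : D.swap.IsStarChart A ↔ D.IsStarChart A := by
  rw [IsStarChart, swap_swap, IsStarChart, or_comm]

lemma sq_le_of_end (hV : Constants V) (hτ : V.valuation D.τ < 1) {A : Subalgebra ℂ K}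
    (hA : A = D.infRing ∨ A = D.branchRing ∨ A = D.tipRing) (hb : Below A V) :
    V.valuation D.τ ^ 2 ≤ V.valuation D.U ^ 2 := by
  rw [sq_le_sq_iff_le]
  rcases hA with rfl | rfl | rfl
  · exact hτ.le.trans ((D.below_infRing hV hτ).1 hb).1
  · exact ((D.below_branchRing hV hτ).1 hb).2.1
  · exact ((D.below_tipRing hV hτ).1 hb).1.ge

lemma sq_le_of_half (hV : Constants V) (hτ : V.valuation D.τ < 1) {A : Subalgebra ℂ K}
    (hA : D.IsHalfChart A) (hb : Below A V) :
    V.valuation D.τ ^ 7 ≤ V.valuation D.U ^ 2 := by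
  rcases hA with hA | ⟨k, rfl⟩
  · exact le_trans (pow_le_pow_right_of_le_one' hτ.le (by norm_num)) (D.sq_le_of_end hV hτ hA hb)
  · exact le_trans (pow_le_pow_right_of_le_one' hτ.le (by omega))
      ((D.below_chainRing k hV hτ).1 hb).2.1

lemma sq_mul_swap : V.valuation D.U ^ 2 * V.valuation D.swap.U ^ 2 = V.valuation D.τ ^ 10 := by
  have h := D.valuation_U_ne (V := V)
  rw [D.valuation_swap_U, div_pow, mul_div_cancel₀ _ (pow_ne_zero _ h), ← pow_mul]

lemma exponent_bound (hτ : V.valuation D.τ < 1) {m n : ℕ}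
    (h1 : V.valuation D.τ ^ m ≤ V.valuation D.U ^ 2)
    (h2 : V.valuation D.τ ^ n ≤ V.valuation D.swap.U ^ 2) : 10 ≤ m + n := by
  have := mul_le_mul' h1 h2
  rw [sq_mul_swap, ← pow_add] at this
  exact exponent_le D.valuation_τ_ne hτ this

lemma not_below_end_swap (hV : Constants V) (hτ : V.valuation D.τ < 1) {A B : Subalgebra ℂ K}
    (hA : A = D.infRing ∨ A = D.branchRing ∨ A = D.tipRing) (hB : D.swap.IsHalfChart B)
    (h1 : Below A V) (h2 : Below B V) : False := by
  have := D.exponent_bound hτ (D.sq_le_of_end hV hτ hA h1) (D.swap.sq_le_of_half hV hτ hB h2)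
  omega

lemma one_le_of_below_chain (hV : Constants V) (hτ : V.valuation D.τ < 1) {k : Fin 3}
    (h : Below (D.chainRing k) V) {m : ℕ} (h1 : V.valuation D.τ ^ m ≤ V.valuation D.U ^ 2) :
    2 * k.1 + 2 ≤ m :=
  exponent_le D.valuation_τ_ne hτ (h1.trans ((D.below_chainRing k hV hτ).1 h).2.2)

lemma glues_inf_branch (hV : Constants V) : Glues V D.infRing D.branchRing := by
  intro hb hb'
  obtain ⟨m1, m2, m3, -⟩ := (IsChart.ring_le_iff D.isChart_b _).1 (le_centre hb')
  have m4 := mul_mem m1 m2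
  rw [D.mul_tip] at m4
  obtain ⟨-, e1, -, -⟩ := (IsChart.below_ring D.isChart_inf hV).1 hb
  have m5 := inv_mem_centre hb' m1 e1
  refine D.isChart_inf.ring_le_centre hV hb hb' m4 m5 ?_
  have hU := D.U_ne
  have : D.W⁻¹ = D.U⁻¹ * (D.U / D.W) := by field_simp
  rw [this]
  exact mul_mem m5 m3

lemma glues_branch_inf (hV : Constants V) : Glues V D.branchRing D.infRing := by
  intro hb hb'
  obtain ⟨m1, m2, m3, -⟩ := (IsChart.ring_le_iff D.isChart_inf _).1 (le_centre hb')
  obtain ⟨e1, -⟩ := (IsChart.below_ring D.isChart_b hV).1 hb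
  have m4 := mem_centre_of_inv hb' m2 e1
  refine D.isChart_b.ring_le_centre hV hb hb' m4 ?_ ?_
  · rw [div_eq_mul_inv]
    exact mul_mem m1 m2
  · rw [div_eq_mul_inv]
    exact mul_mem m4 m3

lemma glues_branch_tip (hV : Constants V) : Glues V D.branchRing D.tipRing := by
  intro hb hb'
  obtain ⟨m1, m2, m3, -⟩ := (IsChart.ring_le_iff D.isChart_tip _).1 (le_centre hb')
  obtain ⟨-, -, e1, -⟩ := (IsChart.below_ring D.isChart_b hV).1 hb
  refine D.isChart_b.ring_le_centre hV hb hb' m1 m2 ?_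
  rw [← inv_div]
  exact inv_mem_centre hb' m3 (by rwa [inv_div])

lemma glues_tip_branch (hV : Constants V) : Glues V D.tipRing D.branchRing := by
  intro hb hb'
  obtain ⟨m1, m2, m3, -⟩ := (IsChart.ring_le_iff D.isChart_b _).1 (le_centre hb')
  obtain ⟨-, -, e1, -⟩ := (IsChart.below_ring D.isChart_tip hV).1 hb
  refine D.isChart_tip.ring_le_centre hV hb hb' m1 m2 ?_
  rw [← inv_div]
  exact inv_mem_centre hb' m3 (by rwa [inv_div])

lemma coe_chainUnit {k : ℕ} (hk : k < 3) : (D.chainUnit hk : K) = D.τ / D.W ^ 2 := by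
  have h := congrArg Subtype.val (D.chainUnit_mul hk)
  rw [MulMemClass.coe_mul, IsChart.coe_aeval₂, D.unit_eq hk] at h
  have := D.τ_ne
  have := D.W_ne
  exact (eq_inv_of_mul_eq_one_right h).trans (inv_div _ _)

lemma chain_mem {k : ℕ} (hk : k < 3) : D.τ ∈ (D.isChart_a hk).ring ∧
    D.W ^ 2 / D.τ ∈ (D.isChart_a hk).ring ∧ D.τ / D.W ^ 2 ∈ (D.isChart_a hk).ring := by
  have key {f g : K} {A : Subalgebra ℂ K} (h : f ∈ A) (hfg : f = g) : g ∈ A := hfg ▸ h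
  refine ⟨?_, ?_, ?_⟩
  · exact key ((D.isChart_a hk).cr * (D.isChart_a hk).cs).2 (D.cyc_mul (k + 1))
  · exact key (aeval ![(D.isChart_a hk).cr, (D.isChart_a hk).cs] (D.unitPoly k)).2
      ((IsChart.coe_aeval₂ (D.isChart_a hk) _).trans (D.unit_eq hk))
  · exact key (D.chainUnit hk).2 (D.coe_chainUnit hk)

lemma glues_branch_chain (hV : Constants V) : Glues V D.branchRing (D.chainRing 0) := by
  intro hb hb'
  obtain ⟨m1, m2, m3, -⟩ := (IsChart.ring_le_iff (D.isChart_a (k := 0) (by norm_num)) _).1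
    (le_centre hb')
  obtain ⟨c1, c2, c3⟩ := D.chain_mem (k := 0) (by norm_num)
  have c1 := le_centre hb' c1
  have c3 := le_centre hb' c3
  have hτ := D.τ_ne
  have hU := D.U_ne
  have hW := D.W_ne
  rw [zero_add, pow_one] at m1 m3
  obtain ⟨-, e1, -, -⟩ := (IsChart.below_ring D.isChart_b hV).1 hb
  refine D.isChart_b.ring_le_centre hV hb hb' ?_ ?_ ?_
  · have : D.U = D.U / D.τ * D.τ := by field_simp
    rw [this]
    exact mul_mem m1 c1
  · rw [← inv_div]
    exact inv_mem_centre hb' m1 (by rwa [inv_div])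
  · have : D.U / D.W = (D.U / D.τ) ^ 2 * (D.W * D.τ / D.U) * (D.τ / D.W ^ 2) := by field_simp
    rw [this]
    exact mul_mem (mul_mem (pow_mem m1 _) m3) c3

lemma glues_chain_branch (hV : Constants V) : Glues V (D.chainRing 0) D.branchRing := by
  intro hb hb'
  obtain ⟨m1, m2, m3, -⟩ := (IsChart.ring_le_iff D.isChart_b _).1 (le_centre hb')
  have m4 := mul_mem m1 m2
  rw [D.mul_tip] at m4
  have m5 := le_centre hb' D.branchTip.2
  rw [coe_branchTip] at m5
  have hτ := D.τ_ne
  have hU := D.U_ne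
  have hW := D.W_ne
  obtain ⟨e1, -⟩ := (IsChart.below_ring (D.isChart_a (k := 0) (by norm_num)) hV).1 hb
  rw [zero_add, pow_one] at e1
  refine (D.isChart_a (k := 0) (by norm_num)).ring_le_centre hV hb hb' ?_ ?_ ?_
  · rw [zero_add, pow_one, ← inv_div]
    exact inv_mem_centre hb' m2 (by rwa [inv_div])
  · have : D.τ ^ (0 + 1 + 1) / D.U = D.τ * (D.τ / D.U) := by ring
    rw [this]
    exact mul_mem m4 m2
  · have : D.W * D.τ ^ (0 + 1) / D.U = (D.τ / D.U) * ((D.W ^ 2 / D.U) * (D.U / D.W)) := by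
      field_simp; ring
    rw [this]
    exact mul_mem m2 (mul_mem m5 m3)

lemma swap_U : D.swap.U = D.τ ^ 5 / D.U := by
  have h : D.swap.U = D.τ ^ D.n / D.U := rfl
  rw [h, D.n_eq]

lemma glues_chain_swap_two (hV : Constants V) (k l : Fin 3) (hkl : k.1 + l.1 = 2) :
    Glues V (D.chainRing k) (D.swap.chainRing l) := by
  intro hb hb'
  obtain ⟨m1, m2, m3, -⟩ := (IsChart.ring_le_iff (D.swap.isChart_a l.2) _).1 (le_centre hb')
  obtain ⟨c1, c2, c3⟩ := D.swap.chain_mem l.2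
  have c3 := le_centre hb' c3
  change D.τ / D.W ^ 2 ∈ (centre hb').carrier at c3
  have hτ := D.τ_ne
  have hU := D.U_ne
  have hW := D.W_ne
  rw [swap_U] at m1 m2 m3
  change D.τ ^ 5 / D.U / D.τ ^ (l.1 + 1) ∈ (centre hb').carrier at m1
  change D.τ ^ (l.1 + 1 + 1) / (D.τ ^ 5 / D.U) ∈ (centre hb').carrier at m2
  change D.W * D.τ ^ (l.1 + 1) / (D.τ ^ 5 / D.U) ∈ (centre hb').carrier at m3
  obtain ⟨-, -, e1, -⟩ := (IsChart.below_ring (D.isChart_a k.2) hV).1 hb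
  have h5 : D.τ ^ 5 = D.τ ^ (l.1 + 1) * D.τ ^ (k.1 + 1) * D.τ := by
    rw [← pow_add, ← pow_succ]; congr 1; omega
  rw [h5] at m1 m2 m3
  refine (D.isChart_a k.2).ring_le_centre hV hb hb' ?_ ?_ ?_
  · convert m2 using 1
    field_simp
    ring
  · convert m1 using 1
    field_simp
    ring
  · refine mem_centre_of_inv hb' ?_ e1
    convert mul_mem m3 c3 using 1
    field_simp

lemma glues_chain_swap_three (hV : Constants V) (k l : Fin 3) (hkl : k.1 + l.1 = 3) :
    Glues V (D.chainRing k) (D.swap.chainRing l) := by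
  intro hb hb'
  obtain ⟨m1, m2, m3, -⟩ := (IsChart.ring_le_iff (D.swap.isChart_a l.2) _).1 (le_centre hb')
  obtain ⟨c1, c2, c3⟩ := D.swap.chain_mem l.2
  have c1 := le_centre hb' c1
  change D.τ ∈ (centre hb').carrier at c1
  have hτ := D.τ_ne
  have hU := D.U_ne
  have hW := D.W_ne
  rw [swap_U] at m1 m2 m3
  change D.τ ^ 5 / D.U / D.τ ^ (l.1 + 1) ∈ (centre hb').carrier at m1
  change D.τ ^ (l.1 + 1 + 1) / (D.τ ^ 5 / D.U) ∈ (centre hb').carrier at m2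
  change D.W * D.τ ^ (l.1 + 1) / (D.τ ^ 5 / D.U) ∈ (centre hb').carrier at m3
  obtain ⟨e1, -⟩ := (IsChart.below_ring (D.isChart_a k.2) hV).1 hb
  have h5 : D.τ ^ 5 = D.τ ^ (l.1 + 1) * D.τ ^ (k.1 + 1) := by
    rw [← pow_add]; congr 1; omega
  rw [h5] at m1 m2 m3
  refine (D.isChart_a k.2).ring_le_centre hV hb hb' ?_ ?_ ?_
  · refine mem_centre_of_inv hb' ?_ e1
    convert m1 using 1
    field_simp
  · convert mul_mem c1 m1 using 1
    field_simp
    ring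
  · convert mul_mem m3 (pow_mem m1 2) using 1
    field_simp

lemma glues_end_end (hV : Constants V) (hτ : V.valuation D.τ < 1) {A B : Subalgebra ℂ K}
    (hA : A = D.infRing ∨ A = D.branchRing ∨ A = D.tipRing)
    (hB : B = D.infRing ∨ B = D.branchRing ∨ B = D.tipRing) : Glues V A B := by
  have key (h1 : Below D.infRing V) (h2 : Below D.tipRing V) : False := by
    have h3 := ((D.below_infRing hV hτ).1 h1).1
    rw [((D.below_tipRing hV hτ).1 h2).1] at h3
    exact hτ.not_ge h3
  rcases hA with rfl | rfl | rfl <;> rcases hB with rfl | rfl | rfl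
  · exact glues_self _ _
  · exact D.glues_inf_branch hV
  · exact fun h h' => (key h h').elim
  · exact D.glues_branch_inf hV
  · exact glues_self _ _
  · exact D.glues_branch_tip hV
  · exact fun h h' => (key h' h).elim
  · exact D.glues_tip_branch hV
  · exact glues_self _ _

lemma end_chain (hV : Constants V) (hτ : V.valuation D.τ < 1) {A : Subalgebra ℂ K}
    (hA : A = D.infRing ∨ A = D.branchRing ∨ A = D.tipRing) {k : Fin 3} (hb : Below A V)
    (hb' : Below (D.chainRing k) V) : A = D.branchRing ∧ k = 0 := by
  have h1 := D.one_le_of_below_chain hV hτ hb' (D.sq_le_of_end hV hτ hA hb)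
  refine ⟨?_, by omega⟩
  rcases hA with rfl | rfl | rfl
  · have h2 := D.one_le_of_below_chain hV hτ hb' (m := 0) (by
      rw [pow_zero]
      exact one_le_pow₀ ((D.below_infRing hV hτ).1 hb).1)
    omega
  · rfl
  · obtain ⟨h2, h3⟩ := (D.below_tipRing hV hτ).1 hb
    have h4 := ((D.below_chainRing k hV hτ).1 hb').1
    rw [← sq_le_sq_iff_le, h4, h2] at h3
    nth_rewrite 1 [← pow_one (V.valuation D.τ)] at h3
    have := exponent_le D.valuation_τ_ne hτ h3
    omega

lemma glues_half_half (hV : Constants V) (hτ : V.valuation D.τ < 1) {A B : Subalgebra ℂ K}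
    (hA : D.IsHalfChart A) (hB : D.IsHalfChart B) : Glues V A B := by
  rcases hA with hA | ⟨k, rfl⟩ <;> rcases hB with hB | ⟨l, rfl⟩
  · exact D.glues_end_end hV hτ hA hB
  · intro hb hb'
    obtain ⟨rfl, rfl⟩ := D.end_chain hV hτ hA hb hb'
    exact D.glues_branch_chain hV hb hb'
  · intro hb hb'
    obtain ⟨rfl, rfl⟩ := D.end_chain hV hτ hB hb' hb
    exact D.glues_chain_branch hV hb hb'
  · intro hb hb'
    have h1 := D.one_le_of_below_chain hV hτ hb ((D.below_chainRing l hV hτ).1 hb').2.1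
    have h2 := D.one_le_of_below_chain hV hτ hb' ((D.below_chainRing k hV hτ).1 hb).2.1
    obtain rfl : k = l := by omega
    exact glues_self _ _ hb hb'

lemma glues_half_swap (hV : Constants V) (hτ : V.valuation D.τ < 1) {A B : Subalgebra ℂ K}
    (hA : D.IsHalfChart A) (hB : D.swap.IsHalfChart B) : Glues V A B := by
  intro hb hb'
  rcases hA with hA' | ⟨k, rfl⟩
  · exact (D.not_below_end_swap hV hτ hA' hB hb hb').elim
  rcases hB with hB' | ⟨l, rfl⟩
  · exact (D.swap.not_below_end_swap hV hτ hB' (B := D.chainRing k)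
      (by rw [swap_swap]; exact Or.inr ⟨k, rfl⟩) hb' hb).elim
  obtain ⟨-, h1, h2⟩ := (D.below_chainRing k hV hτ).1 hb
  obtain ⟨-, h3, h4⟩ := (D.swap.below_chainRing l hV hτ).1 hb'
  have h5 := D.exponent_bound hτ h1 h3
  have h6 := mul_le_mul' h2 h4
  rw [sq_mul_swap] at h6
  change _ ≤ V.valuation D.τ ^ (2 * k.1 + 2) * V.valuation D.τ ^ (2 * l.1 + 2) at h6
  rw [← pow_add] at h6
  have h7 := exponent_le D.valuation_τ_ne hτ h6
  rcases (by omega : k.1 + l.1 = 2 ∨ k.1 + l.1 = 3) with h | h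
  · exact D.glues_chain_swap_two hV k l h hb hb'
  · exact D.glues_chain_swap_three hV k l h hb hb'

lemma glues_isStarChart (hV : Constants V) (hτ : V.valuation D.τ < 1) {A B : Subalgebra ℂ K}
    (hA : D.IsStarChart A) (hB : D.IsStarChart B) : Glues V A B := by
  rcases hA with hA | hA <;> rcases hB with hB | hB
  · exact D.glues_half_half hV hτ hA hB
  · exact D.glues_half_swap hV hτ hA hB
  · exact D.swap.glues_half_swap hV hτ hA (by rwa [swap_swap])
  · exact D.swap.glues_half_half hV hτ hA hB

lemma valuation_W_of_lt (hV : Constants V) (hτ : V.valuation D.τ < 1)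
    (h : V.valuation D.τ < V.valuation D.U) : V.valuation D.W ^ 2 = V.valuation D.U := by
  have h1 : V.valuation (Polynomial.aeval D.τ D.c₁ * D.U) = V.valuation D.U := by
    rw [map_mul, hV.valuation_aeval_eq_one hτ D.c₁_zero, one_mul]
  have h0 := zero_lt_iff.2 (D.valuation_U_ne (V := V))
  rw [← map_pow, D.rel', add_assoc, Valuation.map_add_eq_of_lt_left _ _, h1]
  rw [h1]
  refine Valuation.map_add_lt _ ?_ ?_
  · rw [map_mul]
    refine (mul_le_of_le_one_left' (hV.valuation_aeval_le_one hτ.le _)).trans_lt ?_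
    rw [map_div₀, map_pow, div_lt_iff₀ h0, ← sq]
    refine lt_of_le_of_lt (pow_le_pow_right_of_le_one' hτ.le (show 2 ≤ 5 by norm_num)) ?_
    exact sq_lt_sq_iff_lt.2 h
  · rw [map_mul]
    exact (mul_le_of_le_one_right' (hV.valuation_aeval_le_one hτ.le _)).trans_lt h

lemma valuation_W_of_gt (hV : Constants V) (hτ : V.valuation D.τ < 1)
    (h : V.valuation D.U < V.valuation D.τ) (h' : V.valuation D.τ ^ 4 < V.valuation D.U) :
    V.valuation D.W ^ 2 = V.valuation D.τ := by
  have h1 : V.valuation (D.τ * Polynomial.aeval D.τ D.c₄) = V.valuation D.τ := by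
    rw [map_mul, hV.valuation_aeval_eq_one hτ D.c₄_zero, mul_one]
  have h0 := zero_lt_iff.2 (D.valuation_U_ne (V := V))
  have ht := zero_lt_iff.2 (D.valuation_τ_ne (V := V))
  rw [← map_pow, D.rel', Valuation.map_add_eq_of_lt_right _ _, h1]
  rw [h1]
  refine Valuation.map_add_lt _ ?_ ?_
  · rw [map_mul]
    exact (mul_le_of_le_one_left' (hV.valuation_aeval_le_one hτ.le _)).trans_lt h
  · rw [map_mul]
    refine (mul_le_of_le_one_left' (hV.valuation_aeval_le_one hτ.le _)).trans_lt ?_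
    rw [map_div₀, map_pow, div_lt_iff₀ h0, pow_succ']
    exact (mul_lt_mul_iff_right₀ ht).2 h'

lemma exists_isStarChart_of_le (hV : Constants V) (hτ : V.valuation D.τ < 1)
    (hU : V.valuation D.U ≤ 1) (h : V.valuation D.τ ^ 5 ≤ V.valuation D.U ^ 2) :
    ∃ A, D.IsStarChart A ∧ Below A V := by
  rcases lt_trichotomy (V.valuation D.τ) (V.valuation D.U) with h1 | h1 | h1
  · refine ⟨_, Or.inl (Or.inl (Or.inr (Or.inl rfl))), (D.below_branchRing hV hτ).2 ⟨hU, h1.le, ?_⟩⟩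
    rw [← sq_le_sq_iff_le, D.valuation_W_of_lt hV hτ h1, sq]
    exact mul_le_of_le_one_left' hU
  · rcases le_total (V.valuation D.U) (V.valuation D.W) with h2 | h2
    · exact ⟨_, Or.inl (Or.inl (Or.inr (Or.inl rfl))),
        (D.below_branchRing hV hτ).2 ⟨hU, h1.le, h2⟩⟩
    · exact ⟨_, Or.inl (Or.inl (Or.inr (Or.inr rfl))), (D.below_tipRing hV hτ).2 ⟨h1.symm, h2⟩⟩
  · have h2 : V.valuation D.τ ^ 4 < V.valuation D.U := by
      by_contra h2
      rw [not_lt, ← sq_le_sq_iff_le, ← pow_mul] at h2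
      have := exponent_le D.valuation_τ_ne hτ (h.trans h2)
      omega
    have hW := D.valuation_W_of_gt hV hτ h1 h2
    have h3 := sq_lt_sq_iff_lt.2 h1
    rcases le_total (V.valuation D.τ ^ 3) (V.valuation D.U ^ 2) with h4 | h4
    · exact ⟨_, Or.inl (Or.inr ⟨0, rfl⟩), (D.below_chainRing 0 hV hτ).2 ⟨hW, h4, h3.le⟩⟩
    rcases le_total (V.valuation D.τ ^ 4) (V.valuation D.U ^ 2) with h5 | h5
    · have h6 := D.sq_mul_swap (V := V)
      have h7 := zero_lt_iff.2 (pow_ne_zero 2 (D.valuation_U_ne (V := V)))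
      refine ⟨_, Or.inr (Or.inr ⟨2, rfl⟩), (D.swap.below_chainRing 2 hV hτ).2 ⟨hW, ?_, ?_⟩⟩
      · change V.valuation D.τ ^ 7 ≤ _
        rw [← mul_le_mul_iff_right₀ h7, h6]
        exact (mul_le_mul_left h4 _).trans_eq (pow_add _ 3 7).symm
      · change _ ≤ V.valuation D.τ ^ 6
        rw [← mul_le_mul_iff_right₀ h7, h6]
        exact (pow_add _ 4 6).trans_le (mul_le_mul_left h5 _)
    · exact ⟨_, Or.inl (Or.inr ⟨1, rfl⟩), (D.below_chainRing 1 hV hτ).2 ⟨hW, h, h5⟩⟩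

lemma exists_isStarChart (hV : Constants V) (hτ : V.valuation D.τ < 1) :
    ∃ A, D.IsStarChart A ∧ Below A V := by
  rcases lt_or_ge 1 (V.valuation D.U) with hU | hU
  · exact ⟨_, Or.inl (Or.inl (Or.inl rfl)), D.toFibreModel.below_infRing_of_one_lt hV hτ hU⟩
  rcases lt_or_ge 1 (V.valuation D.swap.U) with hU' | hU'
  · exact ⟨_, Or.inr (Or.inl (Or.inl rfl)),
      D.toFibreModel.swap.below_infRing_of_one_lt hV hτ hU'⟩
  rcases le_total (V.valuation D.τ ^ 5) (V.valuation D.U ^ 2) with h | h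
  · exact D.exists_isStarChart_of_le hV hτ hU h
  · obtain ⟨A, hA, hb⟩ := D.swap.exists_isStarChart_of_le hV hτ hU' (by
      have h6 := D.sq_mul_swap (V := V)
      have h7 := zero_lt_iff.2 (pow_ne_zero 2 (D.valuation_U_ne (V := V)))
      rw [← mul_le_mul_iff_right₀ h7, h6]
      exact (mul_le_mul_left h _).trans_eq (pow_add _ 5 5).symm)
    exact ⟨A, D.isStarChart_swap.1 hA, hb⟩

end StarModel

end Inose

end

noncomputable section

namespace Inose

open IsLocalRing MvPolynomial

variable {K : Type*} [Field K] [Algebra ℂ K]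

section Labels

/-- The labels of the components in even position on the chain. -/
def evenLabel (k : Fin 3) : Fin 7 ⊕ Fin 4 := .inl ⟨2 * k.1, by omega⟩

/-- The labels of the components in odd position on the chain. -/
def oddLabel (k : Fin 3) : Fin 7 ⊕ Fin 4 := .inl ⟨2 * k.1 + 1, by omega⟩

/-- The labels of the components visible on a chart of one half of a fibre of type `I*₆`. -/
def starLabs : Fin 3 ⊕ Option Bool → Finset (Fin 7 ⊕ Fin 4)
  | .inl k => {evenLabel k, oddLabel k}
  | .inr none => {.inl 0, .inr 0, .inr 1}
  | .inr (some false) => {.inr 0}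
  | .inr (some true) => {.inr 1}

/-- The action of the symmetry on the labels. -/
def starFlip : Bool → Fin 7 ⊕ Fin 4 → Fin 7 ⊕ Fin 4
  | false, x => x
  | true, .inl i => .inl (6 - i)
  | true, .inr k => .inr (k + 2)

/-- The exponents in the description of the places of the components. -/
def starDist : Fin 7 ⊕ Fin 4 → ℕ × ℕ
  | .inl i => (i.1 + 2, 1)
  | .inr k => ![(0, 0), (2, 2), (10, 0), (8, 2)] k

/-- The multiplicities of the components. -/
def starMult : Fin 7 ⊕ Fin 4 → ℕ := Sum.elim (fun _ => 2) (fun _ => 1)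

/-- The components `x` and `y` meet on the chart `e`. -/
def StarEdge (e : Bool × (Fin 3 ⊕ Option Bool)) (x y : Fin 7 ⊕ Fin 4) : Prop :=
  x ≠ y ∧ starFlip e.1 x ∈ starLabs e.2 ∧ starFlip e.1 y ∈ starLabs e.2 ∧
    (x.isLeft ∨ y.isLeft)

instance (e : Bool × (Fin 3 ⊕ Option Bool)) : DecidableRel (StarEdge e) := fun x y => by
  unfold StarEdge; infer_instance

/-- The number of common points of two components. -/
def starMeet : Fin 7 ⊕ Fin 4 → Fin 7 ⊕ Fin 4 → ℕ
  | .inl i, .inl j => if i.val + 1 = j.val ∨ j.val + 1 = i.val then 1 else 0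
  | .inl i, .inr k => if (k.val < 2 ∧ i.val = 0) ∨ (2 ≤ k.val ∧ i.val = 6) then 1 else 0
  | .inr k, .inl i => if (k.val < 2 ∧ i.val = 0) ∨ (2 ≤ k.val ∧ i.val = 6) then 1 else 0
  | .inr _, .inr _ => 0

lemma interIStar_eq (x y : Fin 7 ⊕ Fin 4) : CompleteVariety.interIStar 6 x y = starMeet x y := by
  rcases x with i | k <;> rcases y with j | l <;>
    simp only [CompleteVariety.interIStar, starMeet, Nat.cast_ite, Nat.cast_one, Nat.cast_zero]

lemma starFlip_starFlip : ∀ b x, starFlip b (starFlip b x) = x := by decide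

lemma isLeft_starFlip : ∀ b x, (starFlip b x).isLeft = x.isLeft := by decide

lemma starDist_injective : ∀ x y, starDist x = starDist y → x = y := by decide

lemma starDist_le : ∀ x, (starDist x).1 ≤ 10 := by decide

lemma starDist_flip : ∀ x, starDist (starFlip true x) = (10 - (starDist x).1, (starDist x).2) := by
  decide

lemma starMult_flip : ∀ b x, starMult (starFlip b x) = starMult x := by decide

lemma exists_starLabs : ∀ x, ∃ b e, starFlip b x ∈ starLabs e := by decide

set_option maxRecDepth 100000 in
lemma card_starEdge : ∀ x y, x ≠ y →
    (Finset.univ.filter fun e => StarEdge e x y).card = starMeet x y := by decide +kernel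

lemma starMeet_le : ∀ x y, starMeet x y ≤ 1 := by decide

lemma no_star_triangle : ∀ e, ∀ x ∈ starLabs e, ∀ y ∈ starLabs e, ∀ z ∈ starLabs e, x ≠ y → y ≠ z →
    x ≠ z → ¬ ((x.isLeft ∨ y.isLeft) ∧ (y.isLeft ∨ z.isLeft) ∧ (x.isLeft ∨ z.isLeft)) := by
  decide

lemma star_not_exceptional : ∀ x, ∑ y ∈ Finset.univ.erase x, starMult y * starMeet y x ≠
    starMult x := by decide

end Labels

namespace StarModel

variable (D : StarModel K)

/-- The charts of one half of the fibre. -/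
def halfChart : Fin 3 ⊕ Option Bool → Subalgebra ℂ K
  | .inl k => D.chainRing k
  | .inr none => D.branchRing
  | .inr (some false) => D.infRing
  | .inr (some true) => D.tipRing

lemma isHalfChart_iff {A : Subalgebra ℂ K} : D.IsHalfChart A ↔ ∃ e, A = D.halfChart e := by
  constructor
  · rintro ((rfl | rfl | rfl) | ⟨k, rfl⟩)
    exacts [⟨.inr (some false), rfl⟩, ⟨.inr none, rfl⟩, ⟨.inr (some true), rfl⟩, ⟨.inl k, rfl⟩]
  · rintro ⟨k | _ | _ | _, rfl⟩
    exacts [Or.inr ⟨k, rfl⟩, Or.inl (Or.inr (Or.inl rfl)), Or.inl (Or.inl rfl),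
      Or.inl (Or.inr (Or.inr rfl))]

/-- The equation of a component on a chart. -/
def halfEq : (e : Fin 3 ⊕ Option Bool) → Fin 7 ⊕ Fin 4 → D.halfChart e
  | .inl k, x => if x = evenLabel k then (D.isChart_a k.2).cz else (D.isChart_a k.2).cr
  | .inr none, x => if x = .inl 0 then D.isChart_b.cz else
      if x = .inr 0 then D.isChart_b.cs else D.branchTip
  | .inr (some false), _ => D.isChart_inf.cr
  | .inr (some true), _ => D.isChart_tip.cr

lemma chain_label : ∀ k : Fin 3, oddLabel k ≠ evenLabel k := by decide

lemma halfEq_even (k : Fin 3) : D.halfEq (.inl k) (evenLabel k) = (D.isChart_a k.2).cz :=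
  if_pos rfl

lemma halfEq_odd (k : Fin 3) : D.halfEq (.inl k) (oddLabel k) = (D.isChart_a k.2).cr :=
  if_neg (chain_label k)

lemma starDist_chain : ∀ k : Fin 3, starDist (evenLabel k) = (2 * k.1 + 2, 1) ∧
    starDist (oddLabel k) = (2 * k.1 + 3, 1) := by decide

lemma exists_halfCurve (e : Fin 3 ⊕ Option Bool) (x : Fin 7 ⊕ Fin 4) (hx : x ∈ starLabs e) :
    ∃ R : RationalCurve (D.halfChart e), R.g = D.halfEq e x ∧
      (∃ b : D.halfChart e, D.τ = (R.g : K) ^ starMult x * b ∧ R.φ b ≠ 0) ∧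
      ∀ hf hf', D.IsStarPlace (starDist x).1 (starDist x).2 (R.place hf hf') := by
  rcases e with k | _ | _ | _
  · simp only [starLabs, Finset.mem_insert, Finset.mem_singleton] at hx
    obtain ⟨h1, h2⟩ := starDist_chain k
    rcases hx with rfl | rfl
    · obtain ⟨R, h3, h4, h5⟩ := D.exists_curve_chain_z k.2
      refine ⟨R, ?_, h4, ?_⟩
      · exact h3.trans (D.halfEq_even k).symm
      · rw [h1]; exact h5
    · obtain ⟨R, h3, h4, h5⟩ := D.exists_curve_chain_r k.2
      refine ⟨R, ?_, h4, ?_⟩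
      · exact h3.trans (D.halfEq_odd k).symm
      · rw [h2]; exact h5
  · simp only [starLabs, Finset.mem_insert, Finset.mem_singleton] at hx
    rcases hx with rfl | rfl | rfl
    · exact D.exists_curve_branch_z
    · exact D.exists_curve_branch_s
    · exact D.exists_curve_branch_tip
  · simp only [starLabs, Finset.mem_singleton] at hx
    subst hx
    obtain ⟨R, h1, h2⟩ := D.exists_curve_star_inf
    exact ⟨R, Subtype.ext h1, h2⟩
  · simp only [starLabs, Finset.mem_singleton] at hx
    subst hx
    exact D.exists_curve_tip

variable {V : ValuationSubring K}

lemma below_halfChart (hV : Constants V) (e : Fin 3 ⊕ Option Bool) (x : Fin 7 ⊕ Fin 4)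
    (hx : x ∈ starLabs e) (h : D.IsStarPlace (starDist x).1 (starDist x).2 V) :
    Below (D.halfChart e) V ∧ V.valuation (D.halfEq e x : K) < 1 := by
  have ht := D.valuation_τ_ne (V := V)
  have hU := D.valuation_U_ne (V := V)
  rcases e with k | _ | _ | _
  · simp only [starLabs, Finset.mem_insert, Finset.mem_singleton] at hx
    obtain ⟨h1, h2⟩ := starDist_chain k
    rcases hx with rfl | rfl
    · rw [h1] at h
      obtain ⟨h3, h4, h5⟩ := h
      rw [pow_one] at h5
      refine ⟨(D.below_chainRing k hV h3).2 ⟨h5, ?_, h4.le⟩, ?_⟩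
      · rw [h4]; exact pow_le_pow_right_of_le_one' h3.le (by omega)
      · rw [halfEq_even]
        change V.valuation (D.W * D.τ ^ (k.1 + 1) / D.U) < 1
        apply lt_one_of_sq_lt_one
        rw [map_div₀, map_mul, div_pow, mul_pow, map_pow, ← pow_mul, h4, h5,
          show (k.1 + 1) * 2 = 2 * k.1 + 2 by ring, mul_div_cancel_right₀ _ (pow_ne_zero _ ht)]
        exact h3
    · rw [h2] at h
      obtain ⟨h3, h4, h5⟩ := h
      rw [pow_one] at h5
      refine ⟨(D.below_chainRing k hV h3).2 ⟨h5, h4.ge, ?_⟩, ?_⟩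
      · rw [h4]; exact pow_le_pow_right_of_le_one' h3.le (by omega)
      · rw [halfEq_odd]
        change V.valuation (D.U / D.τ ^ (k.1 + 1)) < 1
        apply lt_one_of_sq_lt_one
        rw [map_div₀, div_pow, map_pow, ← pow_mul, h4, show (k.1 + 1) * 2 = 2 * k.1 + 2 by ring,
          pow_succ, mul_div_cancel_left₀ _ (pow_ne_zero _ ht)]
        exact h3
  · simp only [starLabs, Finset.mem_insert, Finset.mem_singleton] at hx
    rcases hx with rfl | rfl | rfl
    · obtain ⟨h3, h4, h5⟩ := h
      have h4 := eq_of_sq_eq_sq (h4 : _ = V.valuation D.τ ^ 2)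
      have h5 : V.valuation D.W ^ 2 = V.valuation D.τ := h5.trans (pow_one _)
      refine ⟨(D.below_branchRing hV h3).2 ⟨h4.trans_le h3.le, h4.ge, ?_⟩, ?_⟩
      · rw [← sq_le_sq_iff_le, h4, h5, sq]
        exact mul_le_of_le_one_left' h3.le
      · change V.valuation (D.U / D.W) < 1
        apply lt_one_of_sq_lt_one
        rw [map_div₀, div_pow, h5, h4, sq, mul_div_cancel_right₀ _ ht]
        exact h3
    · obtain ⟨h3, h4, h5⟩ := h
      have h4 := eq_of_sq_eq_sq (h4.trans ((pow_zero _).trans (one_pow 2).symm))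
      have h5 := eq_of_sq_eq_sq (h5.trans ((pow_zero _).trans (one_pow 2).symm))
      refine ⟨(D.below_branchRing hV h3).2 ⟨h4.le, h3.le.trans h4.ge, (h4.trans h5.symm).le⟩, ?_⟩
      change V.valuation (D.τ / D.U) < 1
      rw [map_div₀, h4, div_one]
      exact h3
    · obtain ⟨h3, h4, h5⟩ := h
      have h4 := eq_of_sq_eq_sq (h4 : _ = V.valuation D.τ ^ 2)
      have h5 := eq_of_sq_eq_sq (h5 : _ = V.valuation D.τ ^ 2)
      refine ⟨(D.below_branchRing hV h3).2 ⟨h4.trans_le h3.le, h4.ge, (h4.trans h5.symm).le⟩, ?_⟩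
      change V.valuation (D.branchTip : K) < 1
      rw [coe_branchTip, map_div₀, map_pow, h5, h4, sq, mul_div_cancel_right₀ _ ht]
      exact h3
  · simp only [starLabs, Finset.mem_singleton] at hx
    subst hx
    obtain ⟨h3, h4, h5⟩ := h
    have h4 := eq_of_sq_eq_sq (h4.trans ((pow_zero _).trans (one_pow 2).symm))
    have h5 := eq_of_sq_eq_sq (h5.trans ((pow_zero _).trans (one_pow 2).symm))
    exact ⟨(D.below_infRing hV h3).2 ⟨h4.ge, h5.ge⟩, h3⟩
  · simp only [starLabs, Finset.mem_singleton] at hx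
    subst hx
    obtain ⟨h3, h4, h5⟩ := h
    have h4 := eq_of_sq_eq_sq (h4 : _ = V.valuation D.τ ^ 2)
    have h5 := eq_of_sq_eq_sq (h5 : _ = V.valuation D.τ ^ 2)
    refine ⟨(D.below_tipRing hV h3).2 ⟨h4, (h5.trans h4.symm).le⟩, ?_⟩
    change V.valuation D.U < 1
    rw [h4]
    exact h3

lemma IsStarPlace.eq {x y : Fin 7 ⊕ Fin 4} (h : D.IsStarPlace (starDist x).1 (starDist x).2 V)
    (h' : D.IsStarPlace (starDist y).1 (starDist y).2 V) : x = y := by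
  have h0 := zero_lt_iff.2 (D.valuation_τ_ne (V := V))
  apply starDist_injective
  have hinj := pow_right_injective₀ h0 h.1.ne
  exact Prod.ext (hinj (h.2.1.symm.trans h'.2.1)) (hinj (h.2.2.symm.trans h'.2.2))

lemma isStarPlace_swap {κ ν : ℕ} (hκ : κ ≤ 10) (h : D.swap.IsStarPlace κ ν V) :
    D.IsStarPlace (10 - κ) ν V := by
  refine ⟨h.1, ?_, h.2.2⟩
  have h1 := D.sq_mul_swap (V := V)
  have h2 : V.valuation D.swap.U ^ 2 = V.valuation D.τ ^ κ := h.2.1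
  rw [h2, ← Nat.sub_add_cancel hκ, pow_add] at h1
  exact mul_right_cancel₀ (pow_ne_zero _ D.valuation_τ_ne) h1

/-- The model or the one obtained from it by the symmetry. -/
def flip : Bool → StarModel K
  | false => D
  | true => D.swap

lemma flip_τ (b : Bool) : (D.flip b).τ = D.τ := by cases b <;> rfl

lemma isStarPlace_flip {b : Bool} {x : Fin 7 ⊕ Fin 4} :
    (D.flip b).IsStarPlace (starDist x).1 (starDist x).2 V ↔
      D.IsStarPlace (starDist (starFlip b x)).1 (starDist (starFlip b x)).2 V := by
  cases b
  · exact Iff.rfl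
  · rw [starDist_flip]
    constructor
    · exact D.isStarPlace_swap (starDist_le x)
    · intro h
      have h1 := D.swap.isStarPlace_swap (Nat.sub_le 10 (starDist x).1) (by rwa [swap_swap])
      rwa [Nat.sub_sub_self (starDist_le x)] at h1

lemma τ_mem_halfChart (e) : D.τ ∈ D.halfChart e := by
  rcases e with k | _ | _ | _
  · exact (D.chain_mem k.2).1
  · have h := (D.isChart_b.cr * D.isChart_b.cs).2
    have h1 : ((D.isChart_b.cr * D.isChart_b.cs : D.isChart_b.ring) : K) = D.τ := D.mul_tip
    rwa [h1] at h
  · exact D.isChart_inf.cr.2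
  · have h := (D.isChart_tip.cr * D.isChart_tip.cs).2
    have h1 : ((D.isChart_tip.cr * D.isChart_tip.cs : D.isChart_tip.ring) : K) = D.τ := D.mul_tip
    rwa [h1] at h

lemma tip_unit : IsUnit D.isChart_tip.cs := by
  have h := D.isChart_tip.mul_ci
  rw [map_mul, aeval_X] at h
  refine IsUnit.of_mul_eq_one (aeval ![D.isChart_tip.cr, D.isChart_tip.cs, D.isChart_tip.cz]
    (Polynomial.aeval (X 0 * X 1 : MvPolynomial (Fin 3) ℂ) D.d) * D.isChart_tip.ci) ?_
  rw [← h]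
  simp only [Matrix.cons_val]
  ring

lemma exists_halfEq_mem (e) (p : Ideal (D.halfChart e)) [hp : p.IsPrime]
    (h : (⟨D.τ, D.τ_mem_halfChart e⟩ : D.halfChart e) ∈ p) :
    ∃ x ∈ starLabs e, D.halfEq e x ∈ p := by
  rcases e with k | _ | _ | _
  · have h1 : (⟨D.τ, D.τ_mem_halfChart (.inl k)⟩ : D.halfChart (.inl k)) =
      (D.isChart_a k.2).cr ^ 2 * (D.isChart_a k.2).cz ^ 2 * D.chainUnit k.2 :=
        Subtype.ext (D.chain_τ k.2)
    rw [h1] at h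
    rcases hp.mem_or_mem h with h | h
    · rcases hp.mem_or_mem h with h | h
      · refine ⟨oddLabel k, by simp [starLabs], ?_⟩
        rw [halfEq_odd]
        exact hp.mem_of_pow_mem _ h
      · refine ⟨evenLabel k, by simp [starLabs], ?_⟩
        rw [halfEq_even]
        exact hp.mem_of_pow_mem _ h
    · exact absurd (Ideal.eq_top_of_isUnit_mem _ h (D.isUnit_chainUnit k.2)) hp.ne_top
  · have h1 : (⟨D.τ, D.τ_mem_halfChart (.inr none)⟩ : D.halfChart (.inr none)) =
      D.branchTip * D.isChart_b.cz ^ 2 * D.isChart_b.cs := Subtype.ext D.branch_τ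
    rw [h1] at h
    rcases hp.mem_or_mem h with h | h
    · rcases hp.mem_or_mem h with h | h
      · exact ⟨.inr 1, by simp [starLabs], h⟩
      · exact ⟨.inl 0, by simp [starLabs], hp.mem_of_pow_mem _ h⟩
    · exact ⟨.inr 0, by simp [starLabs], h⟩
  · exact ⟨.inr 0, by simp [starLabs], h⟩
  · have h1 : (⟨D.τ, D.τ_mem_halfChart (.inr (some true))⟩ : D.halfChart (.inr (some true))) =
      D.isChart_tip.cr * D.isChart_tip.cs := Subtype.ext D.mul_tip.symm
    rw [h1] at h
    rcases hp.mem_or_mem h with h | h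
    · exact ⟨.inr 1, by simp [starLabs], h⟩
    · exact absurd (Ideal.eq_top_of_isUnit_mem _ h D.tip_unit) hp.ne_top

lemma halfEq_pair (e) (x y : Fin 7 ⊕ Fin 4) (hx : x ∈ starLabs e) (hy : y ∈ starLabs e)
    (hxy : x ≠ y) :
    ((x.isLeft ∨ y.isLeft) ∧ (Ideal.span {D.halfEq e x, D.halfEq e y}).IsMaximal) ∨
      (¬ (x.isLeft ∨ y.isLeft) ∧ IsCoprime (D.halfEq e x) (D.halfEq e y)) := by
  rcases e with k | _ | _ | _
  · simp only [starLabs, Finset.mem_insert, Finset.mem_singleton] at hx hy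
    left
    rcases hx with rfl | rfl <;> rcases hy with rfl | rfl
    · exact absurd rfl hxy
    · refine ⟨Or.inl rfl, ?_⟩
      rw [halfEq_even, halfEq_odd]
      exact D.isMaximal_chain k.2
    · refine ⟨Or.inl rfl, ?_⟩
      rw [Set.pair_comm, halfEq_even, halfEq_odd]
      exact D.isMaximal_chain k.2
    · exact absurd rfl hxy
  · simp only [starLabs, Finset.mem_insert, Finset.mem_singleton] at hx hy
    rcases hx with rfl | rfl | rfl <;> rcases hy with rfl | rfl | rfl
    · exact absurd rfl hxy
    · exact Or.inl ⟨Or.inl rfl, D.isMaximal_branch_s⟩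
    · exact Or.inl ⟨Or.inl rfl, D.isMaximal_branch_tip⟩
    · exact Or.inl ⟨Or.inr rfl, Set.pair_comm D.isChart_b.cz D.isChart_b.cs ▸ D.isMaximal_branch_s⟩
    · exact absurd rfl hxy
    · exact Or.inr ⟨by simp, D.isCoprime_branch⟩
    · exact Or.inl ⟨Or.inr rfl, Set.pair_comm D.isChart_b.cz D.branchTip ▸ D.isMaximal_branch_tip⟩
    · exact Or.inr ⟨by simp, D.isCoprime_branch.symm⟩
    · exact absurd rfl hxy
  · simp only [starLabs, Finset.mem_singleton] at hx hy
    exact absurd (hx.trans hy.symm) hxy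
  · simp only [starLabs, Finset.mem_singleton] at hx hy
    exact absurd (hx.trans hy.symm) hxy

lemma isStarChart_iff {A : Subalgebra ℂ K} :
    D.IsStarChart A ↔ ∃ e : Bool × (Fin 3 ⊕ Option Bool), A = (D.flip e.1).halfChart e.2 := by
  rw [IsStarChart, isHalfChart_iff, isHalfChart_iff]
  constructor
  · rintro (⟨e, rfl⟩ | ⟨e, rfl⟩)
    exacts [⟨(false, e), rfl⟩, ⟨(true, e), rfl⟩]
  · rintro ⟨⟨_ | _, e⟩, rfl⟩
    exacts [Or.inl ⟨e, rfl⟩, Or.inr ⟨e, rfl⟩]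

lemma starEdge_unique {e e' : Bool × (Fin 3 ⊕ Option Bool)} {x y : Fin 7 ⊕ Fin 4}
    (h : StarEdge e x y) (h' : StarEdge e' x y) : e = e' := by
  have h1 : (Finset.univ.filter fun e => StarEdge e x y).card ≤ 1 :=
    (card_starEdge x y h.1).trans_le (starMeet_le x y)
  exact Finset.card_le_one.1 h1 _ (by simpa using h) _ (by simpa using h')

/-- The components and their intersections, as seen on the charts of a fibre of type `I*₆`. -/
theorem exists_starAtlas (Y : CompleteVariety K) (hY : ∀ A, D.IsStarChart A → A ∈ Y.charts)
    (hmor : ∀ P ∈ Y.points, D.τ ∈ P.carrier ∨ D.τ⁻¹ ∈ P.carrier) :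
    ∃ F : FibreAtlas Y D.τ starMult, ∃ f : F.E ≃ Bool × (Fin 3 ⊕ Option Bool),
      ∀ e a b, F.edge e a b ↔ StarEdge (f e) a b := by
  have hCh (e : Bool × (Fin 3 ⊕ Option Bool)) : (D.flip e.1).halfChart e.2 ∈ Y.charts :=
    hY _ (D.isStarChart_iff.2 ⟨e, rfl⟩)
  let lab (e : Bool × (Fin 3 ⊕ Option Bool)) (j : {x // x ∈ starLabs e.2}) : Fin 7 ⊕ Fin 4 :=
    starFlip e.1 j.1
  have hlab (e) (j) : starFlip e.1 (lab e j) = j.1 := starFlip_starFlip _ _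
  choose curve curve_g curve_b curve_place using
    fun (e : Bool × (Fin 3 ⊕ Option Bool)) (j : {x // x ∈ starLabs e.2}) =>
      (D.flip e.1).exists_halfCurve e.2 j.1 j.2
  have lab_surjective (i : Fin 7 ⊕ Fin 4) : ∃ e j, lab e j = i := by
    obtain ⟨b, e, h⟩ := exists_starLabs i
    exact ⟨(b, e), ⟨_, h⟩, starFlip_starFlip _ _⟩
  obtain ⟨C, C_injective, C_eq⟩ := Y.exists_components hCh lab curve lab_surjective
    (fun x => D.IsStarPlace (starDist x).1 (starDist x).2)
    (fun e j => D.isStarPlace_flip.1 (curve_place e j _ _))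
    (fun e j V hV h => by
      rw [curve_g]
      exact (D.flip e.1).below_halfChart hV e.2 j.1 j.2 (D.isStarPlace_flip.2 h))
    (fun i j V hV => IsStarPlace.eq D)
  have hmem (e : Bool × (Fin 3 ⊕ Option Bool)) : D.τ ∈ (D.flip e.1).halfChart e.2 := by
    rw [← D.flip_τ e.1]
    exact (D.flip e.1).τ_mem_halfChart e.2
  refine ⟨{
    E := Bool × (Fin 3 ⊕ Option Bool)
    finiteE := inferInstance
    Ch := fun e => (D.flip e.1).halfChart e.2
    mem_charts := hCh
    ne_zero := D.τ_ne
    mem_or_inv_mem := hmor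
    cover := ?_
    J := fun e => {x // x ∈ starLabs e.2}
    lab := lab
    curve := curve
    C := C
    C_injective := C_injective
    localRing_eq := C_eq
    lab_injective := ?_
    lab_surjective := lab_surjective
    mult_pos := by decide
    factor := ?_
    mem := hmem
    exists_mem := ?_
    edge := StarEdge
    edge_or := ?_
    exists_of_edge := ?_
    no_triangle := ?_
    edge_disjoint := ?_ }, Equiv.refl _, fun e a b => Iff.rfl⟩
  · intro V hV h1 h2
    rw [inv_mem_iff_one_le D.τ_ne, not_le] at h2
    obtain ⟨A, hA, hb⟩ := D.exists_isStarChart hV h2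
    obtain ⟨e, rfl⟩ := D.isStarChart_iff.1 hA
    exact ⟨e, hb⟩
  · intro e i j h
    apply Subtype.ext
    rw [← hlab e i, ← hlab e j, h]
  · intro e j
    obtain ⟨b, h1, h2⟩ := curve_b e j
    rw [D.flip_τ] at h1
    exact ⟨b, by rw [starMult_flip]; exact h1, h2⟩
  · intro e p hp h
    obtain ⟨x, hx, h1⟩ := (D.flip e.1).exists_halfEq_mem e.2 p (by
      convert h using 2
      exact D.flip_τ e.1)
    refine ⟨⟨x, hx⟩, ?_⟩
    rw [curve_g]
    exact h1
  · intro e i j hij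
    rw [curve_g, curve_g]
    have hne : lab e i ≠ lab e j := fun h => hij (Subtype.ext (by rw [← hlab e i, ← hlab e j, h]))
    have h1 := (D.flip e.1).halfEq_pair e.2 i.1 j.1 i.2 j.2 (fun h => hij (Subtype.ext h))
    have h2 : StarEdge e (lab e i) (lab e j) ↔ (i.1.isLeft ∨ j.1.isLeft) := by
      rw [StarEdge, hlab, hlab, isLeft_starFlip, isLeft_starFlip]
      exact ⟨fun h => h.2.2.2, fun h => ⟨hne, i.2, j.2, h⟩⟩
    rw [h2]
    exact h1
  · intro e a b h
    refine ⟨⟨_, h.2.1⟩, ⟨_, h.2.2.1⟩, ?_, starFlip_starFlip _ _, starFlip_starFlip _ _⟩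
    intro h1
    have h2 := congrArg (starFlip e.1) (congrArg Subtype.val h1)
    rw [starFlip_starFlip, starFlip_starFlip] at h2
    exact h.1 h2
  · rintro e a b c hab hbc hac ⟨h1, h2, h3⟩
    have hinj {x y} (h : x ≠ y) : starFlip e.1 x ≠ starFlip e.1 y := fun h' => h (by
      rw [← starFlip_starFlip e.1 x, h', starFlip_starFlip])
    refine no_star_triangle e.2 _ h1.2.1 _ h1.2.2.1 _ h2.2.2.1 (hinj hab) (hinj hbc) (hinj hac) ?_
    simp only [isLeft_starFlip]
    exact ⟨h1.2.2.2, h2.2.2.2, h3.2.2.2⟩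
  · intro e e' a b hne h h'
    exact absurd (starEdge_unique h h') hne

theorem isFibreIStar (Y : CompleteVariety K) (hY : ∀ A, D.IsStarChart A → A ∈ Y.charts)
    (hmor : ∀ P ∈ Y.points, D.τ ∈ P.carrier ∨ D.τ⁻¹ ∈ P.carrier) :
    (∀ P ∈ Y.closedPoints, P.Vanishes D.τ → IsRegularLocalRing P.carrier) ∧
      Y.IsFibreIStar D.τ 6 ∧ ¬ Y.IsSmoothFibre D.τ := by
  obtain ⟨F, f, hf⟩ := D.exists_starAtlas Y hY hmor
  refine ⟨fun P hP hPτ => F.isRegularLocalRing hP hPτ, ?_, ?_⟩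
  · have h1 := F.hasFibreConfiguration (CompleteVariety.interIStar 6) (by
      intro a b hab
      have : {e | F.edge e a b} =
          f.symm '' ((Finset.univ.filter fun e => StarEdge e a b : Finset _) : Set _) := by
        ext e
        simp only [Set.mem_ofPred_eq, hf, Set.mem_image, Finset.coe_filter, Finset.mem_univ, true_and]
        exact ⟨fun h => ⟨f e, h, f.symm_apply_apply e⟩,
          fun ⟨e', h1, h2⟩ => by rw [← h2, f.apply_symm_apply]; exact h1⟩
      rw [this, f.symm.injective.encard_image, Set.encard_coe_eq_coe_finsetCard,
        card_starEdge a b hab, interIStar_eq])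
    have h2 : (fun i => ((starMult i : ℕ) : ℕ∞)) = Sum.elim (fun _ => 2) (fun _ => 1) := by
      ext i
      rcases i with i | i <;> rfl
    rw [h2] at h1
    exact h1
  · refine F.not_isSmoothFibre (e := f.symm (false, .inl 0)) (a := .inl 0) (b := .inl 1) (by decide) ?_
    rw [hf, f.apply_symm_apply]
    decide

end StarModel

end Inose

end

noncomputable section

namespace Inose

open IsLocalRing MvPolynomial

variable {K : Type*} [Field K] [Algebra ℂ K]

lemma polynomial_aeval_mem {A : Subalgebra ℂ K} {x : K} (hx : x ∈ A) (p : Polynomial ℂ) :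
    Polynomial.aeval x p ∈ A :=
  map_polynomial_aeval A.val ⟨x, hx⟩ p ▸ (Polynomial.aeval (⟨x, hx⟩ : A) p).2

lemma mem_of_mem_centre {A : Subalgebra ℂ K} {V : ValuationSubring K} (hA : Below A V) {f : K}
    (hf : f ∈ (centre hA).carrier) : f ∈ V := (centre_isDominatedBy hA).1 f hf

lemma valuation_le_of_mem_centre {A : Subalgebra ℂ K} {V : ValuationSubring K} (hA : Below A V)
    {f : K} (hf : f ∈ (centre hA).carrier) : V.valuation f ≤ 1 :=
  (ValuationSubring.valuation_le_one_iff _ _).2 (mem_of_mem_centre hA hf)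

lemma inv_mem_centre_of_eq_one {A : Subalgebra ℂ K} {V : ValuationSubring K} (hA : Below A V)
    {f : K} (hf : f ∈ (centre hA).carrier) (h : V.valuation f = 1) : f⁻¹ ∈ (centre hA).carrier := by
  refine inv_mem_centre hA hf ?_
  rw [← ValuationSubring.valuation_le_one_iff, map_inv₀, h, inv_one]

/-- Generators `x, u, v` of a function field satisfying an equation
`v² = u (u - P(x) - 1) (u - P(x) + 1)`. -/
structure LegendreModel (K : Type*) [Field K] [Algebra ℂ K] where
  x : K
  u : K
  v : K
  P : Polynomial ℂ
  frame : IsFrame x u v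
  rel : v ^ 2 = u * (u - Polynomial.aeval x P - 1) * (u - Polynomial.aeval x P + 1)
  disc_ne : P ^ 2 - 1 ≠ 0

namespace LegendreModel

variable (S : LegendreModel K)

lemma x_ne : S.x ≠ 0 := S.frame.ne_zero.1
lemma u_ne : S.u ≠ 0 := S.frame.ne_zero.2.1
lemma v_ne : S.v ≠ 0 := S.frame.ne_zero.2.2

/-- The discriminant, as a rational function. -/
def disc : K := Polynomial.aeval S.x (S.P ^ 2 - 1)

lemma disc_ne_zero : S.disc ≠ 0 := aeval_ne_zero_of_algebraicIndependent S.frame.ind S.disc_ne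

/-- The right hand side of the equation. -/
def affPoly : MvPolynomial (Fin 2) ℂ :=
  X 1 * (X 1 - Polynomial.aeval (X 0) S.P - 1) * (X 1 - Polynomial.aeval (X 0) S.P + 1)

/-- The left hand side of the equation around the zero section. -/
def zeroPoly : MvPolynomial (Fin 2) ℂ :=
  (1 - (Polynomial.aeval (X 0) S.P + 1) * X 1) * (1 - (Polynomial.aeval (X 0) S.P - 1) * X 1)

lemma aeval_affPoly {R : Type*} [CommRing R] [Algebra ℂ R] (r s : R) : aeval ![r, s] S.affPoly =
    s * (s - Polynomial.aeval r S.P - 1) * (s - Polynomial.aeval r S.P + 1) := by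
  simp [affPoly, aeval_polynomial_aeval]

lemma aeval_zeroPoly {R : Type*} [CommRing R] [Algebra ℂ R] (r s : R) : aeval ![r, s] S.zeroPoly =
    (1 - (Polynomial.aeval r S.P + 1) * s) * (1 - (Polynomial.aeval r S.P - 1) * s) := by
  simp [zeroPoly, aeval_polynomial_aeval]

lemma aeval_disc {R : Type*} [CommRing R] [Algebra ℂ R] (r s z : R) :
    aeval ![r, s, z] (Polynomial.aeval (X 0) (S.P ^ 2 - 1) : MvPolynomial (Fin 3) ℂ) =
      Polynomial.aeval r (S.P ^ 2 - 1) := by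
  rw [aeval_polynomial_aeval, aeval_X]
  rfl

lemma isChart_aff : IsChart S.x S.u S.v 1 S.affPoly (Polynomial.aeval (X 0) (S.P ^ 2 - 1)) where
  frame := S.frame
  relPrime := isRelPrime_one_left
  ne_zero := one_ne_zero
  rel := by rw [map_one, one_mul, S.rel, aeval_affPoly]
  Δ_ne_zero := by rw [aeval_disc]; exact S.disc_ne_zero

lemma zeroPoly_eval_ne : aeval ![(0 : ℂ), 0] S.zeroPoly ≠ 0 := by
  rw [aeval_zeroPoly]; simp

lemma zero_rel : aeval ![S.x, S.u⁻¹] S.zeroPoly * (S.u / S.v) ^ 2 = S.u⁻¹ := by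
  have hu := S.u_ne
  have hv := S.v_ne
  have := S.rel
  rw [aeval_zeroPoly]
  field_simp
  linear_combination -this

lemma isChart_zero : IsChart S.x S.u⁻¹ (S.u / S.v) S.zeroPoly (X 1)
    (Polynomial.aeval (X 0) (S.P ^ 2 - 1)) where
  frame := by
    have hu := S.u_ne
    have hv := S.v_ne
    refine S.frame.change' (l := S.u * (S.v ^ 2)⁻¹) (left_mem_adjoin _ _)
      (inv_mem (right_mem_adjoin _ _)) (left_mem_adjoin _ _) ?_
      (mul_mem (right_mem_adjoin _ _) (inv_mem S.frame.sq_mem))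
      (mul_ne_zero hu (inv_ne_zero (pow_ne_zero _ hv))) (by field_simp)
    have := inv_mem (right_mem_adjoin S.x S.u⁻¹)
    rwa [inv_inv] at this
  relPrime := (isRelPrime_X ![0, 0] (by simp) S.zeroPoly_eval_ne).symm
  ne_zero := fun h => S.zeroPoly_eval_ne (by rw [h, map_zero])
  rel := by rw [S.zero_rel]; simp
  Δ_ne_zero := by rw [aeval_disc]; exact S.disc_ne_zero

/-- The coordinate ring of the affine part of the family over the set of regular values. -/
abbrev affRing : Subalgebra ℂ K := S.isChart_aff.ring

/-- The coordinate ring of a neighbourhood of the zero section. -/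
abbrev zeroRing : Subalgebra ℂ K := S.isChart_zero.ring

/-- The charts of the family over the set of regular values. -/
def IsGenChart (A : Subalgebra ℂ K) : Prop := A = S.affRing ∨ A = S.zeroRing

variable {V : ValuationSubring K}

lemma below_affRing (hV : Constants V) :
    Below S.affRing V ↔ S.x ∈ V ∧ S.u ∈ V ∧ S.v ∈ V ∧ S.disc⁻¹ ∈ V := by
  rw [IsChart.below_ring _ hV, aeval_disc]
  rfl

lemma below_zeroRing (hV : Constants V) :
    Below S.zeroRing V ↔ S.x ∈ V ∧ S.u⁻¹ ∈ V ∧ S.u / S.v ∈ V ∧ S.disc⁻¹ ∈ V := by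
  rw [IsChart.below_ring _ hV, aeval_disc]
  rfl

lemma glues_aff_zero (hV : Constants V) : Glues V S.affRing S.zeroRing := by
  intro hb hb'
  obtain ⟨m1, m2, m3, -⟩ := (IsChart.ring_le_iff S.isChart_zero _).1 (le_centre hb')
  obtain ⟨-, e1, -, -⟩ := (S.below_affRing hV).1 hb
  have m4 := mem_centre_of_inv hb' m2 e1
  refine S.isChart_aff.ring_le_centre hV hb hb' m1 m4 ?_
  have hu := S.u_ne
  have hv := S.v_ne
  have h : S.v = S.u ^ 2 * aeval ![S.x, S.u⁻¹] S.zeroPoly * (S.u / S.v) := by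
    have := S.zero_rel
    have h2 : aeval ![S.x, S.u⁻¹] S.zeroPoly * (S.u / S.v) = S.u⁻¹ * (S.v / S.u) := by
      generalize aeval ![S.x, S.u⁻¹] S.zeroPoly = G at this ⊢
      rw [← this]
      field_simp
    rw [mul_assoc, h2]
    field_simp
  have m5 : aeval ![S.x, S.u⁻¹] S.zeroPoly ∈ (centre hb').carrier := by
    have h1 := polynomial_aeval_mem m1 S.P
    rw [aeval_zeroPoly]
    exact mul_mem (sub_mem (one_mem _) (mul_mem (add_mem h1 (one_mem _)) m2))
      (sub_mem (one_mem _) (mul_mem (sub_mem h1 (one_mem _)) m2))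
  rw [h]
  exact mul_mem (mul_mem (pow_mem m4 _) m5) m3

lemma glues_zero_aff (hV : Constants V) : Glues V S.zeroRing S.affRing := by
  intro hb hb'
  obtain ⟨m1, m2, m3, -⟩ := (IsChart.ring_le_iff S.isChart_aff _).1 (le_centre hb')
  obtain ⟨-, e1, e2, -⟩ := (S.below_zeroRing hV).1 hb
  have m4 := inv_mem_centre hb' m2 e1
  refine S.isChart_zero.ring_le_centre hV hb hb' m1 m4 (mem_centre_of_inv hb' ?_ e2)
  rw [inv_div, div_eq_mul_inv]
  exact mul_mem m3 m4

lemma centre_eq_of_isGenChart (hV : Constants V) {A B : Subalgebra ℂ K} (hA : S.IsGenChart A)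
    (hB : S.IsGenChart B) (h : Below A V) (h' : Below B V) : centre h = centre h' := by
  rcases hA with rfl | rfl <;> rcases hB with rfl | rfl
  · rfl
  · exact centre_eq_of_le h h' (S.glues_aff_zero hV h h') (S.glues_zero_aff hV h' h)
  · exact centre_eq_of_le h h' (S.glues_zero_aff hV h h') (S.glues_aff_zero hV h' h)
  · rfl

lemma v_mem (hV : Constants V) (hx : S.x ∈ V) (hu : S.u ∈ V) : S.v ∈ V := by
  have hp : Polynomial.aeval S.x S.P ∈ V := polynomial_aeval_mem (A := hV.subalgebra) hx S.P
  have h : S.v ^ 2 ∈ V := by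
    rw [S.rel]
    exact mul_mem (mul_mem hu (sub_mem (sub_mem hu hp) (one_mem _)))
      (add_mem (sub_mem hu hp) (one_mem _))
  rw [← ValuationSubring.valuation_le_one_iff, map_pow] at h
  rw [← ValuationSubring.valuation_le_one_iff]
  by_contra h1
  exact (one_lt_pow₀ (not_le.1 h1) two_ne_zero).not_ge h

lemma below_zeroRing_of_notMem (hV : Constants V) (hx : S.x ∈ V) (hd : S.disc⁻¹ ∈ V)
    (hu : S.u ∉ V) : Below S.zeroRing V ∧ V.valuation S.u⁻¹ < 1 ∧ V.valuation (S.u / S.v) < 1 := by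
  have hu1 : V.valuation S.u⁻¹ < 1 := by
    rw [map_inv₀]
    apply inv_lt_one_of_one_lt₀
    rwa [← ValuationSubring.valuation_le_one_iff, not_le] at hu
  have hp : V.valuation (Polynomial.aeval S.x S.P) ≤ 1 :=
    (ValuationSubring.valuation_le_one_iff _ _).2
      (polynomial_aeval_mem (A := hV.subalgebra) hx S.P)
  have key {f : K} (hf : V.valuation f ≤ 1) : V.valuation (1 - f * S.u⁻¹) = 1 := by
    refine Valuation.map_one_sub_of_lt _ ?_
    rw [map_mul]
    exact valuation_mul_lt_one hf hu1
  have h := congrArg V.valuation S.zero_rel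
  rw [aeval_zeroPoly, map_mul, map_mul, key (Valuation.map_add_le _ hp (by simp)),
    key (Valuation.map_sub_le _ hp (by simp)), one_mul, one_mul, map_pow] at h
  have h1 : V.valuation (S.u / S.v) < 1 := lt_one_of_sq_lt_one (h ▸ hu1)
  refine ⟨(S.below_zeroRing hV).2 ⟨hx, ?_, ?_, hd⟩, hu1, h1⟩
  · exact (ValuationSubring.valuation_le_one_iff _ _).1 hu1.le
  · exact (ValuationSubring.valuation_le_one_iff _ _).1 h1.le

lemma exists_isGenChart (hV : Constants V) (hx : S.x ∈ V) (hd : S.disc⁻¹ ∈ V) :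
    ∃ A, S.IsGenChart A ∧ Below A V := by
  by_cases hu : S.u ∈ V
  · exact ⟨_, Or.inl rfl, (S.below_affRing hV).2 ⟨hx, hu, S.v_mem hV hx hu, hd⟩⟩
  · exact ⟨_, Or.inr rfl, (S.below_zeroRing_of_notMem hV hx hd hu).1⟩

end LegendreModel

/-- The model `D` of a neighbourhood of a fibre, seen in the coordinates `x, u, v`. -/
structure FibreModel.Presents (D : FibreModel K) (S : LegendreModel K) where
  i : ℤ
  j : ℤ
  k : ℤ
  F : Polynomial ℂ
  τ_eq : (∃ c : ℂ, D.τ = S.x - algebraMap ℂ K c) ∨ D.τ = S.x⁻¹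
  u_eq : S.u = D.τ ^ i * D.U + Polynomial.aeval S.x F
  v_eq : S.v = D.τ ^ j * (D.U * D.W)
  disc_eq : S.disc = D.τ ^ k * Polynomial.aeval D.τ D.d

namespace FibreModel

variable (D : FibreModel K) {V : ValuationSubring K} {A : Subalgebra ℂ K}

lemma zpow_mem_centre (hA : Below A V) (hτ : D.τ ∈ (centre hA).carrier)
    (h1 : V.valuation D.τ = 1) (z : ℤ) : D.τ ^ z ∈ (centre hA).carrier := by
  cases z with
  | ofNat n => simpa using pow_mem hτ n
  | negSucc n =>
    rw [zpow_negSucc, ← inv_pow]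
    exact pow_mem (inv_mem_centre_of_eq_one hA hτ h1) _

lemma valuation_zpow (h1 : V.valuation D.τ = 1) (z : ℤ) : V.valuation (D.τ ^ z) = 1 := by
  rw [map_zpow₀, h1, one_zpow]

lemma valuation_c₁ (hτ : Polynomial.aeval D.τ D.d ≠ 0) (hV : Constants V) (h : V.valuation D.τ ≤ 1)
    (hd : (Polynomial.aeval D.τ D.d)⁻¹ ∈ V) : V.valuation (Polynomial.aeval D.τ D.c₁) = 1 := by
  refine le_antisymm (hV.valuation_aeval_le_one h _) ?_
  obtain ⟨q, hq⟩ := D.dvd₁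
  rw [inv_mem_iff_one_le hτ, hq, map_mul, map_mul] at hd
  exact hd.trans (mul_le_of_le_one_right' (hV.valuation_aeval_le_one h _))

/-- The denominator at infinity is invertible. -/
lemma valuation_infPoly (hV : Constants V) (h : Below D.infRing V) :
    V.valuation (aeval ![D.τ, D.U⁻¹] D.infPoly) = 1 := by
  obtain ⟨h1, h2, h3, h4⟩ := (IsChart.below_ring D.isChart_inf hV).1 h
  rw [aeval_polynomial_aeval, aeval_X] at h4
  have hG := h _ (aeval ![D.isChart_inf.cr, D.isChart_inf.cs] D.infPoly).2
  rw [IsChart.coe_aeval₂, ← ValuationSubring.valuation_le_one_iff] at hG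
  rw [← ValuationSubring.valuation_le_one_iff] at h1 h2 h3
  refine le_antisymm hG ?_
  by_contra hlt
  rw [not_le] at hlt
  have h5 := congrArg V.valuation D.infPoly_rel
  rw [map_mul, map_pow] at h5
  have hU : V.valuation D.U⁻¹ < 1 := by
    rw [← h5, mul_comm]
    exact valuation_mul_lt_one (pow_le_one' h3 _) hlt
  refine hlt.ne ?_
  rw [aeval_infPoly, add_assoc, Valuation.map_add_eq_of_lt_left]
  · exact D.valuation_c₁ D.d_ne hV h1 h4
  · rw [D.valuation_c₁ D.d_ne hV h1 h4]
    apply Valuation.map_add_lt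
    · rw [map_mul]
      exact valuation_mul_lt_one (hV.valuation_aeval_le_one h1 _) hU
    · rw [map_mul, map_mul, map_pow, map_pow]
      exact valuation_mul_lt_one (mul_le_one' (hV.valuation_aeval_le_one h1 _)
        (pow_le_one' h1 _)) (pow_lt_one₀ zero_le hU two_ne_zero)

namespace Presents

variable {D} {S : LegendreModel K}

lemma x_mem (E : D.Presents S) (hA : Below A V) (hτ : D.τ ∈ (centre hA).carrier) (h1 : V.valuation D.τ = 1) :
    S.x ∈ (centre hA).carrier := by
  rcases E.τ_eq with ⟨c, h⟩ | h
  · have := add_mem hτ ((centre hA).carrier.algebraMap_mem c)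
    rwa [h, sub_add_cancel] at this
  · have := inv_mem_centre_of_eq_one hA hτ h1
    rwa [h, inv_inv] at this

lemma τ_mem (E : D.Presents S) (hA : Below A V) (hx : S.x ∈ (centre hA).carrier) (h1 : V.valuation D.τ = 1) :
    D.τ ∈ (centre hA).carrier := by
  rcases E.τ_eq with ⟨c, h⟩ | h
  · rw [h]
    exact sub_mem hx ((centre hA).carrier.algebraMap_mem c)
  · rw [h]
    refine inv_mem_centre hA hx ?_
    rw [← h, ← ValuationSubring.valuation_le_one_iff, h1]

lemma disc_inv_mem (E : D.Presents S) (h1 : V.valuation D.τ = 1) (hd : (Polynomial.aeval D.τ D.d)⁻¹ ∈ V) :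
    S.disc⁻¹ ∈ V := by
  rw [inv_mem_iff_one_le S.disc_ne_zero, E.disc_eq, map_mul, D.valuation_zpow h1, one_mul,
    ← inv_mem_iff_one_le D.d_ne]
  exact hd

end Presents

/-- The chart `A` agrees, near the centre of `V`, with the part of the surface where `U` is
invertible and `W` is regular. -/
def IsTorusChart (hA : Below A V) : Prop :=
  D.U ∈ (centre hA).carrier ∧ D.U⁻¹ ∈ (centre hA).carrier ∧ D.W ∈ (centre hA).carrier ∧
    ∀ B (hB : Below B V), D.τ ∈ (centre hB).carrier → D.U ∈ (centre hB).carrier →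
      D.U⁻¹ ∈ (centre hB).carrier → D.W ∈ (centre hB).carrier → A ≤ (centre hB).carrier

lemma IsTorusChart.of_swap {hA : Below A V} (hτ : D.τ ∈ (centre hA).carrier)
    (h1 : V.valuation D.τ = 1) (h : D.swap.IsTorusChart hA) : D.IsTorusChart hA := by
  have hτ0 := D.τ_ne
  have hU0 := D.U_ne
  have key {B : Subalgebra ℂ K} (hB : Below B V) (hτ : D.τ ∈ (centre hB).carrier) :
      (D.U ∈ (centre hB).carrier ↔ D.swap.U⁻¹ ∈ (centre hB).carrier) ∧
      (D.U⁻¹ ∈ (centre hB).carrier ↔ D.swap.U ∈ (centre hB).carrier) := by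
    have h2 := pow_mem hτ D.n
    have h3 := pow_mem (inv_mem_centre_of_eq_one hB hτ h1) D.n
    refine ⟨⟨fun h => ?_, fun h => ?_⟩, ⟨fun h => ?_, fun h => ?_⟩⟩
    · have : D.swap.U⁻¹ = D.U * D.τ⁻¹ ^ D.n := by
        rw [inv_pow]; exact (inv_div _ _).trans (div_eq_mul_inv _ _)
      rw [this]
      exact mul_mem h h3
    · have : D.U = D.swap.U⁻¹ * D.τ ^ D.n := by
        change _ = (D.τ ^ D.n / D.U)⁻¹ * _
        field_simp
      rw [this]
      exact mul_mem h h2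
    · change D.τ ^ D.n / D.U ∈ _
      rw [div_eq_mul_inv]
      exact mul_mem h2 h
    · have : D.U⁻¹ = D.swap.U * D.τ⁻¹ ^ D.n := by
        change _ = (D.τ ^ D.n / D.U) * _
        rw [inv_pow]
        field_simp
      rw [this]
      exact mul_mem h h3
  obtain ⟨m1, m2, m3, m4⟩ := h
  exact ⟨(key hA hτ).1.2 m2, (key hA hτ).2.2 m1, m3, fun B hB n1 n2 n3 n4 =>
    m4 B hB n1 ((key hB n1).2.1 n3) ((key hB n1).1.1 n2) n4⟩

namespace Presents

variable {D} {S : LegendreModel K}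

/-- On a neighbourhood of the centre of `V`, the chart `A` agrees with a chart of the family over
the set of regular values. -/
def _root_.Inose.LegendreModel.IsGenAt (S : LegendreModel K) (hA : Below A V) : Prop :=
  ∃ B, S.IsGenChart B ∧ ∃ hB : Below B V, centre hA = centre hB

lemma isGenAt_of_torus (E : D.Presents S) (hV : Constants V) {hA : Below A V} (hτ : D.τ ∈ (centre hA).carrier)
    (h1 : V.valuation D.τ = 1) (hd : (Polynomial.aeval D.τ D.d)⁻¹ ∈ V)
    (h : D.IsTorusChart hA) : S.IsGenAt hA := by
  obtain ⟨m1, m2, m3, m4⟩ := h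
  have hx := E.x_mem hA hτ h1
  have hu : S.u ∈ (centre hA).carrier := by
    rw [E.u_eq]
    exact add_mem (mul_mem (D.zpow_mem_centre hA hτ h1 _) m1) (polynomial_aeval_mem hx _)
  have hv : S.v ∈ (centre hA).carrier := by
    rw [E.v_eq]
    exact mul_mem (D.zpow_mem_centre hA hτ h1 _) (mul_mem m1 m3)
  have hB : Below S.affRing V := (S.below_affRing hV).2 ⟨mem_of_mem_centre hA hx,
    mem_of_mem_centre hA hu, mem_of_mem_centre hA hv, E.disc_inv_mem h1 hd⟩
  refine ⟨_, Or.inl rfl, hB, centre_eq_of_le _ _ ?_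
    (S.isChart_aff.ring_le_centre hV hB hA hx hu hv)⟩
  obtain ⟨n1, n2, n3, -⟩ := (IsChart.ring_le_iff S.isChart_aff _).1 (le_centre hB)
  have n4 := E.τ_mem hB n1 h1
  have hτ0 := D.τ_ne
  have hU0 := D.U_ne
  have n5 : D.U ∈ (centre hB).carrier := by
    have : D.U = (S.u - Polynomial.aeval S.x E.F) * D.τ ^ (-E.i) := by
      rw [E.u_eq, zpow_neg]
      have := zpow_ne_zero E.i hτ0
      field_simp
      ring
    rw [this]
    exact mul_mem (sub_mem n2 (polynomial_aeval_mem n1 _)) (D.zpow_mem_centre hB n4 h1 _)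
  have n6 := inv_mem_centre hB n5 (mem_of_mem_centre hA m2)
  refine m4 _ hB n4 n5 n6 ?_
  have : D.W = S.v * D.τ ^ (-E.j) * D.U⁻¹ := by
    rw [E.v_eq, zpow_neg]
    have := zpow_ne_zero E.j hτ0
    field_simp
  rw [this]
  exact mul_mem (mul_mem n3 (D.zpow_mem_centre hB n4 h1 _)) n6

lemma isGenAt_inf (E : D.Presents S) (hV : Constants V) (hA : Below D.infRing V) (h1 : V.valuation D.τ = 1) :
    S.IsGenAt hA := by
  obtain ⟨m1, m2, m3, -⟩ := (IsChart.ring_le_iff D.isChart_inf _).1 (le_centre hA)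
  obtain ⟨-, -, e3, e4⟩ := (IsChart.below_ring D.isChart_inf hV).1 hA
  rw [aeval_polynomial_aeval, aeval_X] at e4
  replace e4 : (Polynomial.aeval D.τ D.d)⁻¹ ∈ V := e4
  have hG := D.valuation_infPoly hV hA
  have hτ0 := D.τ_ne
  have hU0 := D.U_ne
  have hW0 := D.W_ne
  by_cases hU : D.U ∈ V
  · have hW : D.W ∈ V := by
      have h2 := congrArg V.valuation D.infPoly_rel
      rw [map_mul, hG, one_mul, map_pow, map_inv₀, map_inv₀, inv_pow, inv_inj] at h2
      rw [← ValuationSubring.valuation_le_one_iff] at hU ⊢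
      by_contra h3
      exact (one_lt_pow₀ (not_le.1 h3) two_ne_zero).not_ge (h2 ▸ hU)
    refine E.isGenAt_of_torus hV m1 h1 e4 ⟨mem_centre_of_inv hA m2 hU, m2,
      mem_centre_of_inv hA m3 hW, fun B hB n1 n2 n3 n4 => ?_⟩
    exact D.isChart_inf.ring_le_centre hV hA hB n1 n3 (inv_mem_centre hB n4 e3)
  have hU1 : V.valuation D.U⁻¹ < 1 := by
    rw [map_inv₀]
    apply inv_lt_one_of_one_lt₀
    rwa [← ValuationSubring.valuation_le_one_iff, not_le] at hU
  have hx := E.x_mem hA m1 h1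
  have hf := polynomial_aeval_mem hx E.F
  set f := Polynomial.aeval S.x E.F with hfdef
  have hτi := zpow_ne_zero E.i hτ0
  have hτj := zpow_ne_zero E.j hτ0
  set g := D.τ ^ E.i + f * D.U⁻¹ with hg
  have hgm : g ∈ (centre hA).carrier := add_mem (D.zpow_mem_centre hA m1 h1 _) (mul_mem hf m2)
  have hg1 : V.valuation g = 1 := by
    rw [hg, Valuation.map_add_eq_of_lt_left, D.valuation_zpow h1]
    rw [D.valuation_zpow h1, map_mul]
    exact valuation_mul_lt_one (valuation_le_of_mem_centre hA hf) hU1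
  have hg0 : g ≠ 0 := by
    intro h
    rw [h, map_zero] at hg1
    exact zero_ne_one hg1
  have hug : S.u = D.U * g := by
    rw [E.u_eq, hg, ← hfdef]
    field_simp
  have hu : S.u⁻¹ ∈ (centre hA).carrier := by
    rw [hug, mul_inv]
    exact mul_mem m2 (inv_mem_centre_of_eq_one hA hgm hg1)
  have hz : S.u / S.v ∈ (centre hA).carrier := by
    have : S.u / S.v = g * D.τ ^ (-E.j) * D.W⁻¹ := by
      rw [hug, E.v_eq, zpow_neg]
      field_simp
    rw [this]
    exact mul_mem (mul_mem hgm (D.zpow_mem_centre hA m1 h1 _)) m3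
  have hB : Below S.zeroRing V := (S.below_zeroRing hV).2 ⟨mem_of_mem_centre hA hx,
    mem_of_mem_centre hA hu, mem_of_mem_centre hA hz, E.disc_inv_mem h1 e4⟩
  refine ⟨_, Or.inr rfl, hB, centre_eq_of_le _ _ ?_
    (S.isChart_zero.ring_le_centre hV hB hA hx hu hz)⟩
  obtain ⟨n1, n2, n3, -⟩ := (IsChart.ring_le_iff S.isChart_zero _).1 (le_centre hB)
  have n4 := E.τ_mem hB n1 h1
  have n5 := polynomial_aeval_mem n1 E.F
  rw [← hfdef] at n5
  have hu0 := S.u_ne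
  have hv0 := S.v_ne
  have hw1 : V.valuation (1 - f * S.u⁻¹) = 1 := by
    refine Valuation.map_one_sub_of_lt _ ?_
    rw [map_mul]
    refine valuation_mul_lt_one (valuation_le_of_mem_centre hA hf) ?_
    rw [hug, mul_inv, map_mul, map_inv₀ _ g, hg1, inv_one, mul_one]
    exact hU1
  have n6 : 1 - f * S.u⁻¹ ∈ (centre hB).carrier := sub_mem (one_mem _) (mul_mem n5 n2)
  have hw0 : 1 - f * S.u⁻¹ ≠ 0 := by
    intro h
    rw [h, map_zero] at hw1
    exact zero_ne_one hw1
  have hUu : D.U = S.u * (1 - f * S.u⁻¹) * D.τ ^ (-E.i) := by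
    have : S.u * (1 - f * S.u⁻¹) = S.u - f := by field_simp
    rw [this, E.u_eq, zpow_neg, add_sub_cancel_right]
    field_simp
  refine D.isChart_inf.ring_le_centre hV hA hB n4 ?_ ?_
  · rw [hUu, mul_inv, mul_inv, ← zpow_neg, neg_neg]
    exact mul_mem (mul_mem n2 (inv_mem_centre_of_eq_one hB n6 hw1)) (D.zpow_mem_centre hB n4 h1 _)
  · have h2 : D.W⁻¹ = D.τ ^ E.j * (D.U / S.v) := by
      rw [E.v_eq]
      field_simp
    have h3 : D.U / S.v = (1 - f * S.u⁻¹) * D.τ ^ (-E.i) * (S.u / S.v) := by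
      rw [hUu]
      field_simp
    rw [h2, h3]
    exact mul_mem (D.zpow_mem_centre hB n4 h1 _)
      (mul_mem (mul_mem n6 (D.zpow_mem_centre hB n4 h1 _)) n3)

lemma isGenAt_swap_inf (E : D.Presents S) (hV : Constants V) (hA : Below D.swap.infRing V)
    (h1 : V.valuation D.τ = 1) : S.IsGenAt hA := by
  obtain ⟨m1, m2, m3, -⟩ := (IsChart.ring_le_iff D.swap.isChart_inf _).1 (le_centre hA)
  obtain ⟨-, -, e3, e4⟩ := (IsChart.below_ring D.swap.isChart_inf hV).1 hA
  rw [aeval_polynomial_aeval, aeval_X] at e4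
  have e4 : (Polynomial.aeval D.τ D.d)⁻¹ ∈ V := e4
  have m1 : D.τ ∈ (centre hA).carrier := m1
  have m3 : D.W⁻¹ ∈ (centre hA).carrier := m3
  have hG := D.swap.valuation_infPoly hV hA
  have hGrel := D.swap.infPoly_rel
  have m4 := le_centre hA (aeval ![D.swap.isChart_inf.cr, D.swap.isChart_inf.cs] D.swap.infPoly).2
  rw [IsChart.coe_aeval₂] at m4
  set G := aeval ![D.swap.τ, D.swap.U⁻¹] D.swap.infPoly with hGdef
  have hQ : D.swap.U⁻¹ = D.U * D.τ ^ (-(D.n : ℤ)) := by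
    rw [zpow_neg, zpow_natCast]
    exact (inv_div _ _).trans (div_eq_mul_inv _ _)
  rw [hQ] at m2 hGrel
  have hτ0 := D.τ_ne
  have hU0 := D.U_ne
  have hW0 := D.W_ne
  have hW1 : D.W = G * D.W⁻¹ * D.U⁻¹ * D.τ ^ (D.n : ℤ) := by
    have h2 : G * D.W⁻¹ ^ 2 = D.U * D.τ ^ (-(D.n : ℤ)) := hGrel
    rw [zpow_neg] at h2
    have := zpow_ne_zero (D.n : ℤ) hτ0
    field_simp at h2 ⊢
    linear_combination -h2
  have hτi := zpow_ne_zero E.i hτ0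
  have hτj := zpow_ne_zero E.j hτ0
  have hx := E.x_mem hA m1 h1
  have hU : D.U ∈ (centre hA).carrier := by
    have := mul_mem m2 (D.zpow_mem_centre hA m1 h1 D.n)
    rwa [mul_assoc, ← zpow_add₀ hτ0, neg_add_cancel, zpow_zero, mul_one] at this
  have hu : S.u ∈ (centre hA).carrier := by
    rw [E.u_eq]
    exact add_mem (mul_mem (D.zpow_mem_centre hA m1 h1 _) hU) (polynomial_aeval_mem hx _)
  have hv : S.v ∈ (centre hA).carrier := by
    have : S.v = D.τ ^ E.j * (G * D.W⁻¹ * D.τ ^ (D.n : ℤ)) := by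
      rw [E.v_eq]
      nth_rewrite 1 [hW1]
      field_simp
    rw [this]
    exact mul_mem (D.zpow_mem_centre hA m1 h1 _)
      (mul_mem (mul_mem m4 m3) (D.zpow_mem_centre hA m1 h1 _))
  have hB : Below S.affRing V := (S.below_affRing hV).2 ⟨mem_of_mem_centre hA hx,
    mem_of_mem_centre hA hu, mem_of_mem_centre hA hv, E.disc_inv_mem h1 e4⟩
  refine ⟨_, Or.inl rfl, hB, centre_eq_of_le _ _ ?_
    (S.isChart_aff.ring_le_centre hV hB hA hx hu hv)⟩
  obtain ⟨n1, n2, n3, -⟩ := (IsChart.ring_le_iff S.isChart_aff _).1 (le_centre hB)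
  have n4 := E.τ_mem hB n1 h1
  have n5 : D.U ∈ (centre hB).carrier := by
    have : D.U = (S.u - Polynomial.aeval S.x E.F) * D.τ ^ (-E.i) := by
      rw [E.u_eq, zpow_neg]
      field_simp
      ring
    rw [this]
    exact mul_mem (sub_mem n2 (polynomial_aeval_mem n1 _)) (D.zpow_mem_centre hB n4 h1 _)
  have n6 : D.swap.U⁻¹ ∈ (centre hB).carrier := by
    rw [hQ]
    exact mul_mem n5 (D.zpow_mem_centre hB n4 h1 _)
  have n7 : G ∈ (centre hB).carrier := by
    have a1 := polynomial_aeval_mem n4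
    have n4' : D.swap.τ ∈ (centre hB).carrier := n4
    rw [hGdef, aeval_infPoly]
    exact add_mem (add_mem (a1 _) (mul_mem (a1 _) n6))
      (mul_mem (mul_mem (a1 _) (pow_mem n4' _)) (pow_mem n6 _))
  have hG0 : G ≠ 0 := by
    intro h
    rw [h, map_zero] at hG
    exact zero_ne_one hG
  refine D.swap.isChart_inf.ring_le_centre hV hA hB n4 n6 ?_
  have : D.W⁻¹ = S.v * D.τ ^ (-E.j) * G⁻¹ * D.τ ^ (-(D.n : ℤ)) := by
    have h2 : G * D.W⁻¹ ^ 2 = D.U * D.τ ^ (-(D.n : ℤ)) := hGrel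
    rw [E.v_eq]
    rw [zpow_neg] at h2 ⊢
    rw [zpow_neg]
    have := zpow_ne_zero (D.n : ℤ) hτ0
    field_simp at h2 ⊢
    linear_combination h2
  change D.W⁻¹ ∈ _
  rw [this]
  exact mul_mem (mul_mem (mul_mem n3 (D.zpow_mem_centre hB n4 h1 _))
    (inv_mem_centre_of_eq_one hB n7 hG)) (D.zpow_mem_centre hB n4 h1 _)

end Presents

end FibreModel

end Inose

end

noncomputable section

namespace Inose

open IsLocalRing MvPolynomial

variable {K : Type*} [Field K] [Algebra ℂ K]

lemma inv_mem_of_mul_inv_mem {A : Subalgebra ℂ K} {f g : K} (hg : g ∈ A) (hg0 : g ≠ 0)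
    (h : (f * g)⁻¹ ∈ A) : f⁻¹ ∈ A := by
  have := mul_mem h hg
  rwa [mul_inv, mul_assoc, inv_mul_cancel₀ hg0, mul_one] at this

namespace FibreModel

variable (D : FibreModel K) {V : ValuationSubring K}

lemma d_inv_mem_infRing : (Polynomial.aeval D.τ D.d)⁻¹ ∈ D.infRing := by
  have h := ((IsChart.ring_le_iff D.isChart_inf _).1 le_rfl).2.2.2
  rwa [aeval_polynomial_aeval, aeval_X] at h

lemma τ_mem_infRing : D.τ ∈ D.infRing := ((IsChart.ring_le_iff D.isChart_inf _).1 le_rfl).1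

lemma mem_cycRing (i : ℕ) (w : ℂ) : D.U / D.τ ^ i ∈ D.cycRing i w ∧
    D.τ ^ (i + 1) / D.U ∈ D.cycRing i w ∧ D.W ∈ D.cycRing i w ∧ D.τ ∈ D.cycRing i w ∧
      (Polynomial.aeval D.τ D.d)⁻¹ ∈ D.cycRing i w := by
  obtain ⟨h1, h2, h3, h4⟩ := mem_chartRing (D.U / D.τ ^ i) (D.τ ^ (i + 1) / D.U) D.W
    (aeval ![D.U / D.τ ^ i, D.τ ^ (i + 1) / D.U, D.W] (D.cycUnit w))
  have h5 := mul_mem h1 h2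
  rw [D.cyc_mul] at h5
  rw [aeval_cycUnit, D.cyc_mul] at h4
  refine ⟨h1, h2, h3, h5, ?_⟩
  have h6 : D.W + algebraMap ℂ K w ∈ D.cycRing i w := add_mem h3 ((D.cycRing i w).algebraMap_mem w)
  refine inv_mem_of_mul_inv_mem h6 (D.W_add_ne w) ?_
  unfold cycRing
  rw [aeval_cycUnit, D.cyc_mul]
  exact h4

lemma isTorusChart_cycRing (hV : Constants V) {i : ℕ} (hi : i < D.n) {w : ℂ}
    (hA : Below (D.cycRing i w) V) (h1 : V.valuation D.τ = 1) : D.IsTorusChart hA := by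
  obtain ⟨m1, m2, m3, m4, -⟩ := D.mem_cycRing i w
  replace m1 := le_centre hA m1
  replace m2 := le_centre hA m2
  replace m3 := le_centre hA m3
  replace m4 := le_centre hA m4
  have m5 := inv_mem_centre_of_eq_one hA m4 h1
  have hτ := D.τ_ne
  have hU := D.U_ne
  refine ⟨?_, ?_, m3, fun B hB n1 n2 n3 n4 => ?_⟩
  · have : D.U = D.U / D.τ ^ i * D.τ ^ i := by field_simp
    rw [this]
    exact mul_mem m1 (pow_mem m4 _)
  · have : D.U⁻¹ = D.τ ^ (i + 1) / D.U * D.τ⁻¹ ^ (i + 1) := by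
      rw [inv_pow]
      field_simp
    rw [this]
    exact mul_mem m2 (pow_mem m5 _)
  · have n5 := inv_mem_centre_of_eq_one hB n1 h1
    refine IsChart.ring_le_centre (D.isChart_cyc hi w) hV hA hB ?_ ?_ n4
    · rw [div_eq_mul_inv, ← inv_pow]
      exact mul_mem n2 (pow_mem n5 _)
    · rw [div_eq_mul_inv]
      exact mul_mem (pow_mem n1 _) n3

end FibreModel

namespace StarModel

variable (D : StarModel K) {V : ValuationSubring K}

lemma fg_halfChart (e) : (D.halfChart e).FG := by
  rcases e with k | _ | _ | _
  exacts [(D.isChart_a k.2).fg_ring, D.isChart_b.fg_ring, D.isChart_inf.fg_ring,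
    D.isChart_tip.fg_ring]

lemma isFractionRing_halfChart (e) : IsFractionRing (D.halfChart e) K := by
  rcases e with k | _ | _ | _
  exacts [(D.isChart_a k.2).isFractionRing_ring, D.isChart_b.isFractionRing_ring,
    D.isChart_inf.isFractionRing_ring, D.isChart_tip.isFractionRing_ring]

lemma d_inv_mem_halfChart (e) : (Polynomial.aeval D.τ D.d)⁻¹ ∈ D.halfChart e := by
  have hτ := D.τ_ne
  have hU := D.U_ne
  have hW := D.W_ne
  rcases e with k | _ | _ | _
  · have h := ((IsChart.ring_le_iff (D.isChart_a k.2) _).1 le_rfl).2.2.2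
    rw [aeval_unit, D.unit_eq k.2, D.cyc_mul] at h
    exact inv_mem_of_mul_inv_mem (D.chain_mem k.2).2.1 (div_ne_zero (pow_ne_zero _ hW) hτ) h
  · have h := ((IsChart.ring_le_iff D.isChart_b _).1 le_rfl).2.2.2
    rw [aeval_polynomial_aeval] at h
    simp only [map_mul, aeval_X, Matrix.cons_val] at h
    rwa [D.mul_tip] at h
  · exact D.toFibreModel.d_inv_mem_infRing
  · have h := ((IsChart.ring_le_iff D.isChart_tip _).1 le_rfl)
    obtain ⟨-, h2, -, h⟩ := h
    rw [map_mul, aeval_polynomial_aeval] at h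
    simp only [map_mul, aeval_X, Matrix.cons_val] at h
    rw [D.mul_tip] at h
    exact inv_mem_of_mul_inv_mem h2 (div_ne_zero hτ hU) h

lemma isTorusChart_halfChart (hV : Constants V) (e) (he : e ≠ .inr (some false))
    (hA : Below (D.halfChart e) V) (h1 : V.valuation D.τ = 1) :
    D.toFibreModel.IsTorusChart hA := by
  have m4 := le_centre hA (D.τ_mem_halfChart e)
  have m5 := inv_mem_centre_of_eq_one hA m4 h1
  have hτ := D.τ_ne
  have hU := D.U_ne
  have hW := D.W_ne
  rcases e with k | _ | _ | _
  · obtain ⟨m1, m2, m3, -⟩ := (IsChart.ring_le_iff (D.isChart_a k.2) _).1 (le_centre hA)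
    refine ⟨?_, ?_, ?_, fun B hB n1 n2 n3 n4 => ?_⟩
    · have : D.U = D.U / D.τ ^ (k.1 + 1) * D.τ ^ (k.1 + 1) := by field_simp
      rw [this]
      exact mul_mem m1 (pow_mem m4 _)
    · have : D.U⁻¹ = D.τ ^ (k.1 + 1 + 1) / D.U * D.τ⁻¹ ^ (k.1 + 1 + 1) := by
        rw [inv_pow]
        field_simp
      rw [this]
      exact mul_mem m2 (pow_mem m5 _)
    · have : D.W = D.W * D.τ ^ (k.1 + 1) / D.U * (D.U / D.τ ^ (k.1 + 1)) := by field_simp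
      rw [this]
      exact mul_mem m3 m1
    · have n5 := inv_mem_centre_of_eq_one hB n1 h1
      refine IsChart.ring_le_centre (D.isChart_a k.2) hV hA hB ?_ ?_ ?_
      · rw [div_eq_mul_inv, ← inv_pow]
        exact mul_mem n2 (pow_mem n5 _)
      · rw [div_eq_mul_inv]
        exact mul_mem (pow_mem n1 _) n3
      · rw [div_eq_mul_inv]
        exact mul_mem (mul_mem n4 (pow_mem n1 _)) n3
  · obtain ⟨m1, m2, m3, -⟩ := (IsChart.ring_le_iff D.isChart_b _).1 (le_centre hA)
    refine ⟨m1, ?_, ?_, fun B hB n1 n2 n3 n4 => ?_⟩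
    · have : D.U⁻¹ = D.τ / D.U * D.τ⁻¹ := by field_simp
      rw [this]
      exact mul_mem m2 m5
    · have m6 := le_centre hA D.branchTip.2
      rw [coe_branchTip] at m6
      have := mul_mem m6 m3
      have h : D.W ^ 2 / D.U * (D.U / D.W) = D.W := by field_simp
      rwa [h] at this
    · refine IsChart.ring_le_centre D.isChart_b hV hA hB n2 ?_ ?_
      · rw [div_eq_mul_inv]
        exact mul_mem n1 n3
      · rw [div_eq_mul_inv]
        refine mul_mem n2 (inv_mem_centre hB n4 ?_)
        have := mul_mem (mem_of_mem_centre hA m3) (mem_of_mem_centre hB n3)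
        have h : D.U / D.W * D.U⁻¹ = D.W⁻¹ := by field_simp
        rwa [h] at this
  · exact absurd rfl he
  · obtain ⟨m1, m2, m3, -⟩ := (IsChart.ring_le_iff D.isChart_tip _).1 (le_centre hA)
    refine ⟨m1, ?_, ?_, fun B hB n1 n2 n3 n4 => ?_⟩
    · have : D.U⁻¹ = D.τ / D.U * D.τ⁻¹ := by field_simp
      rw [this]
      exact mul_mem m2 m5
    · have := mul_mem m3 m1
      rwa [div_mul_cancel₀ _ hU] at this
    · refine IsChart.ring_le_centre D.isChart_tip hV hA hB n2 ?_ ?_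
      · rw [div_eq_mul_inv]
        exact mul_mem n1 n3
      · rw [div_eq_mul_inv]
        exact mul_mem n4 n3

lemma flip_d (b : Bool) : (D.flip b).d = D.d := by cases b <;> rfl

end StarModel

/-- Charts covering a neighbourhood of a fibre and compatible with the charts of the family over
the set of regular values. -/
structure FibrePatch (S : LegendreModel K) where
  D : FibreModel K
  charts : Set (Subalgebra ℂ K)
  finite : charts.Finite
  fg : ∀ A ∈ charts, A.FG
  isFractionRing : ∀ A ∈ charts, IsFractionRing A K
  τ_mem : ∀ A ∈ charts, D.τ ∈ A
  glues : ∀ V : ValuationSubring K, Constants V → V.valuation D.τ < 1 → ∀ A ∈ charts,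
    ∀ B ∈ charts, Glues V A B
  exists_chart : ∀ V : ValuationSubring K, Constants V → V.valuation D.τ < 1 →
    ∃ A ∈ charts, Below A V
  isGenAt : ∀ V : ValuationSubring K, Constants V → V.valuation D.τ = 1 → ∀ A ∈ charts,
    ∀ hA : Below A V, S.IsGenAt hA

namespace FibrePatch

variable {S : LegendreModel K}

/-- The charts of a fibre of type `I`. -/
def cyc (D : FibreModel K) (E : D.Presents S) {w : ℂ} (hw : w ≠ 0) : FibrePatch S where
  D := D
  charts := {A | D.IsCycChart w A}
  finite := by
    have : {A | D.IsCycChart w A} ⊆ {D.infRing, D.swap.infRing} ∪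
        ((fun i => D.cycRing i w) '' Set.Iio D.n ∪ (fun i => D.cycRing i (-w)) '' Set.Iio D.n) := by
      rintro A (rfl | rfl | ⟨i, hi, rfl | rfl⟩)
      · exact Or.inl (Or.inl rfl)
      · exact Or.inl (Or.inr rfl)
      · exact Or.inr (Or.inl ⟨i, hi, rfl⟩)
      · exact Or.inr (Or.inr ⟨i, hi, rfl⟩)
    refine Set.Finite.subset ?_ this
    exact (Set.toFinite _).union (((Set.finite_Iio _).image _).union ((Set.finite_Iio _).image _))
  fg := by
    rintro A (rfl | rfl | ⟨i, hi, rfl | rfl⟩)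
    exacts [IsChart.fg_ring _, IsChart.fg_ring _, D.fg_cycRing _ _, D.fg_cycRing _ _]
  isFractionRing := by
    rintro A (rfl | rfl | ⟨i, hi, rfl | rfl⟩)
    exacts [IsChart.isFractionRing_ring _, IsChart.isFractionRing_ring _,
      D.isFractionRing_cycRing hi _, D.isFractionRing_cycRing hi _]
  τ_mem := by
    rintro A (rfl | rfl | ⟨i, hi, rfl | rfl⟩)
    exacts [D.τ_mem_infRing, D.swap.τ_mem_infRing, (D.mem_cycRing _ _).2.2.2.1,
      (D.mem_cycRing _ _).2.2.2.1]
  glues V hV hτ A hA B hB := D.glues_isCycChart hV hτ hA hB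
  exists_chart V hV hτ := D.exists_isCycChart hV hτ hw
  isGenAt := by
    rintro V hV h1 A (rfl | rfl | ⟨i, hi, rfl | rfl⟩) hA
    · exact E.isGenAt_inf hV hA h1
    · exact E.isGenAt_swap_inf hV hA h1
    all_goals
      obtain ⟨-, -, -, m1, m2⟩ := D.mem_cycRing i _
      exact E.isGenAt_of_torus hV (le_centre hA m1) h1 (hA _ m2)
        (D.isTorusChart_cycRing hV hi hA h1)

/-- The charts of a fibre of type `I*₆`. -/
def star (D : StarModel K) (E : D.toFibreModel.Presents S) : FibrePatch S where
  D := D.toFibreModel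
  charts := {A | D.IsStarChart A}
  finite := by
    have : {A | D.IsStarChart A} =
        Set.range fun e : Bool × (Fin 3 ⊕ Option Bool) => (D.flip e.1).halfChart e.2 := by
      ext A
      rw [Set.mem_ofPred_eq, D.isStarChart_iff]
      exact exists_congr fun e => eq_comm
    rw [this]
    exact Set.finite_range _
  fg A hA := by
    obtain ⟨e, rfl⟩ := D.isStarChart_iff.1 hA
    exact StarModel.fg_halfChart _ _
  isFractionRing A hA := by
    obtain ⟨e, rfl⟩ := D.isStarChart_iff.1 hA
    exact StarModel.isFractionRing_halfChart _ _
  τ_mem A hA := by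
    obtain ⟨e, rfl⟩ := D.isStarChart_iff.1 hA
    rw [← D.flip_τ e.1]
    exact StarModel.τ_mem_halfChart _ _
  glues V hV hτ A hA B hB := D.glues_isStarChart hV hτ hA hB
  exists_chart V hV hτ := D.exists_isStarChart hV hτ
  isGenAt V hV h1 A hA' hA := by
    obtain ⟨⟨b, e⟩, rfl⟩ := D.isStarChart_iff.1 hA'
    have m1 := StarModel.τ_mem_halfChart (D.flip b) e
    have m2 := StarModel.d_inv_mem_halfChart (D.flip b) e
    rw [D.flip_τ] at m1
    rw [D.flip_τ, D.flip_d] at m2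
    by_cases he : e = .inr (some false)
    · subst he
      cases b
      · exact E.isGenAt_inf hV hA h1
      · exact E.isGenAt_swap_inf hV hA h1
    · refine E.isGenAt_of_torus hV (le_centre hA m1) h1 (hA _ m2) ?_
      cases b
      · exact D.isTorusChart_halfChart hV e he hA h1
      · exact FibreModel.IsTorusChart.of_swap _ (le_centre hA m1) h1
          (D.swap.isTorusChart_halfChart hV e he hA h1)

end FibrePatch

/-- Patches of fibres that, together with the family over the set of regular values, cover the
surface. -/
structure Covering (S : LegendreModel K) (ι : Type) where
  patch : ι → FibrePatch S
  cover : ∀ V : ValuationSubring K, Constants V →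
    (S.x ∈ V ∧ S.disc⁻¹ ∈ V) ∨ ∃ i, V.valuation (patch i).D.τ < 1
  unique : ∀ V : ValuationSubring K, Constants V → ∀ i j, V.valuation (patch i).D.τ < 1 →
    V.valuation (patch j).D.τ < 1 → i = j
  disjoint : ∀ V : ValuationSubring K, Constants V → ∀ i, V.valuation (patch i).D.τ < 1 →
    S.x ∈ V → S.disc⁻¹ ∈ V → False

namespace Covering

variable {S : LegendreModel K} {ι : Type} (C : Covering S ι)

/-- All charts of the surface. -/
def charts : Set (Subalgebra ℂ K) := {A | S.IsGenChart A} ∪ ⋃ i, (C.patch i).charts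

lemma isGenAt_or {V : ValuationSubring K} (hV : Constants V) {A : Subalgebra ℂ K}
    (hA : A ∈ C.charts) (h : Below A V) :
    S.IsGenAt h ∨ ∃ i, A ∈ (C.patch i).charts ∧ V.valuation (C.patch i).D.τ < 1 := by
  rcases hA with hA | hA
  · exact Or.inl ⟨A, hA, h, rfl⟩
  · obtain ⟨i, hi⟩ := Set.mem_iUnion.1 hA
    have h1 : V.valuation (C.patch i).D.τ ≤ 1 :=
      (ValuationSubring.valuation_le_one_iff _ _).2 (h _ ((C.patch i).τ_mem A hi))
    rcases h1.lt_or_eq with h1 | h1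
    · exact Or.inr ⟨i, hi, h1⟩
    · exact Or.inl ((C.patch i).isGenAt V hV h1 A hi h)

lemma _root_.Inose.LegendreModel.IsGenAt.mem {V : ValuationSubring K} (hV : Constants V)
    {A : Subalgebra ℂ K} {h : Below A V} (hA : S.IsGenAt h) : S.x ∈ V ∧ S.disc⁻¹ ∈ V := by
  obtain ⟨B, rfl | rfl, hB, -⟩ := hA
  · obtain ⟨h1, -, -, h2⟩ := (S.below_affRing hV).1 hB
    exact ⟨h1, h2⟩
  · obtain ⟨h1, -, -, h2⟩ := (S.below_zeroRing hV).1 hB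
    exact ⟨h1, h2⟩

lemma le_centre_of_below {V : ValuationSubring K} (hV : Constants V) {A B : Subalgebra ℂ K}
    (hA : A ∈ C.charts) (hB : B ∈ C.charts) (h : Below A V) (h' : Below B V) :
    A ≤ (centre h').carrier := by
  rcases C.isGenAt_or hV hA h with ⟨A', g1, h1, e1⟩ | ⟨i, hi, hτ⟩
  · rcases C.isGenAt_or hV hB h' with ⟨B', g2, h2, e2⟩ | ⟨j, hj, hτ'⟩
    · rw [e2, ← S.centre_eq_of_isGenChart hV g1 g2 h1 h2, ← e1]
      exact le_centre h
    · have := LegendreModel.IsGenAt.mem hV (S := S) (h := h) ⟨A', g1, h1, e1⟩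
      exact (C.disjoint V hV j hτ' this.1 this.2).elim
  · rcases C.isGenAt_or hV hB h' with hg | ⟨j, hj, hτ'⟩
    · have := LegendreModel.IsGenAt.mem hV hg
      exact (C.disjoint V hV i hτ this.1 this.2).elim
    · obtain rfl := C.unique V hV i j hτ hτ'
      exact (C.patch i).glues V hV hτ A hi B hj h h'

variable [Finite ι]

/-- The surface obtained by gluing. -/
def surface : CompleteVariety K :=
  CompleteVariety.ofCharts C.charts
    (by
      refine Set.Finite.union ?_ (Set.finite_iUnion fun i => (C.patch i).finite)
      exact Set.toFinite ({S.affRing, S.zeroRing} : Set _))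
    (by
      rintro A ((rfl | rfl) | hA)
      · exact IsChart.fg_ring _
      · exact IsChart.fg_ring _
      · obtain ⟨i, hi⟩ := Set.mem_iUnion.1 hA
        exact (C.patch i).fg A hi)
    (by
      rintro A ((rfl | rfl) | hA)
      · exact IsChart.isFractionRing_ring _
      · exact IsChart.isFractionRing_ring _
      · obtain ⟨i, hi⟩ := Set.mem_iUnion.1 hA
        exact (C.patch i).isFractionRing A hi)
    (by
      intro V hV
      rcases C.cover V hV with ⟨h1, h2⟩ | ⟨i, hi⟩
      · obtain ⟨A, hA, h⟩ := S.exists_isGenChart hV h1 h2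
        exact ⟨A, Or.inl hA, h⟩
      · obtain ⟨A, hA, h⟩ := (C.patch i).exists_chart V hV hi
        exact ⟨A, Or.inr (Set.mem_iUnion.2 ⟨i, hA⟩), h⟩)
    (fun V hV A hA B hB h h' => C.le_centre_of_below hV hA hB h h')

end Covering

end Inose

end

noncomputable section

namespace Inose

open IsLocalRing MvPolynomial

variable {K : Type*} [Field K] [Algebra ℂ K]

lemma sub_dvd_aeval_sub_eval {A : Type*} [CommRing A] [Algebra ℂ A] (s : A) (c : ℂ)
    (q : Polynomial ℂ) :
    s - algebraMap ℂ A c ∣ Polynomial.aeval s q - algebraMap ℂ A (q.eval c) := by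
  have := Polynomial.sub_dvd_eval_sub s (algebraMap ℂ A c) (q.map (algebraMap ℂ A))
  rwa [Polynomial.eval_map_algebraMap, Polynomial.eval_map_algebraMap,
    Polynomial.aeval_algebraMap_apply, Polynomial.coe_aeval_eq_eval] at this

lemma algebraMap_mem_iff {A : Type*} [CommRing A] [Algebra ℂ A] {p : Ideal A} [hp : p.IsPrime]
    {c : ℂ} : algebraMap ℂ A c ∈ p ↔ c = 0 := by
  refine ⟨fun h => ?_, fun h => by rw [h, map_zero]; exact p.zero_mem⟩
  by_contra h0
  exact hp.ne_top (Ideal.eq_top_of_isUnit_mem _ h ((isUnit_iff_ne_zero.2 h0).map (algebraMap ℂ A)))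

namespace LegendreModel

variable (S : LegendreModel K)

lemma aff_rel : S.isChart_aff.cz ^ 2 = S.isChart_aff.cs *
    (S.isChart_aff.cs - Polynomial.aeval S.isChart_aff.cr S.P - 1) *
      (S.isChart_aff.cs - Polynomial.aeval S.isChart_aff.cr S.P + 1) := by
  have h := S.isChart_aff.ring_rel
  rwa [map_one, one_mul, aeval_affPoly] at h

lemma zero_rel' : S.isChart_zero.cs = aeval ![S.isChart_zero.cr, S.isChart_zero.cs] S.zeroPoly *
    S.isChart_zero.cz ^ 2 := by
  have h := S.isChart_zero.ring_rel
  rw [aeval_X] at h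
  exact h.symm

lemma disc_ci {x u v : K} {a b : MvPolynomial (Fin 2) ℂ}
    (h : IsChart x u v a b (Polynomial.aeval (X 0) (S.P ^ 2 - 1))) :
    Polynomial.aeval h.cr (S.P ^ 2 - 1) * h.ci = 1 := by
  have := h.mul_ci
  rwa [aeval_disc] at this

variable {c : ℂ}

lemma exists_parameter_aff (hc : S.P.eval c ^ 2 ≠ 1) {p : Ideal S.affRing} [hp : p.IsMaximal]
    (hT : S.isChart_aff.cr - algebraMap ℂ _ c ∈ p) :
    ∃ y ∈ p, maximalIdeal (LocalRingIn.ofPrime S.affRing p).carrier =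
      Ideal.span {LocalRingIn.toLocal S.affRing p (S.isChart_aff.cr - algebraMap ℂ _ c),
        LocalRingIn.toLocal S.affRing p y} := by
  set h := S.isChart_aff with hh
  obtain ⟨u₀, hu⟩ := LocalRingIn.exists_const _ h.fg_ring p h.cs
  obtain ⟨v₀, hv⟩ := LocalRingIn.exists_const _ h.fg_ring p h.cz
  have hrel := S.aff_rel
  rw [← hh] at hrel
  set p₀ := S.P.eval c with hp₀
  obtain ⟨k, hk⟩ := sub_dvd_aeval_sub_eval h.cr c S.P
  rw [← hp₀] at hk
  rw [sub_eq_iff_eq_add] at hk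
  have hpt : v₀ ^ 2 = u₀ * (u₀ - p₀ - 1) * (u₀ - p₀ + 1) := by
    rw [← sub_eq_zero, ← algebraMap_mem_iff (A := h.ring) (p := p)]
    have e1 := (Ideal.Quotient.mk_eq_mk_iff_sub_mem (I := p) _ _).2 hT
    have e2 := (Ideal.Quotient.mk_eq_mk_iff_sub_mem (I := p) _ _).2 hu
    have e3 := (Ideal.Quotient.mk_eq_mk_iff_sub_mem (I := p) _ _).2 hv
    rw [← Ideal.Quotient.eq_zero_iff_mem]
    have h1 := congrArg (Ideal.Quotient.mk p) hrel
    rw [hk] at h1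
    simp only [map_pow, map_mul, map_sub, map_add, map_one] at h1 ⊢
    rw [e3, e2, e1, sub_self, zero_mul, zero_add] at h1
    rw [h1, sub_self]
  have hrel₀ : aeval ![c, u₀] (1 : MvPolynomial (Fin 2) ℂ) * v₀ ^ 2 = aeval ![c, u₀] S.affPoly := by
    rw [map_one, one_mul, aeval_affPoly, hpt]
    simp [← hp₀]
  have hΔ₀ : aeval ![c, u₀, v₀] (Polynomial.aeval (X 0) (S.P ^ 2 - 1) : MvPolynomial (Fin 3) ℂ) ≠ 0 := by
    rw [aeval_disc]
    simpa [sub_ne_zero, ← hp₀] using hc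
  set I : Ideal h.ring := Ideal.span {h.cr - algebraMap ℂ _ c, h.cs - algebraMap ℂ _ u₀,
    h.cz - algebraMap ℂ _ v₀} with hI
  have hImax : I.IsMaximal := by
    refine h.isMaximal c u₀ v₀ hrel₀ hΔ₀ (fun χ h1 h2 h3 x hx => ?_) ?_ ?_ ?_
    · have : I ≤ RingHom.ker χ := by
        rw [hI, Ideal.span_le]
        rintro _ (rfl | rfl | rfl)
        · change χ _ = 0
          rw [map_sub, h1, AlgHom.commutes, Algebra.algebraMap_self_apply, sub_self]
        · change χ _ = 0
          rw [map_sub, h2, AlgHom.commutes, Algebra.algebraMap_self_apply, sub_self]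
        · change χ _ = 0
          rw [map_sub, h3, AlgHom.commutes, Algebra.algebraMap_self_apply, sub_self]
      exact this hx
    all_goals exact Ideal.subset_span (by simp)
  have hIp : I = p := by
    refine hImax.eq_of_le hp.ne_top ?_
    rw [hI, Ideal.span_le]
    rintro _ (rfl | rfl | rfl)
    exacts [hT, hu, hv]
  set T := h.cr - algebraMap ℂ h.ring c with hTdef
  set G := h.cs ^ 2 + h.cs * algebraMap ℂ h.ring u₀ + algebraMap ℂ h.ring u₀ ^ 2 -
    2 * algebraMap ℂ h.ring p₀ * (h.cs + algebraMap ℂ h.ring u₀) + algebraMap ℂ h.ring p₀ ^ 2 - 1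
    with hG
  set H := - (h.cs * k * (2 * (h.cs - algebraMap ℂ h.ring p₀) - T * k)) with hH
  have key : (h.cz - algebraMap ℂ _ v₀) * (h.cz + algebraMap ℂ _ v₀) =
      (h.cs - algebraMap ℂ _ u₀) * G + T * H := by
    have h2 := congrArg (algebraMap ℂ h.ring) hpt
    simp only [map_pow, map_mul, map_sub, map_add, map_one] at h2
    rw [hk] at hrel
    rw [hG, hH]
    linear_combination hrel - h2
  have hmem (a : h.ring) (ha : a ∈ p) : ∃ α β γ, a = α * T + β * (h.cs - algebraMap ℂ _ u₀) +
      γ * (h.cz - algebraMap ℂ _ v₀) := by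
    rw [← hIp, hI, Ideal.mem_span_insert] at ha
    obtain ⟨α, z, hz, rfl⟩ := ha
    obtain ⟨β, γ, rfl⟩ := Ideal.mem_span_pair.1 hz
    exact ⟨α, β, γ, by ring⟩
  by_cases hv0 : v₀ = 0
  · refine ⟨_, hv, ?_⟩
    have := LocalRingIn.maximalIdeal_ofPrime_eq_span _ p {T, h.cz - algebraMap ℂ _ v₀} (by
      rintro _ (rfl | rfl)
      exacts [hT, hv]) (fun a ha => ⟨G, ?_, ?_⟩)
    · rwa [Set.image_pair] at this
    · intro hGp
      have e2 := (Ideal.Quotient.mk_eq_mk_iff_sub_mem (I := p) _ _).2 hu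
      rw [← Ideal.Quotient.eq_zero_iff_mem, hG] at hGp
      simp only [map_pow, map_mul, map_sub, map_add, map_one, map_ofNat, e2] at hGp
      have h3 : algebraMap ℂ h.ring (3 * u₀ ^ 2 - 4 * p₀ * u₀ + p₀ ^ 2 - 1) ∈ p := by
        rw [← Ideal.Quotient.eq_zero_iff_mem]
        simp only [map_pow, map_mul, map_sub, map_add, map_one, map_ofNat]
        linear_combination hGp
      rw [algebraMap_mem_iff] at h3
      rw [hv0, zero_pow two_ne_zero, eq_comm, mul_eq_zero, mul_eq_zero] at hpt
      apply hc
      rcases hpt with (h4 | h4) | h4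
      · rw [h4] at h3
        linear_combination h3
      · have h5 : u₀ = p₀ + 1 := by linear_combination h4
        rw [h5] at h3
        have h6 : p₀ + 1 = 0 := by linear_combination h3 / 2
        linear_combination (p₀ - 1) * h6
      · have h5 : u₀ = p₀ - 1 := by linear_combination h4
        rw [h5] at h3
        have h6 : p₀ - 1 = 0 := by linear_combination - h3 / 2
        linear_combination (p₀ + 1) * h6
    · obtain ⟨α, β, γ, rfl⟩ := hmem a ha
      rw [Ideal.mem_span_pair]
      exact ⟨α * G - β * H, γ * G + β * (h.cz + algebraMap ℂ _ v₀), by linear_combination β * key⟩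
  · refine ⟨_, hu, ?_⟩
    have := LocalRingIn.maximalIdeal_ofPrime_eq_span _ p {T, h.cs - algebraMap ℂ _ u₀} (by
      rintro _ (rfl | rfl)
      exacts [hT, hu]) (fun a ha => ⟨h.cz + algebraMap ℂ _ v₀, ?_, ?_⟩)
    · rwa [Set.image_pair] at this
    · intro hs
      have h1 := p.sub_mem hs hv
      have h2 : algebraMap ℂ h.ring (2 * v₀) ∈ p := by
        rw [map_mul, map_ofNat]
        convert h1 using 1
        ring
      rw [algebraMap_mem_iff] at h2
      exact hv0 (by simpa using h2)
    · obtain ⟨α, β, γ, rfl⟩ := hmem a ha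
      rw [Ideal.mem_span_pair]
      exact ⟨α * (h.cz + algebraMap ℂ _ v₀) + γ * H,
        β * (h.cz + algebraMap ℂ _ v₀) + γ * G, by linear_combination - γ * key⟩

lemma maximalIdeal_zero (hc : S.P.eval c ^ 2 ≠ 1) {p : Ideal S.zeroRing} [hp : p.IsMaximal]
    (hT : S.isChart_zero.cr - algebraMap ℂ _ c ∈ p) (hz : S.isChart_zero.cz ∈ p) :
    maximalIdeal (LocalRingIn.ofPrime S.zeroRing p).carrier =
      Ideal.span {LocalRingIn.toLocal S.zeroRing p S.isChart_zero.cz,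
        LocalRingIn.toLocal S.zeroRing p (S.isChart_zero.cr - algebraMap ℂ _ c)} := by
  set h := S.isChart_zero with hh
  set I : Ideal h.ring := Ideal.span {h.cz, h.cr - algebraMap ℂ _ c} with hI
  have hs : h.cs ∈ I := by
    rw [hh, S.zero_rel', ← hh]
    exact I.mul_mem_left _ (I.pow_mem_of_mem (Ideal.subset_span (by simp)) _ two_pos)
  have hImax : I.IsMaximal := by
    refine h.isMaximal c 0 0 ?_ ?_ (fun χ h1 h2 h3 x hx => ?_) ?_ ?_ ?_
    · simp
    · rw [aeval_disc]
      simpa [sub_ne_zero] using hc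
    · have : I ≤ RingHom.ker χ := by
        rw [hI, Ideal.span_le]
        rintro _ (rfl | rfl)
        · exact h3
        · change χ _ = 0
          rw [map_sub, h1, AlgHom.commutes, Algebra.algebraMap_self_apply, sub_self]
      exact this hx
    · exact Ideal.subset_span (by simp)
    · rwa [map_zero, sub_zero]
    · rw [map_zero, sub_zero]
      exact Ideal.subset_span (by simp)
  have hIp : I = p := by
    refine hImax.eq_of_le hp.ne_top ?_
    rw [hI, Ideal.span_le]
    rintro _ (rfl | rfl)
    exacts [hz, hT]
  have := LocalRingIn.maximalIdeal_ofPrime_eq_span _ p {h.cz, h.cr - algebraMap ℂ _ c} (by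
    rintro _ (rfl | rfl)
    exacts [hz, hT]) (fun a ha => ⟨1, fun h1 => hp.ne_top ((Ideal.eq_top_iff_one _).2 h1), by
      rw [one_mul, ← hI, hIp]
      exact ha⟩)
  rwa [Set.image_pair] at this

/-- The zero section. -/
lemma exists_zeroSection : ∃ R : RationalCurve S.zeroRing, R.g = S.isChart_zero.cz ∧
    ∀ c : ℂ, S.isChart_zero.cr - algebraMap ℂ _ c ∉ R.prime := by
  set h := S.isChart_zero with hh
  obtain ⟨R, h1, h2, -, -⟩ := h.exists_curve_poly Polynomial.X 0 0 (by simp) (by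
      rw [aeval_disc, Polynomial.aeval_X_left_apply]
      exact S.disc_ne) h.cz h.cr (div_ne_zero S.u_ne S.v_ne)
    (fun φ h1 _ h3 => ⟨by simpa using h3, by simpa using h1⟩) (by simp) (by
      rw [map_zero, sub_zero, hh, S.zero_rel', ← hh]
      exact Dvd.dvd.mul_left (dvd_pow_self _ two_ne_zero) _) (by simp)
  refine ⟨R, h1, fun c hc => ?_⟩
  change R.φ _ = 0 at hc
  rw [map_sub, h2, AlgHom.commutes, Polynomial.aeval_X] at hc
  have := aeval_ratFuncX_ne_zero (Polynomial.X_sub_C_ne_zero c)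
  rw [map_sub, Polynomial.aeval_X, Polynomial.aeval_C] at this
  exact this hc

end LegendreModel

end Inose

end

noncomputable section

namespace Inose

open IsLocalRing MvPolynomial

variable {K : Type*} [Field K] [Algebra ℂ K]

/-- The residue field at a prime `p` of `A` is the field of fractions of `A / p`. -/
lemma LocalRingIn.nonempty_residueField_equiv (A : Subalgebra ℂ K) (p : Ideal A) [p.IsPrime]
    {B F : Type*} [CommRing B] [IsDomain B] [Algebra ℂ B] [Field F] [Algebra ℂ F] [Algebra B F]
    [IsScalarTower ℂ B F] [IsFractionRing B F] (φ : A →ₐ[ℂ] B) (hφ : Function.Surjective φ)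
    (hker : ∀ a, φ a = 0 ↔ a ∈ p) :
    Nonempty (F ≃ₐ[ℂ] ResidueField (LocalRingIn.ofPrime A p).carrier) := by
  let ψ : A →ₐ[ℂ] ResidueField (LocalRingIn.ofPrime A p).carrier :=
    (IsScalarTower.toAlgHom ℂ (LocalRingIn.ofPrime A p).carrier
      (ResidueField (LocalRingIn.ofPrime A p).carrier)).comp (LocalRingIn.toLocal A p)
  have hψ (a : A) : ψ a = 0 ↔ a ∈ p := by
    change residue _ (LocalRingIn.toLocal A p a) = 0 ↔ _
    rw [residue_eq_zero_iff]
    exact LocalRingIn.toLocal_mem_iff A p a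
  have hle : RingHom.ker φ ≤ RingHom.ker ψ := fun a ha => (hψ a).2 ((hker a).1 ha)
  let θ₀ : (A ⧸ RingHom.ker φ) →ₐ[ℂ] ResidueField (LocalRingIn.ofPrime A p).carrier :=
    Ideal.Quotient.liftₐ _ ψ (fun a ha => hle ha)
  let θ : B →ₐ[ℂ] ResidueField (LocalRingIn.ofPrime A p).carrier :=
    θ₀.comp (Ideal.quotientKerAlgEquivOfSurjective hφ).symm.toAlgHom
  have hθ (a : A) : θ (φ a) = ψ a := by
    have : (Ideal.quotientKerAlgEquivOfSurjective hφ).symm (φ a) = Ideal.Quotient.mk _ a := by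
      rw [AlgEquiv.symm_apply_eq]
      rfl
    change θ₀ ((Ideal.quotientKerAlgEquivOfSurjective hφ).symm (φ a)) = _
    rw [this]
    rfl
  have hinj : Function.Injective θ := by
    rw [injective_iff_map_eq_zero]
    intro b hb
    obtain ⟨a, rfl⟩ := hφ b
    rw [hθ, hψ] at hb
    exact (hker a).2 hb
  let η : F →ₐ[ℂ] ResidueField (LocalRingIn.ofPrime A p).carrier := IsFractionRing.liftAlgHom hinj
  have hη (a : A) : η (algebraMap B F (φ a)) = ψ a :=
    (IsFractionRing.lift_algebraMap hinj _).trans (hθ a)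
  refine ⟨AlgEquiv.ofBijective η ⟨RingHom.injective _, ?_⟩⟩
  intro y
  obtain ⟨f, rfl⟩ := residue_surjective y
  obtain ⟨n, d, hd, hf⟩ := LocalRingIn.mem_fractions.1 f.2
  have hd0 : ψ d ≠ 0 := fun h => hd ((hψ d).1 h)
  refine ⟨algebraMap B F (φ n) / algebraMap B F (φ d), ?_⟩
  change η _ = _
  rw [map_div₀, hη, hη, div_eq_iff hd0]
  change residue _ _ = residue _ _ * residue _ _
  rw [← map_mul]
  congr 1
  apply Subtype.ext
  change (n : K) = f * d
  rw [hf]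
  have := LocalRingIn.coe_ne_zero hd
  field_simp

/-- The Weierstrass curve `y² = x (x - p - 1) (x - p + 1)`. -/
def legendreCurve (p : ℂ) : WeierstrassCurve ℂ := ⟨0, -2 * p, 0, p ^ 2 - 1, 0⟩

lemma Δ_legendreCurve (p : ℂ) : (legendreCurve p).Δ = 64 * (p ^ 2 - 1) ^ 2 := by
  simp only [WeierstrassCurve.Δ, WeierstrassCurve.b₂, WeierstrassCurve.b₄, WeierstrassCurve.b₆,
    WeierstrassCurve.b₈, legendreCurve]
  ring

lemma isElliptic_legendreCurve {p : ℂ} (hp : p ^ 2 ≠ 1) : (legendreCurve p).IsElliptic := by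
  refine ⟨isUnit_iff_ne_zero.2 ?_⟩
  rw [Δ_legendreCurve]
  exact mul_ne_zero (by norm_num) (pow_ne_zero _ (sub_ne_zero.2 hp))

lemma j_legendreCurve {p : ℂ} (hp : p ^ 2 ≠ 1) [(legendreCurve p).IsElliptic] :
    (legendreCurve p).j = 1728 * ((p ^ 2 + 3) ^ 3 / (27 * (p ^ 2 - 1) ^ 2)) := by
  have h0 := sub_ne_zero.2 hp
  rw [WeierstrassCurve.j, Units.val_inv_eq_inv_val, WeierstrassCurve.coe_Δ', Δ_legendreCurve]
  simp only [WeierstrassCurve.c₄, WeierstrassCurve.b₂, WeierstrassCurve.b₄, legendreCurve]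
  field_simp
  ring

open WeierstrassCurve.Affine in
lemma sq_mk_legendreCurve (p : ℂ) :
    CoordinateRing.mk (legendreCurve p).toAffine Polynomial.X ^ 2 =
      algebraMap (Polynomial ℂ) (legendreCurve p).toAffine.CoordinateRing
        (Polynomial.X * (Polynomial.X - Polynomial.C p - 1) *
          (Polynomial.X - Polynomial.C p + 1)) := by
  have h1 : CoordinateRing.mk (legendreCurve p).toAffine
      (WeierstrassCurve.Affine.polynomial (legendreCurve p).toAffine) = 0 := AdjoinRoot.mk_self
  have h2 : WeierstrassCurve.Affine.polynomial (legendreCurve p).toAffine = Polynomial.X ^ 2 -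
      Polynomial.C (Polynomial.X * (Polynomial.X - Polynomial.C p - 1) *
        (Polynomial.X - Polynomial.C p + 1)) := by
    unfold WeierstrassCurve.Affine.polynomial
    simp only [legendreCurve, map_zero, zero_mul, add_zero, map_mul, map_add, map_sub, map_neg,
      map_one, map_pow, map_ofNat]
    ring
  have h3 := congrArg (CoordinateRing.mk (legendreCurve p).toAffine) h2
  rw [h1, map_sub, eq_comm, sub_eq_zero, map_pow] at h3
  exact h3

namespace LegendreModel

variable (S : LegendreModel K) {c : ℂ}

/-- The restriction of functions to a smooth fibre. -/
lemma exists_restriction (hc : S.P.eval c ^ 2 ≠ 1) {B : Type*} [CommRing B] [Algebra ℂ B]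
    [Algebra (Polynomial ℂ) B] [IsScalarTower ℂ (Polynomial ℂ) B] (yc : B)
    (hyc : yc ^ 2 = algebraMap (Polynomial ℂ) B (Polynomial.X *
      (Polynomial.X - Polynomial.C (S.P.eval c) - 1) *
        (Polynomial.X - Polynomial.C (S.P.eval c) + 1)))
    (hspan : ∀ w : B, ∃ N M : Polynomial ℂ, N • 1 + M • yc = w)
    (hind : ∀ N M : Polynomial ℂ, N • 1 + M • yc = 0 → N = 0 ∧ M = 0) :
    ∃ φ : S.affRing →ₐ[ℂ] B,
      Function.Surjective φ ∧ ∀ a, φ a = 0 ↔ S.isChart_aff.cr - algebraMap ℂ _ c ∣ a := by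
  set h := S.isChart_aff with hh
  set p := S.P.eval c with hp
  let xc : B := algebraMap (Polynomial ℂ) B Polynomial.X
  have hy : yc ^ 2 = xc * (xc - algebraMap ℂ _ p - 1) * (xc - algebraMap ℂ _ p + 1) := by
    have hC : algebraMap (Polynomial ℂ) B (Polynomial.C p) = algebraMap ℂ B p :=
      (IsScalarTower.algebraMap_apply ℂ (Polynomial ℂ) B p).symm
    rw [hyc]
    simp only [map_mul, map_sub, map_add, map_one, hC, xc]
  have haev (z : Polynomial ℂ) : Polynomial.aeval xc z = algebraMap (Polynomial ℂ) _ z := by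
    rw [Polynomial.aeval_algebraMap_apply, Polynomial.aeval_X_left_apply]
  have hcc (z : Polynomial ℂ) : Polynomial.aeval (algebraMap ℂ B c) z =
      algebraMap ℂ _ (z.eval c) := by
    rw [Polynomial.aeval_algebraMap_apply, Polynomial.coe_aeval_eq_eval]
  have hd0 : (S.P ^ 2 - 1).eval c ≠ 0 := by simpa [sub_ne_zero] using hc
  obtain ⟨φ, h1, h2, h3⟩ := h.exists_hom' (algebraMap ℂ B c) xc yc (by
      rw [map_one, one_mul, aeval_affPoly, hy, hcc]) (by
      rw [aeval_disc, hcc]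
      exact (isUnit_iff_ne_zero.2 hd0).map _)
  set T := h.cr - algebraMap ℂ h.ring c with hT
  have hφT : φ T = 0 := by rw [hT, map_sub, h1, AlgHom.commutes, sub_self]
  have hφ (N M : Polynomial ℂ) : φ (Polynomial.aeval h.cs N + Polynomial.aeval h.cs M * h.cz) =
      N • (1 : B) + M • yc := by
    rw [map_add, map_mul, ← Polynomial.aeval_algHom_apply, ← Polynomial.aeval_algHom_apply, h2, h3,
      haev, haev, Algebra.smul_def, Algebra.smul_def, mul_one]
  have key (a : h.ring) : ∃ N M : Polynomial ℂ,
      T ∣ a - (Polynomial.aeval h.cs N + Polynomial.aeval h.cs M * h.cz) := by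
    refine h.induction (motive := fun a => ∃ N M : Polynomial ℂ,
      T ∣ a - (Polynomial.aeval h.cs N + Polynomial.aeval h.cs M * h.cz)) ?_ ?_ ?_ ?_ ?_ ?_ ?_ a
    · exact ⟨Polynomial.C c, 0, by simp [hT]⟩
    · exact ⟨Polynomial.X, 0, by simp⟩
    · exact ⟨0, 1, by simp⟩
    · obtain ⟨k, hk⟩ := sub_dvd_aeval_sub_eval h.cr c (S.P ^ 2 - 1)
      refine ⟨Polynomial.C ((S.P ^ 2 - 1).eval c)⁻¹, 0, ?_⟩
      have h4 := S.disc_ci h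
      set e := (S.P ^ 2 - 1).eval c
      have h5 : algebraMap ℂ h.ring e * algebraMap ℂ h.ring e⁻¹ = 1 := by
        rw [← map_mul, mul_inv_cancel₀ hd0, map_one]
      refine ⟨-(k * h.ci * algebraMap ℂ h.ring e⁻¹), ?_⟩
      simp only [Polynomial.aeval_C, map_zero, zero_mul, add_zero]
      linear_combination -h.ci * h5 + algebraMap ℂ h.ring e⁻¹ * h4 - h.ci * algebraMap ℂ h.ring e⁻¹ * hk
    · exact fun z => ⟨Polynomial.C z, 0, by simp⟩
    · rintro x y ⟨N, M, h4⟩ ⟨N', M', h5⟩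
      refine ⟨N + N', M + M', ?_⟩
      convert dvd_add h4 h5 using 1
      simp only [map_add]
      ring
    · rintro x y ⟨N, M, k, hk⟩ ⟨N', M', l, hl⟩
      obtain ⟨m, hm⟩ := sub_dvd_aeval_sub_eval h.cr c S.P
      rw [← hp] at hm
      have hrel := S.aff_rel
      rw [← hh, sub_eq_iff_eq_add.1 hm] at hrel
      refine ⟨N * N' + M * M' * (Polynomial.X * (Polynomial.X - Polynomial.C p - 1) *
        (Polynomial.X - Polynomial.C p + 1)), N * M' + M * N', ?_⟩
      simp only [map_add, map_mul, map_sub, map_one, Polynomial.aeval_X, Polynomial.aeval_C]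
      have hx := sub_eq_iff_eq_add.1 hk
      have hy := sub_eq_iff_eq_add.1 hl
      refine ⟨k * y + (Polynomial.aeval h.cs N + Polynomial.aeval h.cs M * h.cz) * l +
        Polynomial.aeval h.cs M * Polynomial.aeval h.cs M' *
          (- (h.cs * m * (2 * (h.cs - algebraMap ℂ h.ring p) - T * m))), ?_⟩
      linear_combination y * hx + (Polynomial.aeval h.cs N + Polynomial.aeval h.cs M * h.cz) * hy +
        Polynomial.aeval h.cs M * Polynomial.aeval h.cs M' * hrel
  refine ⟨φ, fun w => ?_, fun a => ⟨fun ha => ?_, ?_⟩⟩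
  · obtain ⟨N, M, rfl⟩ := hspan w
    exact ⟨_, hφ N M⟩
  · obtain ⟨N, M, k, hk⟩ := key a
    have h4 := congrArg φ hk
    rw [map_sub, map_mul, hφT, zero_mul, ha, zero_sub, neg_eq_zero, hφ] at h4
    obtain ⟨rfl, rfl⟩ := hind N M h4
    refine ⟨k, ?_⟩
    rw [← hk]
    simp
  · rintro ⟨k, rfl⟩
    rw [map_mul, hφT, zero_mul]

end LegendreModel

end Inose

end

noncomputable section

namespace Inose

open IsLocalRing MvPolynomial

variable {K : Type*} [Field K] [Algebra ℂ K]

namespace LocalRingIn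

variable {P : LocalRingIn K} {V : ValuationSubring K}

lemma IsDominatedBy.valuation_lt_one (h : P.IsDominatedBy V) {f : K} (hf : P.Vanishes f) :
    V.valuation f < 1 := by
  obtain ⟨h1, h2⟩ := (vanishes_iff P f).1 hf
  rcases eq_or_ne f 0 with rfl | h0
  · rw [map_zero]
    exact zero_lt_one
  have h3 := (ValuationSubring.valuation_le_one_iff _ _).2 (h.1 f h1)
  refine h3.lt_of_ne fun h4 => ?_
  refine h2.elim h0 fun h5 => h5 (h.2 f h1 ((inv_mem_iff_one_le h0).2 h4.ge))

lemma IsDominatedBy.vanishes (h : P.IsDominatedBy V) {f : K} (hf : f ∈ P.carrier)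
    (h1 : V.valuation f < 1) : P.Vanishes f := by
  rw [vanishes_iff]
  refine ⟨hf, ?_⟩
  rcases eq_or_ne f 0 with rfl | h0
  · exact Or.inl rfl
  · exact Or.inr fun h2 => h1.not_ge ((inv_mem_iff_one_le h0).1 (h.1 _ h2))

end LocalRingIn

namespace LegendreModel

variable (S : LegendreModel K) {c : ℂ}

lemma x_sub_ne_zero (c : ℂ) : S.x - algebraMap ℂ K c ≠ 0 := by
  have := aeval_ne_zero_of_algebraicIndependent S.frame.ind (Polynomial.X_sub_C_ne_zero c)
  rwa [map_sub, Polynomial.aeval_X, Polynomial.aeval_C] at this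

lemma mem_of_valuation_sub_lt {V : ValuationSubring K} (hV : Constants V)
    (h : V.valuation (S.x - algebraMap ℂ K c) < 1) : S.x ∈ V := by
  have := add_mem ((ValuationSubring.valuation_le_one_iff _ _).1 h.le) (hV c)
  rwa [sub_add_cancel] at this

lemma valuation_aeval_sub_lt {V : ValuationSubring K} (hV : Constants V)
    (h : V.valuation (S.x - algebraMap ℂ K c) < 1) (q : Polynomial ℂ) :
    V.valuation (Polynomial.aeval S.x q - algebraMap ℂ K (q.eval c)) < 1 := by
  have hx := S.mem_of_valuation_sub_lt hV h
  obtain ⟨k, hk⟩ := sub_dvd_aeval_sub_eval (⟨S.x, hx⟩ : hV.subalgebra) c q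
  have h1 := congrArg (fun z : hV.subalgebra => V.valuation (z : K)) hk
  have h2 := map_polynomial_aeval hV.subalgebra.val ⟨S.x, hx⟩ q
  simp only [AddSubgroupClass.coe_sub, MulMemClass.coe_mul, Subalgebra.coe_algebraMap, map_mul] at h1
  change ((Polynomial.aeval (⟨S.x, hx⟩ : hV.subalgebra) q : hV.subalgebra) : K) = _ at h2
  rw [h2] at h1
  change V.valuation (Polynomial.aeval S.x q - _) = _ at h1
  rw [h1, mul_comm]
  exact valuation_mul_lt_one ((ValuationSubring.valuation_le_one_iff _ _).2 k.2) h

lemma disc_inv_mem_of_lt {V : ValuationSubring K} (hV : Constants V)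
    (h : V.valuation (S.x - algebraMap ℂ K c) < 1) (hc : S.P.eval c ^ 2 ≠ 1) : S.disc⁻¹ ∈ V := by
  have h1 := S.valuation_aeval_sub_lt hV h (S.P ^ 2 - 1)
  have h2 : (S.P ^ 2 - 1).eval c ≠ 0 := by simpa [sub_ne_zero] using hc
  have h3 : V.valuation (algebraMap ℂ K ((S.P ^ 2 - 1).eval c)) = 1 := hV.valuation_eq_one h2
  rw [inv_mem_iff_one_le S.disc_ne_zero]
  refine le_of_eq ?_
  rw [← h3]
  refine (Valuation.map_eq_of_sub_lt _ ?_).symm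
  rw [h3]
  exact h1

variable {Y : CompleteVariety K}

lemma exists_chart_of_vanishes (hc : S.P.eval c ^ 2 ≠ 1) {P : LocalRingIn K}
    (ht : P.Vanishes (S.x - algebraMap ℂ K c)) {V : ValuationSubring K} (hV : Constants V)
    (hdom : P.IsDominatedBy V) : Below S.affRing V ∨
      (Below S.zeroRing V ∧ V.valuation (S.u / S.v) < 1) := by
  have hlt := hdom.valuation_lt_one ht
  have hx := S.mem_of_valuation_sub_lt hV hlt
  have hd := S.disc_inv_mem_of_lt hV hlt hc
  by_cases hu : S.u ∈ V
  · exact Or.inl ((S.below_affRing hV).2 ⟨hx, hu, S.v_mem hV hx hu, hd⟩)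
  · obtain ⟨h3, -, h4⟩ := S.below_zeroRing_of_notMem hV hx hd hu
    exact Or.inr ⟨h3, h4⟩

/-- The ideal of a smooth fibre. -/
def fibreIdeal (c : ℂ) : Ideal S.affRing := Ideal.span {S.isChart_aff.cr - algebraMap ℂ _ c}

lemma exists_restriction_legendre (hc : S.P.eval c ^ 2 ≠ 1) :
    ∃ φ : S.affRing →ₐ[ℂ] (legendreCurve (S.P.eval c)).toAffine.CoordinateRing,
      Function.Surjective φ ∧ ∀ a, φ a = 0 ↔ a ∈ S.fibreIdeal c := by
  obtain ⟨φ, h3, h4⟩ := S.exists_restriction hc _ (sq_mk_legendreCurve _)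
    (fun w => by
      obtain ⟨N, M, h⟩ := WeierstrassCurve.Affine.CoordinateRing.exists_smul_basis_eq w
      exact ⟨N, M, h⟩)
    (fun N M h => WeierstrassCurve.Affine.CoordinateRing.smul_basis_eq_zero h)
  refine ⟨φ, h3, fun a => ?_⟩
  rw [h4, fibreIdeal, Ideal.mem_span_singleton]

lemma isPrime_fibreIdeal (hc : S.P.eval c ^ 2 ≠ 1) : (S.fibreIdeal c).IsPrime := by
  obtain ⟨φ, -, h⟩ := S.exists_restriction_legendre hc
  have : S.fibreIdeal c = RingHom.ker φ := by
    ext a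
    exact (h a).symm
  rw [this]
  exact RingHom.ker_isPrime _

lemma aff_sub_ne : S.isChart_aff.cr - algebraMap ℂ S.affRing c ≠ 0 := fun h =>
  S.x_sub_ne_zero c (congrArg Subtype.val h)

lemma fibreIdeal_ne_bot : S.fibreIdeal c ≠ ⊥ := by
  rw [fibreIdeal, Ne, Ideal.span_singleton_eq_bot]
  exact S.aff_sub_ne

lemma fibreIdeal_ne_of_isMaximal (hc : S.P.eval c ^ 2 ≠ 1) (p : Ideal S.affRing)
    [hp : p.IsMaximal] : S.fibreIdeal c ≠ p := by
  rintro rfl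
  obtain ⟨φ, h3, h⟩ := S.exists_restriction_legendre hc
  obtain ⟨a, ha⟩ := h3 (algebraMap (Polynomial ℂ) _ Polynomial.X)
  obtain ⟨e, he⟩ := LocalRingIn.exists_const _ S.isChart_aff.fg_ring (S.fibreIdeal c) a
  rw [← h, map_sub, ha, AlgHom.commutes] at he
  have h4 : (Polynomial.X - Polynomial.C e) • (1 :
      (legendreCurve (S.P.eval c)).toAffine.CoordinateRing) +
      (0 : Polynomial ℂ) • WeierstrassCurve.Affine.CoordinateRing.mk _ Polynomial.X = 0 := by
    rw [zero_smul, add_zero, Algebra.smul_def, mul_one, map_sub]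
    exact he
  exact Polynomial.X_sub_C_ne_zero e
    (WeierstrassCurve.Affine.CoordinateRing.smul_basis_eq_zero h4).1

lemma fibreIdeal_le {p : Ideal S.affRing} (h : S.isChart_aff.cr - algebraMap ℂ _ c ∈ p) :
    S.fibreIdeal c ≤ p := by
  rwa [fibreIdeal, Ideal.span_singleton_le_iff_mem]

/-- At each closed point of a smooth fibre, the surface is regular and the local parameter of the
base belongs to a system of parameters. -/
lemma regular_of_vanishes (h1 : S.affRing ∈ Y.charts) (h2 : S.zeroRing ∈ Y.charts)
    (hc : S.P.eval c ^ 2 ≠ 1) {P : LocalRingIn K} (hP : P ∈ Y.closedPoints)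
    (ht : P.Vanishes (S.x - algebraMap ℂ K c)) : IsRegularLocalRing P.carrier ∧
      ∀ h : S.x - algebraMap ℂ K c ∈ P.carrier,
        (⟨S.x - algebraMap ℂ K c, h⟩ : P.carrier) ∉ maximalIdeal P.carrier ^ 2 := by
  obtain ⟨V, hV, hdom⟩ := P.exists_dominating
  rcases S.exists_chart_of_vanishes hc ht hV hdom with hA | ⟨hA, hlt⟩
  · obtain ⟨p, hp, rfl⟩ := Y.exists_maximal hP hV hdom h1 hA
    have hT : S.isChart_aff.cr - algebraMap ℂ _ c ∈ p := (LocalRingIn.vanishes_ofPrime _ _ _).1 ht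
    obtain ⟨y, -, hm⟩ := S.exists_parameter_aff hc hT
    have := S.isPrime_fibreIdeal hc
    have hd := LocalRingIn.two_le_ringKrullDim S.fibreIdeal_ne_bot (S.fibreIdeal_le hT)
      (S.fibreIdeal_ne_of_isMaximal hc p)
    have := LocalRingIn.isNoetherianRing_ofPrime S.affRing p S.isChart_aff.fg_ring
    exact ⟨isRegularLocalRing_of_pair hm hd, fun _ => notMem_sq_of_pair hm hd⟩
  · obtain ⟨p, hp, rfl⟩ := Y.exists_maximal hP hV hdom h2 hA
    have hT : S.isChart_zero.cr - algebraMap ℂ _ c ∈ p := (LocalRingIn.vanishes_ofPrime _ _ _).1 ht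
    have hz : S.isChart_zero.cz ∈ p := (LocalRingIn.vanishes_ofPrime _ _ _).1
      (hdom.vanishes (LocalRingIn.le_ofPrime _ _ S.isChart_zero.cz.2) hlt)
    have hm := S.maximalIdeal_zero hc hT hz
    obtain ⟨R, hR, -⟩ := S.exists_zeroSection
    have hd := R.two_le_ringKrullDim S.isChart_zero.fg_ring (p := p) (hR ▸ hz)
    have := LocalRingIn.isNoetherianRing_ofPrime S.zeroRing p S.isChart_zero.fg_ring
    rw [Set.pair_comm] at hm
    exact ⟨isRegularLocalRing_of_pair hm hd, fun _ => notMem_sq_of_pair hm hd⟩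

lemma isSmoothFibre (h1 : S.affRing ∈ Y.charts) (h2 : S.zeroRing ∈ Y.charts)
    (hc : S.P.eval c ^ 2 ≠ 1) : Y.IsSmoothFibre (S.x - algebraMap ℂ K c) :=
  fun _ hP ht => (S.regular_of_vanishes h1 h2 hc hP ht).2

lemma isDiscreteValuationRing_fibre [hp : (S.fibreIdeal c).IsPrime] :
    IsDiscreteValuationRing (LocalRingIn.ofPrime S.affRing (S.fibreIdeal c)).carrier := by
  have h1 : IsNoetherianRing (LocalRingIn.ofPrime S.affRing (S.fibreIdeal c)).carrier :=
    LocalRingIn.isNoetherianRing_ofPrime _ _ S.isChart_aff.fg_ring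
  have h3 := LocalRingIn.maximalIdeal_ofPrime_eq_span S.affRing (S.fibreIdeal c)
    {S.isChart_aff.cr - algebraMap ℂ _ c}
    (by rw [Set.singleton_subset_iff]; exact Ideal.mem_span_singleton_self _)
    (fun a ha => ⟨1, fun h => hp.ne_top ((Ideal.eq_top_iff_one _).2 h), by rwa [one_mul]⟩)
  rw [Set.image_singleton] at h3
  have h2 : ¬ IsField (LocalRingIn.ofPrime S.affRing (S.fibreIdeal c)).carrier := by
    rw [isField_iff_maximalIdeal_eq, h3, Ideal.span_singleton_eq_bot]
    intro h
    exact S.x_sub_ne_zero c (congrArg Subtype.val h)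
  refine ((IsDiscreteValuationRing.TFAE
    (LocalRingIn.ofPrime S.affRing (S.fibreIdeal c)).carrier h2).out 0 4).2 ?_
  exact ⟨_, h3⟩

/-- A smooth fibre is irreducible. -/
lemma fibreComponents_eq (h1 : S.affRing ∈ Y.charts) (h2 : S.zeroRing ∈ Y.charts)
    (hc : S.P.eval c ^ 2 ≠ 1) [(S.fibreIdeal c).IsPrime] :
    Y.fibreComponents (S.x - algebraMap ℂ K c) =
      {LocalRingIn.ofPrime S.affRing (S.fibreIdeal c)} := by
  ext D
  rw [Set.mem_singleton_iff]
  constructor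
  · rintro ⟨⟨hD, hdvr⟩, ht⟩
    obtain ⟨V, hV, hdom⟩ := D.exists_dominating
    rcases S.exists_chart_of_vanishes hc ht hV hdom with hA | ⟨hA, hlt⟩
    · obtain rfl := Y.eq_centre hD hV hdom h1 hA
      have hT : S.isChart_aff.cr - algebraMap ℂ _ c ∈ centreIdeal hA :=
        (LocalRingIn.vanishes_ofPrime _ _ _).1 ht
      have : IsDiscreteValuationRing (LocalRingIn.ofPrime S.affRing (centreIdeal hA)).carrier := hdvr
      exact LocalRingIn.ofPrime_congr _ _ (LocalRingIn.eq_of_isDiscreteValuationRing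
        S.fibreIdeal_ne_bot (S.fibreIdeal_le hT)).symm
    · exfalso
      obtain rfl := Y.eq_centre hD hV hdom h2 hA
      have hT : S.isChart_zero.cr - algebraMap ℂ _ c ∈ centreIdeal hA :=
        (LocalRingIn.vanishes_ofPrime _ _ _).1 ht
      have hz : S.isChart_zero.cz ∈ centreIdeal hA := (LocalRingIn.vanishes_ofPrime _ _ _).1
        (hdom.vanishes (le_centre hA S.isChart_zero.cz.2) hlt)
      have : IsDiscreteValuationRing (LocalRingIn.ofPrime S.zeroRing (centreIdeal hA)).carrier := hdvr
      obtain ⟨R, hR, hR'⟩ := S.exists_zeroSection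
      have := LocalRingIn.eq_of_isDiscreteValuationRing R.prime_ne_bot
        (R.prime_le (p := centreIdeal hA) (hR ▸ hz))
      exact hR' c (this ▸ hT)
  · rintro rfl
    refine ⟨⟨⟨_, h1, _, inferInstance, rfl⟩, S.isDiscreteValuationRing_fibre⟩, ?_⟩
    exact (LocalRingIn.vanishes_ofPrime _ (S.fibreIdeal c)
      (S.isChart_aff.cr - algebraMap ℂ _ c)).2 (Ideal.mem_span_singleton_self _)

lemma exists_component (h1 : S.affRing ∈ Y.charts) (h2 : S.zeroRing ∈ Y.charts)
    (hc : S.P.eval c ^ 2 ≠ 1) : ∃ C : LocalRingIn K,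
      Y.fibreComponents (S.x - algebraMap ℂ K c) = {C} ∧ HasModularInvariant
        (ResidueField C.carrier) ((S.P.eval c ^ 2 + 3) ^ 3 / (27 * (S.P.eval c ^ 2 - 1) ^ 2)) := by
  have := S.isPrime_fibreIdeal hc
  refine ⟨_, S.fibreComponents_eq h1 h2 hc, ?_⟩
  have hell := isElliptic_legendreCurve hc
  obtain ⟨φ, h3, h4⟩ := S.exists_restriction_legendre hc
  exact ⟨legendreCurve (S.P.eval c), hell, j_legendreCurve hc,
    LocalRingIn.nonempty_residueField_equiv _ _ φ h3 h4⟩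

end LegendreModel

lemma CompleteVariety.not_isExceptionalComponent_of_singleton {Y : CompleteVariety K} {t : K}
    {C : LocalRingIn K} (h : Y.fibreComponents t = {C}) (E : LocalRingIn K) :
    ¬ Y.IsExceptionalComponent t E := by
  rintro ⟨h1, -, -, h4⟩
  rw [h, Set.mem_singleton_iff] at h1
  subst h1
  rw [h, Set.sdiff_self, finsum_mem_empty] at h4
  have h5 : E ∈ Y.fibreComponents t := by rw [h]; rfl
  obtain ⟨ht, ht'⟩ := h5.2
  have h6 : ((1 : ℕ) : ℕ∞) ≤ E.order t := by
    unfold LocalRingIn.order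
    exact le_iSup₂_of_le 1 ⟨ht, by rwa [pow_one]⟩ le_rfl
  rw [← h4] at h6
  simp at h6

end Inose

end

noncomputable section

namespace Inose

open IsLocalRing MvPolynomial

variable (a b : ℂ)

instance : CharZero (InoseField a b) :=
  charZero_of_injective_algebraMap (algebraMap ℂ (InoseField a b)).injective

/-- A function fixed by the involution is a function on the quotient. -/
lemma mem_quotientField {f : InoseField a b} (hf : beta a b f = f) : f ∈ QuotientField a b := by
  have h : Subgroup.zpowers (beta a b) ≤ MulAction.stabilizer _ f := (Subgroup.zpowers_le).2 hf
  rintro ⟨g, hg⟩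
  exact h hg

lemma beta_of_mem {f : InoseField a b} (hf : f ∈ QuotientField a b) : beta a b f = f :=
  hf ⟨beta a b, Subgroup.mem_zpowers _⟩

/-- The rational function `y²` on `Y(a,b)`. -/
def quotU : QuotientField a b := ⟨coordY a b ^ 2, mem_quotientField a b (by
  rw [map_pow, (beta_coord a b).2.1, neg_sq])⟩

/-- The rational function `z - 1 / z`. -/
def coordW : InoseField a b := coordZ a b - (coordZ a b)⁻¹

/-- The rational function `y (z - 1 / z) / 2` on `Y(a,b)`. -/
def quotV : QuotientField a b := ⟨coordY a b * coordW a b / 2, mem_quotientField a b (by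
  rw [coordW, map_div₀, map_mul, map_sub, map_inv₀, (beta_coord a b).2.1, (beta_coord a b).2.2,
    map_ofNat, inv_inv]
  ring)⟩

lemma aeval_cubicP {R : Type*} [CommRing R] [Algebra ℂ R] (x : R) :
    Polynomial.aeval x (cubicP a b) = 4 * x ^ 3 - 3 * algebraMap ℂ R a * x - algebraMap ℂ R b := by
  simp only [cubicP, map_sub, map_mul, map_pow, map_ofNat, Polynomial.aeval_X, Polynomial.aeval_C]

lemma coord_add : coordZ a b + (coordZ a b)⁻¹ =
    2 * (coordY a b ^ 2 - Polynomial.aeval (coordX a b) (cubicP a b)) := by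
  have h := coord_eq a b
  have hz := coordZ_ne_zero a b
  have h2 : algebraMap ℂ (InoseField a b) (1 / 2) * 2 = 1 := by
    rw [← map_ofNat (algebraMap ℂ (InoseField a b)) 2, ← map_mul]
    norm_num
  rw [aeval_cubicP]
  field_simp
  linear_combination -2 * h - (coordZ a b ^ 2 + 1) * h2

lemma coordW_sq : coordW a b ^ 2 =
    4 * ((coordY a b ^ 2 - Polynomial.aeval (coordX a b) (cubicP a b)) ^ 2 - 1) := by
  have h := coord_add a b
  have hz := mul_inv_cancel₀ (coordZ_ne_zero a b)
  rw [coordW]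
  linear_combination (coordZ a b + (coordZ a b)⁻¹ + 2 * (coordY a b ^ 2 -
    Polynomial.aeval (coordX a b) (cubicP a b))) * h - 4 * hz

/-- The field of rational functions in `x` and `y²`. -/
abbrev baseField : IntermediateField ℂ (InoseField a b) :=
  IntermediateField.adjoin ℂ {coordX a b, coordY a b ^ 2}

lemma exists_coordinates (f : InoseField a b) : ∃ α β γ δ : baseField a b,
    f = α + β * coordY a b + γ * coordW a b + δ * (coordY a b * coordW a b) := by
  have hx : coordX a b ∈ baseField a b := left_mem_adjoin _ _
  have hu : coordY a b ^ 2 ∈ baseField a b := right_mem_adjoin _ _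
  have hq : coordY a b ^ 2 - Polynomial.aeval (coordX a b) (cubicP a b) ∈ baseField a b :=
    sub_mem hu (polynomial_aeval_mem (A := (baseField a b).toSubalgebra) hx _)
  have hw : coordW a b ^ 2 ∈ baseField a b := by
    rw [coordW_sq]
    exact mul_mem (ofNat_mem _ 4) (sub_mem (pow_mem hq 2) (one_mem _))
  set A := Algebra.adjoin (baseField a b) {coordY a b, coordW a b} with hA
  have hsq (y : InoseField a b) (hy : y ^ 2 ∈ baseField a b) : IsIntegral (baseField a b) y :=
    ⟨Polynomial.X ^ 2 - Polynomial.C ⟨y ^ 2, hy⟩, Polynomial.monic_X_pow_sub_C _ two_ne_zero,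
      by simp⟩
  have hAint : A ≤ integralClosure (baseField a b) (InoseField a b) := by
    rw [hA, Algebra.adjoin_le_iff]
    rintro _ (rfl | rfl)
    exacts [hsq _ hu, hsq _ hw]
  have hAinv {g : InoseField a b} (hg : g ∈ A) : g⁻¹ ∈ A :=
    A.inv_mem_of_algebraic (x := ⟨g, hg⟩) (hAint hg).isAlgebraic
  have hbase {g : InoseField a b} (hg : g ∈ baseField a b) : g ∈ A :=
    A.algebraMap_mem ⟨g, hg⟩
  have hyA : coordY a b ∈ A := Algebra.subset_adjoin (by simp)
  have hwA : coordW a b ∈ A := Algebra.subset_adjoin (by simp)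
  have hzA : coordZ a b ∈ A := by
    have : coordZ a b = (coordY a b ^ 2 - Polynomial.aeval (coordX a b) (cubicP a b)) +
        coordW a b * 2⁻¹ := by
      have h := coord_add a b
      rw [coordW]
      linear_combination h / 2
    rw [this]
    exact add_mem (hbase hq) (mul_mem hwA (hbase (inv_mem (ofNat_mem _ 2))))
  have hpoly (p : MvPolynomial (Fin 3) ℂ) : toField a b p ∈ A := by
    rw [← aeval_coord]
    induction p using MvPolynomial.induction_on with
    | C c => rw [aeval_C]; exact hbase ((baseField a b).algebraMap_mem c)
    | add p q hp hq => rw [map_add]; exact add_mem hp hq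
    | mul_X p k hp =>
      rw [map_mul, aeval_X]
      refine mul_mem hp ?_
      fin_cases k
      exacts [hbase hx, hyA, hzA]
  have hf : f ∈ A := by
    obtain ⟨n, d, -, rfl⟩ := IsFractionRing.div_surjective (A := InoseRing a b) f
    obtain ⟨n, rfl⟩ := Ideal.Quotient.mk_surjective n
    obtain ⟨d, rfl⟩ := Ideal.Quotient.mk_surjective d
    rw [div_eq_mul_inv]
    exact mul_mem (hpoly n) (hAinv (hpoly d))
  induction hf using Algebra.adjoin_induction with
  | mem g hg =>
    rcases hg with rfl | rfl
    exacts [⟨0, 1, 0, 0, by simp⟩, ⟨0, 0, 1, 0, by simp⟩]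
  | algebraMap c => exact ⟨c, 0, 0, 0, by simp⟩
  | add f g _ _ hf hg =>
    obtain ⟨α, β, γ, δ, rfl⟩ := hf
    obtain ⟨α', β', γ', δ', rfl⟩ := hg
    exact ⟨α + α', β + β', γ + γ', δ + δ', by push_cast; ring⟩
  | mul f g _ _ hf hg =>
    obtain ⟨α, β, γ, δ, rfl⟩ := hf
    obtain ⟨α', β', γ', δ', rfl⟩ := hg
    let U : baseField a b := ⟨_, hu⟩
    let W : baseField a b := ⟨_, hw⟩
    refine ⟨α * α' + β * β' * U + γ * γ' * W + δ * δ' * U * W,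
      α * β' + β * α' + γ * δ' * W + δ * γ' * W,
      α * γ' + γ * α' + β * δ' * U + δ * β' * U, α * δ' + δ * α' + β * γ' + γ * β', ?_⟩
    push_cast
    change _ = _ + _ * (coordY a b ^ 2) + _ * (coordW a b ^ 2) +
      _ * (coordY a b ^ 2) * (coordW a b ^ 2) + (_ + _ * (coordW a b ^ 2) +
      _ * (coordW a b ^ 2)) * _ + (_ + _ * (coordY a b ^ 2) + _ * (coordY a b ^ 2)) * _ + _ * _
    ring

lemma beta_base (α : baseField a b) : beta a b α = α := by
  have h : baseField a b ≤ QuotientField a b := by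
    rw [IntermediateField.adjoin_le_iff]
    rintro _ (rfl | rfl)
    exacts [(lam a b).2, (quotU a b).2]
  exact beta_of_mem a b (h α.2)

lemma adjoin_quot : IntermediateField.adjoin ℂ {lam a b, quotU a b, quotV a b} = ⊤ := by
  rw [eq_top_iff]
  rintro f -
  obtain ⟨α, β, γ, δ, h⟩ := exists_coordinates a b f
  have h1 := congrArg (beta a b) h
  rw [beta_of_mem a b f.2] at h1
  simp only [map_add, map_mul, beta_base, coordW, map_sub, map_inv₀, (beta_coord a b).2.1,
    (beta_coord a b).2.2, inv_inv] at h1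
  have h2 : (f : InoseField a b) = α + δ * 2 * (quotV a b : InoseField a b) := by
    change _ = _ + _ * (coordY a b * coordW a b / 2)
    rw [coordW] at h ⊢
    linear_combination (h + h1) / 2
  have hmap := IntermediateField.adjoin_map ℂ {lam a b, quotU a b, quotV a b}
    (QuotientField a b).val
  rw [Set.image_insert_eq, Set.image_pair] at hmap
  have h3 : (f : InoseField a b) ∈ IntermediateField.adjoin ℂ {(QuotientField a b).val (lam a b),
      (QuotientField a b).val (quotU a b), (QuotientField a b).val (quotV a b)} := by
    have hle : baseField a b ≤ IntermediateField.adjoin ℂ {(QuotientField a b).val (lam a b),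
        (QuotientField a b).val (quotU a b), (QuotientField a b).val (quotV a b)} := by
      apply IntermediateField.adjoin.mono
      rintro _ (rfl | rfl)
      exacts [Or.inl rfl, Or.inr (Or.inl rfl)]
    rw [h2]
    exact add_mem (hle α.2) (mul_mem (mul_mem (hle δ.2) (ofNat_mem _ 2))
      (IntermediateField.subset_adjoin _ _ (by simp)))
  rw [← hmap] at h3
  obtain ⟨g, hg, hgf⟩ := h3
  rwa [← Subtype.ext (show (g : InoseField a b) = f from hgf)]

lemma exists_point (x₀ s₀ : ℂ) : ∃ y₀ z₀ : ℂ, y₀ ^ 2 = s₀ ∧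
    aeval ![x₀, y₀, z₀] (inoseAffine a b) = 0 := by
  obtain ⟨y₀, hy⟩ := IsAlgClosed.exists_pow_nat_eq s₀ two_pos
  set q := y₀ ^ 2 - (4 * x₀ ^ 3 - 3 * a * x₀ - b)
  obtain ⟨r, hr⟩ := IsAlgClosed.exists_pow_nat_eq (q ^ 2 - 1) two_pos
  refine ⟨y₀, q + r, hy, ?_⟩
  rw [inoseAffine_eq]
  simp only [map_add, map_sub, map_mul, map_pow, aeval_X, map_ofNat, aeval_C, map_one,
    Matrix.cons_val, Algebra.algebraMap_self_apply]
  simp only [q] at hr ⊢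
  linear_combination -hr / 2

lemma algebraicIndependent_quot : AlgebraicIndependent ℂ ![lam a b, quotU a b] := by
  rw [algebraicIndependent_iff]
  intro p hp
  have h1 := congrArg (QuotientField a b).val hp
  rw [map_zero, map_mvPolynomial_aeval] at h1
  have h2 : toField a b (aeval ![X 0, X 1 ^ 2] p) = 0 := by
    rw [map_mvPolynomial_aeval, ← h1]
    congr 2
    ext i
    fin_cases i
    · rfl
    · exact map_pow (toField a b) _ _
  have h3 : Ideal.Quotient.mk (Ideal.span {inoseAffine a b}) (aeval ![X 0, X 1 ^ 2] p) = 0 :=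
    IsFractionRing.injective (InoseRing a b) (InoseField a b) (h2.trans (map_zero _).symm)
  obtain ⟨k, hk⟩ := Ideal.mem_span_singleton.1 (Ideal.Quotient.eq_zero_iff_mem.1 h3)
  apply MvPolynomial.funext
  intro f
  obtain ⟨y₀, z₀, hy, hz⟩ := exists_point a b (f 0) (f 1)
  have h4 := congrArg (aeval ![f 0, y₀, z₀]) hk
  rw [map_mul, hz, zero_mul, map_mvPolynomial_aeval] at h4
  rw [map_zero, ← coe_aeval_eq_eval, ← h4]
  change aeval f p = _
  congr 2
  ext i
  fin_cases i <;> simp [hy]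

lemma quot_rel : quotV a b ^ 2 = quotU a b *
    (quotU a b - Polynomial.aeval (lam a b) (cubicP a b) - 1) *
      (quotU a b - Polynomial.aeval (lam a b) (cubicP a b) + 1) := by
  apply Subtype.ext
  have h := coordW_sq a b
  rw [aeval_cubicP] at h ⊢
  change (coordY a b * coordW a b / 2) ^ 2 = coordY a b ^ 2 * (coordY a b ^ 2 -
    (4 * coordX a b ^ 3 - 3 * algebraMap ℂ _ a * coordX a b - algebraMap ℂ _ b) - 1) *
    (coordY a b ^ 2 -
    (4 * coordX a b ^ 3 - 3 * algebraMap ℂ _ a * coordX a b - algebraMap ℂ _ b) + 1)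
  linear_combination coordY a b ^ 2 / 4 * h

lemma sq_ne_of_not_dvd {R : Type*} [CommRing R] [IsDomain R] [UniqueFactorizationMonoid R] {p n d G : R}
    (hp : Prime p) (hG : ¬ p ∣ G) (hd : d ≠ 0) : n ^ 2 ≠ d ^ 2 * p * G := by
  intro h
  have hn : n ≠ 0 := by
    rintro rfl
    rw [zero_pow two_ne_zero, eq_comm, mul_eq_zero, mul_eq_zero] at h
    rcases h with (h | h) | h
    exacts [hd (pow_eq_zero_iff two_ne_zero |>.1 h), hp.ne_zero h, hG (h ▸ dvd_zero p)]
  have h1 := congrArg (emultiplicity p) h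
  rw [emultiplicity_mul hp, emultiplicity_mul hp, emultiplicity_pow hp, emultiplicity_pow hp,
    emultiplicity_eq_zero.2 hG,
    (FiniteMultiplicity.of_not_isUnit hp.not_isUnit hn).emultiplicity_eq_multiplicity,
    (FiniteMultiplicity.of_not_isUnit hp.not_isUnit hd).emultiplicity_eq_multiplicity,
    (FiniteMultiplicity.of_not_isUnit hp.not_isUnit hp.ne_zero).emultiplicity_self] at h1
  have h2 : 2 * multiplicity p n = 2 * multiplicity p d + 1 + 0 := by exact_mod_cast h1
  omega

lemma natDegree_cubicP : (cubicP a b).natDegree = 3 := by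
  unfold cubicP
  compute_degree!

lemma cubicP_ne_C (c : ℂ) : cubicP a b - Polynomial.C c ≠ 0 := by
  intro h
  have h1 := natDegree_cubicP a b
  rw [sub_eq_zero.1 h, Polynomial.natDegree_C] at h1
  omega

lemma cubicP_sq_ne : cubicP a b ^ 2 - 1 ≠ 0 := by
  have h : cubicP a b ^ 2 - 1 = (cubicP a b - Polynomial.C 1) * (cubicP a b - Polynomial.C (-1)) := by
    simp only [map_neg, map_one]
    ring
  rw [h]
  exact mul_ne_zero (cubicP_ne_C a b _) (cubicP_ne_C a b _)

lemma quotV_notMem : quotV a b ∉ IntermediateField.adjoin ℂ {lam a b, quotU a b} := by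
  intro hv
  have hr : ({lam a b, quotU a b} : Set _) = Set.range ![lam a b, quotU a b] := by
    simp [Set.pair_comm]
  rw [hr, IntermediateField.mem_adjoin_range_iff] at hv
  obtain ⟨n, d, h⟩ := hv
  have hinj {p q : MvPolynomial (Fin 2) ℂ} (hpq : aeval ![lam a b, quotU a b] p =
      aeval ![lam a b, quotU a b] q) : p = q := algebraicIndependent_quot a b hpq
  set G : MvPolynomial (Fin 2) ℂ := (X 1 - Polynomial.aeval (X 0) (cubicP a b) - 1) *
    (X 1 - Polynomial.aeval (X 0) (cubicP a b) + 1) with hG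
  have hrel : quotV a b ^ 2 = aeval ![lam a b, quotU a b] (X 1 * G) := by
    rw [quot_rel, hG]
    simp [aeval_polynomial_aeval, mul_assoc]
  have hdvd : ¬ (X 1 : MvPolynomial (Fin 2) ℂ) ∣ G := by
    rintro ⟨k, hk⟩
    refine cubicP_sq_ne a b (Polynomial.funext fun c => ?_)
    have h1 := congrArg (aeval ![c, 0]) hk
    simp only [hG, map_mul, map_sub, map_add, map_one, aeval_X, aeval_polynomial_aeval,
      Matrix.cons_val, zero_mul, Polynomial.coe_aeval_eq_eval] at h1
    simp only [Polynomial.eval_sub, Polynomial.eval_pow, Polynomial.eval_one, Polynomial.eval_zero]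
    linear_combination h1
  have hp : Prime (X 1 : MvPolynomial (Fin 2) ℂ) := X_prime
  by_cases hd : aeval ![lam a b, quotU a b] d = 0
  · rw [h, hd, div_zero, zero_pow two_ne_zero, eq_comm, ← map_zero (aeval (R := ℂ) ![lam a b, quotU a b])] at hrel
    rcases mul_eq_zero.1 (hinj hrel) with h1 | h1
    exacts [hp.ne_zero h1, hdvd (h1 ▸ dvd_zero _)]
  · rw [h, div_pow, div_eq_iff (pow_ne_zero _ hd), ← map_pow, ← map_pow, ← map_mul] at hrel
    refine sq_ne_of_not_dvd (n := n) (d := d) hp hdvd ?_ ((hinj hrel).trans (by ring))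
    rintro rfl
    exact hd (map_zero _)

/-- The function field of `Y(a,b)`. -/
def model : LegendreModel (QuotientField a b) where
  x := lam a b
  u := quotU a b
  v := quotV a b
  P := cubicP a b
  frame := {
    ind := algebraicIndependent_quot a b
    notMem := quotV_notMem a b
    sq_mem := by
      have hx : lam a b ∈ IntermediateField.adjoin ℂ {lam a b, quotU a b} := left_mem_adjoin _ _
      have hu : quotU a b ∈ IntermediateField.adjoin ℂ {lam a b, quotU a b} := right_mem_adjoin _ _
      have hp := polynomial_aeval_mem
        (A := (IntermediateField.adjoin ℂ {lam a b, quotU a b}).toSubalgebra) hx (cubicP a b)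
      rw [quot_rel]
      exact mul_mem (mul_mem hu (sub_mem (sub_mem hu hp) (one_mem _)))
        (add_mem (sub_mem hu hp) (one_mem _))
    top := adjoin_quot a b }
  rel := quot_rel a b
  disc_ne := cubicP_sq_ne a b

end Inose

end

noncomputable section

namespace Inose

open IsLocalRing

variable {K : Type*} [Field K] [Algebra ℂ K]

namespace LegendreModel

variable (S : LegendreModel K)

lemma sub_ne : S.u - Polynomial.aeval S.x S.P - 1 ≠ 0 := by
  intro h
  have := S.rel
  rw [h, mul_zero, zero_mul] at this
  exact S.v_ne (pow_eq_zero_iff two_ne_zero |>.1 this)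

lemma exists_shift (c : ℂ) : ∃ h : Polynomial ℂ, h.coeff 0 ≠ 0 ∧
    S.disc = (S.x - algebraMap ℂ K c) ^ (S.P ^ 2 - 1).rootMultiplicity c *
      Polynomial.aeval (S.x - algebraMap ℂ K c) h := by
  obtain ⟨q, hq, hq'⟩ :=
    Polynomial.exists_eq_pow_rootMultiplicity_mul_and_not_dvd (S.P ^ 2 - 1) S.disc_ne c
  refine ⟨q.comp (Polynomial.X + Polynomial.C c), ?_, ?_⟩
  · rw [Polynomial.coeff_zero_eq_eval_zero, Polynomial.eval_comp]
    simpa [Polynomial.dvd_iff_isRoot] using hq'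
  · rw [disc]
    conv_lhs => rw [hq]
    rw [map_mul, map_pow, Polynomial.aeval_comp]
    simp

/-- The equation of the family around the fibre over a root of the discriminant. -/
def nodeModel {c : ℂ} (hc : S.P.eval c ^ 2 = 1) : FibreModel K where
  τ := S.x - algebraMap ℂ K c
  U := S.u
  W := S.u⁻¹ * S.v
  n := (S.P ^ 2 - 1).rootMultiplicity c
  c₁ := 1
  c₂ := (S.exists_shift c).choose
  c₃ := -2 * S.P.comp (Polynomial.X + Polynomial.C c)
  d := (S.exists_shift c).choose
  frame := by
    refine S.frame.change' (l := S.u⁻¹) (sub_mem (left_mem_adjoin _ _)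
      (IntermediateField.algebraMap_mem _ _)) (right_mem_adjoin _ _) ?_ (right_mem_adjoin _ _)
      (inv_mem (right_mem_adjoin _ _)) (inv_ne_zero S.u_ne) rfl
    have := add_mem (left_mem_adjoin (S.x - algebraMap ℂ K c) S.u)
      (IntermediateField.algebraMap_mem _ c)
    rwa [sub_add_cancel] at this
  n_ne := by
    rw [← Nat.pos_iff_ne_zero, Polynomial.rootMultiplicity_pos S.disc_ne]
    simp [hc]
  rel := by
    have hu := S.u_ne
    have h := (S.exists_shift c).choose_spec.2.trans (mul_comm _ _)
    have h2 := S.rel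
    rw [← mul_div_assoc, ← h, map_mul, Polynomial.aeval_comp]
    simp only [disc, map_sub, map_pow, map_add, map_neg, map_ofNat, map_one, Polynomial.aeval_X,
      Polynomial.aeval_C, sub_add_cancel]
    field_simp
    linear_combination h2
  dvd₁ := one_dvd _
  dvd₂ := dvd_rfl
  d_zero := (S.exists_shift c).choose_spec.1

variable {c : ℂ} (hc : S.P.eval c ^ 2 = 1)

/-- The model in the coordinates of the family. -/
def presentsNode : (S.nodeModel hc).Presents S where
  i := 0
  j := 0
  k := (S.P ^ 2 - 1).rootMultiplicity c
  F := 0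
  τ_eq := Or.inl ⟨c, rfl⟩
  u_eq := by simp [nodeModel]
  v_eq := by
    have := S.u_ne
    simp [nodeModel]
    field_simp
  disc_eq := by
    rw [zpow_natCast]
    exact (S.exists_shift c).choose_spec.2

lemma exists_node_sqrt {c : ℂ} (hc : S.P.eval c ^ 2 = 1) :
    ∃ w : ℂ, w ≠ 0 ∧ (S.nodeModel hc).c₃.coeff 0 = w ^ 2 := by
  have h : (S.nodeModel hc).c₃.coeff 0 = -2 * S.P.eval c := by
    rw [Polynomial.coeff_zero_eq_eval_zero]
    simp [nodeModel]
  obtain ⟨w, hw⟩ := IsAlgClosed.exists_pow_nat_eq (-2 * S.P.eval c) two_pos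
  refine ⟨w, ?_, h.trans hw.symm⟩
  rintro rfl
  have : S.P.eval c = 0 := by linear_combination hw / 2
  rw [this] at hc
  norm_num at hc

end LegendreModel

section Infinity

variable (a b : ℂ)

/-- The polynomial `X³ (P(1 / X) + k)`. -/
def reverseP (k : ℂ) : Polynomial ℂ :=
  4 - 3 * Polynomial.C a * Polynomial.X ^ 2 + Polynomial.C (k - b) * Polynomial.X ^ 3

variable {a b} {S : LegendreModel K}

lemma aeval_P_add (hS : S.P = cubicP a b) (k : ℂ) : Polynomial.aeval S.x S.P + algebraMap ℂ K k =
    Polynomial.aeval S.x⁻¹ (reverseP a b k) / S.x⁻¹ ^ 3 := by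
  have hx := S.x_ne
  rw [hS, aeval_cubicP, reverseP]
  simp only [map_add, map_sub, map_mul, map_pow, map_ofNat, Polynomial.aeval_X, Polynomial.aeval_C]
  field_simp
  ring

lemma reverseP_zero (k : ℂ) : (reverseP a b k).coeff 0 = 4 := by
  rw [Polynomial.coeff_zero_eq_eval_zero]
  simp [reverseP]

/-- The equation of the family around the fibre at infinity. -/
def starModel (hS : S.P = cubicP a b) : StarModel K where
  τ := S.x⁻¹
  U := S.x⁻¹ ^ 4 * (S.u - Polynomial.aeval S.x S.P - 1)
  W := S.x⁻¹ ^ 2 / (S.u - Polynomial.aeval S.x S.P - 1) * S.v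
  n := 5
  c₁ := 1
  c₂ := 2 * reverseP a b 1
  c₃ := Polynomial.X * reverseP a b 3
  c₄ := reverseP a b 3
  d := reverseP a b 1 * reverseP a b (-1)
  frame := by
    have hx := S.x_ne
    have he := S.sub_ne
    have hx' := left_mem_adjoin S.x S.u
    have hP := polynomial_aeval_mem (A := (IntermediateField.adjoin ℂ {S.x, S.u}).toSubalgebra)
      hx' S.P
    have he' : S.u - Polynomial.aeval S.x S.P - 1 ∈ IntermediateField.adjoin ℂ {S.x, S.u} :=
      sub_mem (sub_mem (right_mem_adjoin _ _) hP) (one_mem _)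
    have hx2 := inv_mem (left_mem_adjoin S.x⁻¹
      (S.x⁻¹ ^ 4 * (S.u - Polynomial.aeval S.x S.P - 1)))
    rw [inv_inv] at hx2
    refine S.frame.change' (inv_mem hx') (mul_mem (pow_mem (inv_mem hx') 4) he') hx2 ?_
      (div_mem (pow_mem (inv_mem hx') 2) he') (div_ne_zero (pow_ne_zero _ (inv_ne_zero hx)) he) rfl
    have : S.u = S.x⁻¹ ^ 4 * (S.u - Polynomial.aeval S.x S.P - 1) * S.x ^ 4 +
        (Polynomial.aeval S.x S.P + 1) := by
      field_simp
      ring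
    have hm := add_mem (mul_mem (right_mem_adjoin _ _) (pow_mem hx2 4)) (add_mem
      (polynomial_aeval_mem (A := (IntermediateField.adjoin ℂ _).toSubalgebra) hx2 S.P) (one_mem _))
    rwa [← this] at hm
  n_ne := by norm_num
  rel := by
    have hx := S.x_ne
    have he := S.sub_ne
    have h1 := aeval_P_add hS 1
    have h3 := aeval_P_add hS 3
    have h := S.rel
    rw [map_one] at h1
    rw [map_ofNat] at h3
    have hx3 : S.x⁻¹ ^ 3 ≠ 0 := pow_ne_zero _ (inv_ne_zero hx)
    rw [eq_div_iff hx3] at h1 h3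
    simp only [map_mul, map_one, map_ofNat, Polynomial.aeval_X, ← h1, ← h3]
    set e := S.u - Polynomial.aeval S.x S.P - 1 with hedef
    have hP : Polynomial.aeval S.x S.P = S.u - e - 1 := by rw [hedef]; ring
    rw [hP] at h ⊢
    field_simp
    rw [h]
    ring
  dvd₁ := one_dvd _
  dvd₂ := ⟨Polynomial.C (1 / 2) * reverseP a b (-1), by
    have : (2 : Polynomial ℂ) * Polynomial.C (1 / 2) = 1 := by
      rw [← map_ofNat Polynomial.C 2, ← Polynomial.C_mul]
      norm_num
    linear_combination - reverseP a b 1 * reverseP a b (-1) * this⟩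
  d_zero := by
    rw [Polynomial.mul_coeff_zero, reverseP_zero, reverseP_zero]
    norm_num
  n_eq := rfl
  c₃_eq := rfl
  c₄_zero := by rw [reverseP_zero]; norm_num

/-- The model in the coordinates of the family. -/
def presentsStar (hS : S.P = cubicP a b) : (starModel hS).toFibreModel.Presents S where
  i := -4
  j := -6
  k := -6
  F := S.P + 1
  τ_eq := Or.inr rfl
  u_eq := by
    have hx := S.x_ne
    simp only [starModel, map_add, map_one]
    field_simp
    ring
  v_eq := by
    have hx := S.x_ne
    have he := S.sub_ne
    simp only [starModel]
    field_simp
  disc_eq := by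
    have hx := S.x_ne
    have h1 := aeval_P_add hS 1
    have h3 := aeval_P_add hS (-1)
    rw [map_one] at h1
    rw [map_neg, map_one] at h3
    have h : S.disc = (Polynomial.aeval S.x S.P + 1) * (Polynomial.aeval S.x S.P + -1) := by
      rw [LegendreModel.disc, map_sub, map_pow, map_one]
      ring
    rw [h, h1, h3]
    simp only [starModel, map_mul]
    field_simp

end Infinity

end Inose

end

noncomputable section

namespace Inose

open IsLocalRing

variable {K : Type*} [Field K] [Algebra ℂ K]

lemma exists_root_valuation_lt {V : ValuationSubring K} (hV : Constants V) {x : K}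
    {q : Polynomial ℂ} (hq : q ≠ 0) (h : V.valuation (Polynomial.aeval x q) < 1) :
    ∃ c, q.IsRoot c ∧ V.valuation (x - algebraMap ℂ K c) < 1 := by
  by_contra! hc
  rw [(IsAlgClosed.splits q).eq_prod_roots, map_mul, map_mul, Polynomial.aeval_C,
    hV.valuation_eq_one (Polynomial.leadingCoeff_ne_zero.2 hq), one_mul] at h
  refine h.not_ge (Multiset.prod_induction (fun p => 1 ≤ V.valuation (Polynomial.aeval x p)) _
    (fun p r hp hr => ?_) ?_ fun p hp => ?_)
  · rw [map_mul, map_mul]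
    exact one_le_mul hp hr
  · rw [map_one, map_one]
  · obtain ⟨c, hcr, rfl⟩ := Multiset.mem_map.1 hp
    simpa using hc c (Polynomial.isRoot_of_mem_roots hcr)

lemma CompleteVariety.IsFibreI.not_isExceptionalComponent {Y : CompleteVariety K} {t : K} {n : ℕ}
    (h : Y.IsFibreI t n) (E : LocalRingIn K) : ¬ Y.IsExceptionalComponent t E := by
  obtain ⟨hn, h⟩ := h
  have : NeZero n := ⟨by omega⟩
  have : Fact (1 < n) := ⟨hn⟩
  refine h.not_isExceptionalComponent (fun i => ?_) E
  have h1 (j : ZMod n) : i = j + 1 ↔ j = i - 1 := by rw [eq_comm, ← eq_sub_iff_add_eq]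
  have h2 : ∑ j ∈ Finset.univ.erase i, (1 : ℕ∞) * ((if i = j + 1 then 1 else 0) +
      if j = i + 1 then 1 else 0) = 2 := by
    rw [Finset.sum_erase _ (by simp)]
    simp only [one_mul, Finset.sum_add_distrib, h1, Finset.sum_ite_eq', Finset.mem_univ, if_true]
    norm_num
  rw [h2]
  decide

namespace LegendreModel

variable {S : LegendreModel K} {a b : ℂ}

lemma eq_of_valuation_lt {V : ValuationSubring K} (hV : Constants V) {x : K} {c d : ℂ}
    (hc : V.valuation (x - algebraMap ℂ K c) < 1) (hd : V.valuation (x - algebraMap ℂ K d) < 1) :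
    c = d := by
  by_contra hne
  have h1 := hV.valuation_eq_one (sub_ne_zero.2 hne)
  have h2 := (V.valuation.map_sub _ _).trans_lt (max_lt hd hc)
  rw [sub_sub_sub_cancel_left, ← map_sub, h1] at h2
  exact h2.false

/-- The patches of the singular fibres. -/
def singularPatch (hS : S.P = cubicP a b) : Option {c : ℂ // S.P.eval c ^ 2 = 1} → FibrePatch S
  | none => .star (starModel hS) (presentsStar hS)
  | some c => .cyc (S.nodeModel c.2) (S.presentsNode c.2) (S.exists_node_sqrt c.2).choose_spec.1

/-- The patches of the singular fibres cover the complement of the smooth fibres. -/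
def covering (hS : S.P = cubicP a b) : Covering S (Option {c : ℂ // S.P.eval c ^ 2 = 1}) where
  patch := singularPatch hS
  cover V hV := by
    by_cases hx : S.x ∈ V
    · by_cases hd : S.disc⁻¹ ∈ V
      · exact Or.inl ⟨hx, hd⟩
      · rw [inv_mem_iff_one_le S.disc_ne_zero, not_le] at hd
        obtain ⟨c, hc, hlt⟩ := exists_root_valuation_lt hV S.disc_ne hd
        exact Or.inr ⟨some ⟨c, by simpa [sub_eq_zero] using hc⟩, hlt⟩
    · refine Or.inr ⟨none, ?_⟩
      rw [← ValuationSubring.valuation_le_one_iff, not_le] at hx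
      change V.valuation S.x⁻¹ < 1
      rw [map_inv₀]
      exact inv_lt_one_of_one_lt₀ hx
  unique V hV i j hi hj := by
    have key (c : ℂ) (h1 : V.valuation S.x⁻¹ < 1)
        (h2 : V.valuation (S.x - algebraMap ℂ K c) < 1) : False := by
      have := mul_lt_one_of_nonneg_of_lt_one_left zero_le h1
        ((ValuationSubring.valuation_le_one_iff _ _).2 (S.mem_of_valuation_sub_lt hV h2))
      rw [← map_mul, inv_mul_cancel₀ S.x_ne, map_one] at this
      exact this.false
    match i, j with
    | none, none => rfl
    | none, some c => exact (key c hi hj).elim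
    | some c, none => exact (key c hj hi).elim
    | some c, some d => rw [Subtype.ext (eq_of_valuation_lt hV hi hj)]
  disjoint V hV i hi hx hd := by
    match i with
    | none =>
      have := mul_lt_one_of_nonneg_of_lt_one_left zero_le hi
        ((ValuationSubring.valuation_le_one_iff _ _).2 hx)
      change V.valuation S.x⁻¹ * _ < 1 at this
      rw [← map_mul, inv_mul_cancel₀ S.x_ne, map_one] at this
      exact this.false
    | some c =>
      have h1 := S.valuation_aeval_sub_lt hV hi (S.P ^ 2 - 1)
      have h2 : (S.P ^ 2 - 1).eval c.1 = 0 := by simp [c.2]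
      rw [h2, map_zero, sub_zero] at h1
      exact ((inv_mem_iff_one_le S.disc_ne_zero).1 hd).not_gt h1

instance (S : LegendreModel K) : Finite {c : ℂ // S.P.eval c ^ 2 = 1} := by
  refine Set.Finite.subset (Polynomial.finite_setOfPred_isRoot S.disc_ne) fun c hc => ?_
  have hc : S.P.eval c ^ 2 = 1 := hc
  simp [hc]

/-- The nonsingular complete surface, fibred by `x`. -/
def surface (hS : S.P = cubicP a b) : CompleteVariety K := (covering hS).surface

variable (hS : S.P = cubicP a b)

lemma affRing_mem : S.affRing ∈ (surface hS).charts := Or.inl (Or.inl rfl)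

lemma zeroRing_mem : S.zeroRing ∈ (surface hS).charts := Or.inl (Or.inr rfl)

lemma patch_charts_mem {i : Option {c : ℂ // S.P.eval c ^ 2 = 1}} {A : Subalgebra ℂ K}
    (hA : A ∈ (singularPatch hS i).charts) : A ∈ (surface hS).charts :=
  Or.inr (Set.mem_iUnion.2 ⟨i, hA⟩)

lemma isMorphism : (surface hS).IsMorphism S.x := by
  rintro _ ⟨A, hA, p, hp, rfl⟩
  suffices S.x ∈ A ∨ S.x⁻¹ ∈ A from
    this.imp (fun h => LocalRingIn.le_ofPrime A p h) fun h => LocalRingIn.le_ofPrime A p h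
  rcases hA with (rfl | rfl) | hA
  · exact Or.inl (mem_chartRing _ _ _ _).1
  · exact Or.inl (mem_chartRing _ _ _ _).1
  · obtain ⟨i, hi⟩ := Set.mem_iUnion.1 hA
    have h := (singularPatch hS i).τ_mem A hi
    match i with
    | none => exact Or.inr h
    | some c =>
      left
      change S.x - algebraMap ℂ K c ∈ A at h
      simpa using add_mem h (A.algebraMap_mem c)

lemma sub_mem_or_inv_mem (c : ℂ) {P : LocalRingIn K} (hP : P ∈ (surface hS).points) :
    S.x - algebraMap ℂ K c ∈ P.carrier ∨ (S.x - algebraMap ℂ K c)⁻¹ ∈ P.carrier := by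
  by_cases hx : S.x ∈ P.carrier
  · exact Or.inl (sub_mem hx (P.carrier.algebraMap_mem c))
  · have h := (isMorphism hS P hP).resolve_left hx
    right
    obtain ⟨V, hV, hdom⟩ := P.exists_dominating
    have hv : P.Vanishes S.x⁻¹ := (LocalRingIn.vanishes_iff _ _).2 ⟨h, Or.inr (by rwa [inv_inv])⟩
    have h1 : V.valuation (S.x⁻¹ * algebraMap ℂ K c) < 1 := by
      rw [map_mul]
      exact mul_lt_one_of_nonneg_of_lt_one_left zero_le (hdom.valuation_lt_one hv)
        ((ValuationSubring.valuation_le_one_iff _ _).2 (hV c))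
    have h2 : 1 - S.x⁻¹ * algebraMap ℂ K c ∈ P.carrier :=
      sub_mem (one_mem _) (mul_mem h (P.carrier.algebraMap_mem c))
    have h3 : V.valuation (1 - S.x⁻¹ * algebraMap ℂ K c) = 1 :=
      Valuation.map_one_sub_of_lt _ h1
    have h4 : 1 - S.x⁻¹ * algebraMap ℂ K c ≠ 0 := fun h0 => by simp [h0] at h3
    have h5 := mul_mem h (hdom.2 _ h2 ((inv_mem_iff_one_le h4).2 h3.ge))
    rw [← mul_inv, mul_sub, mul_one, mul_inv_cancel_left₀ S.x_ne] at h5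
    exact h5

lemma node_fibre {c : ℂ} (hc : S.P.eval c ^ 2 = 1) :
    (∀ P ∈ (surface hS).closedPoints, P.Vanishes (S.x - algebraMap ℂ K c) →
      IsRegularLocalRing P.carrier) ∧
    (surface hS).IsFibreI (S.x - algebraMap ℂ K c) (2 * (S.P ^ 2 - 1).rootMultiplicity c) ∧
      ¬ (surface hS).IsSmoothFibre (S.x - algebraMap ℂ K c) :=
  (S.nodeModel hc).isFibreI (S.exists_node_sqrt hc).choose_spec.1
    (S.exists_node_sqrt hc).choose_spec.2 (surface hS)
    (fun _ hA => patch_charts_mem hS (i := some ⟨c, hc⟩) hA) fun _ => sub_mem_or_inv_mem hS c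

lemma star_fibre :
    (∀ P ∈ (surface hS).closedPoints, P.Vanishes S.x⁻¹ → IsRegularLocalRing P.carrier) ∧
    (surface hS).IsFibreIStar S.x⁻¹ 6 ∧ ¬ (surface hS).IsSmoothFibre S.x⁻¹ :=
  (starModel hS).isFibreIStar (surface hS)
    (fun _ hA => patch_charts_mem hS (i := none) hA) fun P hP =>
      (isMorphism hS P hP).symm.imp id fun h => by
        change S.x⁻¹⁻¹ ∈ _
        rwa [inv_inv]

lemma isNonsingular : (surface hS).IsNonsingular := by
  intro P hP
  by_cases hx : S.x ∈ P.carrier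
  · obtain ⟨c, hc⟩ := (surface hS).exists_const_of_mem hP hx
    by_cases h : S.P.eval c ^ 2 = 1
    · exact (node_fibre hS h).1 P hP hc
    · exact (S.regular_of_vanishes (affRing_mem hS) (zeroRing_mem hS) h hP hc).1
  · have h := (isMorphism hS P ((surface hS).points_of_closedPoints hP)).resolve_left hx
    exact (star_fibre hS).1 P hP
      ((LocalRingIn.vanishes_iff _ _).2 ⟨h, Or.inr (by rwa [inv_inv])⟩)

lemma not_isSmoothFibre_iff (c : ℂ) :
    ¬ (surface hS).IsSmoothFibre (S.x - algebraMap ℂ K c) ↔ S.P.eval c ^ 2 = 1 :=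
  ⟨fun h => by_contra fun hc => h (S.isSmoothFibre (affRing_mem hS) (zeroRing_mem hS) hc),
    fun h => (node_fibre hS h).2.2⟩

lemma isFunctionalInvariant : (surface hS).IsFunctionalInvariant S.x fun c =>
    (S.P.eval c ^ 2 + 3) ^ 3 / (27 * (S.P.eval c ^ 2 - 1) ^ 2) := fun c hc =>
  S.exists_component (affRing_mem hS) (zeroRing_mem hS)
    fun h => (not_isSmoothFibre_iff hS c).2 h hc

lemma isRelativelyMinimal : (surface hS).IsRelativelyMinimal S.x := by
  refine ⟨fun c E => ?_, fun E => ?_⟩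
  · by_cases hc : S.P.eval c ^ 2 = 1
    · exact (node_fibre hS hc).2.1.not_isExceptionalComponent E
    · obtain ⟨C, hC, -⟩ := S.exists_component (affRing_mem hS) (zeroRing_mem hS) hc
      exact CompleteVariety.not_isExceptionalComponent_of_singleton hC E
  · refine (star_fibre hS).2.1.not_isExceptionalComponent (fun x => ?_) E
    have hm (y : Fin 7 ⊕ Fin 4) : (Sum.elim (fun _ => 2) (fun _ => 1) y : ℕ∞) = starMult y := by
      rcases y with y | y <;> simp [starMult]
    simp only [interIStar_eq, hm]
    exact_mod_cast star_not_exceptional x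

end LegendreModel

end Inose

end

noncomputable section

namespace Inose

section Cubic

variable {a d : ℂ}

lemma eval_cubicP (a d c : ℂ) : (cubicP a d).eval c = 4 * c ^ 3 - 3 * a * c - d := by
  simp [cubicP]

lemma cubicP_ne_zero (a d : ℂ) : cubicP a d ≠ 0 := by
  intro h
  have := natDegree_cubicP a d
  simp [h] at this

lemma cubicP_sub_one (a b : ℂ) : cubicP a b - 1 = cubicP a (b + 1) := by
  simp only [cubicP, map_add, map_one]
  ring

lemma cubicP_add_one (a b : ℂ) : cubicP a b + 1 = cubicP a (b - 1) := by
  simp only [cubicP, map_sub, map_one]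
  ring

/-- The set of roots of a cubic polynomial `cubicP a d`. -/
def rootsP (a d : ℂ) : Set ℂ := {c | (cubicP a d).eval c = 0}

lemma rootsP_eq (a d : ℂ) : rootsP a d = ((cubicP a d).roots.toFinset : Set ℂ) := by
  ext c
  simp [rootsP, cubicP_ne_zero]

lemma setOf_eval_eq_one (a b : ℂ) : {c | (cubicP a b).eval c = 1} = rootsP a (b + 1) := by
  ext c
  simp [rootsP, ← cubicP_sub_one, sub_eq_zero]

lemma setOf_eval_eq_neg_one (a b : ℂ) : {c | (cubicP a b).eval c = -1} = rootsP a (b - 1) := by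
  ext c
  simp [rootsP, ← cubicP_add_one, eq_neg_iff_add_eq_zero]

lemma singularSet_eq (a b : ℂ) : singularSet a b = rootsP a (b + 1) ∪ rootsP a (b - 1) := by
  ext c
  rw [← setOf_eval_eq_one, ← setOf_eval_eq_neg_one]
  change _ ^ 2 = 1 ↔ _ = 1 ∨ _ = -1
  rw [← sq_eq_sq_iff_eq_or_eq_neg, one_pow]

lemma disjoint_rootsP (a b : ℂ) : Disjoint (rootsP a (b + 1)) (rootsP a (b - 1)) := by
  rw [← setOf_eval_eq_one, ← setOf_eval_eq_neg_one, Set.disjoint_left]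
  intro c h1 h2
  have h3 : (1 : ℂ) = -1 := h1.symm.trans h2
  norm_num at h3

lemma ncard_singularSet (a b : ℂ) :
    (singularSet a b).ncard = (rootsP a (b + 1)).ncard + (rootsP a (b - 1)).ncard := by
  rw [singularSet_eq]
  refine Set.ncard_union_eq (disjoint_rootsP a b) ?_ ?_ <;>
  · rw [rootsP_eq]
    exact Finset.finite_toSet _

lemma rootMultiplicity_sq_sub_one (a b c : ℂ) : (cubicP a b ^ 2 - 1).rootMultiplicity c =
    (cubicP a (b + 1)).rootMultiplicity c + (cubicP a (b - 1)).rootMultiplicity c := by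
  rw [← Polynomial.rootMultiplicity_mul (mul_ne_zero (cubicP_ne_zero _ _) (cubicP_ne_zero _ _)),
    ← cubicP_sub_one, ← cubicP_add_one]
  congr 1
  ring

lemma rootMultiplicity_eq_one (h : a ^ 3 ≠ d ^ 2) {c : ℂ} (hc : c ∈ rootsP a d) :
    (cubicP a d).rootMultiplicity c = 1 := by
  have h1 := (Polynomial.rootMultiplicity_pos (cubicP_ne_zero a d)).2 hc
  refine le_antisymm (not_lt.1 fun h2 => h ?_) h1
  have h3 := ((Polynomial.one_lt_rootMultiplicity_iff_isRoot (cubicP_ne_zero a d)).1 h2).2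
  have hc : (cubicP a d).eval c = 0 := hc
  rw [eval_cubicP] at hc
  have h3 : 4 * ((2 + 1) * c ^ 2) - 3 * a = 0 := by simpa [cubicP] using h3
  have h4 : a = 4 * c ^ 2 := by linear_combination -h3 / 3
  have h5 : d = - 8 * c ^ 3 := by linear_combination -hc - 3 * c * h4
  rw [h4, h5]
  ring

lemma ncard_rootsP (h : a ^ 3 ≠ d ^ 2) : (rootsP a d).ncard = 3 := by
  rw [rootsP_eq, Set.ncard_coe_finset, Multiset.toFinset_card_of_nodup,
    IsAlgClosed.card_roots_eq_natDegree, natDegree_cubicP]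
  rw [Multiset.nodup_iff_count_le_one]
  intro c
  rw [Polynomial.count_roots]
  by_cases hc : c ∈ rootsP a d
  · exact (rootMultiplicity_eq_one h hc).le
  · rw [Polynomial.rootMultiplicity_eq_zero hc]
    exact zero_le_one

lemma cubicP_eq_of_cube_eq_sq (h : a ^ 3 = d ^ 2) (ha : a ≠ 0) :
    cubicP a d = Polynomial.C 4 * (Polynomial.X - Polynomial.C (-d / (2 * a))) ^ 2 *
      (Polynomial.X - Polynomial.C (d / a)) := by
  refine Polynomial.funext fun c => ?_
  rw [eval_cubicP]
  simp
  field_simp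
  linear_combination (-12 * a * c - 4 * d) * h

lemma neg_div_ne (h : a ^ 3 = d ^ 2) (ha : a ≠ 0) : -d / (2 * a) ≠ d / a := by
  intro h1
  have h2 : d = 0 := by
    field_simp at h1
    linear_combination -h1 / 3
  rw [h2, zero_pow two_ne_zero] at h
  exact ha (pow_eq_zero_iff three_ne_zero |>.1 h)

lemma rootMultiplicity_of_cube_eq_sq (h : a ^ 3 = d ^ 2) (ha : a ≠ 0) :
    (cubicP a d).rootMultiplicity (-d / (2 * a)) = 2 ∧
      (cubicP a d).rootMultiplicity (d / a) = 1 := by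
  have h0 := cubicP_ne_zero a d
  have hne := neg_div_ne h ha
  rw [cubicP_eq_of_cube_eq_sq h ha] at h0 ⊢
  rw [Polynomial.rootMultiplicity_mul h0, Polynomial.rootMultiplicity_mul h0,
    Polynomial.rootMultiplicity_mul (left_ne_zero_of_mul h0),
    Polynomial.rootMultiplicity_mul (left_ne_zero_of_mul h0),
    Polynomial.rootMultiplicity_C, Polynomial.rootMultiplicity_C,
    Polynomial.rootMultiplicity_X_sub_C_pow, Polynomial.rootMultiplicity_X_sub_C_self,
    Polynomial.rootMultiplicity_eq_zero (x := -d / (2 * a)),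
    Polynomial.rootMultiplicity_eq_zero (x := d / a)]
  · exact ⟨rfl, rfl⟩
  · simpa [sub_eq_zero] using hne.symm
  · simpa [sub_eq_zero] using hne

lemma rootsP_of_cube_eq_sq (h : a ^ 3 = d ^ 2) (ha : a ≠ 0) :
    rootsP a d = {-d / (2 * a), d / a} := by
  ext c
  simp only [rootsP]
  rw [cubicP_eq_of_cube_eq_sq h ha]
  simp [sub_eq_zero]

lemma rootMultiplicity_zero : (cubicP 0 0).rootMultiplicity 0 = 3 := by
  have h : cubicP 0 0 = Polynomial.C 4 * (Polynomial.X - Polynomial.C 0) ^ 3 := by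
    simp [cubicP, Polynomial.C_ofNat]
  rw [h, Polynomial.rootMultiplicity_mul (h ▸ cubicP_ne_zero 0 0), Polynomial.rootMultiplicity_C,
    Polynomial.rootMultiplicity_X_sub_C_pow]

lemma rootsP_zero : rootsP 0 0 = {0} := by
  ext c
  simp [rootsP, eval_cubicP]

lemma rootsP_zero_left (d : ℂ) : rootsP 0 (2 * d) =
    {c | ∃ θ : ℂ, θ ^ 3 = d ∧ c = 1 / (((2 : ℝ) ^ (1 / 3 : ℝ) : ℝ) : ℂ) * θ} := by
  set r : ℂ := (((2 : ℝ) ^ (1 / 3 : ℝ) : ℝ) : ℂ) with hr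
  have h3 : r ^ 3 = 2 := by
    rw [hr, ← Complex.ofReal_pow, ← Real.rpow_natCast, ← Real.rpow_mul zero_le_two]
    norm_num
  have h0 : r ≠ 0 := fun h => by simp [h] at h3
  ext c
  simp only [rootsP, eval_cubicP, Set.mem_ofPred_eq]
  constructor
  · intro h
    exact ⟨r * c, by linear_combination c ^ 3 * h3 + h / 2, by field_simp⟩
  · rintro ⟨θ, rfl, rfl⟩
    field_simp
    linear_combination - 2 * θ ^ 3 * h3

lemma cubicP_of_cube_eq_one (h : a ^ 3 = 1) :
    cubicP a 1 = (2 * Polynomial.X + Polynomial.C (a ^ 2)) ^ 2 *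
      (Polynomial.X - Polynomial.C (a ^ 2)) ∧
    cubicP a (-1) = (2 * Polynomial.X - Polynomial.C (a ^ 2)) ^ 2 *
      (Polynomial.X + Polynomial.C (a ^ 2)) := by
  constructor <;> refine Polynomial.funext fun c => ?_ <;> rw [eval_cubicP] <;>
    simp only [Polynomial.eval_mul, Polynomial.eval_pow, Polynomial.eval_add, Polynomial.eval_sub,
      Polynomial.eval_ofNat, Polynomial.eval_X, Polynomial.eval_C]
  · linear_combination (3 * c * a + a ^ 3 + 1) * h
  · linear_combination (3 * c * a - a ^ 3 - 1) * h

end Cubic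

end Inose

end

open Inose in
theorem mainTheorem9 (a b : ℂ) :
    ∃ Y : Inose.CompleteVariety (Inose.QuotientField a b),
      -- `Y` is the minimal nonsingular model of the quotient, fibred by `λ`
      Y.IsNonsingular ∧ Y.IsMorphism (Inose.lam a b) ∧ Y.IsRelativelyMinimal (Inose.lam a b) ∧
      -- the functional invariant
      Y.IsFunctionalInvariant (Inose.lam a b) (fun c =>
        ((Inose.cubicP a b).eval c ^ 2 + 3) ^ 3 / (27 * ((Inose.cubicP a b).eval c ^ 2 - 1) ^ 2)) ∧
      -- the location of the singular fibres, and the fibre at infinity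
      (∀ c : ℂ, ¬ Y.IsSmoothFibre (Inose.lam a b - algebraMap ℂ _ c) ↔
        c ∈ Inose.singularSet a b) ∧
      ¬ Y.IsSmoothFibre (Inose.lam a b)⁻¹ ∧
      Y.IsFibreIStar (Inose.lam a b)⁻¹ 6 ∧
      -- the generic case
      (a ^ 3 ≠ (b + 1) ^ 2 → a ^ 3 ≠ (b - 1) ^ 2 →
        {c | (Inose.cubicP a b).eval c = 1}.ncard = 3 ∧
        {c | (Inose.cubicP a b).eval c = -1}.ncard = 3 ∧
        (Inose.singularSet a b).ncard = 6 ∧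
        ∀ c ∈ Inose.singularSet a b, Y.IsFibreI (Inose.lam a b - algebraMap ℂ _ c) 2) ∧
      -- the first degenerate case
      (a ^ 3 = (b + 1) ^ 2 → b ≠ 0 → a ≠ 0 →
        {c | (Inose.cubicP a b).eval c = -1}.ncard = 3 ∧
        (Inose.cubicP a b - 1).rootMultiplicity (-(b + 1) / (2 * a)) = 2 ∧
        (Inose.cubicP a b - 1).rootMultiplicity ((b + 1) / a) = 1 ∧
        (Inose.singularSet a b).ncard = 5 ∧
        Inose.singularSet a b = {-(b + 1) / (2 * a), (b + 1) / a} ∪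
          {c | (Inose.cubicP a b).eval c = -1} ∧
        Y.IsFibreI (Inose.lam a b - algebraMap ℂ _ (-(b + 1) / (2 * a))) 4 ∧
        ∀ c ∈ Inose.singularSet a b, c ≠ -(b + 1) / (2 * a) →
          Y.IsFibreI (Inose.lam a b - algebraMap ℂ _ c) 2) ∧
      -- the second degenerate case
      (a ^ 3 = (b - 1) ^ 2 → b ≠ 0 → a ≠ 0 →
        {c | (Inose.cubicP a b).eval c = 1}.ncard = 3 ∧
        (Inose.cubicP a b + 1).rootMultiplicity (-(b - 1) / (2 * a)) = 2 ∧
        (Inose.cubicP a b + 1).rootMultiplicity ((b - 1) / a) = 1 ∧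
        (Inose.singularSet a b).ncard = 5 ∧
        Inose.singularSet a b = {-(b - 1) / (2 * a), (b - 1) / a} ∪
          {c | (Inose.cubicP a b).eval c = 1} ∧
        Y.IsFibreI (Inose.lam a b - algebraMap ℂ _ (-(b - 1) / (2 * a))) 4 ∧
        ∀ c ∈ Inose.singularSet a b, c ≠ -(b - 1) / (2 * a) →
          Y.IsFibreI (Inose.lam a b - algebraMap ℂ _ c) 2) ∧
      -- the third degenerate case
      (a = 0 → b = 1 ∨ b = -1 →
        Inose.singularSet a b =
          {0} ∪ {c | ∃ θ : ℂ, θ ^ 3 = b ∧ c = 1 / (((2 : ℝ) ^ (1 / 3 : ℝ) : ℝ) : ℂ) * θ} ∧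
        (Inose.singularSet a b).ncard = 4 ∧
        Y.IsFibreI (Inose.lam a b - algebraMap ℂ _ 0) 6 ∧
        ∀ c ∈ Inose.singularSet a b, c ≠ 0 →
          Y.IsFibreI (Inose.lam a b - algebraMap ℂ _ c) 2) ∧
      -- the fourth degenerate case
      (a ^ 3 = 1 → b = 0 →
        Inose.cubicP a b - 1 = (2 * Polynomial.X + Polynomial.C (a ^ 2)) ^ 2 *
          (Polynomial.X - Polynomial.C (a ^ 2)) ∧
        Inose.cubicP a b + 1 = (2 * Polynomial.X - Polynomial.C (a ^ 2)) ^ 2 *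
          (Polynomial.X + Polynomial.C (a ^ 2)) ∧
        Inose.singularSet a b = {a ^ 2 / 2, -(a ^ 2 / 2), -a ^ 2, a ^ 2} ∧
        (Inose.singularSet a b).ncard = 4 ∧
        Y.IsFibreI (Inose.lam a b - algebraMap ℂ _ (a ^ 2 / 2)) 4 ∧
        Y.IsFibreI (Inose.lam a b - algebraMap ℂ _ (-(a ^ 2 / 2))) 4 ∧
        Y.IsFibreI (Inose.lam a b - algebraMap ℂ _ (-a ^ 2)) 2 ∧
        Y.IsFibreI (Inose.lam a b - algebraMap ℂ _ (a ^ 2)) 2) := by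
  set Y := LegendreModel.surface (S := model a b) (a := a) (b := b) rfl
  have hI {c : ℂ} (hc : c ∈ singularSet a b) : Y.IsFibreI (lam a b - algebraMap ℂ _ c)
      (2 * (cubicP a b ^ 2 - 1).rootMultiplicity c) :=
    (LegendreModel.node_fibre (S := model a b) rfl hc).2.1
  have hmult {c : ℂ} {m n : ℕ} (hc : c ∈ singularSet a b)
      (h1 : (cubicP a (b + 1)).rootMultiplicity c = m)
      (h2 : (cubicP a (b - 1)).rootMultiplicity c = n) :
      Y.IsFibreI (lam a b - algebraMap ℂ _ c) (2 * (m + n)) := by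
    have h := hI hc
    rwa [rootMultiplicity_sq_sub_one, h1, h2] at h
  have hp {c : ℂ} {m : ℕ} (hc : c ∈ rootsP a (b + 1))
      (h : (cubicP a (b + 1)).rootMultiplicity c = m) :
      Y.IsFibreI (lam a b - algebraMap ℂ _ c) (2 * m) :=
    hmult (singularSet_eq a b ▸ Or.inl hc) h
      (Polynomial.rootMultiplicity_eq_zero (Set.disjoint_left.1 (disjoint_rootsP a b) hc))
  have hm {c : ℂ} {m : ℕ} (hc : c ∈ rootsP a (b - 1))
      (h : (cubicP a (b - 1)).rootMultiplicity c = m) :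
      Y.IsFibreI (lam a b - algebraMap ℂ _ c) (2 * m) := by
    have := hmult (singularSet_eq a b ▸ Or.inr hc) (Polynomial.rootMultiplicity_eq_zero
      (Set.disjoint_right.1 (disjoint_rootsP a b) hc)) h
    rwa [zero_add] at this
  rw [setOf_eval_eq_one, setOf_eval_eq_neg_one, cubicP_sub_one, cubicP_add_one, ncard_singularSet,
    singularSet_eq]
  refine ⟨Y, LegendreModel.isNonsingular rfl, LegendreModel.isMorphism rfl,
    LegendreModel.isRelativelyMinimal rfl, LegendreModel.isFunctionalInvariant rfl, fun c => ?_,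
    (LegendreModel.star_fibre rfl).2.2, (LegendreModel.star_fibre rfl).2.1, fun h1 h2 => ?_,
    fun h hb ha => ?_, fun h hb ha => ?_, ?_, ?_⟩
  · rw [← singularSet_eq]
    exact LegendreModel.not_isSmoothFibre_iff (S := model a b) rfl c
  · refine ⟨ncard_rootsP h1, ncard_rootsP h2, by rw [ncard_rootsP h1, ncard_rootsP h2], ?_⟩
    rintro c (hc | hc)
    exacts [hp hc (rootMultiplicity_eq_one h1 hc), hm hc (rootMultiplicity_eq_one h2 hc)]
  · have h2 : a ^ 3 ≠ (b - 1) ^ 2 := fun h2 => hb (by linear_combination (h2 - h) / 4)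
    obtain ⟨m1, m2⟩ := rootMultiplicity_of_cube_eq_sq h ha
    have hr := rootsP_of_cube_eq_sq h ha
    have h3 := ncard_rootsP h2
    refine ⟨h3, m1, m2, by rw [h3, hr, Set.ncard_pair (neg_div_ne h ha)], by rw [hr],
      hp (by simp [hr]) m1, ?_⟩
    rintro c (hc | hc) hne
    · obtain rfl := (hr ▸ hc : c ∈ ({_, _} : Set ℂ)).resolve_left hne
      exact hp hc m2
    · exact hm hc (rootMultiplicity_eq_one h2 hc)
  · have h2 : a ^ 3 ≠ (b + 1) ^ 2 := fun h2 => hb (by linear_combination (h - h2) / 4)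
    obtain ⟨m1, m2⟩ := rootMultiplicity_of_cube_eq_sq h ha
    have hr := rootsP_of_cube_eq_sq h ha
    have h3 := ncard_rootsP h2
    refine ⟨h3, m1, m2, by rw [h3, hr, Set.ncard_pair (neg_div_ne h ha)],
      by rw [hr, Set.union_comm], hm (by simp [hr]) m1, ?_⟩
    rintro c (hc | hc) hne
    · exact hp hc (rootMultiplicity_eq_one h2 hc)
    · obtain rfl := (hr ▸ hc : c ∈ ({_, _} : Set ℂ)).resolve_left hne
      exact hm hc m2
  · rintro rfl (rfl | rfl)
    · have h2 : (0 : ℂ) ^ 3 ≠ (1 + 1) ^ 2 := by norm_num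
      have h3 := ncard_rootsP h2
      have h4 := rootsP_zero_left 1
      rw [mul_one, ← one_add_one_eq_two] at h4
      rw [sub_self] at hm ⊢
      refine ⟨?_, ?_, hm (by simp [rootsP_zero]) rootMultiplicity_zero, ?_⟩
      · rw [h4, rootsP_zero, Set.union_comm]
      · rw [h3, rootsP_zero, Set.ncard_singleton]
      · rintro c (hc | hc) hne
        · exact hp hc (rootMultiplicity_eq_one h2 hc)
        · rw [rootsP_zero] at hc
          exact (hne hc).elim
    · have h2 : (0 : ℂ) ^ 3 ≠ (-1 - 1) ^ 2 := by norm_num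
      have h3 := ncard_rootsP h2
      have h4 := rootsP_zero_left (-1)
      rw [show (2 : ℂ) * -1 = -1 - 1 by norm_num] at h4
      rw [neg_add_cancel] at hp ⊢
      refine ⟨?_, ?_, hp (by simp [rootsP_zero]) rootMultiplicity_zero, ?_⟩
      · rw [h4, rootsP_zero]
      · rw [h3, rootsP_zero, Set.ncard_singleton]
      · rintro c (hc | hc) hne
        · rw [rootsP_zero] at hc
          exact (hne hc).elim
        · exact hm hc (rootMultiplicity_eq_one h2 hc)
  · rintro h rfl
    have ha : a ≠ 0 := by
      rintro rfl
      norm_num at h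
    have h1 : a ^ 3 = (0 + 1) ^ 2 := by rw [h]; norm_num
    have h2 : a ^ 3 = (0 - 1) ^ 2 := by rw [h]; norm_num
    have e1 : -(0 + 1) / (2 * a) = -(a ^ 2 / 2) := by
      field_simp
      linear_combination h
    have e2 : (0 + 1) / a = a ^ 2 := by
      field_simp
      linear_combination -h
    have e3 : -(0 - 1) / (2 * a) = a ^ 2 / 2 := by
      field_simp
      linear_combination -h
    have e4 : (0 - 1) / a = -a ^ 2 := by
      field_simp
      linear_combination h
    obtain ⟨m1, m2⟩ := rootMultiplicity_of_cube_eq_sq h1 ha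
    obtain ⟨m3, m4⟩ := rootMultiplicity_of_cube_eq_sq h2 ha
    have r1 := rootsP_of_cube_eq_sq h1 ha
    have r2 := rootsP_of_cube_eq_sq h2 ha
    have n1 := neg_div_ne h1 ha
    have n2 := neg_div_ne h2 ha
    rw [e1] at m1 r1 n1
    rw [e2] at m2 r1 n1
    rw [e3] at m3 r2 n2
    rw [e4] at m4 r2 n2
    refine ⟨by rw [zero_add, (cubicP_of_cube_eq_one h).1],
      by rw [zero_sub, (cubicP_of_cube_eq_one h).2], ?_, ?_,     hm (r2 ▸ Or.inl rfl) m3,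
      hp (r1 ▸ Or.inl rfl) m1, hm (r2 ▸ Or.inr rfl) m4, hp (r1 ▸ Or.inr rfl) m2⟩
    · rw [r1, r2, Set.union_comm, Set.insert_union, Set.singleton_union, Set.insert_comm (-a ^ 2)]
    · rw [r1, r2, Set.ncard_pair n1, Set.ncard_pair n2]
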